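/- Let $m\ge 2$, $N\ge 1$ be integers and $\ell\in\mathbb C$. Let $\mathfrak g=\mathfrak{sl}_m(\mathbb C)\otimes\mathbb C[t,t^{-1}]\oplus\mathbb Cc_{\mathfrak g}\oplus\mathbb Cd_{\mathfrak g}$ be the affine Lie algebra with $[X\otimes f,Y\otimes g]=[X,Y]\otimes fg+\mathrm{tr}(XY)\,\mathrm{Res}_{t=0}\big(\tfrac{df}{dt}g\,dt\big)c_{\mathfrak g}$, $[d_{\mathfrak g},X\otimes f]=X\otimes t\tfrac{df}{dt}$, $c_{\mathfrak g}$ central, let $\mathfrak g'=[\mathfrak g,\mathfrak g]$, let $\mathfrak h=\bar{\mathfrak h}\oplus\mathbb Cc_{\mathfrak g}\oplus\mathbb Cd_{\mathfrak g}$ be its Cartan subalgebra ($\bar{\mathfrak h}$ the traceless diagonal matrices), and let $\mathfrak h^*(\ell)=\{\lambda\in\mathfrak h^*:\lambda(c_{\mathfrak g})=\ell\}$. For $\lambda,\mu\in\mathfrak h^*(\ell)$ let $M(\mu)$ be the Verma module of highest weight $\mu$ and $M^\dagger(\lambda)$ the lowest weight Verma module of lowest weight $-\lambda$, let $V=\mathbb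 C^m$ be the vector representation of $\mathfrak{sl}_m$, and put $$\mathcal M(\lambda,\mu)=\Big(M(\mu)\otimes\bigotimes_{i=1}^N\big(\mathbb C[z_i^{\pm1}]\otimes V\big)\otimes M^\dagger(\lambda)\Big)\Big/\mathfrak g'\Big(M(\mu)\otimes\bigotimes_{i=1}^N\big(\mathbb C[z_i^{\pm1}]\otimes V\big)\otimes M^\dagger(\lambda)\Big),$$ where $\mathbb C[z_i^{\pm1}]\otimes V$ is the evaluation module ($X\otimes f(t)\mapsto f(z_i)\otimes X$, $d_{\mathfrak g}\mapsto z_i\partial_{z_i}$, $c_{\mathfrak g}\mapsto0$) and $\mathfrak g'$ acts diagonally. Let $\mathcal H$ be the degenerate double affine Hecke algebra of $\mathfrak{gl}_N$, generated by the group algebra of $W=\mathfrak S_N\ltimes\mathbb Z^N$ (with translations $t_\eta$, $\eta\in\mathbb Z^N=\bigoplus_i\mathbb Z\epsilon_i$) and the symmetric algebra of $\mathfrak t'=\bigoplus_{i=1}^N\mathbb C\epsilon_i^\vee\oplus\mathbb Cc$, with the relations $s_i\xi-s_i(\xi)s_i=-\alpha_i(\xi)$ $(0\le i\le N-1)$ and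 $\pi\xi=\pi(\xi)\pi$ for $\xi\in\mathfrak t'$. Here $\mathfrak S_N$ permutes the $\epsilon_i^\vee$ and fixes $c$, $t_\eta(\xi)=\xi-\eta(\xi)c$, $\eta(c)=0$; $s_i$ is the transposition $(i,i+1)$ and $\alpha_i=\epsilon_i-\epsilon_{i+1}$ for $1\le i<N$; $s_0=t_{\epsilon_1-\epsilon_N}(1,N)$, and $\alpha_0=-(\epsilon_1-\epsilon_N)$ on $\mathfrak t'$; $\pi=t_{\epsilon_1}s_1\cdots s_{N-1}$. The algebra $\mathcal H$ acts in a unique way on $\mathcal M(\lambda,\mu)$ by the following operators: $c\mapsto\ell+m$; $w\in\mathfrak S_N$ acts by $\tau(w)$, which permutes the variables $z_i$ and the factors $V$ simultaneously; $t_\eta$ acts by multiplication by $z^\eta$; and $\xi\in\bigoplus_i\mathbb C\epsilon_i^\vee$ acts by the operator induced from $$\mathcal D_\xi=\sum_i\epsilon_i(\xi)\nabla_i+\sum_{1\le j<k\le N}(\epsilon_j-\epsilon_k)(\xi)\,\frac{1-\tau((j,k))}{1-z_k/z_j}-\tfrac12\sum_{1\le j<k\le N}(\epsilon_j-\epsilon_k)(\xi)-\tfrac{m-1}{2m}\,\partial_\xi\log\prod_{j\ne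 k}\Big(1-\frac{z_k}{z_j}\Big),$$ which preserves Laurent polynomial coefficients, where $\partial_\xi=\sum_i\epsilon_i(\xi)z_i\partial_{z_i}$ and $\nabla_i=\sum_{0\le j<i}r_{(ji)}-\sum_{i<j\le N+1}r_{(ij)}+\theta_i(\check\rho+m\,d_{\mathfrak g})$ is the Knizhnik–Zamolodchikov operator. Here the tensor factors are numbered $0,\dots,N+1$, $\theta_i$ is the action of $\mathfrak g$ on the $i$-th one, $\check\rho$ is half the sum of the positive coroots of $\mathfrak{sl}_m$, and $r_{(ij)}=(\theta_i\otimes\theta_j)(r)$ for the universal classical $r$-matrix $$r=\bar r+\tfrac12(c_{\mathfrak g}\otimes d_{\mathfrak g}+d_{\mathfrak g}\otimes c_{\mathfrak g})+\sum_{n\ge1}\sum_k(J_k\otimes t^n)\otimes(J_k\otimes t^{-n}),\qquad \bar r=\tfrac12\sum_aH_a\otimes H_a+\sum_{p<q}E_{pq}\otimes E_{qp},$$ with $(J_k)$, $(H_a)$ orthonormal bases of $\mathfrak{sl}_m$, $\bar{\mathfrak h}$ for the trace form; for $1\le i<j\le N$ this is read as $r_{(ij)}=(\theta_i\otimes\theta_j)(\bar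 r)+\frac{z_i/z_j}{1-z_i/z_j}(\theta_i\otimes\theta_j)(\bar r+\bar r_{21})$, where $\bar r_{21}$ is the transpose of $\bar r$. Suppose that $\mu$ is dominant integral, that is, takes non-negative integer values on the simple coroots $E_{aa}-E_{a+1,a+1}$ $(1\le a<m)$ and $c_{\mathfrak g}-(E_{11}-E_{mm})$, and that the restriction of $\lambda-\mu$ to $\bar{\mathfrak h}$ is a weight of $V^{\otimes N}$. Then the $\mathcal H$-module $\mathcal M(\lambda,\mu)$ has a unique irreducible quotient: it has exactly one submodule $K$ such that $\mathcal M(\lambda,\mu)/K$ is irreducible. -/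

import Mathlib

open scoped TensorProduct LaurentPolynomial

noncomputable section

/-! ### Euler derivations of group algebras -/

/-- The derivation of the group algebra `ℂ[G]` with `e^g ↦ φ(g) e^g`. -/
def eulerLin {G : Type} [AddCommMonoid G] (φ : G →+ ℂ) :
    AddMonoidAlgebra ℂ G →ₗ[ℂ] AddMonoidAlgebra ℂ G :=
  (AddMonoidAlgebra.basis G ℂ).constr ℂ fun g => AddMonoidAlgebra.single g (φ g)

theorem eulerLin_single {G : Type} [AddCommMonoid G] (φ : G →+ ℂ) (g : G) (r : ℂ) :
    eulerLin φ (AddMonoidAlgebra.single g r) = AddMonoidAlgebra.single g (φ g * r) := by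
  have h1 : eulerLin φ (AddMonoidAlgebra.single g 1) = AddMonoidAlgebra.single g (φ g) := by
    have := (AddMonoidAlgebra.basis G ℂ).constr_basis ℂ
      (fun g => AddMonoidAlgebra.single g (φ g)) g
    simpa [eulerLin] using this
  have h2 : (AddMonoidAlgebra.single g r : AddMonoidAlgebra ℂ G)
      = r • AddMonoidAlgebra.single g 1 := by simp
  rw [h2, map_smul, h1]
  simp [mul_comm]

theorem eulerLin_mul {G : Type} [AddCommMonoid G] (φ : G →+ ℂ) (x y : AddMonoidAlgebra ℂ G) :
    eulerLin φ (x * y) = eulerLin φ x * y + x * eulerLin φ y := by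
  induction x using AddMonoidAlgebra.induction_linear with
  | zero => simp
  | add a b ha hb => simp only [add_mul, map_add, ha, hb]; ring
  | single g r =>
    induction y using AddMonoidAlgebra.induction_linear with
    | zero => simp
    | add a b ha hb => simp only [mul_add, map_add, ha, hb]; ring
    | single g' r' =>
      simp only [eulerLin_single, AddMonoidAlgebra.single_mul_single, map_add]
      rw [← AddMonoidAlgebra.single_add]
      congr 1
      ring

/-! ### The affine Lie algebra of `sl_m` -/

/-- The loop algebra `sl_m(ℂ) ⊗ ℂ[t,t⁻¹]`, realised as the traceless matrices over
`ℂ[t,t⁻¹]`. -/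
abbrev LoopSl (m : ℕ) : Type := LieAlgebra.SpecialLinear.sl (Fin m) ℂ[T;T⁻¹]

/-- The derivation `t d/dt` of `ℂ[t,t⁻¹]`. -/
def tddt : ℂ[T;T⁻¹] →ₗ[ℂ] ℂ[T;T⁻¹] := eulerLin (Int.castAddHom ℂ)

theorem tddt_mul (f g : ℂ[T;T⁻¹]) : tddt (f * g) = tddt f * g + f * tddt g :=
  eulerLin_mul _ f g

/-- The constant term of a Laurent polynomial, i.e. the residue at `0` of `f dt/t`. -/
def constTerm : ℂ[T;T⁻¹] →ₗ[ℂ] ℂ where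
  toFun f := f.coeff 0
  map_add' _ _ := rfl
  map_smul' _ _ := rfl

theorem constTerm_tddt (f : ℂ[T;T⁻¹]) : constTerm (tddt f) = 0 := by
  induction f using AddMonoidAlgebra.induction_linear with
  | zero => simp
  | add a b ha hb => simp only [map_add, ha, hb, add_zero]
  | single g r =>
    rw [tddt, eulerLin_single]
    change (Finsupp.single g _ : ℤ →₀ ℂ) 0 = 0
    by_cases h : g = 0
    · simp [h]
    · rw [Finsupp.single_eq_of_ne (Ne.symm h)]

/-- `t d/dt` applied to every entry of a matrix. -/
def matD (m : ℕ) :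
    Matrix (Fin m) (Fin m) ℂ[T;T⁻¹] →ₗ[ℂ] Matrix (Fin m) (Fin m) ℂ[T;T⁻¹] :=
  tddt.mapMatrix

theorem matD_mul {m : ℕ} (X Y : Matrix (Fin m) (Fin m) ℂ[T;T⁻¹]) :
    matD m (X * Y) = matD m X * Y + X * matD m Y := by
  ext1 i j
  simp [matD, Matrix.mul_apply, tddt_mul, Finset.sum_add_distrib]

theorem trace_matD {m : ℕ} (X : Matrix (Fin m) (Fin m) ℂ[T;T⁻¹]) :
    (matD m X).trace = tddt X.trace := by
  simp [matD, Matrix.trace]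

instance (m : ℕ) : LieAlgebra ℂ (LoopSl m) where
  lie_smul r X Y := by
    ext1
    change X.1 * (r • Y.1) - (r • Y.1) * X.1 = r • (X.1 * Y.1 - Y.1 * X.1)
    rw [Matrix.mul_smul, Matrix.smul_mul, smul_sub]

theorem mem_sl_iff {m : ℕ} {R : Type} [CommRing R] (X : Matrix (Fin m) (Fin m) R) :
    X ∈ LieAlgebra.SpecialLinear.sl (Fin m) R ↔ X.trace = 0 := Iff.rfl

/-- The derivation `X ⊗ f ↦ X ⊗ t df/dt` of the loop algebra. -/
def loopD (m : ℕ) : LoopSl m →ₗ[ℂ] LoopSl m where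
  toFun X := ⟨matD m X.1, by
    have h := (mem_sl_iff X.1).1 X.2
    rw [mem_sl_iff, trace_matD, h, map_zero]⟩
  map_add' X Y := by ext1; exact map_add (matD m) X.1 Y.1
  map_smul' r X := by ext1; exact map_smul (matD m) r X.1

/-- The cocycle `(X ⊗ f, Y ⊗ g) ↦ tr(XY) Res_{t=0} (df/dt) g dt`. -/
def loopCocycle (m : ℕ) : LoopSl m →ₗ[ℂ] LoopSl m →ₗ[ℂ] ℂ :=
  LinearMap.mk₂ ℂ (fun X Y => constTerm (matD m X.1 * Y.1).trace)
    (fun X X' Y => by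
      have : matD m (X + X').1 = matD m X.1 + matD m X'.1 := map_add (matD m) X.1 X'.1
      simp only [this, add_mul, Matrix.trace_add, map_add])
    (fun r X Y => by
      have : matD m (r • X).1 = r • matD m X.1 := map_smul (matD m) r X.1
      simp only [this, Matrix.smul_mul, Matrix.trace_smul, map_smul])
    (fun X Y Y' => by
      have : (Y + Y').1 = Y.1 + Y'.1 := rfl
      simp only [this, mul_add, Matrix.trace_add, map_add])
    (fun r X Y => by
      have : (r • Y).1 = r • Y.1 := rfl
      simp only [this, Matrix.mul_smul, Matrix.trace_smul, map_smul])

theorem loopCocycle_apply {m : ℕ} (X Y : LoopSl m) :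
    loopCocycle m X Y = constTerm (matD m X.1 * Y.1).trace := rfl

theorem loopCocycle_skew {m : ℕ} (X Y : LoopSl m) :
    loopCocycle m X Y = - loopCocycle m Y X := by
  have h := constTerm_tddt (X.1 * Y.1).trace
  rw [← trace_matD, matD_mul, Matrix.trace_add, map_add] at h
  rw [loopCocycle_apply, loopCocycle_apply, Matrix.trace_mul_comm (matD m Y.1) X.1]
  exact eq_neg_of_add_eq_zero_left h

theorem loopCocycle_self {m : ℕ} (X : LoopSl m) : loopCocycle m X X = 0 := by
  have h := loopCocycle_skew X X
  linear_combination h / 2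

theorem loopCocycle_lie {m : ℕ} (X Y Z : LoopSl m) :
    loopCocycle m X ⁅Y, Z⁆ = loopCocycle m ⁅X, Y⁆ Z + loopCocycle m Y ⁅X, Z⁆ := by
  have e : ∀ A B : LoopSl m, (⁅A, B⁆ : LoopSl m).1 = A.1 * B.1 - B.1 * A.1 := fun A B => rfl
  simp only [loopCocycle_apply, e, map_sub, matD_mul, mul_sub, sub_mul, add_mul,
    Matrix.trace_sub, Matrix.trace_add, ← mul_assoc, map_add]
  rw [Matrix.trace_mul_cycle (matD m X.1) Z.1 Y.1, Matrix.trace_mul_cycle (matD m Y.1) Z.1 X.1]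
  ring

theorem loopCocycle_loopD {m : ℕ} (X Y : LoopSl m) :
    loopCocycle m (loopD m X) Y = - loopCocycle m X (loopD m Y) := by
  have h := constTerm_tddt (matD m X.1 * Y.1).trace
  rw [← trace_matD, matD_mul, Matrix.trace_add, map_add] at h
  exact eq_neg_of_add_eq_zero_left h

theorem loopD_lie {m : ℕ} (X Y : LoopSl m) :
    loopD m ⁅X, Y⁆ = ⁅loopD m X, Y⁆ + ⁅X, loopD m Y⁆ := by
  ext1
  change matD m (X.1 * Y.1 - Y.1 * X.1) = (matD m X.1 * Y.1 - Y.1 * matD m X.1)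
    + (X.1 * matD m Y.1 - matD m Y.1 * X.1)
  rw [map_sub, matD_mul, matD_mul]
  abel

theorem affine_jacobi_aux {L : Type} [LieRing L] [LieAlgebra ℂ L] (D : L →ₗ[ℂ] L)
    (hD : ∀ X Y : L, D ⁅X, Y⁆ = ⁅D X, Y⁆ + ⁅X, D Y⁆) (X Y Z : L) (a b c : ℂ) :
    ⁅X, ⁅Y, Z⁆ + b • D Z - c • D Y⁆ + a • D (⁅Y, Z⁆ + b • D Z - c • D Y) =
    (⁅⁅X, Y⁆ + a • D Y - b • D X, Z⁆ - c • D (⁅X, Y⁆ + a • D Y - b • D X)) +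
    (⁅Y, ⁅X, Z⁆ + a • D Z - c • D X⁆ + b • D (⁅X, Z⁆ + a • D Z - c • D X)) := by
  simp only [map_add, map_sub, map_smul, hD, lie_add, lie_sub, add_lie, sub_lie, lie_smul,
    smul_lie, smul_add, smul_sub]
  rw [leibniz_lie X Y Z, smul_comm a b, smul_comm a c, smul_comm b c, ← lie_skew (D X) Y]
  simp only [smul_neg]
  abel

theorem affine_cocycle_aux {m : ℕ} (X Y Z : LoopSl m) (a b c : ℂ) :
    loopCocycle m X (⁅Y, Z⁆ + b • loopD m Z - c • loopD m Y) =
    loopCocycle m (⁅X, Y⁆ + a • loopD m Y - b • loopD m X) Z +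
    loopCocycle m Y (⁅X, Z⁆ + a • loopD m Z - c • loopD m X) := by
  have h1 := loopCocycle_lie X Y Z
  have h2 := loopCocycle_loopD X Z
  have h3 := loopCocycle_loopD Y Z
  have h4 := loopCocycle_loopD X Y
  have h5 := loopCocycle_skew (loopD m X) Y
  simp only [map_add, map_sub, map_smul, LinearMap.add_apply, LinearMap.sub_apply,
    LinearMap.smul_apply, smul_eq_mul]
  linear_combination h1 + b * h2 - a * h3 - c * h4 + c * h5

/-- The affine Lie algebra `sl_m(ℂ) ⊗ ℂ[t,t⁻¹] ⊕ ℂ c ⊕ ℂ d`; the triple `(X, a, b)` stands for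
`X + a c + b d`. -/
def AffineSl (m : ℕ) : Type := LoopSl m × ℂ × ℂ

namespace AffineSl

variable {m : ℕ}

instance : AddCommGroup (AffineSl m) := inferInstanceAs (AddCommGroup (LoopSl m × ℂ × ℂ))

instance : Module ℂ (AffineSl m) := inferInstanceAs (Module ℂ (LoopSl m × ℂ × ℂ))

/-- The element `X + a c + b d`. -/
def mk (X : LoopSl m) (a b : ℂ) : AffineSl m := (X, a, b)

/-- The loop component. -/
def loop : AffineSl m →ₗ[ℂ] LoopSl m := LinearMap.fst ℂ (LoopSl m) (ℂ × ℂ)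

/-- The coefficient of the central element `c`. -/
def coC : AffineSl m →ₗ[ℂ] ℂ := LinearMap.fst ℂ ℂ ℂ ∘ₗ LinearMap.snd ℂ (LoopSl m) (ℂ × ℂ)

/-- The coefficient of the degree element `d`. -/
def coD : AffineSl m →ₗ[ℂ] ℂ := LinearMap.snd ℂ ℂ ℂ ∘ₗ LinearMap.snd ℂ (LoopSl m) (ℂ × ℂ)

theorem ext' {x y : AffineSl m} (h1 : loop x = loop y) (h2 : coC x = coC y)
    (h3 : coD x = coD y) : x = y :=
  Prod.ext h1 (Prod.ext h2 h3)

/-- `[X ⊗ f, Y ⊗ g] = [X, Y] ⊗ fg + tr(XY) Res(df g) c`, `[d, X ⊗ f] = X ⊗ t df/dt`,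
and `c` is central. -/
instance : Bracket (AffineSl m) (AffineSl m) where
  bracket x y := mk
    (⁅loop x, loop y⁆ + coD x • loopD m (loop y) - coD y • loopD m (loop x))
    (loopCocycle m (loop x) (loop y)) 0

theorem loop_lie (x y : AffineSl m) : loop ⁅x, y⁆ =
    ⁅loop x, loop y⁆ + coD x • loopD m (loop y) - coD y • loopD m (loop x) := rfl

theorem coC_lie (x y : AffineSl m) : coC ⁅x, y⁆ = loopCocycle m (loop x) (loop y) := rfl

theorem coD_lie (x y : AffineSl m) : coD ⁅x, y⁆ = 0 := rfl

instance : LieRing (AffineSl m) where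
  add_lie x y z := by
    apply ext'
    · simp only [loop_lie, map_add, add_lie, add_smul, smul_add]; abel
    · simp only [coC_lie, map_add, LinearMap.add_apply]
    · simp only [coD_lie, map_add, add_zero]
  lie_add x y z := by
    apply ext'
    · simp only [loop_lie, map_add, lie_add, add_smul, smul_add]; abel
    · simp only [coC_lie, map_add]
    · simp only [coD_lie, map_add, add_zero]
  lie_self x := by
    apply ext'
    · simp [loop_lie]
    · simp [coC_lie, loopCocycle_self]
    · simp [coD_lie]
  leibniz_lie x y z := by
    apply ext'
    · simpa only [loop_lie, map_add, coD_lie, zero_smul, sub_zero, add_zero, zero_sub, zero_add,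
        sub_eq_add_neg, neg_zero, neg_smul]
        using affine_jacobi_aux (loopD m) loopD_lie (loop x) (loop y) (loop z)
          (coD x) (coD y) (coD z)
    · simpa only [coC_lie, loop_lie, map_add] using affine_cocycle_aux (loop x) (loop y) (loop z)
        (coD x) (coD y) (coD z)
    · simp only [coD_lie, map_add, add_zero]

instance : LieAlgebra ℂ (AffineSl m) where
  lie_smul r x y := by
    apply ext'
    · simp only [loop_lie, map_smul, lie_smul, smul_add, smul_sub, smul_eq_mul]
      rw [smul_comm r (coD x), mul_smul]
    · simp [coC_lie]
    · simp [coD_lie]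

/-- The traceless part `X - (tr X / m) 1` of a matrix. -/
def traceless (X : Matrix (Fin m) (Fin m) ℂ[T;T⁻¹]) : LoopSl m :=
  ⟨X - ((m : ℂ)⁻¹ • X.trace) • (1 : Matrix (Fin m) (Fin m) ℂ[T;T⁻¹]), by
    rw [mem_sl_iff, Matrix.trace_sub, Matrix.trace_smul, Matrix.trace_one, Fintype.card_fin]
    rcases Nat.eq_zero_or_pos m with h | h
    · subst h
      simp [Matrix.trace]
    · have hm : (m : ℂ) ≠ 0 := Nat.cast_ne_zero.2 h.ne'
      have h1 : ((m : ℂ)⁻¹ • X.trace) • (m : ℂ[T;T⁻¹]) = X.trace := by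
        rw [smul_eq_mul, mul_comm, ← nsmul_eq_mul, ← Nat.cast_smul_eq_nsmul ℂ, smul_smul,
          mul_inv_cancel₀ hm, one_smul]
      rw [h1, sub_self]⟩

/-- The element `Ē_{ab} ⊗ t^n`, where `Ē_{ab}` is the matrix unit `E_{ab}` if `a ≠ b`, and
`Ē_{aa} = E_{aa} - 1/m`, the orthogonal projection of `E_{aa}` to the traceless diagonal matrices.
With respect to the trace form, `∑_{a} Ē_{aa} ⊗ Ē_{aa} = ∑ H_k ⊗ H_k` for every orthonormal basis
`H_k` of the traceless diagonal matrices, and `∑_{a,b} Ē_{ab} ⊗ Ē_{ba} = ∑ J_k ⊗ J_k` for every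
orthonormal basis `J_k` of `sl_m(ℂ)`. -/
def E (a b : Fin m) (n : ℤ) : AffineSl m :=
  mk (traceless (Matrix.single a b (LaurentPolynomial.T n))) 0 0

/-- The central element `c`. -/
def cen : AffineSl m := mk 0 1 0

/-- The degree element `d`. -/
def deg : AffineSl m := mk 0 0 1

variable (m) in
/-- The Cartan subalgebra `𝔥`: traceless constant diagonal matrices, `c` and `d`. -/
def cartan : Submodule ℂ (AffineSl m) :=
  Submodule.span ℂ ({x | ∃ a, x = E a a 0} ∪ {cen, deg})

variable (m) in
/-- `𝔫₊`: strictly upper triangular constant matrices and `sl_m(ℂ) ⊗ tℂ[t]`. -/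
def nPlus : Submodule ℂ (AffineSl m) :=
  Submodule.span ℂ ({x | ∃ a b, a < b ∧ x = E a b 0} ∪ {x | ∃ a b, ∃ n : ℤ, 0 < n ∧ x = E a b n})

variable (m) in
/-- `𝔫₋`: strictly lower triangular constant matrices and `sl_m(ℂ) ⊗ t⁻¹ℂ[t⁻¹]`. -/
def nMinus : Submodule ℂ (AffineSl m) :=
  Submodule.span ℂ ({x | ∃ a b, b < a ∧ x = E a b 0} ∪ {x | ∃ a b, ∃ n : ℤ, n < 0 ∧ x = E a b n})

/-- `c` as an element of `𝔥`. -/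
def cenH : cartan m := ⟨cen, Submodule.subset_span (Or.inr (Or.inl rfl))⟩

/-- The coroot `E_{aa} - E_{bb}` as an element of `𝔥`. -/
def corootH (a b : Fin m) : cartan m :=
  ⟨E a a 0 - E b b 0, Submodule.sub_mem _ (Submodule.subset_span (Or.inl ⟨a, rfl⟩))
    (Submodule.subset_span (Or.inl ⟨b, rfl⟩))⟩

/-- The element `ρ̌ + m d`, where `ρ̌` is half the sum of the positive coroots of `sl_m(ℂ)`. -/
def rhoCheck : AffineSl m :=
  (1 / 2 : ℂ) • (∑ a : Fin m, ∑ b : Fin m, if a < b then E a a 0 - E b b 0 else 0)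
    + (m : ℂ) • deg

/-- The linear form "`a`-th diagonal entry", whose restriction to the traceless diagonal matrices
is the weight `ē_a` of the `a`-th basis vector of `ℂ^m`. -/
def diagEntry (a : Fin m) (x : AffineSl m) : ℂ := constTerm ((loop x).1 a a)

variable (m) in
/-- Weights of the affine Lie algebra: the dual `𝔥*` of the Cartan subalgebra. -/
abbrev Weight : Type := Module.Dual ℂ (cartan m)

/-- `l` is a dominant integral weight: it takes non-negative integer values on the simple coroots
`E_{aa} - E_{a+1,a+1}` (`1 ≤ a < m`) and `c - (E_{11} - E_{mm})`. -/
def IsDominantIntegral (l : Weight m) : Prop :=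
  (∀ a b : Fin m, (a : ℕ) + 1 = b → ∃ n : ℕ, l (corootH a b) = n) ∧
  ∀ a b : Fin m, (a : ℕ) = 0 → (b : ℕ) + 1 = m → ∃ n : ℕ, l (cenH - corootH a b) = n

/-- The restriction of `l` to the traceless diagonal matrices is a weight of the `N`-th tensor power
of the vector representation `ℂ^m`, i.e. it equals `∑ β_a ē_a` with `β_a ≥ 0` and `∑ β_a = N`. -/
def IsTensorPowerWeight (N : ℕ) (l : Weight m) : Prop :=
  ∃ β : Fin m → ℕ, ∑ a, β a = N ∧ ∀ h : cartan m, coC h.1 = 0 → coD h.1 = 0 →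
    l h = ∑ a, (β a : ℂ) * diagEntry a h.1

/-! ### Verma modules -/

variable (m) in
/-- The universal enveloping algebra of the affine Lie algebra. -/
abbrev U : Type := UniversalEnvelopingAlgebra ℂ (AffineSl m)

section

attribute [local instance 100] LieRing.ofAssociativeRing

/-- The canonical map to the universal enveloping algebra. -/
def toU : AffineSl m →ₗ[ℂ] U m := (UniversalEnvelopingAlgebra.ι ℂ : AffineSl m →ₗ⁅ℂ⁆ U m)

theorem toU_lie (x y : AffineSl m) : toU ⁅x, y⁆ = toU x * toU y - toU y * toU x :=
  LieHom.map_lie (UniversalEnvelopingAlgebra.ι ℂ : AffineSl m →ₗ⁅ℂ⁆ U m) x y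

end

/-- The left ideal generated by `n` and by `h - l(h)`, `h ∈ 𝔥`. -/
def vermaIdeal (n : Submodule ℂ (AffineSl m)) (l : Weight m) : Submodule (U m) (U m) :=
  Submodule.span (U m) ({u | ∃ x ∈ n, u = toU x} ∪
    {u | ∃ h : cartan m, u = toU h.1 - algebraMap ℂ (U m) (l h)})

/-- The quotient of the enveloping algebra by the left ideal generated by `n` and by `h - l(h)`,
`h ∈ 𝔥`, as a module over the affine Lie algebra. -/
def VermaOf (n : Submodule ℂ (AffineSl m)) (l : Weight m) : Type := U m ⧸ vermaIdeal n l

instance (n : Submodule ℂ (AffineSl m)) (l : Weight m) : AddCommGroup (VermaOf n l) :=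
  inferInstanceAs (AddCommGroup (U m ⧸ vermaIdeal n l))

instance (n : Submodule ℂ (AffineSl m)) (l : Weight m) : Module (U m) (VermaOf n l) :=
  inferInstanceAs (Module (U m) (U m ⧸ vermaIdeal n l))

instance (n : Submodule ℂ (AffineSl m)) (l : Weight m) : Module ℂ (VermaOf n l) :=
  inferInstanceAs (Module ℂ (U m ⧸ vermaIdeal n l))

instance (n : Submodule ℂ (AffineSl m)) (l : Weight m) : IsScalarTower ℂ (U m) (VermaOf n l) :=
  inferInstanceAs (IsScalarTower ℂ (U m) (U m ⧸ vermaIdeal n l))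

/-- The action of `x` is left multiplication by `x`. -/
instance (n : Submodule ℂ (AffineSl m)) (l : Weight m) :
    LieRingModule (AffineSl m) (VermaOf n l) where
  bracket x v := toU x • v
  add_lie x y v := by
    change toU (x + y) • v = toU x • v + toU y • v
    rw [map_add, add_smul]
  lie_add x v w := smul_add (toU x) v w
  leibniz_lie x y v := by
    change toU x • toU y • v = toU ⁅x, y⁆ • v + toU y • toU x • v
    rw [toU_lie, sub_smul, mul_smul, mul_smul, sub_add_cancel]

instance (n : Submodule ℂ (AffineSl m)) (l : Weight m) :
    LieModule ℂ (AffineSl m) (VermaOf n l) where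
  smul_lie r x v := by
    change toU (r • x) • v = r • toU x • v
    rw [map_smul, smul_assoc]
  lie_smul r x v := by
    change toU x • r • v = r • toU x • v
    rw [← algebraMap_smul (U m) r v, ← algebraMap_smul (U m) r (toU x • v), ← mul_smul,
      ← mul_smul, Algebra.commutes]

/-- The highest weight Verma module of highest weight `l`. -/
abbrev Verma (l : Weight m) : Type := VermaOf (nPlus m) l

/-- The lowest weight Verma module of lowest weight `-l`. -/
abbrev LowestVerma (l : Weight m) : Type := VermaOf (nMinus m) (-l)

end AffineSl

/-! ### The degenerate double affine Hecke algebra -/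

namespace DDAHA

/-- The action `(w η)_i = η_{w⁻¹ i}` of a permutation on the lattice `P = ℤ^N`. -/
def permLattice {N : ℕ} (w : Equiv.Perm (Fin N)) : (Fin N → ℤ) →+ (Fin N → ℤ) where
  toFun η := fun i => η (w⁻¹ i)
  map_zero' := rfl
  map_add' _ _ := rfl

/-- The action of the symmetric group on the (multiplicatively written) lattice `P = ℤ^N`. -/
def permAut (N : ℕ) : Equiv.Perm (Fin N) →* MulAut (Multiplicative (Fin N → ℤ)) where
  toFun w :=
    { toFun := fun η => Multiplicative.ofAdd (permLattice w η.toAdd)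
      invFun := fun η => Multiplicative.ofAdd (permLattice w⁻¹ η.toAdd)
      left_inv := fun η => by
        apply Multiplicative.toAdd.injective
        funext i
        simp [permLattice]
      right_inv := fun η => by
        apply Multiplicative.toAdd.injective
        funext i
        simp [permLattice]
      map_mul' := fun _ _ => rfl }
  map_one' := rfl
  map_mul' _ _ := rfl

/-- The (extended) affine Weyl group `W = P ⋊ S_N` of type `gl_N`; the pair `⟨η, w⟩` stands
for `t_η w`. -/
abbrev W (N : ℕ) : Type :=
  Multiplicative (Fin N → ℤ) ⋊[permAut N] Equiv.Perm (Fin N)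

/-- The translation `t_η`. -/
def transl {N : ℕ} (η : Fin N → ℤ) : W N := SemidirectProduct.inl (Multiplicative.ofAdd η)

/-- The element of `W` given by a permutation. -/
def ofPerm {N : ℕ} (w : Equiv.Perm (Fin N)) : W N := SemidirectProduct.inr w

/-- The space `𝔱' = ⨁ ℂ ε_i^∨ ⊕ ℂ c`; the pair `(x, k)` stands for `∑ x_i ε_i^∨ + k c`. -/
abbrev T' (N : ℕ) : Type := (Fin N → ℂ) × ℂ

/-- The action of `W` on `𝔱'`: permutations permute the `ε_i^∨` and fix `c`, and
`t_η(ξ) = ξ - η(ξ) c`. -/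
def act {N : ℕ} (w : W N) (ξ : T' N) : T' N :=
  (fun i => ξ.1 (w.right⁻¹ i), ξ.2 - ∑ i, (w.left.toAdd i : ℂ) * ξ.1 (w.right⁻¹ i))

/-- The value on `𝔱'` of the simple affine root `α_i`; the indices `1, …, N` of `ε` are the elements
`0, …, N - 1` of `Fin N`, so that `α_i = ε_{i-1} - ε_i` for `i ≠ 0`, and `α_0 = δ - (ε_0 - ε_{N-1})`,
where `δ` vanishes on `𝔱'`. -/
def simpleRoot {N : ℕ} [NeZero N] (i : Fin N) (ξ : T' N) : ℂ := ξ.1 (i - 1) - ξ.1 i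

/-- The simple reflections: `s_i` is the transposition of `i - 1` and `i` for `i ≠ 0`, and
`s_0 = t_{ε_0 - ε_{N-1}} (0, N-1)`. -/
def simpleRefl {N : ℕ} [NeZero N] (i : Fin N) : W N :=
  if i = 0 then transl (Pi.single 0 1 - Pi.single (0 - 1) 1) * ofPerm (Equiv.swap (0 - 1) 0)
  else ofPerm (Equiv.swap (i - 1) i)

/-- The element `π = t_{ε_0} s_1 ⋯ s_{N-1}`; the product `s_1 ⋯ s_{N-1}` is the cyclic permutation
`i ↦ i + 1`. -/
def piElt (N : ℕ) [NeZero N] : W N := transl (Pi.single 0 1) * ofPerm (Equiv.addRight 1)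

/-- The defining relations: `W` and `𝔱'` generate the group algebra `ℂ[W]` and the symmetric algebra
`S[𝔱']`, and `s_i ξ - s_i(ξ) s_i = -α_i(ξ)`, `π ξ = π(ξ) π`. -/
inductive Rel (N : ℕ) [NeZero N] :
    FreeAlgebra ℂ (W N ⊕ T' N) → FreeAlgebra ℂ (W N ⊕ T' N) → Prop
  | one : Rel N (FreeAlgebra.ι ℂ (Sum.inl 1)) 1
  | mul (v w : W N) : Rel N (FreeAlgebra.ι ℂ (Sum.inl (v * w)))
      (FreeAlgebra.ι ℂ (Sum.inl v) * FreeAlgebra.ι ℂ (Sum.inl w))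
  | add (ξ ξ' : T' N) : Rel N (FreeAlgebra.ι ℂ (Sum.inr (ξ + ξ')))
      (FreeAlgebra.ι ℂ (Sum.inr ξ) + FreeAlgebra.ι ℂ (Sum.inr ξ'))
  | smul (r : ℂ) (ξ : T' N) : Rel N (FreeAlgebra.ι ℂ (Sum.inr (r • ξ)))
      (r • FreeAlgebra.ι ℂ (Sum.inr ξ))
  | comm (ξ ξ' : T' N) : Rel N (FreeAlgebra.ι ℂ (Sum.inr ξ) * FreeAlgebra.ι ℂ (Sum.inr ξ'))
      (FreeAlgebra.ι ℂ (Sum.inr ξ') * FreeAlgebra.ι ℂ (Sum.inr ξ))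
  | refl (i : Fin N) (ξ : T' N) : Rel N
      (FreeAlgebra.ι ℂ (Sum.inl (simpleRefl i)) * FreeAlgebra.ι ℂ (Sum.inr ξ)
        - FreeAlgebra.ι ℂ (Sum.inr (act (simpleRefl i) ξ))
          * FreeAlgebra.ι ℂ (Sum.inl (simpleRefl i)))
      (algebraMap ℂ _ (-simpleRoot i ξ))
  | pi (ξ : T' N) : Rel N
      (FreeAlgebra.ι ℂ (Sum.inl (piElt N)) * FreeAlgebra.ι ℂ (Sum.inr ξ))
      (FreeAlgebra.ι ℂ (Sum.inr (act (piElt N) ξ)) * FreeAlgebra.ι ℂ (Sum.inl (piElt N)))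

/-- The degenerate double affine Hecke algebra `H` of `gl_N`. -/
abbrev H (N : ℕ) [NeZero N] : Type := RingQuot (Rel N)

/-- The element of `H` given by an element of `W`. -/
def ofW {N : ℕ} [NeZero N] (w : W N) : H N :=
  RingQuot.mkAlgHom ℂ (Rel N) (FreeAlgebra.ι ℂ (Sum.inl w))

/-- The element of `H` given by an element of `𝔱'`. -/
def ofT {N : ℕ} [NeZero N] (ξ : T' N) : H N :=
  RingQuot.mkAlgHom ℂ (Rel N) (FreeAlgebra.ι ℂ (Sum.inr ξ))

end DDAHA

/-! ### The functor `F(A, B)` -/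

namespace KZ

open AffineSl DDAHA

/-- `ℂ[P]`, the Laurent polynomials in `z_1, …, z_N`; `e^η` is `single η 1` and `z_i = e^{ε_i}`. -/
abbrev Lau (N : ℕ) : Type := AddMonoidAlgebra ℂ (Fin N → ℤ)

/-- The field of rational functions in `z_1, …, z_N`. -/
abbrev RatFun (N : ℕ) : Type := FractionRing (Lau N)

/-- The `N`-th tensor power of the vector representation `ℂ^m`. -/
abbrev VN (m N : ℕ) : Type := ⨂[ℂ] _ : Fin N, (Fin m → ℂ)

/-- The space `A ⊗ (S ⊗ (ℂ^m)^{⊗ N}) ⊗ B` for a space `S` of functions of `z_1, …, z_N`. -/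
abbrev Num (m N : ℕ) (S A B : Type) [AddCommGroup S] [Module ℂ S] [AddCommGroup A] [Module ℂ A]
    [AddCommGroup B] [Module ℂ B] : Type :=
  A ⊗[ℂ] ((S ⊗[ℂ] VN m N) ⊗[ℂ] B)

/-- The additive map `η ↦ η(ξ) = ∑ ξ_i η_i`. -/
def pairing {N : ℕ} (ξ : Fin N → ℂ) : (Fin N → ℤ) →+ ℂ where
  toFun η := ∑ i, ξ i * η i
  map_zero' := by simp
  map_add' η η' := by simp [mul_add, Finset.sum_add_distrib]

/-- The derivation `∂_ξ` of `ℂ[P]`, with `∂_ξ e^η = η(ξ) e^η`. -/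
def partialD {N : ℕ} (ξ : Fin N → ℂ) : Lau N →ₗ[ℂ] Lau N := eulerLin (pairing ξ)

/-- The substitution `f(t) ↦ f(z_i)`. -/
def evalAt {N : ℕ} (i : Fin N) : ℂ[T;T⁻¹] →ₐ[ℂ] Lau N :=
  AddMonoidAlgebra.mapDomainAlgHom ℂ ℂ (AddMonoidHom.single (fun _ : Fin N => ℤ) i)

/-- The matrix unit `E_{ab}` acting on the `i`-th factor of `(ℂ^m)^{⊗ N}`. -/
def slotE {m N : ℕ} (i : Fin N) (a b : Fin m) : VN m N →ₗ[ℂ] VN m N :=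
  PiTensorProduct.map
    (Function.update (fun _ => LinearMap.id) i (Matrix.toLin' (Matrix.single a b (1 : ℂ))))

/-- The action of `𝔤` on the `i`-th evaluation module `ℂ[z_i,z_i⁻¹] ⊗ ℂ^m`: `X ⊗ f(t)` acts by
`f(z_i) ⊗ X`, `d` by `z_i ∂/∂z_i` and `c` by `0`. -/
def thetaEval {m N : ℕ} (i : Fin N) (x : AffineSl m) : Module.End ℂ (Lau N ⊗[ℂ] VN m N) :=
  (∑ a : Fin m, ∑ b : Fin m,
    TensorProduct.map (LinearMap.mulLeft ℂ (evalAt i ((loop x).1 a b))) (slotE i a b))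
  + coD x • TensorProduct.map (partialD (Pi.single i 1)) LinearMap.id

section

variable {m N : ℕ} (A B : Type)
  [AddCommGroup A] [Module ℂ A] [LieRingModule (AffineSl m) A] [LieModule ℂ (AffineSl m) A]
  [AddCommGroup B] [Module ℂ B] [LieRingModule (AffineSl m) B] [LieModule ℂ (AffineSl m) B]

/-- The action of `𝔤` on the factor `A`. -/
def thetaA (x : AffineSl m) : Module.End ℂ (Num m N (Lau N) A B) :=
  LinearMap.rTensor _ (LieModule.toEnd ℂ (AffineSl m) A x)

/-- The action of `𝔤` on the `i`-th evaluation factor. -/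
def thetaI (i : Fin N) (x : AffineSl m) : Module.End ℂ (Num m N (Lau N) A B) :=
  LinearMap.lTensor A (LinearMap.rTensor B (thetaEval i x))

/-- The action of `𝔤` on the factor `B`. -/
def thetaB (x : AffineSl m) : Module.End ℂ (Num m N (Lau N) A B) :=
  LinearMap.lTensor A (LinearMap.lTensor _ (LieModule.toEnd ℂ (AffineSl m) B x))

/-- The diagonal action of `𝔤`. -/
def theta (x : AffineSl m) : Module.End ℂ (Num m N (Lau N) A B) :=
  thetaA A B x + (∑ i, thetaI A B i x) + thetaB A B x

variable (m N) in
/-- The subspace `𝔤' (A ⊗ ℂ[P] ⊗ (ℂ^m)^{⊗ N} ⊗ B)`, where `𝔤' = [𝔤, 𝔤]`. -/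
def gPrimeNum : Submodule ℂ (Num m N (Lau N) A B) :=
  Submodule.span ℂ {v | ∃ x ∈ ⁅(⊤ : LieIdeal ℂ (AffineSl m)), (⊤ : LieIdeal ℂ (AffineSl m))⁆,
    ∃ y, v = theta A B x y}

variable (m N) in
/-- The space `F(A, B) = (A ⊗ ℂ[P] ⊗ (ℂ^m)^{⊗ N} ⊗ B) / 𝔤'`. -/
abbrev F : Type := Num m N (Lau N) A B ⧸ gPrimeNum m N A B

/-- The action of permutations on `ℂ[P]`, with `w(e^η) = e^{w(η)}`. -/
def tau1 (w : Equiv.Perm (Fin N)) : Lau N →ₗ[ℂ] Lau N :=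
  (AddMonoidAlgebra.mapDomainAlgHom ℂ ℂ (permLattice w)).toLinearMap

variable (m) in
/-- The action of permutations on `(ℂ^m)^{⊗ N}`: the `i`-th factor is moved to the `w(i)`-th
place. -/
def tau2 (w : Equiv.Perm (Fin N)) : VN m N →ₗ[ℂ] VN m N :=
  (PiTensorProduct.reindex ℂ (fun _ => Fin m → ℂ) w).toLinearMap

/-- The action `τ = id ⊗ τ₁ ⊗ τ₂ ⊗ id` of permutations. -/
def tau (w : Equiv.Perm (Fin N)) : Module.End ℂ (Num m N (Lau N) A B) :=
  LinearMap.lTensor A (LinearMap.rTensor B (TensorProduct.map (tau1 w) (tau2 m w)))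

variable (m) in
/-- Multiplication by an element of `ℂ[P]`. -/
def mulLau (f : Lau N) : Module.End ℂ (Num m N (Lau N) A B) :=
  LinearMap.lTensor A (LinearMap.rTensor B (LinearMap.rTensor _ (LinearMap.mulLeft ℂ f)))

variable (m) in
/-- Multiplication by a rational function. -/
def mulRat (f : RatFun N) : Module.End ℂ (Num m N (RatFun N) A B) :=
  LinearMap.lTensor A (LinearMap.rTensor B (LinearMap.rTensor _ (LinearMap.mulLeft ℂ f)))

variable (m N) in
/-- The inclusion of Laurent polynomial into rational coefficients. -/
def incl : Num m N (Lau N) A B →ₗ[ℂ] Num m N (RatFun N) A B :=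
  LinearMap.lTensor A (LinearMap.rTensor B (LinearMap.rTensor _
    (IsScalarTower.toAlgHom ℂ (Lau N) (RatFun N)).toLinearMap))

/-! #### The classical `r`-matrix -/

/-- The classical `r`-matrix `r̄ = ½ ∑ H_k ⊗ H_k + ∑_{γ > 0} E_γ ⊗ E_{-γ}` of `sl_m(ℂ)`, the first
factor acting through `p` and the second one through `q`. -/
def rBar {M : Type} [AddCommGroup M] [Module ℂ M] (p q : AffineSl m → Module.End ℂ M) :
    Module.End ℂ M :=
  (1 / 2 : ℂ) • (∑ a : Fin m, p (E a a 0) * q (E a a 0))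
    + ∑ a : Fin m, ∑ b : Fin m, if a < b then p (E a b 0) * q (E b a 0) else 0

/-- The universal classical `r`-matrix
`r = r̄ + ½ (c ⊗ d + d ⊗ c) + ∑_{n ≥ 1} ∑_k (J_k ⊗ t^n) ⊗ (J_k ⊗ t^{-n})`, the first factor acting
through `p` and the second one through `q`, applied to a vector `y`. The sum over `n` is finite
for every `y` when the first factor acts on a highest weight module or the second one
on a lowest weight module. -/
def rUniv {M : Type} [AddCommGroup M] [Module ℂ M] (p q : AffineSl m → Module.End ℂ M) (y : M) :
    M :=
  rBar p q y + (1 / 2 : ℂ) • (p cen (q deg y) + p deg (q cen y))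
    + ∑ᶠ n : ℕ, ∑ a : Fin m, ∑ b : Fin m, p (E a b (n + 1)) (q (E b a (-(n + 1))) y)

/-- The rational function `e^{-(ε_j - ε_k)} = z_k / z_j`. -/
def zRatio (k j : Fin N) : RatFun N :=
  algebraMap (Lau N) (RatFun N) (AddMonoidAlgebra.single (Pi.single k 1 - Pi.single j 1) 1)

/-- The `r`-matrix `r_{(ij)} = r̄_{ij} + (z_i/z_j) / (1 - z_i/z_j) Ω_{ij}` between the `i`-th and the
`j`-th evaluation factor, where `Ω` is the sum of `r̄` and its transpose. -/
def rEval (i j : Fin N) (y : Num m N (Lau N) A B) : Num m N (RatFun N) A B :=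
  incl m N A B (rBar (thetaI A B i) (thetaI A B j) y)
    + mulRat m A B (zRatio i j / (1 - zRatio i j))
      (incl m N A B (rBar (thetaI A B i) (thetaI A B j) y + rBar (thetaI A B j) (thetaI A B i) y))

/-- The Knizhnik–Zamolodchikov operator
`∇_i = ∑_{0 ≤ j < i} r_{(ji)} - ∑_{i < j ≤ N+1} r_{(ij)} + θ_i(ρ̌ + m d)`,
where the places `0` and `N + 1` belong to `A` and `B`, applied to a vector with Laurent
polynomial coefficients. -/
def nabla (i : Fin N) (y : Num m N (Lau N) A B) : Num m N (RatFun N) A B :=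
  incl m N A B (rUniv (thetaA A B) (thetaI A B i) y)
    + (∑ j : Fin N, if j < i then rEval A B j i y else 0)
    - (∑ j : Fin N, if i < j then rEval A B i j y else 0)
    - incl m N A B (rUniv (thetaI A B i) (thetaB A B) y)
    + incl m N A B (thetaI A B i rhoCheck y)

variable (N) in
/-- The function `G = ∏_α (1 - e^{-α})`, `α` running through all roots `ε_j - ε_k`, `j ≠ k`. -/
def bigG : Lau N :=
  ∏ j : Fin N, ∏ k : Fin N,
    if j ≠ k then 1 - AddMonoidAlgebra.single (Pi.single k 1 - Pi.single j 1) 1 else 1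

/-- The logarithmic derivative `∂_ξ log G`. -/
def dlogG (ξ : Fin N → ℂ) : RatFun N :=
  algebraMap (Lau N) (RatFun N) (partialD ξ (bigG N)) / algebraMap (Lau N) (RatFun N) (bigG N)

/-- The value `½ ∑_{j<k} (ξ_j - ξ_k)` at `ξ` of half the sum of the positive roots. -/
def rhoBar (ξ : Fin N → ℂ) : ℂ :=
  (1 / 2) * ∑ j : Fin N, ∑ k : Fin N, if j < k then ξ j - ξ k else 0

/-- The generalised Cherednik–Dunkl operator
`D_ξ = ∑ ξ_i ∇_i + ∑_{α > 0} α(ξ) (1 - e^{-α})⁻¹ (1 - τ(s_α)) - ρ(ξ) - (m-1)/(2m) ∂_ξ log G`,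
applied to a vector with Laurent polynomial coefficients. -/
def dunkl (ξ : Fin N → ℂ) (y : Num m N (Lau N) A B) : Num m N (RatFun N) A B :=
  (∑ i, ξ i • nabla A B i y)
    + (∑ j : Fin N, ∑ k : Fin N, if j < k then
        (ξ j - ξ k) • mulRat m A B (1 / (1 - zRatio k j))
          (incl m N A B (y - tau A B (Equiv.swap j k) y)) else 0)
    - rhoBar ξ • incl m N A B y
    - (((m : ℂ) - 1) / (2 * m)) • mulRat m A B (dlogG ξ) (incl m N A B y)

/-- `ρ` is the action of the degenerate double affine Hecke algebra on `F(A, B)`, for `A` of level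
`lev` and `B` of level `-lev`, in which `c` acts by `lev + m`, permutations by `τ`, translations
`t_η` by multiplication by `e^η`, and `ξ` by the operator `D_ξ`, which takes Laurent polynomial
coefficients to such coefficients. -/
structure IsAction [NeZero N] (lev : ℂ) (ρ : H N →ₐ[ℂ] Module.End ℂ (F m N A B)) : Prop where
  map_c : ρ (ofT (0, 1)) = (lev + m) • 1
  map_perm : ∀ (w : Equiv.Perm (Fin N)) (y : Num m N (Lau N) A B),
    ρ (ofW (ofPerm w)) (Submodule.Quotient.mk y) = Submodule.Quotient.mk (tau A B w y)
  map_transl : ∀ (η : Fin N → ℤ) (y : Num m N (Lau N) A B),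
    ρ (ofW (transl η)) (Submodule.Quotient.mk y)
      = Submodule.Quotient.mk (mulLau m A B (AddMonoidAlgebra.single η 1) y)
  map_xi : ∀ (ξ : Fin N → ℂ) (y : Num m N (Lau N) A B), ∃ y' : Num m N (Lau N) A B,
    incl m N A B y' = dunkl A B ξ y ∧
      ρ (ofT (ξ, 0)) (Submodule.Quotient.mk y) = Submodule.Quotient.mk y'

end

/-- The space `M(λ, μ) = F(M(μ), M†(λ))`, where `M(μ)` is the Verma module of highest weight `μ` and
`M†(λ)` the Verma module of lowest weight `-λ`. -/
abbrev StdModule {m : ℕ} (N : ℕ) (lam mu : Weight m) : Type :=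
  F m N (Verma mu) (LowestVerma lam)

end KZ

/-- The `R`-module `M` has exactly one submodule with irreducible quotient. -/
def HasUniqueIrreducibleQuotient (R M : Type) [Ring R] [AddCommGroup M] [Module R M] : Prop :=
  ∃! K : Submodule R M, IsSimpleModule R (M ⧸ K)

/-- The representation `ρ : R → End_ℂ(M)` has a unique irreducible quotient. -/
def RepHasUniqueIrreducibleQuotient {R M : Type} [Ring R] [Algebra ℂ R] [AddCommGroup M]
    [Module ℂ M] (ρ : R →ₐ[ℂ] Module.End ℂ M) : Prop :=
  letI : Module R M := Module.compHom M ρ.toRingHom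
  HasUniqueIrreducibleQuotient R M

end

/-! Put κ = ℓ + m. Modulo the image of 𝔤', elements of 𝔫₋ can be moved off the left Verma factor and
elements of 𝔫₊ off the right one, so the module is spanned by the classes of vacuum ⊗ z^η u_c ⊗
vacuum (`vacMap_surjective`). If β is the content with λ - μ = ∑ β_a ē_a, the Cartan subalgebra
kills every such class whose word c does not have content β (`vacMap_eb_eq_zero`). On these vectors
the Dunkl operators are explicit: κ z_i ∂_i, plus a function of the i-th colour, plus the operators
`xOp j k`, each a divided difference times a flip minus the constant r-matrix of gl_m (`incl_xOp`,
`dunklLau_vacNum`). The scalar terms of the original formula all cancel.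

Existence of the action has three ingredients. The Dunkl operators preserve the image of 𝔤', because
the commutator with a Chevalley generator e is a combination of θ(e)h_i - θ(h)e_i, where h is the
corresponding coroot; this is the standard Lie bialgebra cobracket, summed over all tensor legs
(`rUniv_comm`, `xOp_comm`, `dunklLau_comm`). The cross relations with permutations and with π are
verified on the middle factor, where they reduce to identities between `xOp j k` and `xOp k j`
(`tauM_swap_dunklMid`, `piM_dunklMid`). Commutativity of the Dunkl operators needs no Yang–Baxter
computation: by the cross relations the common kernel of all commutators is stable under W, it
contains the class v of the increasing word at exponent zero, which is a joint eigenvector, and the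
W-translates of v span the module (`dF_comm`). Uniqueness of the action holds because its values on
generators are prescribed, and passing from Laurent to rational coefficients loses nothing
(`isAction_unique`).

For the irreducible quotient, the Dunkl operators are triangular on the basis z^η u_c with respect
to the energy ∑ (N(c_i - m η_i) - i)² (`xOp_eb_triangular`), with explicit diagonal entries
(`eigV_eq`). Dominance of μ says that the numbers μ_a - a + κ n, listed by the level a - m n,
decrease by positive integers from one level to the next
(`exists_level_function_of_isDominantIntegral`). This forces the tuple of diagonal entries of v to
occur for no other pair (η, c) of the right content (`word_eq_of_eigV_eq`). Hence the module is
spanned by v together with the vectors killed by some product of operators D_i - a, each a different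
from the eigenvalue of D_i at v. Such products act invertibly on v, so a submodule that does not
contain v consists of killed vectors. Since v is cyclic, the sum of all proper submodules is proper,
and it is the only maximal submodule (`hasUniqueIrreducibleQuotient_of_cyclic`).

It remains that v is nonzero (`vacMap_eb_ne_zero`). A functional on the coinvariants which is 1 on v
is built from the freeness of M(μ) over 𝔫₋ and from the universal property of M†(λ). Freeness is
obtained without a PBW basis, by an explicit model of the induced representation on U(𝔫₋)
(`exists_induced`, `exists_verma_nMinus_map`). -/

open scoped TensorProduct LaurentPolynomial

noncomputable section

namespace AffineSl
variable {m : ℕ}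

/-! ### Structure of the affine Lie algebra -/

/-- The traceless part of a matrix as a linear map. -/
def tl : Matrix (Fin m) (Fin m) ℂ[T;T⁻¹] →ₗ[ℂ] LoopSl m where
  toFun := traceless
  map_add' X Y := by
    ext1
    change X + Y - _ = (X - _) + (Y - _)
    rw [Matrix.trace_add, smul_add, add_smul]
    abel
  map_smul' r X := by
    ext1
    change r • X - _ = r • (X - _)
    rw [Matrix.trace_smul, smul_sub, smul_comm _ r, smul_assoc]

theorem tl_val (X : Matrix (Fin m) (Fin m) ℂ[T;T⁻¹]) :
    (tl X).1 = X - ((m : ℂ)⁻¹ • X.trace) • (1 : Matrix (Fin m) (Fin m) ℂ[T;T⁻¹]) := rfl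

theorem tl_self (X : LoopSl m) : tl X.1 = X := by
  ext1
  rw [tl_val, (mem_sl_iff X.1).1 X.2, smul_zero, zero_smul, sub_zero]

/-- The matrix unit `E_{ab} ⊗ t^n`. -/
abbrev unitT (a b : Fin m) (n : ℤ) : Matrix (Fin m) (Fin m) ℂ[T;T⁻¹] :=
  Matrix.single a b (LaurentPolynomial.T n)

@[simp] theorem loop_mk (X : LoopSl m) (a b : ℂ) : loop (mk X a b) = X := rfl
@[simp] theorem coC_mk (X : LoopSl m) (a b : ℂ) : coC (mk X a b) = a := rfl
@[simp] theorem coD_mk (X : LoopSl m) (a b : ℂ) : coD (mk X a b) = b := rfl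
@[simp] theorem loop_E (a b : Fin m) (n : ℤ) : loop (E a b n) = tl (unitT a b n) := rfl
@[simp] theorem coC_E (a b : Fin m) (n : ℤ) : coC (E a b n) = 0 := rfl
@[simp] theorem coD_E (a b : Fin m) (n : ℤ) : coD (E a b n) = 0 := rfl
@[simp] theorem loop_cen : loop (cen : AffineSl m) = 0 := rfl
@[simp] theorem coC_cen : coC (cen : AffineSl m) = 1 := rfl
@[simp] theorem coD_cen : coD (cen : AffineSl m) = 0 := rfl
@[simp] theorem loop_deg : loop (deg : AffineSl m) = 0 := rfl
@[simp] theorem coC_deg : coC (deg : AffineSl m) = 0 := rfl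
@[simp] theorem coD_deg : coD (deg : AffineSl m) = 1 := rfl

theorem tl_commutator (X Y : Matrix (Fin m) (Fin m) ℂ[T;T⁻¹]) :
    ⁅tl X, tl Y⁆ = tl (X * Y - Y * X) := by
  ext1
  rw [tl_val (X * Y - Y * X), Matrix.trace_sub, Matrix.trace_mul_comm, sub_self, smul_zero,
    zero_smul, sub_zero]
  change (tl X).1 * (tl Y).1 - (tl Y).1 * (tl X).1 = _
  simp only [tl_val, sub_mul, mul_sub, Matrix.smul_mul, Matrix.mul_smul, one_mul, mul_one]
  rw [smul_comm]
  abel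

theorem tddt_T (n : ℤ) (r : ℂ) : tddt (AddMonoidAlgebra.single n r) =
    (n : ℂ) • (AddMonoidAlgebra.single n r : ℂ[T;T⁻¹]) := by
  rw [tddt, eulerLin_single, AddMonoidAlgebra.smul_single, smul_eq_mul]
  rfl

theorem matD_unitT (a b : Fin m) (n : ℤ) : matD m (unitT a b n) = (n : ℂ) • unitT a b n := by
  ext1 i j
  simp only [matD, unitT, LinearMap.mapMatrix_apply, Matrix.map_apply, Matrix.smul_apply]
  by_cases h : a = i ∧ b = j
  · obtain ⟨rfl, rfl⟩ := h
    rw [Matrix.single_apply_same]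
    exact tddt_T n 1
  · rw [Matrix.single_apply_of_ne _ _ _ _ _ h, map_zero, smul_zero]

theorem loopD_tl (X : Matrix (Fin m) (Fin m) ℂ[T;T⁻¹]) : loopD m (tl X) = tl (matD m X) := by
  ext1
  change matD m (tl X).1 = _
  rw [tl_val, tl_val, map_sub, trace_matD]
  congr 1
  ext1 i j
  simp only [matD, LinearMap.mapMatrix_apply, Matrix.map_apply, Matrix.smul_apply]
  by_cases h : i = j
  · subst h; simp
  · simp [h]

theorem constTerm_T (n : ℤ) : constTerm (LaurentPolynomial.T n) = if n = 0 then 1 else 0 := by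
  change (Finsupp.single n (1 : ℂ)) 0 = _
  rw [Finsupp.single_apply]

/-- Passing to traceless parts replaces tr(XY) by tr(XY) - tr(X) tr(Y)/m, which is where the term
with `(m : ℂ)⁻¹` comes from. -/
theorem cocycle_unitT (a b c d : Fin m) (n k : ℤ) :
    loopCocycle m (tl (unitT a b n)) (tl (unitT c d k)) =
      if n + k = 0 then (n : ℂ) * ((if a = d ∧ b = c then 1 else 0)
        - (if a = b ∧ c = d then (m : ℂ)⁻¹ else 0)) else 0 := by
  have hm : (m : ℂ) ≠ 0 := Nat.cast_ne_zero.2 (by have := a.2; omega)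
  have h1 : matD m (tl (unitT a b n)).1 = (n : ℂ) • (tl (unitT a b n)).1 := by
    have := congrArg Subtype.val (loopD_tl (unitT a b n))
    rw [matD_unitT, map_smul] at this
    exact this
  have h2 : ∀ X Y : Matrix (Fin m) (Fin m) ℂ[T;T⁻¹], ((tl X).1 * (tl Y).1).trace
      = (X * Y).trace - ((m : ℂ)⁻¹ • X.trace) * Y.trace := by
    intro X Y
    have h3 : ((m : ℂ)⁻¹ • X.trace) * (m : ℂ[T;T⁻¹]) = X.trace := by
      rw [mul_comm, ← nsmul_eq_mul, ← Nat.cast_smul_eq_nsmul ℂ, smul_smul, mul_inv_cancel₀ hm,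
        one_smul]
    simp only [tl_val, sub_mul, mul_sub, Matrix.smul_mul, Matrix.mul_smul, one_mul, mul_one,
      Matrix.trace_sub, Matrix.trace_smul, Matrix.trace_one, Fintype.card_fin, smul_eq_mul]
    rw [h3, sub_self, sub_zero]
  rw [loopCocycle_apply, h1, Matrix.smul_mul, Matrix.trace_smul, h2, map_smul, map_sub]
  have h4 : (unitT a b n * unitT c d k).trace
      = if a = d ∧ b = c then LaurentPolynomial.T (n + k) else 0 := by
    by_cases hbc : b = c
    · subst hbc
      rw [Matrix.single_mul_single_same, ← LaurentPolynomial.T_add]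
      by_cases had : a = d
      · subst had; simp
      · simp [had, Matrix.trace_single_eq_of_ne]
    · simp [hbc, Matrix.single_mul_single_of_ne]
  have h5 : ∀ (a b : Fin m) (n : ℤ), (unitT a b n).trace
      = if a = b then LaurentPolynomial.T n else 0 := by
    intro a b n
    by_cases had : a = b
    · subst had; simp
    · simp [had, Matrix.trace_single_eq_of_ne]
  rw [h4, h5, h5]
  have h6 : constTerm (((m : ℂ)⁻¹ • if a = b then LaurentPolynomial.T n else 0) *
      (if c = d then LaurentPolynomial.T k else 0)) =
      if a = b ∧ c = d then (if n + k = 0 then (m : ℂ)⁻¹ else 0) else 0 := by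
    by_cases h1 : a = b
    · by_cases h2 : c = d
      · rw [if_pos h1, if_pos h2, if_pos ⟨h1, h2⟩, smul_mul_assoc, ← LaurentPolynomial.T_add,
          map_smul, constTerm_T, smul_eq_mul, mul_ite, mul_one, mul_zero]
      · rw [if_neg h2, if_neg (show ¬(a = b ∧ c = d) from fun h => h2 h.2), mul_zero, map_zero]
    · rw [if_neg h1, if_neg (show ¬(a = b ∧ c = d) from fun h => h1 h.1), smul_zero, zero_mul, map_zero]
  rw [h6]
  have h7 : constTerm (if a = d ∧ b = c then LaurentPolynomial.T (n + k) else 0) =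
      if a = d ∧ b = c then (if n + k = 0 then 1 else 0) else 0 := by
    rw [apply_ite constTerm, map_zero, constTerm_T]
  rw [h7, smul_eq_mul]
  by_cases h : n + k = 0
  · simp only [if_pos h]
  · simp only [if_neg h, ite_self, sub_zero, mul_zero]

theorem lie_E_E (a b c d : Fin m) (n k : ℤ) : ⁅E a b n, E c d k⁆ =
    (if b = c then E a d (n + k) else 0) - (if d = a then E c b (n + k) else 0)
    + (if n + k = 0 then (n : ℂ) * ((if a = d ∧ b = c then 1 else 0)
        - (if a = b ∧ c = d then (m : ℂ)⁻¹ else 0)) else 0) • cen := by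
  have key : ∀ (p : Prop) [Decidable p] (x y : Fin m) (j : ℤ),
      loop (if p then E x y j else 0) = tl (if p then unitT x y j else 0) := by
    intro p _ x y j; split_ifs <;> simp
  have keyC : ∀ (p : Prop) [Decidable p] (x y : Fin m) (j : ℤ),
      coC (if p then E x y j else 0) = 0 := by
    intro p _ x y j; split_ifs <;> simp
  have keyD : ∀ (p : Prop) [Decidable p] (x y : Fin m) (j : ℤ),
      coD (if p then E x y j else 0) = 0 := by
    intro p _ x y j; split_ifs <;> simp
  have key2 : ∀ (a b c d : Fin m) (n k : ℤ), unitT a b n * unitT c d k =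
      if b = c then unitT a d (n + k) else 0 := by
    intro a b c d n k
    by_cases h : b = c
    · subst h; rw [if_pos rfl, Matrix.single_mul_single_same, ← LaurentPolynomial.T_add]
    · rw [if_neg h, Matrix.single_mul_single_of_ne _ _ _ _ h]
  apply ext'
  · rw [loop_lie, map_add, map_sub, key, key, map_smul]
    simp only [loop_E, coD_E, loop_cen, zero_smul, smul_zero, add_zero, sub_zero]
    rw [tl_commutator, key2, key2, add_comm k n, map_sub]
  · rw [coC_lie, map_add, map_sub, keyC, keyC, map_smul]
    simp only [loop_E, coC_cen, smul_eq_mul, mul_one, sub_zero, zero_add]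
    exact cocycle_unitT a b c d n k
  · rw [coD_lie, map_add, map_sub, keyD, keyD, map_smul]
    simp

theorem lie_deg_E (a b : Fin m) (n : ℤ) : ⁅(deg : AffineSl m), E a b n⁆ = (n : ℂ) • E a b n := by
  apply ext'
  · rw [loop_lie, map_smul]
    simp only [loop_deg, coD_deg, loop_E, coD_E, zero_lie, zero_smul, one_smul, zero_add, sub_zero]
    rw [loopD_tl, matD_unitT, map_smul]
  · rw [coC_lie, map_smul]
    simp
  · rw [coD_lie, map_smul]
    simp

theorem cen_lie (x : AffineSl m) : ⁅(cen : AffineSl m), x⁆ = 0 := by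
  apply ext'
  · rw [loop_lie]; simp
  · rw [coC_lie]; simp
  · rw [coD_lie]; simp

theorem lie_cen (x : AffineSl m) : ⁅x, (cen : AffineSl m)⁆ = 0 := by
  rw [← lie_skew, cen_lie, neg_zero]

theorem sum_E_diag (n : ℤ) : ∑ a : Fin m, E a a n = 0 := by
  apply ext'
  · rw [map_sum]
    simp only [loop_E]
    rw [← map_sum, map_zero]
    have : ∑ a : Fin m, unitT a a n = (LaurentPolynomial.T n : ℂ[T;T⁻¹]) • 1 := by
      ext1 i j
      by_cases h : i = j
      · subst h
        simp [Matrix.sum_apply, Matrix.single_apply]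
      · simp only [Matrix.sum_apply, Matrix.single_apply, Matrix.smul_apply, Matrix.one_apply_ne h,
          smul_zero]
        apply Finset.sum_eq_zero
        intro a _
        rw [if_neg]
        rintro ⟨rfl, rfl⟩
        exact h rfl
    rw [this]
    ext1
    rw [tl_val, Matrix.trace_smul, Matrix.trace_one, Fintype.card_fin]
    rcases Nat.eq_zero_or_pos m with h | h
    · subst h
      ext1 i
      exact i.elim0
    · have hm : (m : ℂ) ≠ 0 := Nat.cast_ne_zero.2 h.ne'
      rw [smul_eq_mul, mul_comm, ← nsmul_eq_mul, ← Nat.cast_smul_eq_nsmul ℂ, smul_smul,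
        inv_mul_cancel₀ hm, one_smul, sub_self]
      rfl
  · simp
  · simp

/-- The affine Lie algebra is spanned by the `Ē_{ab} ⊗ t^n`, `c` and `d`. -/
theorem span_E : Submodule.span ℂ ({x : AffineSl m | ∃ a b n, x = E a b n} ∪ {cen, deg}) = ⊤ := by
  set S := Submodule.span ℂ ({x : AffineSl m | ∃ a b n, x = E a b n} ∪ {cen, deg}) with hS
  rw [eq_top_iff]
  rintro x -
  have hl : ∀ X : Matrix (Fin m) (Fin m) ℂ[T;T⁻¹], mk (tl X) 0 0 ∈ S := by
    let f : Matrix (Fin m) (Fin m) ℂ[T;T⁻¹] →ₗ[ℂ] AffineSl m :=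
      (LinearMap.inl ℂ (LoopSl m) (ℂ × ℂ)) ∘ₗ tl
    intro X
    change f X ∈ S
    rw [Matrix.matrix_eq_sum_single X, map_sum]
    refine Submodule.sum_mem _ fun i _ => ?_
    rw [map_sum]
    refine Submodule.sum_mem _ fun j _ => ?_
    generalize X i j = p
    induction p using AddMonoidAlgebra.induction_linear with
    | zero => rw [Matrix.single_zero, map_zero]; exact zero_mem _
    | add a b ha hb => rw [Matrix.single_add, map_add]; exact add_mem ha hb
    | single n r =>
      have : Matrix.single i j (AddMonoidAlgebra.single n r : ℂ[T;T⁻¹]) = r • unitT i j n := by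
        rw [Matrix.smul_single]
        congr 1
        change _ = r • (AddMonoidAlgebra.single n 1)
        rw [AddMonoidAlgebra.smul_single, smul_eq_mul, mul_one]
      rw [this, map_smul]
      exact S.smul_mem _ (Submodule.subset_span (Or.inl ⟨i, j, n, rfl⟩))
  have : x = mk (tl (loop x).1) 0 0 + coC x • cen + coD x • deg := by
    rw [tl_self]
    apply ext' <;> simp
  rw [this]
  refine add_mem (add_mem (hl _) (S.smul_mem _ (Submodule.subset_span (Or.inr (Or.inl rfl)))))
    (S.smul_mem _ (Submodule.subset_span (Or.inr (Or.inr rfl))))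

/-- Linear induction over the affine Lie algebra. -/
theorem induction_E {P : AffineSl m → Prop} (hE : ∀ a b n, P (E a b n)) (hc : P cen) (hd : P deg)
    (hadd : ∀ x y, P x → P y → P (x + y)) (hsmul : ∀ (r : ℂ) x, P x → P (r • x)) (x) : P x := by
  have hx : x ∈ Submodule.span ℂ ({x : AffineSl m | ∃ a b n, x = E a b n} ∪ {cen, deg}) := by
    rw [span_E]; trivial
  induction hx using Submodule.span_induction with
  | mem x h =>
    rcases h with ⟨a, b, n, rfl⟩ | rfl | rfl
    · exact hE a b n
    · exact hc
    · exact hd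
  | zero => simpa using hsmul 0 _ hc
  | add x y _ _ hx hy => exact hadd x y hx hy
  | smul r x _ hx => exact hsmul r x hx

/-! ### Chevalley generators -/

/-- `E c d n` is a simple root vector (`ε = 1`) or the negative of one (`ε = -1`). -/
inductive IsSimple : Fin m → Fin m → ℤ → ℂ → Prop
  | up (c d : Fin m) (h : (c : ℕ) + 1 = d) : IsSimple c d 0 1
  | down (c d : Fin m) (h : (d : ℕ) + 1 = c) : IsSimple c d 0 (-1)
  | affineUp (c d : Fin m) (hc : (c : ℕ) + 1 = m) (hd : (d : ℕ) = 0) : IsSimple c d 1 1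
  | affineDown (c d : Fin m) (hc : (c : ℕ) = 0) (hd : (d : ℕ) + 1 = m) : IsSimple c d (-1) (-1)

theorem IsSimple.ne (hm : 2 ≤ m) {c d : Fin m} {n : ℤ} {ε : ℂ} (h : IsSimple c d n ε) : c ≠ d := by
  intro e
  have := congrArg Fin.val e
  cases h <;> omega

theorem lie_E_E_of_ne {a d : Fin m} (h : a ≠ d) (c : Fin m) (n k : ℤ) :
    ⁅E a c n, E c d k⁆ = E a d (n + k) := by
  rw [lie_E_E, if_pos rfl, if_neg (Ne.symm h), sub_zero]
  have h1 : ¬(a = d ∧ c = c) := fun e => h e.1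
  have h2 : ¬(a = c ∧ c = d) := fun e => h (e.1.trans e.2)
  rw [if_neg h1, if_neg h2, sub_zero, mul_zero, ite_self, zero_smul, add_zero]

theorem lie_E_E_swap {a b : Fin m} (h : a ≠ b) (n k : ℤ) :
    ⁅E a b n, E b a k⁆ = E a a (n + k) - E b b (n + k)
      + (if n + k = 0 then (n : ℂ) else 0) • cen := by
  rw [lie_E_E, if_pos rfl, if_pos rfl]
  have h2 : ¬(a = b ∧ b = a) := fun e => h e.1
  rw [if_pos (show a = a ∧ b = b from ⟨rfl, rfl⟩), if_neg h2, sub_zero, mul_one]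

theorem lie_E_diag {a b : Fin m} (h : a ≠ b) (n k : ℤ) :
    ⁅E a a n - E b b n, E a b k⁆ = (2 : ℂ) • E a b (n + k) := by
  rw [sub_lie, lie_E_E_of_ne h, ← lie_skew, lie_E_E_of_ne h, add_comm k n, sub_neg_eq_add, two_smul]

/-- The root vectors of a fixed degree form one orbit under brackets with constant matrix units:
rows and columns can be changed one at a time. -/
theorem E_mem_of_E_mem (G : LieSubalgebra ℂ (AffineSl m)) (h0 : ∀ a b, a ≠ b → E a b 0 ∈ G)
    {p q : Fin m} (hpq : p ≠ q) {n : ℤ} (h : E p q n ∈ G) (a b : Fin m) (hab : a ≠ b) :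
    E a b n ∈ G := by
  have h1 : ∀ a, a ≠ q → E a q n ∈ G := by
    intro a ha
    by_cases hap : a = p
    · rwa [hap]
    · have := G.lie_mem (h0 a p hap) h
      rwa [lie_E_E_of_ne ha, zero_add] at this
  -- A row equal to `q` is not reached by changing rows. There `E a b n` arises from its opposite `E
  -- b a n` by bracketing twice with `E a b 0`, up to the invertible factor -2.
  by_cases haq : a = q
  · subst haq
    have h2 := G.lie_mem (G.lie_mem (h1 b hab.symm) (h0 a b hab)) (h0 a b hab)
    rw [lie_E_E_swap hab.symm, add_lie, smul_lie, cen_lie, smul_zero, add_zero, ← neg_sub, neg_lie,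
      lie_E_diag hab, add_zero, add_zero] at h2
    have h3 := G.smul_mem (-(1 / 2 : ℂ)) h2
    rw [smul_neg, neg_smul, neg_neg, smul_smul] at h3
    norm_num at h3
    exact h3
  · by_cases hbq : b = q
    · rw [hbq]; exact h1 a haq
    · have := G.lie_mem (h1 a haq) (h0 q b (Ne.symm hbq))
      rwa [lie_E_E_of_ne hab, add_zero] at this

/-- The simple root vectors and their negatives generate the derived algebra. -/
theorem mem_of_simple_mem (hm : 2 ≤ m) (G : LieSubalgebra ℂ (AffineSl m))
    (hG : ∀ c d n ε, IsSimple c d n ε → E c d n ∈ G) (x : AffineSl m) (hx : coD x = 0) : x ∈ G := by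
  -- Constant matrix units, by induction on the distance from the diagonal.
  have h1 : ∀ k : ℕ, ∀ a b : Fin m, (a : ℕ) + k + 1 = b → E a b 0 ∈ G ∧ E b a 0 ∈ G := by
    intro k
    induction k with
    | zero => intro a b h; exact ⟨hG a b 0 1 (.up a b h), hG b a 0 (-1) (.down b a h)⟩
    | succ k ih =>
      intro a b h
      have hb := b.2
      let c : Fin m := ⟨a + k + 1, by omega⟩
      have hc : (c : ℕ) + 1 = b := by simp only [c]; omega
      have hab : a ≠ b := by intro e; have := congrArg Fin.val e; omega
      obtain ⟨h1, h2⟩ := ih a c rfl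
      have h3 := G.lie_mem h1 (hG c b 0 1 (.up c b hc))
      have h4 := G.lie_mem (hG b c 0 (-1) (.down b c hc)) h2
      rw [lie_E_E_of_ne hab, add_zero] at h3
      rw [lie_E_E_of_ne hab.symm, add_zero] at h4
      exact ⟨h3, h4⟩
  have h2 : ∀ a b : Fin m, a ≠ b → E a b 0 ∈ G := by
    intro a b hab
    rcases Nat.lt_or_gt_of_ne (Fin.val_ne_of_ne hab) with h | h
    · exact (h1 (b - a - 1) a b (by omega)).1
    · exact (h1 (a - b - 1) b a (by omega)).2
  let z : Fin m := ⟨0, by omega⟩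
  let l : Fin m := ⟨m - 1, by omega⟩
  have hl : (l : ℕ) + 1 = m := by simp only [l]; omega
  have hlz : l ≠ z := by
    intro e
    have : m - 1 = 0 := congrArg Fin.val e
    omega
  have h3 := E_mem_of_E_mem G h2 hlz (hG l z 1 1 (.affineUp l z hl rfl))
  have h4 := E_mem_of_E_mem G h2 hlz.symm (hG z l (-1) (-1) (.affineDown z l rfl hl))
  -- The degrees whose root vectors all lie in `G` are closed under addition: bracketing with the
  -- constant opposite vector gives a coroot in degree n, which acts on a root vector of degree k
  -- with eigenvalue 2.
  have step : ∀ n k : ℤ, (∀ a b : Fin m, a ≠ b → E a b n ∈ G) →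
      (∀ a b : Fin m, a ≠ b → E a b k ∈ G) → ∀ a b : Fin m, a ≠ b → E a b (n + k) ∈ G := by
    intro n k hn hk a b hab
    have h := G.lie_mem (G.lie_mem (hn a b hab) (h2 b a hab.symm)) (hk a b hab)
    rw [lie_E_E_swap hab, add_lie, smul_lie, cen_lie, smul_zero, add_zero,
      lie_E_diag hab, add_zero] at h
    have h3 := G.smul_mem (1 / 2 : ℂ) h
    rw [smul_smul] at h3
    norm_num at h3
    exact h3
  have h5 : ∀ n : ℤ, ∀ a b : Fin m, a ≠ b → E a b n ∈ G := by
    intro n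
    induction n using Int.induction_on with
    | zero => exact h2
    | succ i ih => exact step _ _ ih h3
    | pred i ih => exact step _ _ ih h4
  have h6 : ∀ (n : ℤ) (a b : Fin m), E a a n - E b b n ∈ G := by
    intro n a b
    by_cases hab : a = b
    · rw [hab, sub_self]; exact G.zero_mem
    · have h := G.lie_mem (h5 n a b hab) (h5 0 b a (Ne.symm hab))
      rw [lie_E_E_swap hab, add_zero] at h
      have h0 : (if n = 0 then (n : ℂ) else 0) = 0 := by
        split_ifs with e
        · rw [e, Int.cast_zero]
        · rfl
      rwa [h0, zero_smul, add_zero] at h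
  have hm0 : (m : ℂ) ≠ 0 := Nat.cast_ne_zero.2 (by omega)
  -- Only differences of diagonal elements arise as brackets; since all `E b b n` add up to zero,
  -- the sum of the differences over b is m times one of them.
  have h7 : ∀ (n : ℤ) (a : Fin m), E a a n ∈ G := by
    intro n a
    have h : ∑ b : Fin m, (E a a n - E b b n) ∈ G := sum_mem fun b _ => h6 n a b
    rw [Finset.sum_sub_distrib, sum_E_diag, sub_zero, Finset.sum_const, Finset.card_univ,
      Fintype.card_fin, ← Nat.cast_smul_eq_nsmul ℂ] at h
    have h3 := G.smul_mem (m : ℂ)⁻¹ h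
    rwa [smul_smul, inv_mul_cancel₀ hm0, one_smul] at h3
  have h8 : ∀ (n : ℤ) (a b : Fin m), E a b n ∈ G := by
    intro n a b
    by_cases hab : a = b
    · rw [hab]; exact h7 n b
    · exact h5 n a b hab
  -- The central element is what remains of the bracket of opposite root vectors of degrees 1 and -1
  -- after subtracting the coroot.
  have h9 : cen ∈ G := by
    have h := G.lie_mem (h5 1 l z hlz) (h5 (-1) z l hlz.symm)
    rw [lie_E_E_swap hlz, add_neg_cancel, if_pos rfl, Int.cast_one, one_smul] at h
    have := G.sub_mem h (h6 0 l z)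
    rwa [add_sub_cancel_left] at this
  have h10 : ∀ y : AffineSl m, y - coD y • deg ∈ G := by
    intro y
    induction y using induction_E with
    | hE a b n => rw [coD_E, zero_smul, sub_zero]; exact h8 n a b
    | hc => rw [coD_cen, zero_smul, sub_zero]; exact h9
    | hd => rw [coD_deg, one_smul, sub_self]; exact G.zero_mem
    | hadd x y hx hy => rw [map_add, add_smul, add_sub_add_comm]; exact G.add_mem hx hy
    | hsmul r x hx => rw [map_smul, smul_assoc, ← smul_sub]; exact G.smul_mem r hx
  have := h10 x
  rwa [hx, zero_smul, sub_zero] at this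

/-- Brackets have no d-component. Conversely each Chevalley generator `E c d n` equals the bracket
of `E c c 0` with itself, and these generators generate everything without d-component. -/
theorem mem_derived_iff (hm : 2 ≤ m) (x : AffineSl m) :
    x ∈ ⁅(⊤ : LieIdeal ℂ (AffineSl m)), (⊤ : LieIdeal ℂ (AffineSl m))⁆ ↔ coD x = 0 := by
  constructor
  · intro h
    rw [← LieSubmodule.mem_toSubmodule, LieSubmodule.lieIdeal_oper_eq_linear_span'] at h
    induction h using Submodule.span_induction with
    | mem x h => obtain ⟨y, -, z, -, rfl⟩ := h; exact coD_lie y z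
    | zero => exact map_zero _
    | add x y _ _ hx hy => rw [map_add, hx, hy, add_zero]
    | smul r x _ hx => rw [map_smul, hx, smul_zero]
  · intro h
    refine mem_of_simple_mem hm (LieIdeal.toLieSubalgebra ℂ (AffineSl m)
      ⁅(⊤ : LieIdeal ℂ (AffineSl m)), (⊤ : LieIdeal ℂ (AffineSl m))⁆) ?_ x h
    intro c d n ε hs
    have h1 : ⁅E c c 0, E c d n⁆ ∈
        ⁅(⊤ : LieIdeal ℂ (AffineSl m)), (⊤ : LieIdeal ℂ (AffineSl m))⁆ :=
      LieSubmodule.lie_mem_lie (LieSubmodule.mem_top _) (LieSubmodule.mem_top _)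
    rw [lie_E_E_of_ne (hs.ne hm), zero_add] at h1
    exact h1

end AffineSl

namespace KZ
open AffineSl
variable {m : ℕ} {M : Type} [AddCommGroup M] [Module ℂ M]

/-! ### Commutators of the classical `r`-matrix with Chevalley generators -/

/-- `p` is a representation of the affine Lie algebra. -/
structure IsRep (p : AffineSl m → Module.End ℂ M) : Prop where
  add : ∀ x y, p (x + y) = p x + p y
  smul : ∀ (r : ℂ) x, p (r • x) = r • p x
  lie : ∀ x y, p ⁅x, y⁆ = p x * p y - p y * p x

namespace IsRep
variable {p : AffineSl m → Module.End ℂ M} (hp : IsRep p)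
include hp

theorem zero : p 0 = 0 := by simpa using hp.smul 0 0
theorem neg (x) : p (-x) = - p x := by simpa using hp.smul (-1) x
theorem sub (x y) : p (x - y) = p x - p y := by rw [sub_eq_add_neg, hp.add, hp.neg, sub_eq_add_neg]
theorem ite (P : Prop) [Decidable P] (x) : p (if P then x else 0) = if P then p x else 0 := by
  split_ifs
  · rfl
  · exact hp.zero

end IsRep

theorem lie_E_E_ne {c d : Fin m} (hcd : c ≠ d) (a b : Fin m) (k n : ℤ) : ⁅E a b k, E c d n⁆ =
    (if b = c then E a d (k + n) else 0) - (if d = a then E c b (k + n) else 0)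
    + (if d = a then if b = c then if k + n = 0 then (k : ℂ) • cen else 0 else 0 else 0) := by
  rw [lie_E_E, if_neg (show ¬(a = b ∧ c = d) from fun h => hcd h.2), sub_zero]
  congr 1
  by_cases f1 : d = a
  · by_cases f2 : b = c
    · subst f1 f2; simp
    · simp [f2]
  · simp [f1, Ne.symm (a := d) f1]

/-- The weights of `E_{ab} ⊗ E_{ba}` in `r̄`. -/
def rWt (a b : Fin m) : ℂ := if a < b then 1 else if a = b then 1 / 2 else 0

theorem rBar_eq (p q : AffineSl m → Module.End ℂ M) :
    rBar p q = ∑ a : Fin m, ∑ b : Fin m, rWt a b • (p (E a b 0) * q (E b a 0)) := by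
  rw [rBar, Finset.smul_sum, ← Finset.sum_add_distrib]
  refine Finset.sum_congr rfl fun a _ => ?_
  have : ∀ b : Fin m, rWt a b • (p (E a b 0) * q (E b a 0)) =
      (if a = b then (1 / 2 : ℂ) • (p (E a b 0) * q (E b a 0)) else 0)
      + (if a < b then (p (E a b 0) * q (E b a 0)) else 0) := by
    intro b
    rw [rWt]
    rcases lt_trichotomy a b with h | h | h
    · rw [if_pos h, if_neg h.ne, if_pos h, one_smul, zero_add]
    · rw [if_neg h.not_lt, if_pos h, if_pos h, if_neg h.not_lt, add_zero]
    · rw [if_neg h.not_gt, if_neg h.ne', if_neg h.ne', if_neg h.not_gt, zero_smul, zero_add]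
  simp only [this, Finset.sum_add_distrib, Finset.sum_ite_eq, Finset.mem_univ, if_true]

/-- The operator `∑_{a,b} (E_{ab} ⊗ t^k) ⊗ (E_{ba} ⊗ t^{-k})`. -/
def omegaOp (p q : AffineSl m → Module.End ℂ M) (k : ℤ) : Module.End ℂ M :=
  ∑ a : Fin m, ∑ b : Fin m, p (E a b k) * q (E b a (-k))

/-- The operator `∑_{a,b} [E_{ab}, E_{cd}] ⊗ E_{ba}` in degree `(k + n, -k)`. -/
def phiOp (p q : AffineSl m → Module.End ℂ M) (c d : Fin m) (n k : ℤ) : Module.End ℂ M :=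
  ∑ a : Fin m, p (E a d (k + n)) * q (E c a (-k)) - ∑ b : Fin m, p (E c b (k + n)) * q (E b d (-k))

theorem sum_smul_ite (f : Fin m → Module.End ℂ M) (c : Fin m) (r : ℂ) :
    ∑ a, (r * if a = c then 1 else 0) • f a = r • f c := by
  simp

section commutators

variable {p q : AffineSl m → Module.End ℂ M} (hp : IsRep p) (hq : IsRep q)
  (hpq : ∀ x y, p x * q y = q y * p x)
include hp hq hpq

theorem mul_comm_add (x y e : AffineSl m) : p x * q y * (p e + q e) - (p e + q e) * (p x * q y) =
    p ⁅x, e⁆ * q y + p x * q ⁅y, e⁆ := by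
  rw [hp.lie, hq.lie]
  have h1 := hpq e y
  have h2 := hpq x e
  calc p x * q y * (p e + q e) - (p e + q e) * (p x * q y)
      = p x * (q y * p e) + p x * q y * q e - p e * p x * q y - q e * p x * q y := by noncomm_ring
    _ = _ := by rw [← h1, ← h2]; noncomm_ring

/-- One computation with arbitrary weights serves both the constant r-matrix (`rWt`, k = 0) and the
loop terms (weights 1). -/
theorem sum_mul_comm_add (w : Fin m → Fin m → ℂ) (k : ℤ) (c d : Fin m) (hcd : c ≠ d) (n : ℤ) :
    (∑ a : Fin m, ∑ b : Fin m, w a b • (p (E a b k) * q (E b a (-k)))) * (p (E c d n) + q (E c d n))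
    - (p (E c d n) + q (E c d n)) *
      (∑ a : Fin m, ∑ b : Fin m, w a b • (p (E a b k) * q (E b a (-k)))) =
    (∑ a, w a c • (p (E a d (k + n)) * q (E c a (-k))))
      - (∑ b, w d b • (p (E c b (k + n)) * q (E b d (-k))))
      + ((∑ b, w c b • (p (E c b k) * q (E b d (-k + n))))
        - ∑ a, w a d • (p (E a d k) * q (E c a (-k + n))))
      + (if k + n = 0 then (k : ℂ) * w d c else 0) • (p cen * q (E c d (-k)))
      - (if -k + n = 0 then (k : ℂ) * w c d else 0) • (p (E c d k) * q cen) := by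
  have h1 : ∀ a b : Fin m, w a b • (p (E a b k) * q (E b a (-k))) * (p (E c d n) + q (E c d n))
      - (p (E c d n) + q (E c d n)) * w a b • (p (E a b k) * q (E b a (-k))) =
      (if b = c then w a b • (p (E a d (k + n)) * q (E b a (-k))) else 0)
      - (if d = a then w a b • (p (E c b (k + n)) * q (E b a (-k))) else 0)
      + ((if a = c then w a b • (p (E a b k) * q (E b d (-k + n))) else 0)
      - (if d = b then w a b • (p (E a b k) * q (E c a (-k + n))) else 0))
      + (if d = a then if b = c then (if k + n = 0 then (k : ℂ) * w a b else 0) •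
          (p cen * q (E b a (-k))) else 0 else 0)
      - (if d = b then if a = c then (if -k + n = 0 then (k : ℂ) * w a b else 0) •
          (p (E a b k) * q cen) else 0 else 0) := by
    intro a b
    rw [smul_mul_assoc, mul_smul_comm, ← smul_sub, mul_comm_add hp hq hpq, lie_E_E_ne hcd,
      lie_E_E_ne hcd]
    simp only [hp.add, hp.sub, hp.ite, hp.smul, hq.add, hq.sub, hq.ite, hq.smul]
    simp only [add_mul, sub_mul, mul_add, mul_sub, ite_mul, mul_ite, zero_mul, mul_zero, smul_add,
      smul_sub, smul_ite, smul_zero, smul_mul_assoc, mul_smul_comm, smul_smul]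
    rw [Int.cast_neg, mul_neg, neg_smul]
    have e4 : ∀ (P Q R : Prop) [Decidable P] [Decidable Q] [Decidable R] (x : Module.End ℂ M),
        (if P then if Q then if R then -x else 0 else 0 else 0) =
        -(if P then if Q then if R then x else 0 else 0 else 0) := by
      intro P Q R _ _ _ x
      split_ifs <;> simp
    rw [e4, mul_comm (k : ℂ)]
    simp only [ite_smul, zero_smul]
    abel
  rw [Finset.sum_mul, Finset.mul_sum, ← Finset.sum_sub_distrib]
  simp only [Finset.sum_mul, Finset.mul_sum, ← Finset.sum_sub_distrib, h1]
  have e5 : ∀ (P : Prop) [Decidable P] (f : Fin m → Module.End ℂ M),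
      (∑ b, if P then f b else 0) = if P then ∑ b, f b else 0 := by
    intro P _ f
    split_ifs <;> simp
  simp only [Finset.sum_sub_distrib, Finset.sum_add_distrib, Finset.sum_ite_eq,
    Finset.sum_ite_eq', Finset.mem_univ, if_true, e5]

/-- For a finite simple root the weights of `rWt` attached to c and d differ only at c and d
themselves, by 1/2, and only Cartan terms survive. For the affine root one of c, d is the first
index and the other the last, so the weights are constantly 0 or 1 off one place; this leaves a full
`phiOp`, later cancelled by the loop part or by a divided difference. -/
theorem rBar_comm {c d : Fin m} {n : ℤ} {ε : ℂ} (hs : IsSimple c d n ε) (hcd : c ≠ d) :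
    rBar p q * (p (E c d n) + q (E c d n)) - (p (E c d n) + q (E c d n)) * rBar p q =
    (if n = 1 then phiOp p q c d n 0 else if n = -1 then - phiOp p q c d n 1 else 0)
    - (ε / 2) • (p (E c d n) * q (E c c 0 - E d d 0) - p (E c c 0 - E d d 0) * q (E c d n)) := by
  have key := sum_mul_comm_add hp hq hpq rWt 0 c d hcd n
  simp only [neg_zero, zero_add, Int.cast_zero, zero_mul, ite_self, zero_smul, add_zero, sub_zero]
    at key
  rw [rBar_eq, key, hp.sub, hq.sub, mul_sub, sub_mul, phiOp, phiOp]
  -- Affine roots: weights equal to a constant s apart from a correction r at one place.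
  have hw : ∀ (r : ℂ) (x : Fin m) (f : Fin m → Module.End ℂ M) (w : Fin m → ℂ) (s : ℂ)
      (_ : ∀ a, w a = s + r * if a = x then 1 else 0),
      ∑ a, w a • f a = s • ∑ a, f a + r • f x := by
    intro r x f w s h
    simp only [h, add_smul, Finset.sum_add_distrib, Finset.smul_sum, sum_smul_ite]
  -- Finite roots: two weights which differ by the same r at c and at d.
  have hw2 : ∀ (r : ℂ) (f : Fin m → Module.End ℂ M) (w w' : Fin m → ℂ)
      (_ : ∀ a, w a - w' a = r * (if a = c then 1 else 0) + r * if a = d then 1 else 0),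
      ∑ a, w a • f a = ∑ a, w' a • f a + r • f c + r • f d := by
    intro r f w w' h
    rw [add_assoc, ← sub_eq_iff_eq_add', ← Finset.sum_sub_distrib, ← sum_smul_ite f c r,
      ← sum_smul_ite f d r, ← Finset.sum_add_distrib]
    refine Finset.sum_congr rfl fun a _ => ?_
    rw [← sub_smul, h, add_smul]
  have e : ∀ a b : Fin m, a = b ↔ (a : ℕ) = b := fun a b => Fin.ext_iff
  have l : ∀ a b : Fin m, a < b ↔ (a : ℕ) < b := fun a b => Iff.rfl
  cases hs with
  | up h =>
    rw [hw2 (-(1 / 2)) _ (fun a => rWt a c) (fun a => rWt a d), hw2 (-(1 / 2)) _ (fun b => rWt d b)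
      (fun b => rWt c b)]
    · simp only [if_neg (show ¬((0 : ℤ) = 1) by decide), if_neg (show ¬((0 : ℤ) = -1) by decide)]
      module
    · intro a
      simp only [rWt, e, l]
      split_ifs <;> first | omega | norm_num
    · intro a
      simp only [rWt, e, l]
      split_ifs <;> first | omega | norm_num
  | down h =>
    rw [hw2 (1 / 2) _ (fun a => rWt a c) (fun a => rWt a d), hw2 (1 / 2) _ (fun b => rWt d b)
      (fun b => rWt c b)]
    · simp only [if_neg (show ¬((0 : ℤ) = 1) by decide), if_neg (show ¬((0 : ℤ) = -1) by decide)]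
      module
    · intro a
      simp only [rWt, e, l]
      split_ifs <;> first | omega | norm_num
    · intro a
      simp only [rWt, e, l]
      split_ifs <;> first | omega | norm_num
  | affineUp hc hd =>
    rw [hw (-(1 / 2)) c _ (fun a => rWt a c) 1, hw (-(1 / 2)) d _ (fun b => rWt d b) 1,
      hw (1 / 2) c _ (fun b => rWt c b) 0, hw (1 / 2) d _ (fun a => rWt a d) 0]
    · simp only [if_true, neg_zero, zero_add]
      module
    all_goals
      intro a
      have := a.2
      simp only [rWt, e, l]
      split_ifs <;> first | omega | norm_num
  | affineDown hc hd =>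
    rw [hw (1 / 2) c _ (fun a => rWt a c) 0, hw (1 / 2) d _ (fun b => rWt d b) 0,
      hw (-(1 / 2)) c _ (fun b => rWt c b) 1, hw (-(1 / 2)) d _ (fun a => rWt a d) 1]
    · simp only [if_neg (show ¬((-1 : ℤ) = 1) by decide), if_true, add_neg_cancel]
      module
    all_goals
      intro a
      have := a.2
      simp only [rWt, e, l]
      split_ifs <;> first | omega | norm_num

/-- The sum over a, b is invariant under sl_m, so the only defect is the shift of degree: a
difference of two values of `phiOp`, which telescopes in the sum over k, and the central terms of
the cocycle. -/
theorem omegaOp_comm {c d : Fin m} (n k : ℤ) (hcd : c ≠ d) :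
    omegaOp p q k * (p (E c d n) + q (E c d n)) - (p (E c d n) + q (E c d n)) * omegaOp p q k =
    phiOp p q c d n k - phiOp p q c d n (k - n)
    + (if k + n = 0 then (k : ℂ) else 0) • (p cen * q (E c d (-k)))
    - (if -k + n = 0 then (k : ℂ) else 0) • (p (E c d k) * q cen) := by
  have key := sum_mul_comm_add hp hq hpq (fun _ _ => 1) k c d hcd n
  simp only [one_smul, mul_one] at key
  rw [omegaOp, key, phiOp, phiOp, sub_add_cancel, neg_sub, sub_eq_neg_add n k]
  abel

theorem cartan_comm (c d : Fin m) (n : ℤ) :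
    (p cen * q deg + p deg * q cen) * (p (E c d n) + q (E c d n))
    - (p (E c d n) + q (E c d n)) * (p cen * q deg + p deg * q cen) =
    (n : ℂ) • (p cen * q (E c d n) + p (E c d n) * q cen) := by
  rw [add_mul (p cen * q deg), mul_add _ (p cen * q deg), add_sub_add_comm,
    mul_comm_add hp hq hpq, mul_comm_add hp hq hpq,
    cen_lie, lie_deg_E, hp.zero, hq.zero, hp.smul, hq.smul, zero_mul, mul_zero, zero_add, add_zero,
    mul_smul_comm, smul_mul_assoc, smul_add]

end commutators

/-- The products `(E_{ab} ⊗ t^k) ⊗ (E_{cd} ⊗ t^l)` with `k, -l` large kill every vector. -/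
def LocFin (p q : AffineSl m → Module.End ℂ M) : Prop :=
  ∀ y : M, ∃ K : ℕ, ∀ k l : ℤ, K ≤ k → K ≤ -l → ∀ a b c d, p (E a b k) (q (E c d l) y) = 0

/-- The series may be cut at any large enough place. A common cut for several vectors turns
statements about `rUniv` into identities between honest operators. -/
theorem rUniv_eq {p q : AffineSl m → Module.End ℂ M} (hf : LocFin p q) (y : M) : ∃ K : ℕ,
    (∀ k l : ℤ, K ≤ k → K ≤ -l → ∀ a b c d, p (E a b k) (q (E c d l) y) = 0) ∧ ∀ K' ≥ K,
    rUniv p q y = (rBar p q + (1 / 2 : ℂ) • (p cen * q deg + p deg * q cen)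
      + ∑ n ∈ Finset.range K', omegaOp p q (n + 1)) y := by
  obtain ⟨K, hK⟩ := hf y
  refine ⟨K, hK, fun K' hK' => ?_⟩
  rw [rUniv, finsum_eq_sum_of_support_subset (s := Finset.range K')]
  · simp only [LinearMap.add_apply, LinearMap.smul_apply, LinearMap.sum_apply, omegaOp,
      Module.End.mul_apply]
  · intro n hn
    rw [Function.mem_support] at hn
    rw [Finset.coe_range, Set.mem_Iio]
    by_contra hlt
    refine hn (Finset.sum_eq_zero fun a _ => Finset.sum_eq_zero fun b _ => hK _ _ ?_ ?_ _ _ _ _)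
    · omega
    · omega

/-- The operator `rUniv` as a linear map. -/
theorem rUniv_linear {p q : AffineSl m → Module.End ℂ M} (hf : LocFin p q) :
    ∃ R : Module.End ℂ M, ∀ y, R y = rUniv p q y := by
  refine ⟨⟨⟨fun y => rUniv p q y, fun x y => ?_⟩, fun r x => ?_⟩, fun y => rfl⟩
  · obtain ⟨K1, -, h1⟩ := rUniv_eq hf x
    obtain ⟨K2, -, h2⟩ := rUniv_eq hf y
    obtain ⟨K3, -, h3⟩ := rUniv_eq hf (x + y)
    rw [h1 (K1 + K2 + K3) (by omega), h2 (K1 + K2 + K3) (by omega), h3 (K1 + K2 + K3) (by omega),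
      map_add]
  · obtain ⟨K1, -, h1⟩ := rUniv_eq hf x
    obtain ⟨K3, -, h3⟩ := rUniv_eq hf (r • x)
    dsimp only
    rw [h1 (K1 + K3) (by omega), h3 (K1 + K3) (by omega), map_smul, RingHom.id_apply]

theorem sum_phiOp_telescope (p q : AffineSl m → Module.End ℂ M) (c d : Fin m) (n : ℤ)
    (hn : n = 0 ∨ n = 1 ∨ n = -1) (K : ℕ) :
    ∑ k ∈ Finset.range K, (phiOp p q c d n (k + 1) - phiOp p q c d n (k + 1 - n)) =
    if n = 1 then phiOp p q c d n K - phiOp p q c d n 0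
    else if n = -1 then phiOp p q c d n 1 - phiOp p q c d n (K + 1) else 0 := by
  rcases hn with rfl | rfl | rfl
  · simp
  · rw [if_pos rfl]
    have := Finset.sum_range_sub (fun k : ℕ => phiOp p q c d 1 k) K
    simpa using this
  · rw [if_neg (by decide), if_pos rfl]
    have := Finset.sum_range_sub' (fun k : ℕ => phiOp p q c d (-1) (k + 1)) K
    simpa using this

/-- The commutator of the universal `r`-matrix with a Chevalley generator. -/
theorem rUniv_comm {p q : AffineSl m → Module.End ℂ M} (hp : IsRep p) (hq : IsRep q)
    (hpq : ∀ x y, p x * q y = q y * p x) (hf : LocFin p q)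
    {c d : Fin m} {n : ℤ} {ε : ℂ} (hs : IsSimple c d n ε) (hcd : c ≠ d) (y : M) :
    rUniv p q ((p (E c d n) + q (E c d n)) y) - (p (E c d n) + q (E c d n)) (rUniv p q y) =
    -(ε / 2) • (p (E c d n) * q (E c c 0 - E d d 0 + (n : ℂ) • cen)
      - p (E c c 0 - E d d 0 + (n : ℂ) • cen) * q (E c d n)) y := by
  obtain ⟨K1, h0, h1⟩ := rUniv_eq hf y
  obtain ⟨K2, -, h2⟩ := rUniv_eq hf ((p (E c d n) + q (E c d n)) y)
  -- The extra 2 keeps the index 0 in the range, where the central term sits, and makes the upper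
  -- boundary term of the telescoping sum vanish on y.
  set K := K1 + K2 + 2 with hK
  rw [h1 K (by omega), h2 K (by omega), ← Module.End.mul_apply, ← Module.End.mul_apply,
    ← LinearMap.sub_apply]
  have hsum : (∑ k ∈ Finset.range K, omegaOp p q (k + 1)) * (p (E c d n) + q (E c d n))
      - (p (E c d n) + q (E c d n)) * (∑ k ∈ Finset.range K, omegaOp p q (k + 1)) =
      (if n = 1 then phiOp p q c d n K - phiOp p q c d n 0
        else if n = -1 then phiOp p q c d n 1 - phiOp p q c d n (K + 1) else 0)
      + (if n = -1 then p cen * q (E c d n) else 0)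
      - (if n = 1 then p (E c d n) * q cen else 0) := by
    have hn : n = 0 ∨ n = 1 ∨ n = -1 := by cases hs <;> simp
    rw [← sum_phiOp_telescope p q c d n hn, Finset.sum_mul, Finset.mul_sum,
      ← Finset.sum_sub_distrib]
    simp only [omegaOp_comm hp hq hpq n _ hcd]
    rw [Finset.sum_sub_distrib, Finset.sum_add_distrib]
    congr 1
    · congr 1
      split_ifs with h
      · rw [Finset.sum_eq_single 0]
        · simp [h]
        · intro k _ hk
          rw [if_neg (by omega), zero_smul]
        · intro hk
          exact absurd (Finset.mem_range.2 (by omega)) hk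
      · refine Finset.sum_eq_zero fun k _ => ?_
        rw [if_neg (by omega), zero_smul]
    · split_ifs with h
      · rw [Finset.sum_eq_single 0]
        · simp [h]
        · intro k _ hk
          rw [if_neg (by omega), zero_smul]
        · intro hk
          exact absurd (Finset.mem_range.2 (by omega)) hk
      · refine Finset.sum_eq_zero fun k _ => ?_
        rw [if_neg (by omega), zero_smul]
  -- The first leg of `phiOp` has degree k + n with n ≥ -1, hence the bound K1 + 1.
  have hphi : ∀ k : ℤ, K1 + 1 ≤ k → (n = 1 ∨ n = -1) → phiOp p q c d n k y = 0 := by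
    intro k hk hn
    simp only [phiOp, LinearMap.sub_apply, LinearMap.sum_apply, Module.End.mul_apply]
    rw [Finset.sum_eq_zero, Finset.sum_eq_zero, sub_zero]
    · intro a _
      exact h0 _ _ (by omega) (by omega) _ _ _ _
    · intro a _
      exact h0 _ _ (by omega) (by omega) _ _ _ _
  have htot := rBar_comm hp hq hpq hs hcd
  have hcar := cartan_comm hp hq hpq c d n
  have hsplit : ∀ A B C e : Module.End ℂ M, (A + (1 / 2 : ℂ) • B + C) * e
      - e * (A + (1 / 2 : ℂ) • B + C) = (A * e - e * A) + (1 / 2 : ℂ) • (B * e - e * B)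
        + (C * e - e * C) := by
    intro A B C e
    simp only [add_mul, mul_add, smul_mul_assoc, mul_smul_comm, smul_sub]
    abel
  rw [hsplit, htot, hcar, hsum, hp.add, hq.add, hp.smul, hq.smul]
  have hphi1 := hphi K (by omega)
  have hphi2 := hphi (K + 1) (by omega)
  -- The lower boundary term of the telescoping sum cancels the `phiOp` left over by the constant
  -- r-matrix, the upper one kills y, and the central terms complete the coroot to `E c c 0 - E d d
  -- 0 + n • cen`.
  cases hs with
  | up h => simp
  | down h => simp
  | affineUp hc hd =>
    simp [hphi1 (Or.inl rfl)]
    module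
  | affineDown hc hd =>
    simp [hphi2 (Or.inr rfl)]
    module

end KZ

namespace KZ
open AffineSl DDAHA
variable {m N : ℕ}

/-! ### Bases and elementary operators on `ℂ[P] ⊗ (ℂ^m)^{⊗ N}` -/

/-- The standard basis vector `u_{c_1} ⊗ ⋯ ⊗ u_{c_N}`. -/
def vb (c : Fin N → Fin m) : VN m N := PiTensorProduct.tprod ℂ fun i => Pi.single (c i) 1

/-- The standard basis of the tensor power. -/
def vBasis (m N : ℕ) : Module.Basis (Fin N → Fin m) ℂ (VN m N) :=
  Basis.piTensorProduct fun _ => Pi.basisFun ℂ (Fin m)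

theorem vBasis_apply (c : Fin N → Fin m) : vBasis m N c = vb c := by
  rw [vBasis, Basis.piTensorProduct_apply]
  simp [vb]

theorem vn_ext {M : Type} [AddCommGroup M] [Module ℂ M] {f g : VN m N →ₗ[ℂ] M}
    (h : ∀ c, f (vb c) = g (vb c)) : f = g :=
  (vBasis m N).ext fun c => by rw [vBasis_apply, h]

/-- The middle factor `ℂ[P] ⊗ (ℂ^m)^{⊗ N}`. -/
abbrev Mid (m N : ℕ) : Type := Lau N ⊗[ℂ] VN m N

/-- The tensor power as an additive group, with the standard additive monoid structure. -/
abbrev vnGroup (m N : ℕ) : AddCommGroup (VN m N) := Module.addCommMonoidToAddCommGroup ℂ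

/-- The middle factor as an additive group, with the standard additive monoid structure. -/
abbrev midGroup (m N : ℕ) : AddCommGroup (Mid m N) := Module.addCommMonoidToAddCommGroup ℂ

/-- The middle factor as an additive group, with the standard additive monoid structure. -/
abbrev midAddGroup (m N : ℕ) : AddGroup (Mid m N) := (midGroup m N).toAddGroup

attribute [local instance] vnGroup midGroup midAddGroup

/-- The monomial `z^η`. -/
abbrev zz (η : Fin N → ℤ) : Lau N := AddMonoidAlgebra.single η 1

theorem zz_mul (η θ : Fin N → ℤ) : zz η * zz θ = zz (η + θ) := by
  rw [AddMonoidAlgebra.single_mul_single, one_mul]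

theorem zz_zero : zz (0 : Fin N → ℤ) = 1 := rfl

theorem lau_ext {M : Type} [AddCommGroup M] [Module ℂ M] {f g : Lau N →ₗ[ℂ] M}
    (h : ∀ η, f (zz η) = g (zz η)) : f = g :=
  (AddMonoidAlgebra.basis (Fin N → ℤ) ℂ).ext fun η => by
    simpa using h η

/-- The basis vector `z^η ⊗ u_{c_1} ⊗ ⋯ ⊗ u_{c_N}`. -/
def eb (η : Fin N → ℤ) (c : Fin N → Fin m) : Mid m N := zz η ⊗ₜ vb c

theorem mid_ext {M : Type} [AddCommGroup M] [Module ℂ M] {f g : Mid m N →ₗ[ℂ] M}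
    (h : ∀ η c, f (eb η c) = g (eb η c)) : f = g := by
  apply TensorProduct.ext
  apply lau_ext
  intro η
  apply vn_ext
  intro c
  exact h η c

theorem span_eb : Submodule.span ℂ {x : Mid m N | ∃ η c, x = eb η c} = ⊤ := by
  have h : (Submodule.span ℂ {x : Mid m N | ∃ η c, x = eb η c}).mkQ = 0 := by
    apply mid_ext
    intro η c
    rw [LinearMap.zero_apply, Submodule.mkQ_apply, Submodule.Quotient.mk_eq_zero]
    exact Submodule.subset_span ⟨η, c, rfl⟩
  rw [← Submodule.ker_mkQ (Submodule.span ℂ {x : Mid m N | ∃ η c, x = eb η c}), h,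
    LinearMap.ker_zero]

theorem slotE_vb (i : Fin N) (a b : Fin m) (c : Fin N → Fin m) :
    slotE i a b (vb c) = if c i = b then vb (Function.update c i a) else 0 := by
  rw [slotE, vb, PiTensorProduct.map_tprod]
  by_cases h : c i = b
  · rw [if_pos h, vb]
    congr 1
    funext j
    by_cases hj : j = i
    · subst hj
      simp only [Function.update_self]
      ext x
      simp [Matrix.toLin'_apply, h, Matrix.single_apply, Pi.single_apply, eq_comm]
    · simp [Function.update_of_ne hj]
  · rw [if_neg h]
    apply MultilinearMap.map_coord_zero _ i
    simp only [Function.update_self]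
    ext x
    simp [Matrix.toLin'_apply, Ne.symm h]

theorem slotE_mul_same (i : Fin N) (a b c d : Fin m) :
    slotE i a b * slotE i c d = if b = c then slotE (N := N) i a d else 0 := by
  apply vn_ext
  intro x
  rw [Module.End.mul_apply, slotE_vb]
  by_cases h : x i = d
  · rw [if_pos h, slotE_vb, Function.update_self, Function.update_idem]
    by_cases hb : b = c
    · rw [if_pos hb.symm, if_pos hb, slotE_vb, if_pos h]
    · rw [if_neg (Ne.symm hb), if_neg hb, LinearMap.zero_apply]
  · rw [if_neg h, map_zero]
    by_cases hb : b = c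
    · rw [if_pos hb, slotE_vb, if_neg h]
    · rw [if_neg hb, LinearMap.zero_apply]

theorem slotE_comm {i j : Fin N} (hij : i ≠ j) (a b c d : Fin m) :
    Commute (slotE i a b) (slotE j c d) := by
  apply vn_ext
  intro x
  simp only [Module.End.mul_apply, slotE_vb]
  by_cases h1 : x i = b <;> by_cases h2 : x j = d <;>
    simp [h1, h2, slotE_vb, Function.update_of_ne hij, Function.update_of_ne hij.symm,
      Function.update_comm hij]

theorem sum_slotE (i : Fin N) : ∑ a : Fin m, slotE i a a = 1 := by
  apply vn_ext
  intro c
  rw [LinearMap.sum_apply]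
  simp [slotE_vb]

theorem tau2_vb (w : Equiv.Perm (Fin N)) (c : Fin N → Fin m) :
    tau2 m w (vb c) = vb fun i => c (w⁻¹ i) := by
  rw [tau2, vb, LinearEquiv.coe_coe, PiTensorProduct.reindex_tprod]
  rfl

theorem tau2_slotE (w : Equiv.Perm (Fin N)) (i : Fin N) (a b : Fin m) :
    tau2 m w * slotE i a b = slotE (w i) a b * tau2 m w := by
  apply vn_ext
  intro c
  simp only [Module.End.mul_apply, slotE_vb, tau2_vb]
  have h : c (w⁻¹ (w i)) = c i := by simp
  rw [h]
  split_ifs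
  · rw [tau2_vb]
    congr 1
    funext j
    by_cases hj : j = w i
    · subst hj; simp
    · rw [Function.update_of_ne hj, Function.update_of_ne]
      rintro rfl
      simp at hj
  · exact map_zero _

theorem tau1_zz (w : Equiv.Perm (Fin N)) (η : Fin N → ℤ) : tau1 w (zz η) = zz (permLattice w η) := by
  simp [tau1]

theorem tau1_mul (w : Equiv.Perm (Fin N)) (f g : Lau N) :
    tau1 w (f * g) = tau1 w f * tau1 w g :=
  map_mul (AddMonoidAlgebra.mapDomainAlgHom ℂ ℂ (permLattice w)) f g

theorem tau1_one (w : Equiv.Perm (Fin N)) : tau1 w (1 : Lau N) = 1 := by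
  simp [tau1]

theorem permLattice_single (w : Equiv.Perm (Fin N)) (i : Fin N) (n : ℤ) :
    permLattice w (Pi.single i n) = Pi.single (w i) n := by
  funext j
  simp only [permLattice, AddMonoidHom.coe_mk, ZeroHom.coe_mk, Pi.single_apply]
  congr 1
  rw [Equiv.Perm.inv_eq_iff_eq, eq_comm, eq_iff_iff]

theorem evalAt_T (i : Fin N) (n : ℤ) : evalAt i (LaurentPolynomial.T n) = zz (Pi.single i n) := by
  change AddMonoidAlgebra.mapDomain _ (AddMonoidAlgebra.single n 1) = _
  rw [AddMonoidAlgebra.mapDomain_single]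
  rfl

theorem partialD_zz (ξ : Fin N → ℂ) (η : Fin N → ℤ) : partialD ξ (zz η) = pairing ξ η • zz η := by
  rw [partialD, eulerLin_single, AddMonoidAlgebra.smul_single, smul_eq_mul]

theorem pairing_single (i : Fin N) (η : Fin N → ℤ) : pairing (Pi.single i 1) η = η i := by
  simp [pairing, Pi.single_apply]

theorem partialD_evalAt (i j : Fin N) (f : ℂ[T;T⁻¹]) :
    partialD (Pi.single j 1) (evalAt i f) = if i = j then evalAt i (tddt f) else 0 := by
  induction f using AddMonoidAlgebra.induction_linear with
  | zero => simp
  | add a b ha hb => simp only [map_add, ha, hb]; split_ifs <;> simp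
  | single n r =>
    have h : (AddMonoidAlgebra.single n r : ℂ[T;T⁻¹]) = r • LaurentPolynomial.T n := by
      change _ = r • AddMonoidAlgebra.single n 1
      rw [AddMonoidAlgebra.smul_single, smul_eq_mul, mul_one]
    have h2 : tddt (LaurentPolynomial.T n) = (n : ℂ) • LaurentPolynomial.T n := tddt_T n 1
    rw [h, map_smul, map_smul, map_smul, map_smul, h2, map_smul, evalAt_T, partialD_zz,
      pairing_single, Pi.single_apply]
    by_cases hij : i = j
    · rw [if_pos hij.symm, if_pos hij]
    · rw [if_neg (Ne.symm hij), if_neg hij, Int.cast_zero, zero_smul, smul_zero]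

/-! ### The evaluation representations -/

/-- Multiplication by `f` on `ℂ[P]` combined with an operator on the tensor power. -/
def op (f : Lau N) (s : Module.End ℂ (VN m N)) : Module.End ℂ (Mid m N) :=
  TensorProduct.map (LinearMap.mulLeft ℂ f) s

theorem op_tmul (f : Lau N) (s : Module.End ℂ (VN m N)) (g : Lau N) (v : VN m N) :
    op f s (g ⊗ₜ v) = (f * g) ⊗ₜ s v := rfl

theorem op_mul (f g : Lau N) (s t : Module.End ℂ (VN m N)) :
    op f s * op g t = op (f * g) (s * t) := by
  apply TensorProduct.ext'
  intro x v
  simp only [Module.End.mul_apply, op_tmul, mul_assoc]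

theorem op_add_left (f g : Lau N) (s : Module.End ℂ (VN m N)) :
    op (f + g) s = op f s + op g s := by
  apply TensorProduct.ext'
  intro x v
  simp only [LinearMap.add_apply, op_tmul, add_mul, TensorProduct.add_tmul]

theorem op_smul_left (r : ℂ) (f : Lau N) (s : Module.End ℂ (VN m N)) :
    op (r • f) s = r • op f s := by
  apply TensorProduct.ext'
  intro x v
  simp only [LinearMap.smul_apply, op_tmul, smul_mul_assoc, TensorProduct.smul_tmul']

theorem op_add_right (f : Lau N) (s t : Module.End ℂ (VN m N)) :
    op f (s + t) = op f s + op f t := by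
  apply TensorProduct.ext'
  intro x v
  simp only [LinearMap.add_apply, op_tmul, TensorProduct.tmul_add]

theorem op_smul_right (r : ℂ) (f : Lau N) (s : Module.End ℂ (VN m N)) :
    op f (r • s) = r • op f s := by
  apply TensorProduct.ext'
  intro x v
  simp only [LinearMap.smul_apply, op_tmul, TensorProduct.tmul_smul]

theorem op_zero_left (s : Module.End ℂ (VN m N)) : op (0 : Lau N) s = 0 := by
  simpa using op_smul_left 0 (0 : Lau N) s

theorem op_zero_right (f : Lau N) : op f (0 : Module.End ℂ (VN m N)) = 0 := by
  simpa using op_smul_right 0 f (0 : Module.End ℂ (VN m N))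

theorem op_one_one : op (1 : Lau N) (1 : Module.End ℂ (VN m N)) = 1 := by
  apply TensorProduct.ext'
  intro x v
  simp only [op_tmul, one_mul, Module.End.one_apply]

theorem op_sum_right {ι : Type} (t : Finset ι) (f : Lau N) (s : ι → Module.End ℂ (VN m N)) :
    op f (∑ i ∈ t, s i) = ∑ i ∈ t, op f (s i) := by
  classical
  induction t using Finset.induction_on with
  | empty => simp [op_zero_right]
  | insert i t hi ih => rw [Finset.sum_insert hi, Finset.sum_insert hi, op_add_right, ih]

theorem op_sum_left {ι : Type} (t : Finset ι) (f : ι → Lau N) (s : Module.End ℂ (VN m N)) :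
    op (∑ i ∈ t, f i) s = ∑ i ∈ t, op (f i) s := by
  classical
  induction t using Finset.induction_on with
  | empty => simp [op_zero_left]
  | insert i t hi ih => rw [Finset.sum_insert hi, Finset.sum_insert hi, op_add_left, ih]

/-- The action of a matrix over `ℂ[t,t⁻¹]` on the `i`-th evaluation factor. -/
def thetaMat (i : Fin N) (X : Matrix (Fin m) (Fin m) ℂ[T;T⁻¹]) : Module.End ℂ (Mid m N) :=
  ∑ a : Fin m, ∑ b : Fin m, op (evalAt i (X a b)) (slotE i a b)

/-- The operator `z_i ∂/∂z_i`. -/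
def dz (i : Fin N) : Module.End ℂ (Mid m N) :=
  TensorProduct.map (partialD (Pi.single i 1)) LinearMap.id

theorem dz_tmul (i : Fin N) (f : Lau N) (v : VN m N) :
    dz i (f ⊗ₜ v) = partialD (Pi.single i 1) f ⊗ₜ v := rfl

theorem thetaEval_eq (i : Fin N) (x : AffineSl m) :
    thetaEval i x = thetaMat i (loop x).1 + coD x • dz i := rfl

theorem thetaMat_add (i : Fin N) (X Y : Matrix (Fin m) (Fin m) ℂ[T;T⁻¹]) :
    thetaMat i (X + Y) = thetaMat i X + thetaMat i Y := by
  simp only [thetaMat, Matrix.add_apply, map_add, op_add_left, ← Finset.sum_add_distrib]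

theorem thetaMat_smul (i : Fin N) (r : ℂ) (X : Matrix (Fin m) (Fin m) ℂ[T;T⁻¹]) :
    thetaMat i (r • X) = r • thetaMat i X := by
  simp only [thetaMat, Matrix.smul_apply, map_smul, Finset.smul_sum, op_smul_left]

theorem thetaMat_sub (i : Fin N) (X Y : Matrix (Fin m) (Fin m) ℂ[T;T⁻¹]) :
    thetaMat i (X - Y) = thetaMat i X - thetaMat i Y :=
  eq_sub_of_add_eq (by rw [← thetaMat_add, sub_add_cancel])

theorem thetaMat_mul (i : Fin N) (X Y : Matrix (Fin m) (Fin m) ℂ[T;T⁻¹]) :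
    thetaMat i (X * Y) = thetaMat i X * thetaMat i Y := by
  have h : ∀ (f : Lau N) (P : Prop) [Decidable P] (s : Module.End ℂ (VN m N)),
      op f (if P then s else 0) = if P then op f s else 0 := by
    intro f P _ s
    split_ifs
    · rfl
    · exact op_zero_right f
  rw [thetaMat, thetaMat, Finset.sum_mul]
  refine Finset.sum_congr rfl fun a _ => ?_
  simp only [Matrix.mul_apply, map_sum, map_mul, op_sum_left]
  rw [Finset.sum_comm, Finset.sum_mul]
  refine Finset.sum_congr rfl fun b _ => ?_
  simp only [thetaMat, Finset.mul_sum, op_mul, slotE_mul_same, h]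
  rw [Finset.sum_comm]
  refine Finset.sum_congr rfl fun d _ => ?_
  simp

theorem dz_op (j : Fin N) (f : Lau N) (s : Module.End ℂ (VN m N)) :
    dz j * op f s - op f s * dz j = op (partialD (Pi.single j 1) f) s := by
  apply TensorProduct.ext'
  intro x v
  simp only [LinearMap.sub_apply, Module.End.mul_apply, op_tmul, dz_tmul]
  rw [partialD, eulerLin_mul, TensorProduct.add_tmul, add_sub_cancel_right]

theorem dz_thetaMat (i j : Fin N) (X : Matrix (Fin m) (Fin m) ℂ[T;T⁻¹]) :
    dz j * thetaMat i X - thetaMat i X * dz j = if i = j then thetaMat i (matD m X) else 0 := by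
  simp only [thetaMat, Finset.sum_mul, Finset.mul_sum, ← Finset.sum_sub_distrib, dz_op,
    partialD_evalAt]
  by_cases h : i = j
  · simp only [if_pos h]
    rfl
  · simp only [if_neg h, op_zero_left, Finset.sum_const_zero]

theorem isRep_thetaEval (i : Fin N) : IsRep (thetaEval (m := m) i) where
  add x y := by
    have : (loop (x + y)).1 = (loop x).1 + (loop y).1 := rfl
    rw [thetaEval_eq, thetaEval_eq, thetaEval_eq, this, thetaMat_add, map_add, add_smul]
    abel
  smul r x := by
    have : (loop (r • x)).1 = r • (loop x).1 := rfl
    rw [thetaEval_eq, thetaEval_eq, this, thetaMat_smul, map_smul, smul_add, smul_assoc]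
  lie x y := by
    have : (loop ⁅x, y⁆).1 = (loop x).1 * (loop y).1 + (-1 : ℂ) • ((loop y).1 * (loop x).1)
        + coD x • matD m (loop y).1 + (-1 : ℂ) • (coD y • matD m (loop x).1) := by
      rw [loop_lie, neg_one_smul, neg_one_smul, ← sub_eq_add_neg, ← sub_eq_add_neg]
      rfl
    have h1 := dz_thetaMat i i (loop x).1
    have h2 := dz_thetaMat i i (loop y).1
    rw [if_pos rfl] at h1 h2
    rw [thetaEval_eq, thetaEval_eq, thetaEval_eq, this, coD_lie, zero_smul, add_zero,
      thetaMat_add, thetaMat_add, thetaMat_add, thetaMat_smul, thetaMat_smul, thetaMat_smul,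
      thetaMat_smul, thetaMat_mul, thetaMat_mul, ← h1, ← h2]
    simp only [add_mul, mul_add, smul_mul_assoc, mul_smul_comm, smul_sub]
    module

theorem thetaEval_commute {i j : Fin N} (hij : i ≠ j) (x y : AffineSl m) :
    thetaEval i x * thetaEval j y = thetaEval j y * thetaEval i x := by
  have h1 : ∀ X Y : Matrix (Fin m) (Fin m) ℂ[T;T⁻¹],
      Commute (thetaMat i X) (thetaMat j Y) := by
    intro X Y
    refine Commute.sum_left _ _ _ fun a _ => Commute.sum_left _ _ _ fun b _ =>
      Commute.sum_right _ _ _ fun c _ => Commute.sum_right _ _ _ fun d _ => ?_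
    change _ * _ = _ * _
    rw [op_mul, op_mul, mul_comm, (slotE_comm hij a b c d).eq]
  have h2 : ∀ (i j : Fin N) (_ : i ≠ j) (X : Matrix (Fin m) (Fin m) ℂ[T;T⁻¹]),
      Commute (thetaMat i X) (dz j) := by
    intro i j hij X
    have := dz_thetaMat i j X
    rw [if_neg hij, sub_eq_zero] at this
    exact this.symm
  have h3 : Commute (dz (m := m) i) (dz j) := by
    apply mid_ext
    intro η c
    simp only [Module.End.mul_apply, eb, dz_tmul, partialD_zz, map_smul]
    rw [smul_comm]
  change Commute _ _
  rw [thetaEval_eq, thetaEval_eq]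
  exact ((h1 _ _).add_right ((h2 i j hij _).smul_right _)).add_left
    ((((h2 j i hij.symm _).symm).add_right (h3.smul_right _)).smul_left _)

theorem thetaMat_diag (i : Fin N) (p : ℂ[T;T⁻¹]) :
    thetaMat (m := m) i (p • 1) = op (evalAt i p) 1 := by
  rw [← sum_slotE i, op_sum_right]
  refine Finset.sum_congr rfl fun a _ => ?_
  rw [Finset.sum_eq_single a]
  · simp
  · intro b _ hb
    rw [Matrix.smul_apply, Matrix.one_apply_ne (Ne.symm hb), smul_zero, map_zero, op_zero_left]
  · simp

theorem thetaMat_unitT (i : Fin N) (a b : Fin m) (n : ℤ) :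
    thetaMat i (unitT a b n) = op (zz (Pi.single i n)) (slotE i a b) := by
  rw [thetaMat, Finset.sum_eq_single a, Finset.sum_eq_single b]
  · rw [unitT, Matrix.single_apply_same, evalAt_T]
  · intro d _ hd
    rw [unitT, Matrix.single_apply_of_ne _ _ _ _ _ (fun h => hd h.2.symm), map_zero, op_zero_left]
  · simp
  · intro d _ hd
    refine Finset.sum_eq_zero fun e _ => ?_
    rw [unitT, Matrix.single_apply_of_ne _ _ _ _ _ (fun h => hd h.1.symm), map_zero, op_zero_left]
  · simp

theorem thetaEval_E (i : Fin N) (a b : Fin m) (n : ℤ) : thetaEval i (E a b n) =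
    op (zz (Pi.single i n)) (slotE i a b)
    - (if a = b then (m : ℂ)⁻¹ else 0) • op (zz (Pi.single i n)) 1 := by
  rw [thetaEval_eq, coD_E, zero_smul, add_zero, loop_E, tl_val, thetaMat_sub, thetaMat_diag,
    thetaMat_unitT, map_smul, op_smul_left]
  congr 1
  by_cases h : a = b
  · subst h
    rw [if_pos rfl, Matrix.trace_single_eq_same, evalAt_T]
  · rw [if_neg h, Matrix.trace_single_eq_of_ne _ _ _ h, map_zero, op_zero_left, smul_zero,
      zero_smul]

theorem thetaEval_E_of_ne (i : Fin N) {a b : Fin m} (h : a ≠ b) (n : ℤ) :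
    thetaEval i (E a b n) = op (zz (Pi.single i n)) (slotE i a b) := by
  rw [thetaEval_E, if_neg h, zero_smul, sub_zero]

theorem thetaEval_cen (i : Fin N) : thetaEval i (cen : AffineSl m) = 0 := by
  rw [thetaEval_eq, coD_cen, zero_smul, add_zero, loop_cen]
  simpa using thetaMat_smul i 0 (0 : Matrix (Fin m) (Fin m) ℂ[T;T⁻¹])

theorem thetaEval_deg (i : Fin N) : thetaEval i (deg : AffineSl m) = dz i := by
  rw [thetaEval_eq, coD_deg, one_smul, loop_deg]
  have : thetaMat i (0 : LoopSl m).1 = 0 := by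
    simpa using thetaMat_smul i 0 (0 : Matrix (Fin m) (Fin m) ℂ[T;T⁻¹])
  rw [this, zero_add]

theorem op_eb (θ : Fin N → ℤ) (s : Module.End ℂ (VN m N)) (η : Fin N → ℤ) (c : Fin N → Fin m) :
    op (zz θ) s (eb η c) = zz (θ + η) ⊗ₜ s (vb c) := by
  rw [eb, op_tmul, zz_mul]

end KZ

namespace KZ
open AffineSl DDAHA
variable {m N : ℕ}

section
attribute [local instance] vnGroup midGroup midAddGroup

/-! ### Divided differences -/

/-- The exponent of `z_k / z_j`. -/
abbrev dl (k j : Fin N) : Fin N → ℤ := Pi.single k 1 - Pi.single j 1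

theorem one_sub_zz_ne_zero {δ : Fin N → ℤ} (h : δ ≠ 0) : (1 : Lau N) - zz δ ≠ 0 := by
  intro e
  have e1 := congrArg (fun f : Lau N => f.coeff 0) (sub_eq_zero.1 e)
  have e2 : (1 : Lau N).coeff 0 = 1 := by
    rw [← zz_zero, zz, AddMonoidAlgebra.coeff_single, Finsupp.single_eq_same]
  have e3 : (zz δ).coeff 0 = 0 := by
    rw [zz, AddMonoidAlgebra.coeff_single, Finsupp.single_eq_of_ne (Ne.symm h)]
  rw [e2, e3] at e1
  exact one_ne_zero e1

theorem dl_ne_zero {j k : Fin N} (h : j ≠ k) : dl k j ≠ 0 := by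
  intro e
  have := congrFun e k
  simp [h.symm] at this

theorem permLattice_swap {j k : Fin N} (h : j ≠ k) (η : Fin N → ℤ) :
    permLattice (Equiv.swap j k) η = η + (η j - η k) • dl k j := by
  funext i
  simp only [permLattice, AddMonoidHom.coe_mk, ZeroHom.coe_mk, Equiv.swap_inv, Pi.add_apply,
    Pi.smul_apply, Pi.sub_apply, Pi.single_apply, smul_eq_mul]
  by_cases h1 : i = j
  · subst h1; simp [h]
  · by_cases h2 : i = k
    · subst h2; simp [h1]
    · simp [h1, h2, Equiv.swap_apply_of_ne_of_ne]

/-- The divided difference of a monomial. -/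
def divDiffFun (j k : Fin N) (η : Fin N → ℤ) : Lau N :=
  if 0 ≤ η j - η k then ∑ t ∈ Finset.range (η j - η k).toNat, zz (η + (t : ℤ) • dl k j)
  else -∑ t ∈ Finset.range (η k - η j).toNat, zz (η - ((t : ℤ) + 1) • dl k j)

/-- The divided difference `f ↦ (f - s_{jk} f) / (1 - z_k / z_j)`. -/
def divDiff (j k : Fin N) : Lau N →ₗ[ℂ] Lau N :=
  (AddMonoidAlgebra.basis (Fin N → ℤ) ℂ).constr ℂ (divDiffFun j k)

theorem divDiff_zz (j k : Fin N) (η : Fin N → ℤ) : divDiff j k (zz η) = divDiffFun j k η := by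
  have := (AddMonoidAlgebra.basis (Fin N → ℤ) ℂ).constr_basis ℂ (divDiffFun j k) η
  simpa [divDiff] using this

/-- On a monomial, exchanging the two variables multiplies by a power of z_k/z_j, and the defining
sum is the geometric series of that power; multiplication by 1 - z_k/z_j telescopes it. -/
theorem divDiff_spec {j k : Fin N} (h : j ≠ k) (f : Lau N) :
    (1 - zz (dl k j)) * divDiff j k f = f - tau1 (Equiv.swap j k) f := by
  have key : LinearMap.mulLeft ℂ (1 - zz (dl k j)) ∘ₗ divDiff j k
      = LinearMap.id - tau1 (Equiv.swap j k) := by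
    apply lau_ext
    intro η
    rw [LinearMap.comp_apply, LinearMap.mulLeft_apply, LinearMap.sub_apply, LinearMap.id_apply,
      divDiff_zz, tau1_zz, permLattice_swap h, divDiffFun]
    split_ifs with hn
    · have : ∀ t : ℕ, (1 - zz (dl k j)) * zz (η + (t : ℤ) • dl k j) =
          zz (η + (t : ℤ) • dl k j) - zz (η + ((t + 1 : ℕ) : ℤ) • dl k j) := by
        intro t
        rw [sub_mul, one_mul, zz_mul]
        congr 2
        rw [Nat.cast_add, Nat.cast_one, add_smul, one_smul]
        abel
      rw [Finset.mul_sum, Finset.sum_congr rfl fun t _ => this t,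
        Finset.sum_range_sub' (fun t : ℕ => zz (η + (t : ℤ) • dl k j)), Int.toNat_of_nonneg hn]
      simp
    · have : ∀ t : ℕ, (1 - zz (dl k j)) * zz (η - ((t : ℤ) + 1) • dl k j) =
          zz (η - ((t + 1 : ℕ) : ℤ) • dl k j) - zz (η - (t : ℤ) • dl k j) := by
        intro t
        rw [sub_mul, one_mul, zz_mul]
        congr 2
        rw [add_smul, one_smul]
        abel
      rw [mul_neg, Finset.mul_sum, Finset.sum_congr rfl fun t _ => this t,
        Finset.sum_range_sub (fun t : ℕ => zz (η - (t : ℤ) • dl k j)),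
        Int.toNat_of_nonneg (by omega), neg_sub, sub_eq_add_neg η ((η k - η j) • dl k j),
        ← neg_smul, neg_sub]
      simp
  exact LinearMap.congr_fun key f

/-- Laurent polynomials form a domain, so identities between divided differences may be checked
after multiplication by 1 - z_k/z_j, where `divDiff_spec` applies. -/
theorem mul_one_sub_cancel {j k : Fin N} (h : j ≠ k) {f g : Lau N}
    (e : (1 - zz (dl k j)) * f = (1 - zz (dl k j)) * g) : f = g :=
  mul_left_cancel₀ (one_sub_zz_ne_zero (dl_ne_zero h)) e

theorem dl_mul (j k : Fin N) : zz (dl k j) * zz (Pi.single j 1) = zz (Pi.single k 1) := by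
  rw [zz_mul, sub_add_cancel]

theorem dl_mul_neg (j k : Fin N) : zz (dl k j) * zz (Pi.single k (-1)) = zz (Pi.single j (-1)) := by
  rw [zz_mul, Pi.single_neg, Pi.single_neg]
  congr 1
  simp only [dl]
  abel

theorem dl_mul_dl (j k : Fin N) : zz (dl k j) * zz (dl j k) = 1 := by
  rw [zz_mul, ← zz_zero]
  congr 1
  simp only [dl]
  abel

theorem tau1_swap_mul (j k : Fin N) (n : ℤ) (f : Lau N) :
    tau1 (Equiv.swap j k) (zz (Pi.single j n) * f) =
      zz (Pi.single k n) * tau1 (Equiv.swap j k) f := by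
  rw [tau1_mul, tau1_zz, permLattice_single, Equiv.swap_apply_left]

theorem tau1_swap_mul' (j k : Fin N) (n : ℤ) (f : Lau N) :
    tau1 (Equiv.swap j k) (zz (Pi.single k n) * f) =
      zz (Pi.single j n) * tau1 (Equiv.swap j k) f := by
  rw [tau1_mul, tau1_zz, permLattice_single, Equiv.swap_apply_right]

/-- This twisted Leibniz rule and its three companions measure how the divided difference fails to
commute with the loop variable of the affine Chevalley generators. -/
theorem divDiff_mul_left {j k : Fin N} (h : j ≠ k) (f : Lau N) :
    divDiff j k (zz (Pi.single j 1) * f) =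
      zz (Pi.single k 1) * divDiff j k f + zz (Pi.single j 1) * f := by
  apply mul_one_sub_cancel h
  rw [divDiff_spec h, tau1_swap_mul]
  linear_combination (-zz (Pi.single k 1)) * divDiff_spec h f + f * dl_mul j k

theorem divDiff_mul_right {j k : Fin N} (h : j ≠ k) (f : Lau N) :
    divDiff j k (zz (Pi.single k 1) * f) =
      zz (Pi.single j 1) * divDiff j k f - zz (Pi.single j 1) * f := by
  apply mul_one_sub_cancel h
  rw [divDiff_spec h, tau1_swap_mul']
  linear_combination (-zz (Pi.single j 1)) * divDiff_spec h f - f * dl_mul j k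

theorem divDiff_mul_left_neg {j k : Fin N} (h : j ≠ k) (f : Lau N) :
    divDiff j k (zz (Pi.single j (-1)) * f) =
      zz (Pi.single k (-1)) * divDiff j k f - zz (Pi.single k (-1)) * f := by
  apply mul_one_sub_cancel h
  rw [divDiff_spec h, tau1_swap_mul]
  linear_combination (-zz (Pi.single k (-1))) * divDiff_spec h f - f * dl_mul_neg j k

theorem divDiff_mul_right_neg {j k : Fin N} (h : j ≠ k) (f : Lau N) :
    divDiff j k (zz (Pi.single k (-1)) * f) =
      zz (Pi.single j (-1)) * divDiff j k f + zz (Pi.single k (-1)) * f := by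
  apply mul_one_sub_cancel h
  rw [divDiff_spec h, tau1_swap_mul']
  linear_combination (-zz (Pi.single j (-1))) * divDiff_spec h f + f * dl_mul_neg j k

theorem swap_conj (w : Equiv.Perm (Fin N)) (j k : Fin N) :
    w * Equiv.swap j k = Equiv.swap (w j) (w k) * w := by
  rw [Equiv.swap_apply_apply, inv_mul_cancel_right]

theorem tau1_mul_perm (w v : Equiv.Perm (Fin N)) : tau1 (w * v) = tau1 w * tau1 v := by
  apply lau_ext
  intro η
  rw [Module.End.mul_apply, tau1_zz, tau1_zz, tau1_zz]
  congr 1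

theorem tau1_divDiff (w : Equiv.Perm (Fin N)) {j k : Fin N} (h : j ≠ k) (f : Lau N) :
    tau1 w (divDiff j k f) = divDiff (w j) (w k) (tau1 w f) := by
  have h' : w j ≠ w k := fun e => h (w.injective e)
  apply mul_one_sub_cancel h'
  have hs : tau1 w (tau1 (Equiv.swap j k) f) = tau1 (Equiv.swap (w j) (w k)) (tau1 w f) := by
    have : tau1 w * tau1 (Equiv.swap j k) = tau1 (Equiv.swap (w j) (w k)) * tau1 w := by
      rw [← tau1_mul_perm, ← tau1_mul_perm, swap_conj]
    exact LinearMap.congr_fun this f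
  have hd : tau1 w (1 - zz (dl k j)) = 1 - zz (dl (w k) (w j)) := by
    rw [map_sub, tau1_one, tau1_zz, map_sub, permLattice_single, permLattice_single]
  rw [divDiff_spec h', ← hd, ← tau1_mul, divDiff_spec h, map_sub, hs]

theorem divDiff_flip {j k : Fin N} (h : j ≠ k) (f : Lau N) :
    divDiff k j f = -(zz (dl k j) * divDiff j k f) := by
  apply mul_one_sub_cancel h.symm
  have h1 := divDiff_spec h f
  rw [divDiff_spec h.symm, Equiv.swap_comm]
  linear_combination (-1 : Lau N) * h1 - divDiff j k f * dl_mul_dl j k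

/-- With x = z_k/z_j this is 1/(1 - x) + 1/(1 - 1/x) = 1. -/
theorem divDiff_add_swap {j k : Fin N} (h : j ≠ k) (f : Lau N) :
    divDiff j k f + divDiff k j f = f - tau1 (Equiv.swap j k) f := by
  rw [divDiff_flip h, ← divDiff_spec h]
  ring

theorem divDiff_translate {j k : Fin N} (h : j ≠ k) (f : Lau N) :
    zz (Pi.single j 1) * divDiff k j f + divDiff j k (zz (Pi.single j 1) * f)
      = zz (Pi.single j 1) * f := by
  rw [divDiff_mul_left h, divDiff_flip h]
  linear_combination (-divDiff j k f) * dl_mul j k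

/-! ### The rational part of the Dunkl operators -/

/-- The action of the classical `r`-matrix of `gl_m` on two factors of the tensor power. -/
def rV (j k : Fin N) : Module.End ℂ (VN m N) :=
  ∑ a : Fin m, ∑ b : Fin m, rWt a b • (slotE j a b * slotE k b a)

theorem rV_vb {j k : Fin N} (h : j ≠ k) (c : Fin N → Fin m) :
    rV j k (vb c) = rWt (c k) (c j) • vb (fun i => c (Equiv.swap j k i)) := by
  simp only [rV, LinearMap.sum_apply, LinearMap.smul_apply, Module.End.mul_apply, slotE_vb]
  rw [Finset.sum_eq_single (c k), Finset.sum_eq_single (c j)]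
  · rw [if_pos rfl, slotE_vb, Function.update_of_ne h, if_pos rfl]
    congr 2
    funext i
    by_cases h1 : i = j
    · subst h1; simp
    · rw [Function.update_of_ne h1]
      by_cases h2 : i = k
      · subst h2; simp
      · rw [Function.update_of_ne h2, Equiv.swap_apply_of_ne_of_ne h1 h2]
  · intro b _ hb
    rw [if_pos rfl, slotE_vb, Function.update_of_ne h, if_neg (Ne.symm hb), smul_zero]
  · simp
  · intro a _ ha
    refine Finset.sum_eq_zero fun b _ => ?_
    rw [if_neg (Ne.symm ha), map_zero, smul_zero]
  · simp

theorem rWt_add (a b : Fin m) : rWt a b + rWt b a = 1 := by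
  simp only [rWt]
  rcases lt_trichotomy a b with h | h | h
  · simp [h, h.not_gt, h.ne']
  · subst h; norm_num
  · simp [h, h.not_gt, h.ne']

theorem tau2_swap_vb (j k : Fin N) (c : Fin N → Fin m) :
    tau2 m (Equiv.swap j k) (vb c) = vb (fun i => c (Equiv.swap j k i)) := by
  rw [tau2_vb, Equiv.swap_inv]

/-- The weights `rWt a b` and `rWt b a` add up to 1, so the symmetrised r-matrix of gl_m is the
flip. -/
theorem rV_add {j k : Fin N} (h : j ≠ k) : rV j k + rV k j = tau2 m (Equiv.swap j k) := by
  apply vn_ext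
  intro c
  rw [LinearMap.add_apply, rV_vb h, rV_vb h.symm, tau2_swap_vb, Equiv.swap_comm k j, ← add_smul,
    rWt_add, one_smul]

theorem tau2_rV (w : Equiv.Perm (Fin N)) (j k : Fin N) :
    tau2 m w * rV j k = rV (w j) (w k) * tau2 m w := by
  simp only [rV, Finset.mul_sum, Finset.sum_mul, mul_smul_comm, smul_mul_assoc]
  refine Finset.sum_congr rfl fun a _ => Finset.sum_congr rfl fun b _ => ?_
  rw [← mul_assoc, tau2_slotE, mul_assoc, tau2_slotE, mul_assoc]

/-- The r-matrices of sl_m and gl_m differ only in the diagonal part ½ ∑ Ē_aa ⊗ Ē_aa. Subtracting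
1/m from each E_aa contributes -1/(2m) twice from the cross terms and +1/(2m) from the product of
the scalars. -/
theorem rBar_thetaEval (hm : m ≠ 0) (j k : Fin N) :
    rBar (thetaEval (m := m) j) (thetaEval k) = op 1 (rV j k) - (1 / (2 * m : ℂ)) • 1 := by
  have hm' : (m : ℂ) ≠ 0 := Nat.cast_ne_zero.2 hm
  have h1 : ∀ (i : Fin N) (a b : Fin m), thetaEval i (E a b 0) =
      op 1 (slotE i a b) - (if a = b then (m : ℂ)⁻¹ else 0) • 1 := by
    intro i a b
    rw [thetaEval_E, Pi.single_zero, zz_zero, op_one_one]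
  have h2 : ∀ a b : Fin m, rWt a b • (thetaEval j (E a b 0) * thetaEval k (E b a 0)) =
      op 1 (rWt a b • (slotE j a b * slotE k b a))
      + if a = b then (-(1 / 2 : ℂ) * (m : ℂ)⁻¹) • (op 1 (slotE j a a) + op 1 (slotE k a a))
        + ((1 / 2 : ℂ) * ((m : ℂ)⁻¹ * (m : ℂ)⁻¹)) • 1 else 0 := by
    intro a b
    rw [h1, h1, op_smul_right, ← one_mul (1 : Lau N), ← op_mul, one_mul]
    by_cases hab : a = b
    · subst hab
      have : rWt a a = 1 / 2 := by simp [rWt]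
      simp only [if_true, this, sub_mul, mul_sub, smul_mul_assoc, mul_smul_comm, one_mul, mul_one]
      module
    · simp only [if_neg hab, if_neg (Ne.symm hab), zero_smul, sub_zero, add_zero]
  simp only [rBar_eq, h2, Finset.sum_add_distrib, Finset.sum_ite_eq, Finset.mem_univ, if_true,
    ← Finset.smul_sum, ← op_sum_right, sum_slotE, op_one_one]
  rw [rV, Finset.sum_const, Finset.card_univ, Fintype.card_fin, ← Nat.cast_smul_eq_nsmul ℂ,
    eq_sub_iff_add_eq, smul_smul, ← two_smul ℂ, smul_smul, add_assoc, ← add_smul, ← add_smul]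
  have : -(1 / 2 : ℂ) * (m : ℂ)⁻¹ * 2 + 1 / 2 * ((m : ℂ)⁻¹ * (m : ℂ)⁻¹) * m
      + 1 / (2 * (m : ℂ)) = 0 := by
    field_simp
    ring
  rw [this, zero_smul, add_zero]

/-- The operator `P_{jk} (1 - K_{jk}) / (1 - z_k / z_j) - r_{jk}`, where `K_{jk}` permutes
the variables, `P_{jk}` the tensor factors and `r` is the classical `r`-matrix of `gl_m`. -/
def xOp (j k : Fin N) : Module.End ℂ (Mid m N) :=
  TensorProduct.map (divDiff j k) (tau2 m (Equiv.swap j k)) - op 1 (rV j k)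

/-- The simultaneous permutation of the variables and the tensor factors. -/
def tauM (w : Equiv.Perm (Fin N)) : Module.End ℂ (Mid m N) :=
  TensorProduct.map (tau1 w) (tau2 m w)

theorem tauM_eb (w : Equiv.Perm (Fin N)) (η : Fin N → ℤ) (c : Fin N → Fin m) :
    tauM w (eb η c) = eb (permLattice w η) fun i => c (w⁻¹ i) := by
  rw [tauM, eb, TensorProduct.map_tmul, tau1_zz, tau2_vb, eb]

theorem tau2_mul (w v : Equiv.Perm (Fin N)) : tau2 m (w * v) = tau2 m w * tau2 m v := by
  apply vn_ext
  intro c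
  rw [Module.End.mul_apply, tau2_vb, tau2_vb, tau2_vb]
  congr 1

theorem tauM_xOp (w : Equiv.Perm (Fin N)) {j k : Fin N} (h : j ≠ k) :
    tauM w * xOp (m := m) j k = xOp (w j) (w k) * tauM w := by
  rw [xOp, xOp, mul_sub, sub_mul]
  congr 1
  · apply TensorProduct.ext'
    intro f v
    simp only [Module.End.mul_apply, tauM, TensorProduct.map_tmul]
    have h2 : tau2 m w * tau2 m (Equiv.swap j k) = tau2 m (Equiv.swap (w j) (w k)) * tau2 m w := by
      rw [← tau2_mul, ← tau2_mul, swap_conj]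
    rw [tau1_divDiff w h]
    congr 1
    exact LinearMap.congr_fun h2 v
  · apply TensorProduct.ext'
    intro f v
    simp only [Module.End.mul_apply, tauM, op_tmul, TensorProduct.map_tmul, one_mul]
    rw [← Module.End.mul_apply, tau2_rV, Module.End.mul_apply]

/-- Reversing one pair costs exactly a transposition; this produces the constant -α_i(ξ) in the
cross relation with s_i. -/
theorem xOp_add_swap {j k : Fin N} (h : j ≠ k) :
    xOp (m := m) j k + xOp k j = -tauM (Equiv.swap j k) := by
  apply TensorProduct.ext'
  intro f v
  simp only [xOp, tauM, LinearMap.add_apply, LinearMap.sub_apply, LinearMap.neg_apply, op_tmul,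
    TensorProduct.map_tmul, one_mul]
  rw [Equiv.swap_comm k j, sub_add_sub_comm, ← TensorProduct.add_tmul, ← TensorProduct.tmul_add,
    divDiff_add_swap h, ← LinearMap.add_apply, rV_add h, sub_eq_iff_eq_add,
    eq_neg_add_iff_add_eq, ← TensorProduct.add_tmul, add_sub_cancel]

/-- Multiplication by z_j turns the ordered pair (k, j) into (j, k) with a sign. This is what
happens to the pairs that wrap around under π. -/
theorem xOp_translate {j k : Fin N} (h : j ≠ k) :
    op (zz (Pi.single j 1)) 1 * xOp (m := m) k j = -(xOp j k * op (zz (Pi.single j 1)) 1) := by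
  rw [eq_neg_iff_add_eq_zero]
  apply TensorProduct.ext'
  intro f v
  simp only [xOp, LinearMap.add_apply, LinearMap.sub_apply, Module.End.mul_apply, op_tmul,
    TensorProduct.map_tmul, one_mul, map_sub, Module.End.one_apply]
  rw [Equiv.swap_comm k j, sub_add_sub_comm, ← TensorProduct.add_tmul, ← TensorProduct.tmul_add,
    divDiff_translate h, ← LinearMap.add_apply, rV_add h.symm, Equiv.swap_comm, sub_self,
    LinearMap.zero_apply]

theorem xOp_translate_of_ne {i j k : Fin N} (hjk : j ≠ k) (hj : i ≠ j) (hk : i ≠ k) :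
    op (zz (Pi.single i 1)) 1 * xOp (m := m) j k = xOp j k * op (zz (Pi.single i 1)) 1 := by
  have h : ∀ f : Lau N, divDiff j k (zz (Pi.single i 1) * f) = zz (Pi.single i 1) * divDiff j k f := by
    intro f
    apply mul_one_sub_cancel hjk
    rw [divDiff_spec hjk, tau1_mul, tau1_zz, permLattice_single,
      Equiv.swap_apply_of_ne_of_ne hj hk]
    linear_combination (-zz (Pi.single i 1)) * divDiff_spec hjk f
  apply TensorProduct.ext'
  intro f v
  simp only [xOp, LinearMap.sub_apply, Module.End.mul_apply, op_tmul,
    TensorProduct.map_tmul, one_mul, map_sub, Module.End.one_apply, h]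

theorem tau2_swap_eq {j k : Fin N} (h : j ≠ k) :
    tau2 m (Equiv.swap j k) = ∑ a : Fin m, ∑ b : Fin m, slotE j a b * slotE k b a := by
  have h1 : rV (m := m) k j = ∑ a : Fin m, ∑ b : Fin m, rWt b a • (slotE j a b * slotE k b a) := by
    rw [rV, Finset.sum_comm]
    refine Finset.sum_congr rfl fun a _ => Finset.sum_congr rfl fun b _ => ?_
    rw [(slotE_comm h a b b a).eq]
  rw [← rV_add h, h1, rV, ← Finset.sum_add_distrib]
  refine Finset.sum_congr rfl fun a _ => ?_
  rw [← Finset.sum_add_distrib]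
  refine Finset.sum_congr rfl fun b _ => ?_
  rw [← add_smul, rWt_add, one_smul]

/-- The flip is ∑ E_ab ⊗ E_ba, so each of the two sums in `phiOp` is a matrix unit times the flip;
the trace corrections of the two sums agree and cancel. -/
theorem phiOp_thetaEval {j k : Fin N} (h : j ≠ k) {c d : Fin m} (hcd : c ≠ d) (n l : ℤ) :
    phiOp (thetaEval j) (thetaEval k) c d n l =
      op (zz (Pi.single j (l + n)) * zz (Pi.single k (-l)))
        ((slotE k c d - slotE j c d) * tau2 m (Equiv.swap j k)) := by
  have h1 : slotE k c d * tau2 m (Equiv.swap j k) = ∑ a : Fin m, slotE j a d * slotE k c a := by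
    rw [tau2_swap_eq h, Finset.mul_sum]
    refine Finset.sum_congr rfl fun a _ => ?_
    simp only [Finset.mul_sum, ← mul_assoc, (slotE_comm h.symm _ _ _ _).eq]
    simp [mul_assoc, slotE_mul_same]
  have h2 : slotE j c d * tau2 m (Equiv.swap j k) = ∑ b : Fin m, slotE j c b * slotE k b d := by
    rw [tau2_swap_eq h, Finset.sum_comm, Finset.mul_sum]
    refine Finset.sum_congr rfl fun a _ => ?_
    simp [Finset.mul_sum, ← mul_assoc, slotE_mul_same]
  set z := zz (Pi.single j (l + n)) * zz (Pi.single k (-l)) with hz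
  have h3 : ∀ a : Fin m, thetaEval j (E a d (l + n)) * thetaEval k (E c a (-l)) =
      op z (slotE j a d * slotE k c a) - (if a = d then (m : ℂ)⁻¹ • op z (slotE k c d) else 0)
      - (if a = c then (m : ℂ)⁻¹ • op z (slotE j c d) else 0) := by
    intro a
    rw [thetaEval_E, thetaEval_E]
    by_cases e1 : a = d
    · have e2 : c ≠ a := fun e => hcd (e.trans e1)
      rw [if_pos e1, if_pos e1, if_neg e2, if_neg e2.symm, zero_smul, sub_zero, sub_zero, sub_mul,
        smul_mul_assoc, op_mul, op_mul, one_mul, e1]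
    · by_cases e2 : a = c
      · rw [if_neg e1, if_neg e1, if_pos e2, if_pos e2.symm, zero_smul, sub_zero, sub_zero, mul_sub,
          mul_smul_comm, op_mul, op_mul, mul_one, e2]
      · rw [if_neg e1, if_neg e1, if_neg e2, if_neg (Ne.symm e2), zero_smul, zero_smul, sub_zero,
          sub_zero, sub_zero, sub_zero, op_mul]
  have h4 : ∀ b : Fin m, thetaEval j (E c b (l + n)) * thetaEval k (E b d (-l)) =
      op z (slotE j c b * slotE k b d) - (if b = c then (m : ℂ)⁻¹ • op z (slotE k c d) else 0)
      - (if b = d then (m : ℂ)⁻¹ • op z (slotE j c d) else 0) := by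
    intro a
    rw [thetaEval_E, thetaEval_E]
    by_cases e1 : a = d
    · have e2 : c ≠ a := fun e => hcd (e.trans e1)
      rw [if_pos e1, if_pos e1, if_neg e2, if_neg e2.symm, zero_smul, sub_zero, sub_zero, mul_sub,
        mul_smul_comm, op_mul, op_mul, mul_one, e1]
    · by_cases e2 : a = c
      · rw [if_neg e1, if_neg e1, if_pos e2, if_pos e2.symm, zero_smul, sub_zero, sub_zero, sub_mul,
          smul_mul_assoc, op_mul, op_mul, one_mul, e2]
      · rw [if_neg e1, if_neg e1, if_neg e2, if_neg (Ne.symm e2), zero_smul, zero_smul, sub_zero,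
          sub_zero, sub_zero, sub_zero, op_mul]
  have h5 : (slotE k c d - slotE j c d) * tau2 m (Equiv.swap j k) + slotE j c d *
      tau2 m (Equiv.swap j k) = slotE k c d * tau2 m (Equiv.swap j k) := by
    rw [← add_mul, sub_add_cancel]
  rw [phiOp, sub_eq_iff_eq_add]
  simp only [h3, h4, Finset.sum_sub_distrib, ← op_sum_right, ← h1, ← h2, Finset.sum_ite_eq',
    Finset.mem_univ, if_true]
  rw [← h5, op_add_right]
  abel

/-- Abstract form of the next commutator: D commutes with the two multiplications up to exchanging
them and up to defects wj, wk, while P exchanges ej and ek exactly. Writing the defects on both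
sides avoids subtraction. -/
theorem map_comm_add {S T : Type} [AddCommMonoid S] [Module ℂ S] [AddCommMonoid T] [Module ℂ T]
    {D zj zk wj wk : Module.End ℂ S} {P ej ek : Module.End ℂ T} (hj : D * zj + wj = zk * D + wk)
    (hk : D * zk + wk = zj * D + wj) (hPj : P * ej = ek * P) (hPk : P * ek = ej * P) :
    TensorProduct.map D P * (TensorProduct.map zj ej + TensorProduct.map zk ek)
      + (TensorProduct.map wj (ek * P) + TensorProduct.map wk (ej * P))
    = (TensorProduct.map zj ej + TensorProduct.map zk ek) * TensorProduct.map D P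
      + (TensorProduct.map wk (ek * P) + TensorProduct.map wj (ej * P)) := by
  have e1 := congrArg (fun x => TensorProduct.map x (ek * P)) hj
  have e2 := congrArg (fun x => TensorProduct.map x (ej * P)) hk
  simp only [TensorProduct.map_add_left] at e1 e2
  simp only [mul_add, add_mul, ← TensorProduct.map_mul, hPj, hPk]
  rw [add_add_add_comm, e1, e2, add_add_add_comm, add_comm (TensorProduct.map (zk * D) (ek * P))]

theorem op_eq_map (f : Lau N) (s : Module.End ℂ (VN m N)) :
    op f s = TensorProduct.map (LinearMap.mulLeft ℂ f) s := rfl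

/-- The divided difference times the flip has the same non-Cartan defect as the constant r-matrix in
`rBar_comm`. This is why `xOp`, their difference, replaces the r-matrix with spectral parameter. -/
theorem divDiff_comm {j k : Fin N} (h : j ≠ k) {c d : Fin m} (hcd : c ≠ d) {n : ℤ} {ε : ℂ}
    (hs : IsSimple c d n ε) :
    TensorProduct.map (divDiff j k) (tau2 m (Equiv.swap j k)) *
      (thetaEval j (E c d n) + thetaEval k (E c d n))
    - (thetaEval j (E c d n) + thetaEval k (E c d n)) *
      TensorProduct.map (divDiff j k) (tau2 m (Equiv.swap j k)) =
    if n = 1 then phiOp (thetaEval j) (thetaEval k) c d n 0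
      else if n = -1 then - phiOp (thetaEval j) (thetaEval k) c d n 1 else 0 := by
  have hj : tau2 m (Equiv.swap j k) * slotE j c d = slotE k c d * tau2 m (Equiv.swap j k) := by
    rw [tau2_slotE, Equiv.swap_apply_left]
  have hk : tau2 m (Equiv.swap j k) * slotE k c d = slotE j c d * tau2 m (Equiv.swap j k) := by
    rw [tau2_slotE, Equiv.swap_apply_right]
  have h0 : (slotE k c d - slotE j c d) * tau2 m (Equiv.swap j k) + slotE j c d *
      tau2 m (Equiv.swap j k) = slotE k c d * tau2 m (Equiv.swap j k) := by
    rw [← add_mul, sub_add_cancel]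
  rw [thetaEval_E_of_ne j hcd, thetaEval_E_of_ne k hcd, phiOp_thetaEval h hcd,
    phiOp_thetaEval h hcd, sub_eq_iff_eq_add]
  -- Here f and g are the inhomogeneous terms of the Leibniz rules: both zero for finite roots,
  -- (z_j, 0) and (0, z_k⁻¹) for the two affine ones.
  have gen : ∀ f g : Lau N,
      divDiff j k * LinearMap.mulLeft ℂ (zz (Pi.single j n)) + LinearMap.mulLeft ℂ g =
        LinearMap.mulLeft ℂ (zz (Pi.single k n)) * divDiff j k + LinearMap.mulLeft ℂ f →
      divDiff j k * LinearMap.mulLeft ℂ (zz (Pi.single k n)) + LinearMap.mulLeft ℂ f =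
        LinearMap.mulLeft ℂ (zz (Pi.single j n)) * divDiff j k + LinearMap.mulLeft ℂ g →
      TensorProduct.map (divDiff j k) (tau2 m (Equiv.swap j k)) *
        (op (zz (Pi.single j n)) (slotE j c d) + op (zz (Pi.single k n)) (slotE k c d))
        + op g ((slotE k c d - slotE j c d) * tau2 m (Equiv.swap j k)) =
      op f ((slotE k c d - slotE j c d) * tau2 m (Equiv.swap j k)) +
      (op (zz (Pi.single j n)) (slotE j c d) + op (zz (Pi.single k n)) (slotE k c d)) *
        TensorProduct.map (divDiff j k) (tau2 m (Equiv.swap j k)) := by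
    intro f g e1 e2
    have e3 := map_comm_add e1 e2 hj hk
    simp only [← op_eq_map, ← h0, op_add_right] at e3
    apply add_right_cancel (b := op g (slotE j c d * tau2 m (Equiv.swap j k))
      + op f (slotE j c d * tau2 m (Equiv.swap j k)))
    rw [add_assoc, ← add_assoc (op g _)]
    refine e3.trans ?_
    abel
  cases hs with
  | up =>
    rw [if_neg (by decide), if_neg (by decide)]
    have := gen 0 0 (LinearMap.ext fun f => by simp [zz_zero])
      (LinearMap.ext fun f => by simp [zz_zero])
    simpa only [op_zero_left, add_zero, zero_add] using this
  | down =>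
    rw [if_neg (by decide), if_neg (by decide)]
    have := gen 0 0 (LinearMap.ext fun f => by simp [zz_zero])
      (LinearMap.ext fun f => by simp [zz_zero])
    simpa only [op_zero_left, add_zero, zero_add] using this
  | affineUp =>
    rw [if_pos rfl, neg_zero, zero_add, Pi.single_zero, zz_zero, mul_one]
    have := gen (zz (Pi.single j 1)) 0
      (LinearMap.ext fun f => by simp [divDiff_mul_left h])
      (LinearMap.ext fun f => by simp [divDiff_mul_right h])
    simpa only [op_zero_left, add_zero] using this
  | affineDown =>
    rw [if_neg (by decide), if_pos rfl, add_neg_cancel, Pi.single_zero, zz_zero, one_mul,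
      eq_neg_add_iff_add_eq]
    have := gen 0 (zz (Pi.single k (-1)))
      (LinearMap.ext fun f => by simp [divDiff_mul_left_neg h])
      (LinearMap.ext fun f => by simp [divDiff_mul_right_neg h])
    rw [op_zero_left, zero_add] at this
    rw [← this, add_comm]

/-- The `phiOp` terms of `divDiff_comm` and `rBar_comm` cancel, leaving the cobracket of the
Chevalley generator with sign opposite to that of the r-matrix. The scalar -1/(2m) in
`rBar_thetaEval` commutes with everything. -/
theorem xOp_comm (hm : m ≠ 0) {j k : Fin N} (h : j ≠ k) {c d : Fin m} (hcd : c ≠ d) {n : ℤ} {ε : ℂ}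
    (hs : IsSimple c d n ε) :
    xOp j k * (thetaEval j (E c d n) + thetaEval k (E c d n))
    - (thetaEval j (E c d n) + thetaEval k (E c d n)) * xOp j k =
    (ε / 2) • (thetaEval j (E c d n) * thetaEval k (E c c 0 - E d d 0 + (n : ℂ) • cen)
      - thetaEval j (E c c 0 - E d d 0 + (n : ℂ) • cen) * thetaEval k (E c d n)) := by
  have h1 := divDiff_comm h hcd hs
  have h2 := rBar_comm (isRep_thetaEval j) (isRep_thetaEval k) (thetaEval_commute h) hs hcd
  rw [rBar_thetaEval hm] at h2
  have hc : ∀ i : Fin N, thetaEval i (E c c 0 - E d d 0 + (n : ℂ) • cen) =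
      thetaEval i (E c c 0 - E d d 0) := by
    intro i
    rw [(isRep_thetaEval i).add, (isRep_thetaEval i).smul, thetaEval_cen, smul_zero, add_zero]
  rw [hc, hc, xOp]
  have e : ∀ {R : Type} [Ring R] [Algebra ℂ R] (D r a q u v : R) (t u' : ℂ),
      (r - t • 1) * a - a * (r - t • 1) = D * a - a * D - u' • (u - v) →
      (D - r) * a - a * (D - r) = u' • (u - v) := by
    intro R _ _ D r a q u v t u' h3
    simp only [sub_mul, mul_sub, smul_mul_assoc, mul_smul_comm, one_mul, mul_one] at h3 ⊢
    have h4 : r * a - a * r = D * a - a * D - u' • (u - v) := by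
      rw [← h3]; abel
    calc _ = (D * a - a * D) - (r * a - a * r) := by abel
      _ = _ := by rw [h4]; abel
  apply e _ _ _ 0 _ _ (1 / (2 * m : ℂ))
  rw [h1]
  exact h2

end

end KZ

namespace KZ
open AffineSl DDAHA
variable {m N : ℕ}

section
set_option linter.unusedSectionVars false
attribute [local instance] vnGroup midGroup midAddGroup

/-! ### Operators on the numerator space -/

section

variable (A B : Type) [AddCommGroup A] [Module ℂ A] [AddCommGroup B] [Module ℂ B]

/-- Operators on the middle factor. -/
def liftMid : Module.End ℂ (Mid m N) →ₐ[ℂ] Module.End ℂ (Num m N (Lau N) A B) :=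
  (Module.End.lTensorAlgHom ℂ _ _).comp (Module.End.rTensorAlgHom ℂ _ _)

/-- Operators on the left factor. -/
def liftA : Module.End ℂ A →ₐ[ℂ] Module.End ℂ (Num m N (Lau N) A B) :=
  Module.End.rTensorAlgHom ℂ _ _

/-- Operators on the right factor. -/
def liftB : Module.End ℂ B →ₐ[ℂ] Module.End ℂ (Num m N (Lau N) A B) :=
  (Module.End.lTensorAlgHom ℂ _ _).comp (Module.End.lTensorAlgHom ℂ _ _)

/-- Multiplication by rational functions. -/
def mulRatHom : RatFun N →ₐ[ℂ] Module.End ℂ (Num m N (RatFun N) A B) :=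
  (Module.End.lTensorAlgHom ℂ _ _).comp ((Module.End.rTensorAlgHom ℂ _ _).comp
    ((Module.End.rTensorAlgHom ℂ _ _).comp (Algebra.lmul ℂ (RatFun N))))

theorem thetaI_eq (i : Fin N) (x : AffineSl m) :
    thetaI A B i x = liftMid A B (thetaEval i x) := rfl

theorem tau_eq (w : Equiv.Perm (Fin N)) : tau A B w = liftMid (m := m) A B (tauM w) := rfl

theorem mulLau_eq (f : Lau N) : mulLau m A B f = liftMid A B (op f 1) := rfl

theorem mulRat_eq (f : RatFun N) : mulRat m A B f = mulRatHom A B f := rfl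

section

variable {A B}

theorem num_ext {M : Type} [AddCommGroup M] [Module ℂ M] {f g : Num m N (Lau N) A B →ₗ[ℂ] M}
    (h : ∀ a x b, f (a ⊗ₜ (x ⊗ₜ b)) = g (a ⊗ₜ (x ⊗ₜ b))) : f = g := by
  apply TensorProduct.ext'
  intro a y
  have : f ∘ₗ TensorProduct.mk ℂ A _ a = g ∘ₗ TensorProduct.mk ℂ A _ a :=
    TensorProduct.ext' fun x b => h a x b
  exact LinearMap.congr_fun this y

theorem liftA_comm_liftMid (f : Module.End ℂ A) (g : Module.End ℂ (Mid m N)) :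
    liftA A B f * liftMid A B g = liftMid A B g * liftA A B f :=
  num_ext fun _ _ _ => rfl

theorem liftMid_comm_liftB (f : Module.End ℂ (Mid m N)) (g : Module.End ℂ B) :
    liftMid A B f * liftB A B g = liftB A B g * liftMid A B f :=
  num_ext fun _ _ _ => rfl

theorem liftA_comm_liftB (f : Module.End ℂ A) (g : Module.End ℂ B) :
    liftA (m := m) (N := N) A B f * liftB A B g = liftB A B g * liftA A B f :=
  num_ext fun _ _ _ => rfl

end

theorem IsRep.map {M M' : Type} [AddCommGroup M] [Module ℂ M] [AddCommGroup M'] [Module ℂ M']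
    {p : AffineSl m → Module.End ℂ M} (hp : IsRep p)
    (φ : Module.End ℂ M →ₐ[ℂ] Module.End ℂ M') : IsRep fun x => φ (p x) where
  add x y := by rw [hp.add, map_add]
  smul r x := by rw [hp.smul, map_smul]
  lie x y := by rw [hp.lie, map_sub, map_mul, map_mul]

theorem isRep_thetaI (i : Fin N) : IsRep (thetaI (m := m) A B i) := (isRep_thetaEval i).map (liftMid A B)

theorem rBar_map {M M' : Type} [AddCommGroup M] [Module ℂ M] [AddCommGroup M'] [Module ℂ M']
    (p q : AffineSl m → Module.End ℂ M) (φ : Module.End ℂ M →ₐ[ℂ] Module.End ℂ M') :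
    rBar (fun x => φ (p x)) (fun x => φ (q x)) = φ (rBar p q) := by
  simp only [rBar_eq, map_sum, map_smul, map_mul]

theorem rBar_thetaI (hm : m ≠ 0) (j k : Fin N) : rBar (thetaI A B j) (thetaI A B k) =
    liftMid (m := m) A B (op 1 (rV j k)) - (1 / (2 * m : ℂ)) • 1 := by
  have h := rBar_map (thetaEval (m := m) j) (thetaEval k) (liftMid A B)
  rw [rBar_thetaEval hm, map_sub, map_smul, map_one] at h
  exact h

theorem incl_mulLau (f : Lau N) (y : Num m N (Lau N) A B) :
    incl m N A B (liftMid A B (op f 1) y) =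
      mulRatHom A B (algebraMap (Lau N) (RatFun N) f) (incl m N A B y) := by
  have : incl m N A B ∘ₗ liftMid A B (op f 1) =
      mulRatHom A B (algebraMap (Lau N) (RatFun N) f) ∘ₗ incl m N A B := by
    apply num_ext
    intro a x b
    have h2 : ∀ x : Mid m N,
        LinearMap.rTensor (VN m N) (IsScalarTower.toAlgHom ℂ (Lau N) (RatFun N)).toLinearMap
          (op f 1 x) = LinearMap.rTensor (VN m N)
            (LinearMap.mulLeft ℂ (algebraMap (Lau N) (RatFun N) f))
          (LinearMap.rTensor (VN m N) (IsScalarTower.toAlgHom ℂ (Lau N) (RatFun N)).toLinearMap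
            x) := by
      intro x
      induction x using TensorProduct.induction_on with
      | zero => simp only [map_zero]
      | add x y hx hy => simp only [map_add, hx, hy]
      | tmul g v =>
        simp only [op_tmul, LinearMap.rTensor_tmul, Module.End.one_apply, LinearMap.mulLeft_apply]
        congr 1
        exact map_mul (algebraMap (Lau N) (RatFun N)) f g
    exact congrArg (fun t => a ⊗ₜ[ℂ] (t ⊗ₜ[ℂ] b)) (h2 x)
  exact LinearMap.congr_fun this y

/-- Everything is flat over ℂ. Injectivity makes the vector y' in `IsAction.map_xi` unique, hence
the action unique. -/
theorem incl_injective : Function.Injective (incl m N A B) := by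
  have h : Function.Injective (IsScalarTower.toAlgHom ℂ (Lau N) (RatFun N)).toLinearMap :=
    IsFractionRing.injective (Lau N) (RatFun N)
  exact Module.Flat.lTensor_preserves_injective_linearMap _
    (Module.Flat.rTensor_preserves_injective_linearMap _
      (Module.Flat.rTensor_preserves_injective_linearMap _ h))

variable [LieRingModule (AffineSl m) A] [LieModule ℂ (AffineSl m) A]
  [LieRingModule (AffineSl m) B] [LieModule ℂ (AffineSl m) B]

theorem thetaA_eq (x : AffineSl m) :
    thetaA (N := N) A B x = liftA A B (LieModule.toEnd ℂ (AffineSl m) A x) := rfl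

theorem thetaB_eq (x : AffineSl m) :
    thetaB (N := N) A B x = liftB A B (LieModule.toEnd ℂ (AffineSl m) B x) := rfl

theorem isRep_toEnd (A : Type) [AddCommGroup A] [Module ℂ A] [LieRingModule (AffineSl m) A]
    [LieModule ℂ (AffineSl m) A] : IsRep (LieModule.toEnd ℂ (AffineSl m) A) where
  add := map_add _
  smul := map_smul _
  lie x y := by
    ext v
    exact lie_lie x y v

theorem isRep_thetaA : IsRep (thetaA (m := m) (N := N) A B) := (isRep_toEnd (m := m) A).map (liftA A B)

theorem isRep_thetaB : IsRep (thetaB (m := m) (N := N) A B) := (isRep_toEnd (m := m) B).map (liftB A B)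

end

/-! ### Logarithmic derivatives -/

theorem zRatio_eq (k j : Fin N) : zRatio k j = algebraMap (Lau N) (RatFun N) (zz (dl k j)) := rfl

theorem one_sub_zRatio_ne_zero {j k : Fin N} (h : j ≠ k) : 1 - zRatio k j ≠ 0 := by
  rw [zRatio_eq, ← map_one (algebraMap (Lau N) (RatFun N)), ← map_sub, Ne,
    map_eq_zero_iff _ (IsFractionRing.injective (Lau N) (RatFun N))]
  exact one_sub_zz_ne_zero (dl_ne_zero h)

theorem zRatio_mul (j k : Fin N) : zRatio k j * zRatio j k = 1 := by
  rw [zRatio_eq, zRatio_eq, ← map_mul, dl_mul_dl, map_one]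

/-- The logarithmic derivative of a Laurent polynomial. -/
def logDerivLau (ξ : Fin N → ℂ) (f : Lau N) : RatFun N :=
  algebraMap (Lau N) (RatFun N) (partialD ξ f) / algebraMap (Lau N) (RatFun N) f

theorem logDerivLau_one (ξ : Fin N → ℂ) : logDerivLau ξ 1 = 0 := by
  have : partialD ξ (1 : Lau N) = 0 := by
    rw [← zz_zero, partialD_zz]
    simp
  rw [logDerivLau, this, map_zero, zero_div]

theorem logDerivLau_prod {ι : Type} (ξ : Fin N → ℂ) (s : Finset ι) (f : ι → Lau N)
    (hf : ∀ i ∈ s, f i ≠ 0) : logDerivLau ξ (∏ i ∈ s, f i) = ∑ i ∈ s, logDerivLau ξ (f i) := by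
  classical
  induction s using Finset.induction_on with
  | empty => simp [logDerivLau_one]
  | insert i s hi ih =>
    rw [Finset.prod_insert hi, Finset.sum_insert hi,
      ← ih fun j hj => hf j (Finset.mem_insert_of_mem hj)]
    have hinj := IsFractionRing.injective (Lau N) (RatFun N)
    have h1 : algebraMap (Lau N) (RatFun N) (f i) ≠ 0 := by
      rw [Ne, map_eq_zero_iff _ hinj]
      exact hf i (Finset.mem_insert_self _ _)
    have h2 : algebraMap (Lau N) (RatFun N) (∏ i ∈ s, f i) ≠ 0 := by
      rw [Ne, map_eq_zero_iff _ hinj, Finset.prod_eq_zero_iff]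
      rintro ⟨j, hj, e⟩
      exact hf j (Finset.mem_insert_of_mem hj) e
    rw [logDerivLau, logDerivLau, logDerivLau, partialD, eulerLin_mul, map_add, map_mul, map_mul,
      map_mul]
    field_simp

theorem pairing_single_right (ξ : Fin N → ℂ) (i : Fin N) : pairing ξ (Pi.single i 1) = ξ i := by
  simp [pairing, Pi.single_apply]

theorem logDerivLau_root (ξ : Fin N → ℂ) (j k : Fin N) : logDerivLau ξ (1 - zz (dl k j)) =
    algebraMap ℂ (RatFun N) (ξ j - ξ k) * (zRatio k j / (1 - zRatio k j)) := by
  have h1 : partialD ξ (1 : Lau N) = 0 := by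
    rw [← zz_zero, partialD_zz]
    simp
  rw [logDerivLau, map_sub (partialD ξ), h1, map_sub (algebraMap (Lau N) (RatFun N)) 1, map_one,
    partialD_zz, zRatio_eq, map_sub (pairing ξ), pairing_single_right,
    pairing_single_right, zero_sub]
  rw [← neg_smul, neg_sub, Algebra.smul_def, map_mul, ← IsScalarTower.algebraMap_apply, mul_div_assoc]

theorem sum_ne_eq_sum_lt {M : Type} [AddCommMonoid M] (f : Fin N → Fin N → M) :
    (∑ j, ∑ k, if j ≠ k then f j k else 0) = ∑ j, ∑ k, if j < k then f j k + f k j else 0 := by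
  have h : ∀ j k : Fin N, (if j ≠ k then f j k else 0) =
      (if j < k then f j k else 0) + if k < j then f j k else 0 := by
    intro j k
    rcases lt_trichotomy j k with h | h | h
    · simp [h, h.ne, h.not_gt]
    · simp [h]
    · simp [h, h.ne', h.not_gt]
  have h' : ∀ j k : Fin N, (if j < k then f j k + f k j else 0) =
      (if j < k then f j k else 0) + if j < k then f k j else 0 := by
    intro j k
    split_ifs <;> simp
  simp only [h, h', Finset.sum_add_distrib]
  rw [Finset.sum_comm (f := fun j k => if k < j then f j k else 0)]

/-- A root and its negative together contribute x/(1 - x) - x⁻¹/(1 - x⁻¹) = 2/(1 - x) - 1 with x =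
z_k/z_j. -/
theorem dlogG_eq (ξ : Fin N → ℂ) : dlogG ξ = ∑ j, ∑ k, if j < k then
    algebraMap ℂ (RatFun N) (ξ j - ξ k) * (2 * (1 / (1 - zRatio k j)) - 1) else 0 := by
  have h1 : dlogG ξ = logDerivLau ξ (bigG N) := rfl
  have h2 : ∀ j k : Fin N, (if j ≠ k then (1 : Lau N) - zz (dl k j) else 1) ≠ 0 := by
    intro j k
    split_ifs with h
    · exact one_sub_zz_ne_zero (dl_ne_zero h)
    · exact one_ne_zero
  have h3 : ∀ j k : Fin N, logDerivLau ξ (if j ≠ k then (1 : Lau N) - zz (dl k j) else 1) =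
      if j ≠ k then algebraMap ℂ (RatFun N) (ξ j - ξ k) * (zRatio k j / (1 - zRatio k j)) else 0 := by
    intro j k
    split_ifs
    · exact logDerivLau_root ξ j k
    · exact logDerivLau_one ξ
  rw [h1, bigG, logDerivLau_prod _ _ _ fun j _ => Finset.prod_ne_zero_iff.2 fun k _ => h2 j k]
  rw [Finset.sum_congr rfl fun j _ => logDerivLau_prod ξ _ _ fun k _ => h2 j k]
  simp only [h3]
  rw [sum_ne_eq_sum_lt]
  refine Finset.sum_congr rfl fun j _ => Finset.sum_congr rfl fun k _ => ?_
  split_ifs with h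
  · have e1 := one_sub_zRatio_ne_zero h.ne
    have e2 := one_sub_zRatio_ne_zero h.ne'
    have e3 := zRatio_mul j k
    have e4 : algebraMap ℂ (RatFun N) (ξ k - ξ j) = -algebraMap ℂ (RatFun N) (ξ j - ξ k) := by
      rw [← map_neg, neg_sub]
    rw [e4]
    field_simp
    linear_combination algebraMap ℂ (RatFun N) (ξ j - ξ k) * e3
  · rfl

/-! ### The Dunkl operators on Laurent polynomials -/

section

/-- The linear operator defined by the universal classical `r`-matrix. -/
def rUnivL {M : Type} [AddCommGroup M] [Module ℂ M] (p q : AffineSl m → Module.End ℂ M) :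
    Module.End ℂ M :=
  open Classical in
  -- The default 0 plays no role: the operator is only evaluated under `LocFin`, where `rUniv` is
  -- linear.
  if h : ∃ R : Module.End ℂ M, ∀ y, R y = rUniv p q y then h.choose else 0

theorem rUnivL_apply {M : Type} [AddCommGroup M] [Module ℂ M] {p q : AffineSl m → Module.End ℂ M}
    (hf : LocFin p q) (y : M) : rUnivL p q y = rUniv p q y := by
  rw [rUnivL, dif_pos (rUniv_linear hf)]
  exact (rUniv_linear hf).choose_spec y

variable (A B : Type)
  [AddCommGroup A] [Module ℂ A] [LieRingModule (AffineSl m) A] [LieModule ℂ (AffineSl m) A]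
  [AddCommGroup B] [Module ℂ B] [LieRingModule (AffineSl m) B] [LieModule ℂ (AffineSl m) B]

/-- The part of the Knizhnik–Zamolodchikov operator coming from the two outer factors. -/
def outerKZ (i : Fin N) : Module.End ℂ (Num m N (Lau N) A B) :=
  rUnivL (thetaA A B) (thetaI A B i) - rUnivL (thetaI A B i) (thetaB A B) + thetaI A B i rhoCheck

/-- The Dunkl operator acting on vectors with Laurent polynomial coefficients. -/
def dunklLau (ξ : Fin N → ℂ) : Module.End ℂ (Num m N (Lau N) A B) :=
  (∑ i, ξ i • outerKZ A B i) + ∑ j, ∑ k, if j < k then (ξ j - ξ k) • liftMid A B (xOp j k) else 0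

/-- Regroups a sum over places, with signs for smaller and larger neighbours, into a sum over
positive roots. The same regrouping handles the r-matrices, their commutators and the diagonal
coefficients. -/
theorem sum_smul_lt_sub {M : Type} [AddCommGroup M] [Module ℂ M] (ξ : Fin N → ℂ)
    (r : Fin N → Fin N → M) :
    (∑ i, ξ i • ((∑ j, if j < i then r j i else 0) - ∑ j, if i < j then r i j else 0)) =
      ∑ j, ∑ k, if j < k then (ξ j - ξ k) • (-r j k) else 0 := by
  have h1 : ∀ i j : Fin N, ξ i • (if j < i then r j i else 0) = if j < i then ξ i • r j i else 0 := by
    intro i j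
    split_ifs <;> simp
  have h2 : ∀ i j : Fin N, ξ i • (if i < j then r i j else 0) = if i < j then ξ i • r i j else 0 := by
    intro i j
    split_ifs <;> simp
  simp only [smul_sub, Finset.smul_sum, h1, h2, Finset.sum_sub_distrib]
  rw [Finset.sum_comm, ← Finset.sum_sub_distrib]
  refine Finset.sum_congr rfl fun j _ => ?_
  rw [← Finset.sum_sub_distrib]
  refine Finset.sum_congr rfl fun k _ => ?_
  split_ifs
  · module
  · simp

/-- Let g = 1/(1 - z_k/z_j), P the flip of tensor factors and τ the simultaneous transposition. The
right side is -r̄_V + 1/(2m) + g(P - 1/m) + g(1 - τ) - 1/2 - (m - 1)/(2m) (2g - 1), with r̄_V the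
r-matrix of gl_m. All scalars cancel and g(P - τ) - r̄_V remains; g(P - τ) is the divided difference
times P, so no denominators are left. -/
theorem incl_xOp (hm : m ≠ 0) {j k : Fin N} (h : j ≠ k) (y : Num m N (Lau N) A B) :
    incl m N A B (liftMid A B (xOp j k) y) =
      -rEval A B j k y + mulRat m A B (1 / (1 - zRatio k j))
        (incl m N A B (y - tau A B (Equiv.swap j k) y)) - (1 / 2 : ℂ) • incl m N A B y
      - (((m : ℂ) - 1) / (2 * m)) •
        mulRat m A B (2 * (1 / (1 - zRatio k j)) - 1) (incl m N A B y) := by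
  have hm' : (m : ℂ) ≠ 0 := Nat.cast_ne_zero.2 hm
  have h1 : zRatio j k / (1 - zRatio j k) = -(1 / (1 - zRatio k j)) := by
    have e1 := one_sub_zRatio_ne_zero h
    have e2 := one_sub_zRatio_ne_zero h.symm
    have e3 := zRatio_mul j k
    field_simp
    linear_combination -e3
  set g : RatFun N := 1 / (1 - zRatio k j) with hg
  have h2 : rBar (thetaI A B j) (thetaI A B k) + rBar (thetaI A B k) (thetaI A B j) =
      liftMid (m := m) A B (op 1 (tau2 m (Equiv.swap j k))) - (1 / (m : ℂ)) • 1 := by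
    rw [rBar_thetaI A B hm, rBar_thetaI A B hm, ← rV_add h, op_add_right, map_add]
    have : (1 / (m : ℂ)) = 1 / (2 * m) + 1 / (2 * m) := by
      field_simp
      norm_num
    rw [this, add_smul]
    abel
  have h3 : ∀ w, mulRatHom A B g (incl m N A B (liftMid A B (op (1 - zz (dl k j)) 1) w)) =
      incl m N A B w := by
    intro w
    rw [incl_mulLau, ← Module.End.mul_apply, ← map_mul]
    have : g * algebraMap (Lau N) (RatFun N) (1 - zz (dl k j)) = 1 := by
      rw [map_sub, map_one, ← zRatio_eq, hg, one_div, inv_mul_cancel₀ (one_sub_zRatio_ne_zero h)]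
    rw [this, map_one, Module.End.one_apply]
  have h4 : op (1 - zz (dl k j)) 1 * TensorProduct.map (divDiff j k) (tau2 m (Equiv.swap j k)) +
      tauM (Equiv.swap j k) = op 1 (tau2 m (Equiv.swap j k)) := by
    apply TensorProduct.ext'
    intro f v
    simp only [LinearMap.add_apply, Module.End.mul_apply, op_tmul, tauM, TensorProduct.map_tmul,
      Module.End.one_apply, divDiff_spec h, one_mul]
    rw [← TensorProduct.add_tmul, sub_add_cancel]
  have h5 := h3 (liftMid A B (TensorProduct.map (divDiff j k) (tau2 m (Equiv.swap j k))) y)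
  have h6 : liftMid A B (op (1 - zz (dl k j)) 1)
      (liftMid A B (TensorProduct.map (divDiff j k) (tau2 m (Equiv.swap j k))) y) =
      liftMid A B (op 1 (tau2 m (Equiv.swap j k))) y - liftMid A B (tauM (Equiv.swap j k)) y := by
    rw [← h4, map_add, map_mul, LinearMap.add_apply, Module.End.mul_apply, add_sub_cancel_right]
  rw [h6] at h5
  rw [rEval, h1, tau_eq, mulRat_eq, mulRat_eq, mulRat_eq, ← LinearMap.add_apply, h2,
    rBar_thetaI A B hm, xOp]
  simp only [map_sub, map_neg, LinearMap.sub_apply, LinearMap.smul_apply, Module.End.one_apply,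
    LinearMap.neg_apply, map_smul, map_mul, map_one, map_ofNat, Module.End.mul_apply,
    Module.End.ofNat_apply] at h5 ⊢
  rw [← h5]
  have e1 : (1 / (2 * m) : ℂ) = 1 / 2 * (m : ℂ)⁻¹ := by field_simp
  have e2 : (((m : ℂ) - 1) / (2 * m)) = 1 / 2 - 1 / 2 * (m : ℂ)⁻¹ := by field_simp
  rw [e1, e2, one_div (m : ℂ)]
  module

/-- The Dunkl operators thus preserve Laurent polynomial coefficients. The correction terms of their
definition are distributed over the positive roots, one `incl_xOp` for each. -/
theorem incl_dunklLau (hm : m ≠ 0) (hA : ∀ i, LocFin (thetaA A B) (thetaI (m := m) (N := N) A B i))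
    (hB : ∀ i, LocFin (thetaI (m := m) (N := N) A B i) (thetaB A B)) (ξ : Fin N → ℂ)
    (y : Num m N (Lau N) A B) : incl m N A B (dunklLau A B ξ y) = dunkl A B ξ y := by
  have h1 : ∀ i, ξ i • nabla A B i y = ξ i • incl m N A B (outerKZ A B i y) +
      ξ i • ((∑ j, if j < i then rEval A B j i y else 0)
        - ∑ j, if i < j then rEval A B i j y else 0) := by
    intro i
    rw [← smul_add, nabla, outerKZ, LinearMap.add_apply, LinearMap.sub_apply, rUnivL_apply (hA i),
      rUnivL_apply (hB i), map_add, map_sub]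
    congr 1
    abel
  have h2 : mulRat m A B (dlogG ξ) (incl m N A B y) = ∑ j, ∑ k, if j < k then
      (ξ j - ξ k) • mulRat m A B (2 * (1 / (1 - zRatio k j)) - 1) (incl m N A B y) else 0 := by
    rw [dlogG_eq, mulRat_eq, map_sum, LinearMap.sum_apply]
    refine Finset.sum_congr rfl fun j _ => ?_
    rw [map_sum, LinearMap.sum_apply]
    refine Finset.sum_congr rfl fun k _ => ?_
    split_ifs
    · rw [← Algebra.smul_def, map_smul, LinearMap.smul_apply, mulRat_eq]
    · rw [map_zero, LinearMap.zero_apply]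
  rw [dunkl, Finset.sum_congr rfl fun i _ => h1 i, Finset.sum_add_distrib, sum_smul_lt_sub, h2,
    rhoBar, dunklLau, LinearMap.add_apply, map_add, LinearMap.sum_apply, map_sum, add_assoc,
    add_sub_assoc, add_sub_assoc]
  congr 1
  · refine Finset.sum_congr rfl fun i _ => ?_
    rw [LinearMap.smul_apply, map_smul]
  · rw [Finset.mul_sum, Finset.sum_smul, Finset.smul_sum, ← Finset.sum_add_distrib,
      ← Finset.sum_sub_distrib, ← Finset.sum_sub_distrib, LinearMap.sum_apply, map_sum]
    refine Finset.sum_congr rfl fun j _ => ?_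
    rw [Finset.mul_sum, Finset.sum_smul, Finset.smul_sum, ← Finset.sum_add_distrib,
      ← Finset.sum_sub_distrib, ← Finset.sum_sub_distrib, LinearMap.sum_apply, map_sum]
    refine Finset.sum_congr rfl fun k _ => ?_
    split_ifs with h
    · rw [LinearMap.smul_apply, map_smul, incl_xOp A B hm h.ne]
      module
    · simp

end

end

end KZ

namespace AffineSl
variable {m : ℕ}

/-! ### Verma modules -/

/-- The canonical generator of `VermaOf n l`. -/
def vac (n : Submodule ℂ (AffineSl m)) (l : Weight m) : VermaOf n l :=
  (Submodule.Quotient.mk 1 : U m ⧸ vermaIdeal n l)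

variable {n : Submodule ℂ (AffineSl m)} {l : Weight m}

theorem lie_vac_of_mem {x : AffineSl m} (hx : x ∈ n) : ⁅x, vac n l⁆ = 0 := by
  refine (Submodule.Quotient.mk_eq_zero (vermaIdeal n l)).2 ?_
  change toU x * 1 ∈ _
  rw [mul_one]
  exact Submodule.subset_span (Or.inl ⟨x, hx, rfl⟩)

theorem lie_vac_cartan (h : cartan m) : ⁅h.1, vac n l⁆ = l h • vac n l := by
  rw [← sub_eq_zero]
  refine (Submodule.Quotient.mk_eq_zero (vermaIdeal n l)).2 ?_
  have : toU h.1 - algebraMap ℂ (U m) (l h) ∈ vermaIdeal n l :=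
    Submodule.subset_span (Or.inr ⟨h, rfl⟩)
  simpa [Algebra.algebraMap_eq_smul_one] using this

theorem U_induction {P : U m → Prop} (halg : ∀ r : ℂ, P (algebraMap ℂ (U m) r))
    (hι : ∀ x, P (toU x)) (hmul : ∀ u v, P u → P v → P (u * v))
    (hadd : ∀ u v, P u → P v → P (u + v)) (u : U m) : P u := by
  let S : Subalgebra ℂ (U m) :=
    { carrier := {u | P u}
      mul_mem' := fun {u v} => hmul u v
      add_mem' := fun {u v} => hadd u v
      algebraMap_mem' := halg }
  let _ := LieRing.ofAssociativeRing (A := S)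
  let _ := LieRing.ofAssociativeRing (A := U m)
  let f : AffineSl m →ₗ⁅ℂ⁆ S :=
    { toFun := fun x => ⟨toU x, hι x⟩
      map_add' := fun x y => Subtype.ext (map_add toU x y)
      map_smul' := fun r x => Subtype.ext (map_smul toU r x)
      map_lie' := fun {x y} => Subtype.ext (toU_lie x y) }
  have h : S.val.comp (UniversalEnvelopingAlgebra.lift ℂ f) = AlgHom.id ℂ (U m) := by
    apply UniversalEnvelopingAlgebra.hom_ext
    ext x
    change (UniversalEnvelopingAlgebra.lift ℂ f (UniversalEnvelopingAlgebra.ι ℂ x)).1 = _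
    rw [UniversalEnvelopingAlgebra.lift_ι_apply]
    rfl
  have := (UniversalEnvelopingAlgebra.lift ℂ f u).2
  have e : (UniversalEnvelopingAlgebra.lift ℂ f u).1 = u := DFunLike.congr_fun h u
  rwa [e] at this

theorem verma_induction_lie (S : Submodule ℂ (VermaOf n l)) (h0 : vac n l ∈ S)
    (h : ∀ x : AffineSl m, ∀ a ∈ S, ⁅x, a⁆ ∈ S) (a : VermaOf n l) : a ∈ S := by
  obtain ⟨u, rfl⟩ := Submodule.Quotient.mk_surjective (vermaIdeal n l) a
  have key : ∀ v : U m, ∀ a ∈ S, v • a ∈ S := by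
    intro v
    induction v using U_induction with
    | halg r =>
      intro a ha
      rw [algebraMap_smul]
      exact S.smul_mem r ha
    | hι x => intro a ha; exact h x a ha
    | hmul u v hu hv => intro a ha; rw [mul_smul]; exact hu _ (hv a ha)
    | hadd u v hu hv => intro a ha; rw [add_smul]; exact S.add_mem (hu a ha) (hv a ha)
  have := key u _ h0
  have e : u • vac n l = (Submodule.Quotient.mk u : U m ⧸ vermaIdeal n l) := by
    change (Submodule.Quotient.mk (u * 1) : U m ⧸ vermaIdeal n l) = _
    rw [mul_one]
  rwa [e] at this

/-- The vacuum generates under n' alone, since n and 𝔥 act on it by scalars. Commuting elements of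
n' to the left replaces any use of a PBW basis. -/
theorem verma_induction (n' : Submodule ℂ (AffineSl m)) (hn : n' ⊔ cartan m ⊔ n = ⊤)
    (S : Submodule ℂ (VermaOf n l)) (h0 : vac n l ∈ S)
    (h : ∀ x ∈ n', ∀ a ∈ S, ⁅x, a⁆ ∈ S) (a : VermaOf n l) : a ∈ S := by
  -- The given S need not be stable under the whole algebra, but the least n'-stable subspace
  -- containing the vacuum is.
  let S0 : Submodule ℂ (VermaOf n l) :=
    sInf {S | vac n l ∈ S ∧ ∀ x ∈ n', ∀ a ∈ S, ⁅x, a⁆ ∈ S}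
  have hv : vac n l ∈ S0 := by
    rw [Submodule.mem_sInf]
    exact fun T hT => hT.1
  have hs : ∀ x ∈ n', ∀ a ∈ S0, ⁅x, a⁆ ∈ S0 := by
    intro x hx a ha
    rw [Submodule.mem_sInf] at ha ⊢
    exact fun T hT => hT.2 x hx a (ha T hT)
  -- The vectors of S0 which every element of the algebra keeps inside S0. By the Jacobi identity S1
  -- is n'-stable, so minimality of S0 gives S0 ≤ S1.
  let S1 : Submodule ℂ (VermaOf n l) :=
    { carrier := {a | a ∈ S0 ∧ ∀ x : AffineSl m, ⁅x, a⁆ ∈ S0}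
      add_mem' := fun {a b} ha hb => ⟨S0.add_mem ha.1 hb.1, fun x => by
        rw [lie_add]; exact S0.add_mem (ha.2 x) (hb.2 x)⟩
      zero_mem' := ⟨S0.zero_mem, fun x => by rw [lie_zero]; exact S0.zero_mem⟩
      smul_mem' := fun r a ha => ⟨S0.smul_mem r ha.1, fun x => by
        rw [lie_smul]; exact S0.smul_mem r (ha.2 x)⟩ }
  have h1 : S0 ≤ S1 := by
    refine sInf_le ⟨⟨hv, fun x => ?_⟩, fun y hy a ha => ⟨hs y hy a ha.1, fun x => ?_⟩⟩
    · have hx : x ∈ n' ⊔ cartan m ⊔ n := by rw [hn]; trivial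
      obtain ⟨z, hz, w, hw, rfl⟩ := Submodule.mem_sup.1 hx
      obtain ⟨y, hy, t, ht, rfl⟩ := Submodule.mem_sup.1 hz
      rw [add_lie, add_lie, lie_vac_of_mem hw, add_zero, lie_vac_cartan ⟨t, ht⟩]
      exact S0.add_mem (hs y hy _ hv) (S0.smul_mem _ hv)
    · rw [leibniz_lie]
      exact S0.add_mem (ha.2 _) (hs y hy _ (ha.2 x))
  have h2 : a ∈ S0 := verma_induction_lie S0 hv (fun x a ha => (h1 ha).2 x) a
  exact Submodule.mem_sInf.1 h2 S ⟨h0, h⟩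

theorem E_mem_triangular (a b : Fin m) (k : ℤ) :
    E a b k ∈ nMinus m ∨ E a b k ∈ cartan m ∨ E a b k ∈ nPlus m := by
  rcases lt_trichotomy k 0 with h | h | h
  · exact Or.inl (Submodule.subset_span (Or.inr ⟨a, b, k, h, rfl⟩))
  · subst h
    rcases lt_trichotomy a b with h | h | h
    · exact Or.inr (Or.inr (Submodule.subset_span (Or.inl ⟨a, b, h, rfl⟩)))
    · subst h
      exact Or.inr (Or.inl (Submodule.subset_span (Or.inl ⟨a, rfl⟩)))
    · exact Or.inl (Submodule.subset_span (Or.inl ⟨a, b, h, rfl⟩))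
  · exact Or.inr (Or.inr (Submodule.subset_span (Or.inr ⟨a, b, k, h, rfl⟩)))

theorem nMinus_sup_cartan_sup_nPlus : nMinus m ⊔ cartan m ⊔ nPlus m = ⊤ := by
  rw [eq_top_iff, ← span_E, Submodule.span_le]
  rintro x (⟨a, b, k, rfl⟩ | rfl | rfl)
  · rcases E_mem_triangular a b k with h | h | h
    · exact Submodule.mem_sup_left (Submodule.mem_sup_left h)
    · exact Submodule.mem_sup_left (Submodule.mem_sup_right h)
    · exact Submodule.mem_sup_right h
  · exact Submodule.mem_sup_left (Submodule.mem_sup_right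
      (Submodule.subset_span (Or.inr (Or.inl rfl))))
  · exact Submodule.mem_sup_left (Submodule.mem_sup_right
      (Submodule.subset_span (Or.inr (Or.inr rfl))))

theorem nPlus_sup_cartan_sup_nMinus : nPlus m ⊔ cartan m ⊔ nMinus m = ⊤ := by
  rw [sup_comm, sup_comm (nPlus m), ← sup_assoc, nMinus_sup_cartan_sup_nPlus]

theorem cen_lie_verma (a : VermaOf n l) : ⁅(cen : AffineSl m), a⁆ = l cenH • a := by
  let S : Submodule ℂ (VermaOf n l) :=
    { carrier := {a | ⁅(cen : AffineSl m), a⁆ = l cenH • a}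
      add_mem' := fun {a b} ha hb => by
        simp only [Set.mem_ofPred_eq] at ha hb ⊢
        rw [lie_add, smul_add, ha, hb]
      zero_mem' := by simp
      smul_mem' := fun r a ha => by
        simp only [Set.mem_ofPred_eq] at ha ⊢
        rw [lie_smul, ha, smul_comm] }
  refine verma_induction_lie S (lie_vac_cartan cenH) (fun x a ha => ?_) a
  have ha' : ⁅(cen : AffineSl m), a⁆ = l cenH • a := ha
  change ⁅(cen : AffineSl m), ⁅x, a⁆⁆ = l cenH • ⁅x, a⁆
  rw [leibniz_lie, cen_lie, zero_lie, zero_add, ha', lie_smul]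

/-- The sign s treats highest and lowest weight modules at once. Being killed in all large degrees
passes from x to its translates, since commutators only shift the degree by a bounded amount. -/
theorem exists_E_lie_eq_zero (s : ℤ) (hs : s = 1 ∨ s = -1) (hv : ∀ (a b : Fin m) (k : ℤ), 0 < k →
    ⁅E a b (s * k), vac n l⁆ = 0) (x : VermaOf n l) :
    ∃ K : ℕ, ∀ k : ℤ, K ≤ k → ∀ a b : Fin m, ⁅E a b (s * k), x⁆ = 0 := by
  let S : Submodule ℂ (VermaOf n l) :=
    { carrier := {x | ∃ K : ℕ, ∀ k : ℤ, K ≤ k → ∀ a b : Fin m, ⁅E a b (s * k), x⁆ = 0}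
      add_mem' := by
        rintro x y ⟨K, hK⟩ ⟨K', hK'⟩
        refine ⟨max K K', fun k hk a b => ?_⟩
        rw [Nat.cast_max, max_le_iff] at hk
        rw [lie_add, hK k hk.1, hK' k hk.2, add_zero]
      zero_mem' := ⟨0, fun k _ a b => lie_zero _⟩
      smul_mem' := by
        rintro r x ⟨K, hK⟩
        refine ⟨K, fun k hk a b => ?_⟩
        rw [lie_smul, hK k hk, smul_zero] }
  refine verma_induction_lie S ⟨1, fun k hk a b => hv a b k (by push_cast at hk; omega)⟩ ?_ x
  intro y
  induction y using induction_E with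
  | hE c d t =>
    rintro x ⟨K, hK⟩
    -- A shift by t keeps the degree beyond K, and the extra 1 keeps the total degree nonzero, so
    -- that no central term appears.
    refine ⟨K + t.natAbs + 1, fun k hk a b => ?_⟩
    push_cast at hk
    have ht1 := le_abs_self t
    have ht2 := neg_abs_le t
    have h1 : ∃ k' : ℤ, (K : ℤ) ≤ k' ∧ s * k + t = s * k' ∧ s * k + t ≠ 0 := by
      rcases hs with rfl | rfl
      · exact ⟨k + t, by omega, by ring, by omega⟩
      · exact ⟨k - t, by omega, by ring, by omega⟩
    obtain ⟨k', hk', e1, e2⟩ := h1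
    rw [leibniz_lie, hK k (by omega), lie_zero, add_zero, lie_E_E, if_neg e2, zero_smul, add_zero,
      sub_lie, e1]
    have h3 : ∀ (P : Prop) [Decidable P] (a b : Fin m),
        ⁅(if P then E a b (s * k') else 0 : AffineSl m), x⁆ = 0 := by
      intro P _ a b
      split_ifs
      · exact hK k' hk' a b
      · exact zero_lie x
    rw [h3, h3, sub_zero]
  | hc =>
    rintro x ⟨K, hK⟩
    refine ⟨K, fun k hk a b => ?_⟩
    rw [cen_lie_verma, lie_smul, hK k hk, smul_zero]
  | hd =>
    rintro x ⟨K, hK⟩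
    refine ⟨K, fun k hk a b => ?_⟩
    rw [leibniz_lie, hK k hk, lie_zero, add_zero, ← lie_skew, lie_deg_E, neg_lie, smul_lie,
      hK k hk, smul_zero, neg_zero]
  | hadd y z hy hz => intro x hx; rw [add_lie]; exact S.add_mem (hy x hx) (hz x hx)
  | hsmul r y hy => intro x hx; rw [smul_lie]; exact S.smul_mem r (hy x hx)

theorem exists_E_lie_verma_eq_zero (l : Weight m) (x : Verma l) :
    ∃ K : ℕ, ∀ k : ℤ, K ≤ k → ∀ a b : Fin m, ⁅E a b k, x⁆ = 0 := by
  have := exists_E_lie_eq_zero 1 (Or.inl rfl) (fun a b k hk => ?_) x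
  · simpa only [one_mul] using this
  · rw [one_mul]
    exact lie_vac_of_mem (Submodule.subset_span (Or.inr ⟨a, b, k, hk, rfl⟩))

theorem exists_E_lie_lowestVerma_eq_zero (l : Weight m) (x : LowestVerma l) :
    ∃ K : ℕ, ∀ k : ℤ, K ≤ -k → ∀ a b : Fin m, ⁅E a b k, x⁆ = 0 := by
  have hv : ∀ (a b : Fin m) (k : ℤ), 0 < k → ⁅E a b (-1 * k), vac (nMinus m) (-l)⁆ = 0 := by
    intro a b k hk
    rw [neg_mul, one_mul]
    exact lie_vac_of_mem (Submodule.subset_span (Or.inr ⟨a, b, -k, by omega, rfl⟩))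
  obtain ⟨K, hK⟩ := exists_E_lie_eq_zero (-1) (Or.inr rfl) hv x
  refine ⟨K, fun k hk a b => ?_⟩
  have := hK (-k) hk a b
  rwa [neg_mul, one_mul, neg_neg] at this

/-- The element ρ̌ + m d defines the principal gradation: ρ̌ alone gives the lowest root degree 1 -
m, and m d raises the affine simple root to degree 1. -/
theorem rhoCheck_lie {c d : Fin m} {n : ℤ} {ε : ℂ} (hcd : c ≠ d) (h : IsSimple c d n ε) :
    ⁅(rhoCheck : AffineSl m), E c d n⁆ = ε • E c d n := by
  have h1 : ∀ a : Fin m, ⁅E a a 0, E c d n⁆ =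
      ((if a = c then 1 else 0) - (if a = d then 1 else 0) : ℂ) • E c d n := by
    intro a
    rw [lie_E_E, if_neg (show ¬(a = a ∧ c = d) from fun h => hcd h.2)]
    have : ¬(a = d ∧ a = c) := fun h => hcd (h.2.symm.trans h.1)
    rw [if_neg this, zero_add, sub_zero]
    simp only [mul_zero, ite_self, zero_smul, add_zero, sub_smul, ite_smul, one_smul, Int.cast_zero,
      eq_comm (a := d)]
    split_ifs with h1 h2 h2 <;> simp_all
  have h2 : ∀ a b : Fin m, ⁅(if a < b then E a a 0 - E b b 0 else 0 : AffineSl m), E c d n⁆ =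
      (if a < b then ((if a = c then 1 else 0) - (if a = d then 1 else 0)
        - ((if b = c then 1 else 0) - (if b = d then 1 else 0)) : ℂ) else 0) • E c d n := by
    intro a b
    by_cases hab : a < b
    · rw [if_pos hab, if_pos hab, sub_lie, h1, h1, ← sub_smul]
    · rw [if_neg hab, if_neg hab, zero_lie, zero_smul]
  have h3 : ∀ x : Fin m, (∑ a : Fin m, if a < x then (1 : ℂ) else 0) = (x : ℕ) := by
    intro x
    rw [Finset.sum_boole, Finset.filter_gt_eq_Iio, Fin.card_Iio]
  have h4 : ∀ x : Fin m, (∑ a : Fin m, if x < a then (1 : ℂ) else 0) = (m : ℂ) - 1 - (x : ℕ) := by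
    intro x
    rw [Finset.sum_boole, Finset.filter_lt_eq_Ioi, Fin.card_Ioi, Nat.sub_sub, Nat.cast_sub (by omega)]
    push_cast
    ring
  have h5 : ∀ x : Fin m, (∑ a : Fin m, ∑ b : Fin m, if a < b then
      (if a = x then (1 : ℂ) else 0) else 0) = (m : ℂ) - 1 - (x : ℕ) := by
    intro x
    rw [Finset.sum_eq_single x]
    · simpa using h4 x
    · intro a _ ha; simp [ha]
    · simp
  have h6 : ∀ x : Fin m, (∑ a : Fin m, ∑ b : Fin m, if a < b then
      (if b = x then (1 : ℂ) else 0) else 0) = (x : ℕ) := by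
    intro x
    rw [Finset.sum_comm, Finset.sum_eq_single x]
    · simpa using h3 x
    · intro a _ ha; simp [ha]
    · simp
  have h7 : ∀ a b : Fin m, (if a < b then ((if a = c then 1 else 0) - (if a = d then 1 else 0)
        - ((if b = c then 1 else 0) - (if b = d then 1 else 0)) : ℂ) else 0) =
      (if a < b then (if a = c then (1 : ℂ) else 0) else 0)
      - (if a < b then (if a = d then (1 : ℂ) else 0) else 0)
      - (if a < b then (if b = c then (1 : ℂ) else 0) else 0)
      + (if a < b then (if b = d then (1 : ℂ) else 0) else 0) := by
    intro a b
    by_cases h : a < b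
    · simp only [if_pos h]; ring
    · simp only [if_neg h]; ring
  have h8 : ⁅∑ a : Fin m, ∑ b : Fin m, (if a < b then E a a 0 - E b b 0 else 0 : AffineSl m),
      E c d n⁆ = (2 * ((d : ℕ) - (c : ℕ) : ℂ)) • E c d n := by
    simp only [sum_lie, h2, ← Finset.sum_smul, h7, Finset.sum_sub_distrib,
      Finset.sum_add_distrib, h5, h6]
    congr 1
    ring
  rw [rhoCheck, add_lie, smul_lie, smul_lie, lie_deg_E, h8, smul_smul, smul_smul, ← add_smul]
  congr 1
  cases h with
  | up h => rw [← h]; push_cast; ring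
  | down h => rw [← h]; push_cast; ring
  | affineUp hc hd =>
    have : (m : ℂ) = (c : ℕ) + 1 := by rw [← Nat.cast_add_one, hc]
    rw [hd, this]
    push_cast
    ring
  | affineDown hc hd =>
    have : (m : ℂ) = (d : ℕ) + 1 := by rw [← Nat.cast_add_one, hd]
    rw [hc, this]
    push_cast
    ring

end AffineSl

namespace KZ
open AffineSl DDAHA
variable {m N : ℕ}

section
set_option linter.unusedSectionVars false
attribute [local instance] vnGroup midGroup midAddGroup

/-! ### Invariance under the derived algebra -/

theorem rUniv_commute {M : Type} [AddCommGroup M] [Module ℂ M] {p q : AffineSl m → Module.End ℂ M}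
    (hf : LocFin p q) (Z : Module.End ℂ M) (hp : ∀ x, p x * Z = Z * p x)
    (hq : ∀ x, q x * Z = Z * q x) : rUnivL p q * Z = Z * rUnivL p q := by
  ext y
  rw [Module.End.mul_apply, Module.End.mul_apply, rUnivL_apply hf, rUnivL_apply hf]
  obtain ⟨K1, -, h1⟩ := rUniv_eq hf y
  obtain ⟨K2, -, h2⟩ := rUniv_eq hf (Z y)
  rw [h1 (max K1 K2) (le_max_left _ _), h2 (max K1 K2) (le_max_right _ _), ← Module.End.mul_apply,
    ← Module.End.mul_apply]
  have hpq : ∀ x y, Commute (p x * q y) Z := fun x y =>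
    show p x * q y * Z = Z * (p x * q y) by rw [mul_assoc, hq, ← mul_assoc, hp, mul_assoc]
  have hc : Commute (rBar p q + (1 / 2 : ℂ) • (p cen * q deg + p deg * q cen)
      + ∑ n ∈ Finset.range (max K1 K2), omegaOp p q (n + 1)) Z := by
    refine ((Commute.add_left ?_ ?_).add_left ?_)
    · rw [rBar_eq]
      exact Commute.sum_left _ _ _ fun a _ => Commute.sum_left _ _ _ fun b _ =>
        (hpq _ _).smul_left _
    · exact ((hpq _ _).add_left (hpq _ _)).smul_left _
    · exact Commute.sum_left _ _ _ fun k _ => Commute.sum_left _ _ _ fun a _ =>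
        Commute.sum_left _ _ _ fun b _ => hpq _ _
  rw [hc.eq]

variable (A B : Type)
  [AddCommGroup A] [Module ℂ A] [LieRingModule (AffineSl m) A] [LieModule ℂ (AffineSl m) A]
  [AddCommGroup B] [Module ℂ B] [LieRingModule (AffineSl m) B] [LieModule ℂ (AffineSl m) B]

theorem thetaA_comm_thetaI (i : Fin N) (x y : AffineSl m) :
    thetaA A B x * thetaI A B i y = thetaI A B i y * thetaA A B x := liftA_comm_liftMid _ _

theorem thetaI_comm_thetaB (i : Fin N) (x y : AffineSl m) :
    thetaI A B i x * thetaB A B y = thetaB A B y * thetaI A B i x := liftMid_comm_liftB _ _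

theorem thetaA_comm_thetaB (x y : AffineSl m) :
    thetaA (N := N) A B x * thetaB A B y = thetaB A B y * thetaA A B x := liftA_comm_liftB _ _

theorem thetaI_comm_thetaI {i j : Fin N} (h : i ≠ j) (x y : AffineSl m) :
    thetaI A B i x * thetaI A B j y = thetaI A B j y * thetaI A B i x := by
  rw [thetaI_eq, thetaI_eq, ← map_mul, thetaEval_commute h, map_mul]

theorem locFin_thetaA (hA : ∀ a : A, ∃ K : ℕ, ∀ k : ℤ, K ≤ k → ∀ b c : Fin m, ⁅E b c k, a⁆ = 0)
    (i : Fin N) : LocFin (thetaA (m := m) A B) (thetaI A B i) := by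
  intro y
  induction y using TensorProduct.induction_on with
  | zero => exact ⟨0, fun k l _ _ a b c d => by rw [map_zero, map_zero]⟩
  | add x y hx hy =>
    obtain ⟨K1, h1⟩ := hx
    obtain ⟨K2, h2⟩ := hy
    refine ⟨max K1 K2, fun k l hk hl a b c d => ?_⟩
    rw [Nat.cast_max, max_le_iff] at hk hl
    rw [map_add, map_add, h1 k l hk.1 hl.1, h2 k l hk.2 hl.2, add_zero]
  | tmul a x =>
    obtain ⟨K, hK⟩ := hA a
    refine ⟨K, fun k l hk _ b c d e => ?_⟩
    change ⁅E b c k, a⁆ ⊗ₜ[ℂ] _ = 0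
    rw [hK k hk, TensorProduct.zero_tmul]

theorem locFin_thetaB (hB : ∀ a : B, ∃ K : ℕ, ∀ k : ℤ, K ≤ -k → ∀ b c : Fin m, ⁅E b c k, a⁆ = 0)
    (i : Fin N) : LocFin (thetaI (m := m) A B i) (thetaB A B) := by
  intro y
  induction y using TensorProduct.induction_on with
  | zero => exact ⟨0, fun k l _ _ a b c d => by rw [map_zero, map_zero]⟩
  | add x y hx hy =>
    obtain ⟨K1, h1⟩ := hx
    obtain ⟨K2, h2⟩ := hy
    refine ⟨max K1 K2, fun k l hk hl a b c d => ?_⟩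
    rw [Nat.cast_max, max_le_iff] at hk hl
    rw [map_add, map_add, h1 k l hk.1 hl.1, h2 k l hk.2 hl.2, add_zero]
  | tmul a z =>
    have h : ∃ K : ℕ, ∀ k l : ℤ, K ≤ k → K ≤ -l → ∀ b c d e : Fin m,
        LinearMap.lTensor (Mid m N) (LieModule.toEnd ℂ (AffineSl m) B (E d e l)) z = 0 := by
      induction z using TensorProduct.induction_on with
      | zero => exact ⟨0, fun k l _ _ a b c d => by rw [map_zero]⟩
      | add x y hx hy =>
        obtain ⟨K1, h1⟩ := hx
        obtain ⟨K2, h2⟩ := hy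
        refine ⟨max K1 K2, fun k l hk hl a b c d => ?_⟩
        rw [Nat.cast_max, max_le_iff] at hk hl
        rw [map_add, h1 k l hk.1 hl.1 a b, h2 k l hk.2 hl.2 a b, add_zero]
      | tmul x b =>
        obtain ⟨K, hK⟩ := hB b
        refine ⟨K, fun k l _ hl _ _ d e => ?_⟩
        change x ⊗ₜ[ℂ] ⁅E d e l, b⁆ = 0
        rw [hK l hl, TensorProduct.tmul_zero]
    obtain ⟨K, hK⟩ := h
    refine ⟨K, fun k l hk hl b c d e => ?_⟩
    change thetaI A B i (E b c k) (a ⊗ₜ[ℂ]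
      LinearMap.lTensor (Mid m N) (LieModule.toEnd ℂ (AffineSl m) B (E d e l)) z) = 0
    rw [hK k l hk hl b c, TensorProduct.tmul_zero, map_zero]

theorem isRep_theta : IsRep (theta (m := m) (N := N) A B) where
  add x y := by
    simp only [theta, (isRep_thetaA A B).add, (isRep_thetaB A B).add, (isRep_thetaI A B _).add,
      Finset.sum_add_distrib]
    abel
  smul r x := by
    simp only [theta, (isRep_thetaA A B).smul, (isRep_thetaB A B).smul, (isRep_thetaI A B _).smul,
      smul_add, Finset.smul_sum]
  lie x y := by
    have h1 : ∀ i : Fin N, thetaI A B i ⁅x, y⁆ = thetaI A B i x * (∑ j, thetaI A B j y)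
        - (∑ j, thetaI A B j y) * thetaI A B i x := by
      intro i
      rw [(isRep_thetaI A B i).lie, Finset.mul_sum, Finset.sum_mul, ← Finset.sum_sub_distrib,
        Finset.sum_eq_single i]
      · intro j _ hj
        rw [thetaI_comm_thetaI A B hj.symm, sub_self]
      · simp
    have h2 : ∀ x y : AffineSl m, thetaA A B x * (∑ j : Fin N, thetaI A B j y) =
        (∑ j, thetaI A B j y) * thetaA A B x := by
      intro x y
      simp only [Finset.mul_sum, Finset.sum_mul, thetaA_comm_thetaI]
    have h3 : ∀ x y : AffineSl m, (∑ j : Fin N, thetaI A B j x) * thetaB A B y =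
        thetaB A B y * (∑ j, thetaI A B j x) := by
      intro x y
      simp only [Finset.mul_sum, Finset.sum_mul, thetaI_comm_thetaB]
    simp only [theta, h1, Finset.sum_sub_distrib, ← Finset.sum_mul, ← Finset.mul_sum,
      (isRep_thetaA A B).lie, (isRep_thetaB A B).lie, add_mul, mul_add, h2, h3,
      thetaA_comm_thetaB]
    abel

theorem xOp_thetaEval_comm {i j k : Fin N} (hjk : j ≠ k) (hj : i ≠ j) (hk : i ≠ k) {c d : Fin m}
    (hcd : c ≠ d) (n : ℤ) :
    xOp j k * thetaEval i (E c d n) = thetaEval i (E c d n) * xOp j k := by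
  have h1 : ∀ f : Lau N,
      divDiff j k (zz (Pi.single i n) * f) = zz (Pi.single i n) * divDiff j k f := by
    intro f
    apply mul_one_sub_cancel hjk
    rw [divDiff_spec hjk, tau1_mul, tau1_zz, permLattice_single,
      Equiv.swap_apply_of_ne_of_ne hj hk]
    linear_combination (-zz (Pi.single i n)) * divDiff_spec hjk f
  have h2 : tau2 m (Equiv.swap j k) * slotE i c d = slotE i c d * tau2 m (Equiv.swap j k) := by
    rw [tau2_slotE, Equiv.swap_apply_of_ne_of_ne hj hk]
  have h3 : rV j k * slotE i c d = slotE i c d * rV j k := by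
    simp only [rV, Finset.mul_sum, Finset.sum_mul, mul_smul_comm, smul_mul_assoc]
    refine Finset.sum_congr rfl fun a _ => Finset.sum_congr rfl fun b _ => ?_
    rw [mul_assoc, (slotE_comm hk.symm _ _ _ _).eq, ← mul_assoc, (slotE_comm hj.symm _ _ _ _).eq,
      mul_assoc]
  rw [thetaEval_E_of_ne i hcd, xOp, sub_mul, mul_sub, op_mul, op_mul, h3, mul_one, one_mul]
  congr 1
  apply TensorProduct.ext'
  intro f v
  simp only [Module.End.mul_apply, op_tmul, TensorProduct.map_tmul, h1]
  rw [← Module.End.mul_apply, h2, Module.End.mul_apply]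

variable {c d : Fin m} {n : ℤ} {ε : ℂ} (hs : IsSimple c d n ε) (hcd : c ≠ d)
include hs hcd

/-- Each outer r-matrix contributes the cobracket on its two legs, by `rUniv_comm`; all remaining
legs commute with it. The term ρ̌ + m d contributes ε e_i, which will account for the leg i paired
with itself. -/
theorem outerKZ_comm (hA : ∀ i, LocFin (thetaA A B) (thetaI (m := m) (N := N) A B i))
    (hB : ∀ i, LocFin (thetaI (m := m) (N := N) A B i) (thetaB A B)) (i : Fin N) :
    outerKZ A B i * theta A B (E c d n) - theta A B (E c d n) * outerKZ A B i =
    -(ε / 2) • (thetaA A B (E c d n) * thetaI A B i (E c c 0 - E d d 0 + (n : ℂ) • cen)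
      - thetaA A B (E c c 0 - E d d 0 + (n : ℂ) • cen) * thetaI A B i (E c d n)
      - thetaI A B i (E c d n) * thetaB A B (E c c 0 - E d d 0 + (n : ℂ) • cen)
      + thetaI A B i (E c c 0 - E d d 0 + (n : ℂ) • cen) * thetaB A B (E c d n)
      - (2 : ℂ) • thetaI A B i (E c d n)) := by
  set e := E c d n with he
  set h := E c c 0 - E d d 0 + (n : ℂ) • cen with hh
  have hth : theta A B e = thetaA A B e + thetaI A B i e
      + (∑ j ∈ Finset.univ.erase i, thetaI A B j e) + thetaB A B e := by
    rw [theta, ← Finset.add_sum_erase _ _ (Finset.mem_univ i)]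
    abel
  set Z := ∑ j ∈ Finset.univ.erase i, thetaI A B j e with hZ
  have hAZ : ∀ x : AffineSl m, thetaA A B x * Z = Z * thetaA A B x := by
    intro x
    simp only [hZ, Finset.mul_sum, Finset.sum_mul, thetaA_comm_thetaI]
  have hBZ : ∀ x : AffineSl m, thetaB A B x * Z = Z * thetaB A B x := by
    intro x
    simp only [hZ, Finset.mul_sum, Finset.sum_mul, thetaI_comm_thetaB]
  have hIZ : ∀ x : AffineSl m, thetaI A B i x * Z = Z * thetaI A B i x := by
    intro x
    rw [hZ, Finset.mul_sum, Finset.sum_mul]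
    refine Finset.sum_congr rfl fun j hj => ?_
    rw [thetaI_comm_thetaI A B (Finset.ne_of_mem_erase hj).symm]
  have e1 := rUniv_commute (hA i) Z hAZ hIZ
  have e2 := rUniv_commute (hA i) (thetaB A B e) (fun x => thetaA_comm_thetaB A B x e)
    fun x => thetaI_comm_thetaB A B i x e
  have e3 := rUniv_commute (hB i) Z hIZ hBZ
  have e4 := rUniv_commute (hB i) (thetaA A B e) (fun x : AffineSl m => (thetaA_comm_thetaI A B i e x).symm)
    fun x : AffineSl m => (thetaA_comm_thetaB A B e x).symm
  have e5 : rUnivL (thetaA A B) (thetaI A B i) * (thetaA A B e + thetaI A B i e)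
      - (thetaA A B e + thetaI A B i e) * rUnivL (thetaA A B) (thetaI A B i) =
      -(ε / 2) • (thetaA A B e * thetaI A B i h - thetaA A B h * thetaI A B i e) := by
    refine LinearMap.ext fun y => ?_
    have := rUniv_comm (isRep_thetaA A B) (isRep_thetaI A B i) (thetaA_comm_thetaI A B i) (hA i) hs
      hcd y
    rw [← rUnivL_apply (hA i), ← rUnivL_apply (hA i)] at this
    exact this
  have e6 : rUnivL (thetaI A B i) (thetaB A B) * (thetaI A B i e + thetaB A B e)
      - (thetaI A B i e + thetaB A B e) * rUnivL (thetaI A B i) (thetaB A B) =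
      -(ε / 2) • (thetaI A B i e * thetaB A B h - thetaI A B i h * thetaB A B e) := by
    refine LinearMap.ext fun y => ?_
    have := rUniv_comm (isRep_thetaI A B i) (isRep_thetaB A B) (thetaI_comm_thetaB A B i) (hB i) hs
      hcd y
    rw [← rUnivL_apply (hB i), ← rUnivL_apply (hB i)] at this
    exact this
  have e7 : thetaI A B i rhoCheck * thetaI A B i e - thetaI A B i e * thetaI A B i rhoCheck =
      ε • thetaI A B i e := by
    rw [← (isRep_thetaI A B i).lie, rhoCheck_lie hcd hs, (isRep_thetaI A B i).smul]
  have e8 := thetaA_comm_thetaI A B i e (rhoCheck : AffineSl m)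
  have e9 := thetaI_comm_thetaB A B i rhoCheck e
  have e10 := hIZ rhoCheck
  rw [outerKZ, hth]
  simp only [mul_add, add_mul, sub_mul, mul_sub] at e5 e6 ⊢
  rw [e1, e2, e3, e4, e8, e9, e10]
  linear_combination (norm := module) e5 - e6 + e7

theorem liftMid_xOp_comm (hm : m ≠ 0) {j k : Fin N} (hjk : j ≠ k) :
    liftMid A B (xOp j k) * theta A B (E c d n) - theta A B (E c d n) * liftMid A B (xOp j k) =
    (ε / 2) • (thetaI A B j (E c d n) * thetaI A B k (E c c 0 - E d d 0 + (n : ℂ) • cen)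
      - thetaI A B j (E c c 0 - E d d 0 + (n : ℂ) • cen) * thetaI A B k (E c d n)) := by
  set e := E c d n with he
  have hth : theta A B e = thetaA A B e + (thetaI A B j e + thetaI A B k e
      + ∑ l ∈ (Finset.univ.erase j).erase k, thetaI A B l e) + thetaB A B e := by
    rw [theta, ← Finset.add_sum_erase _ _ (Finset.mem_univ j), ← Finset.add_sum_erase _ _
      (Finset.mem_erase.2 ⟨hjk.symm, Finset.mem_univ k⟩), add_assoc (thetaI A B j e)]
  have h1 := congrArg (liftMid A B) (xOp_comm hm hjk hcd hs)
  simp only [map_sub, map_mul, map_add, map_smul] at h1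
  have h2 : liftMid A B (xOp j k) * (∑ l ∈ (Finset.univ.erase j).erase k, thetaI A B l e) =
      (∑ l ∈ (Finset.univ.erase j).erase k, thetaI A B l e) * liftMid A B (xOp j k) := by
    rw [Finset.mul_sum, Finset.sum_mul]
    refine Finset.sum_congr rfl fun l hl => ?_
    have hk := Finset.ne_of_mem_erase hl
    have hj := Finset.ne_of_mem_erase (Finset.mem_of_mem_erase hl)
    rw [thetaI_eq, ← map_mul, ← map_mul, he, xOp_thetaEval_comm hjk hj hk hcd]
  have h3 : liftMid A B (xOp j k) * thetaA A B e = thetaA A B e * liftMid A B (xOp j k) :=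
    (liftA_comm_liftMid _ _).symm
  have h4 : liftMid A B (xOp j k) * thetaB A B e = thetaB A B e * liftMid A B (xOp j k) :=
    liftMid_comm_liftB _ _
  simp only [thetaI_eq] at h2 hth ⊢
  rw [← h1, hth]
  simp only [mul_add, add_mul, h2, h3, h4]
  abel

/-- The cobrackets on the single pairs of legs add up to the diagonal actions θ(e) and θ(h) followed
by an operator on leg i. The right side therefore takes values in the image of 𝔤'. -/
theorem dunklLau_comm (hm : m ≠ 0) (hA : ∀ i, LocFin (thetaA A B) (thetaI (m := m) (N := N) A B i))
    (hB : ∀ i, LocFin (thetaI (m := m) (N := N) A B i) (thetaB A B)) (ξ : Fin N → ℂ) :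
    dunklLau A B ξ * theta A B (E c d n) - theta A B (E c d n) * dunklLau A B ξ =
    -(ε / 2) • ∑ i, ξ i • (theta A B (E c d n)
        * thetaI A B i (E c c 0 - E d d 0 + (n : ℂ) • cen)
      - theta A B (E c c 0 - E d d 0 + (n : ℂ) • cen) * thetaI A B i (E c d n)) := by
  have hO := outerKZ_comm A B hs hcd hA hB
  have hX := fun j k (h : j ≠ k) => liftMid_xOp_comm A B hs hcd hm (N := N) h
  have hhe : ⁅E c c 0 - E d d 0 + (n : ℂ) • cen, E c d n⁆ = (2 : ℂ) • E c d n := by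
    rw [add_lie, smul_lie, cen_lie, smul_zero, add_zero, lie_E_diag hcd, zero_add]
  set e := E c d n with he
  set h := E c c 0 - E d d 0 + (n : ℂ) • cen with hh
  let r : Fin N → Fin N → Module.End ℂ (Num m N (Lau N) A B) := fun j k =>
    thetaI A B j e * thetaI A B k h - thetaI A B j h * thetaI A B k e
  -- Expanding the diagonal actions over the legs: the two outer legs match `outerKZ_comm`, the legs
  -- j ≠ i match the operators `xOp`, and j = i gives e_i h_i - h_i e_i = -2 e_i.
  have hi : ∀ i : Fin N, theta A B e * thetaI A B i h - theta A B h * thetaI A B i e =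
      (thetaA A B e * thetaI A B i h - thetaA A B h * thetaI A B i e
      - thetaI A B i e * thetaB A B h + thetaI A B i h * thetaB A B e
      - (2 : ℂ) • thetaI A B i e)
      + ((∑ j, if j < i then r j i else 0) - ∑ j, if i < j then r i j else 0) := by
    intro i
    have h1 : (∑ j, thetaI A B j e) * thetaI A B i h - (∑ j, thetaI A B j h) * thetaI A B i e =
        -((2 : ℂ) • thetaI A B i e)
        + ((∑ j, if j < i then r j i else 0) - ∑ j, if i < j then r i j else 0) := by
      have h2 : ∀ j : Fin N, thetaI A B j e * thetaI A B i h - thetaI A B j h * thetaI A B i e =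
          (if j = i then -((2 : ℂ) • thetaI A B i e) else 0)
          + ((if j < i then r j i else 0) - if i < j then r i j else 0) := by
        intro j
        rcases lt_trichotomy j i with hj | hj | hj
        · rw [if_neg hj.ne, if_pos hj, if_neg hj.not_gt, zero_add, sub_zero]
        · subst hj
          rw [if_pos rfl, if_neg (lt_irrefl j), sub_zero, add_zero,
            ← (isRep_thetaI A B j).smul, ← hhe, (isRep_thetaI A B j).lie, neg_sub]
        · rw [if_neg hj.ne', if_neg hj.not_gt, if_pos hj, zero_add, zero_sub, neg_sub,
            thetaI_comm_thetaI A B hj.ne', thetaI_comm_thetaI A B hj.ne' h]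
      rw [Finset.sum_mul, Finset.sum_mul, ← Finset.sum_sub_distrib,
        Finset.sum_congr rfl fun j _ => h2 j, Finset.sum_add_distrib, Finset.sum_sub_distrib,
        Finset.sum_ite_eq', if_pos (Finset.mem_univ i)]
    rw [theta, theta]
    simp only [add_mul, ← thetaI_comm_thetaB]
    rw [sub_eq_iff_eq_add] at h1
    rw [h1]
    abel
  let C : Module.End ℂ (Num m N (Lau N) A B) →ₗ[ℂ] Module.End ℂ (Num m N (Lau N) A B) :=
    LinearMap.mulRight ℂ (theta A B e) - LinearMap.mulLeft ℂ (theta A B e)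
  have hC : ∀ x : Module.End ℂ (Num m N (Lau N) A B),
      x * theta A B e - theta A B e * x = C x := fun x => rfl
  simp only [hC] at hO hX ⊢
  have hX' : ∀ j k : Fin N, C (if j < k then (ξ j - ξ k) • liftMid A B (xOp j k) else 0) =
      -(ε / 2) • if j < k then (ξ j - ξ k) • (-r j k) else 0 := by
    intro j k
    split_ifs with hjk
    · rw [map_smul, hX j k hjk.ne]
      module
    · rw [map_zero, smul_zero]
  simp only [hi]
  rw [Finset.sum_congr rfl fun i _ => smul_add (ξ i) _ _, Finset.sum_add_distrib, sum_smul_lt_sub,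
    dunklLau, map_add, map_sum, map_sum, smul_add, Finset.smul_sum, Finset.smul_sum]
  congr 1
  · refine Finset.sum_congr rfl fun i _ => ?_
    rw [map_smul, hO i, smul_comm]
  · refine Finset.sum_congr rfl fun j _ => ?_
    rw [map_sum, Finset.smul_sum]
    exact Finset.sum_congr rfl fun k _ => hX' j k

omit hs hcd in
theorem theta_mem_gPrimeNum (hm : 2 ≤ m) {x : AffineSl m} (hx : coD x = 0)
    (y : Num m N (Lau N) A B) : theta A B x y ∈ gPrimeNum m N A B :=
  Submodule.subset_span ⟨x, (mem_derived_iff hm x).2 hx, y, rfl⟩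

-- The elements x for which the Dunkl operator sends the image of θ(x) into the image of 𝔤' form a
-- Lie subalgebra, so only Chevalley generators have to be tested. There `dunklLau_comm` applies,
-- both e and h having no d-component.
omit hs hcd in
theorem dunklLau_mem_gPrimeNum (hm : 2 ≤ m)
    (hA : ∀ i, LocFin (thetaA A B) (thetaI (m := m) (N := N) A B i))
    (hB : ∀ i, LocFin (thetaI (m := m) (N := N) A B i) (thetaB A B)) (ξ : Fin N → ℂ)
    {y : Num m N (Lau N) A B} (hy : y ∈ gPrimeNum m N A B) :
    dunklLau A B ξ y ∈ gPrimeNum m N A B := by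
  let G : LieSubalgebra ℂ (AffineSl m) :=
    { carrier := {x | ∀ y : Num m N (Lau N) A B, dunklLau A B ξ (theta A B x y) ∈ gPrimeNum m N A B}
      add_mem' := fun {x x'} hx hx' y => by
        rw [(isRep_theta A B).add, LinearMap.add_apply, map_add]
        exact Submodule.add_mem _ (hx y) (hx' y)
      zero_mem' := fun y => by
        rw [(isRep_theta A B).zero, LinearMap.zero_apply, map_zero]
        exact Submodule.zero_mem _
      smul_mem' := fun r x hx y => by
        rw [(isRep_theta A B).smul, LinearMap.smul_apply, map_smul]
        exact Submodule.smul_mem _ _ (hx y)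
      lie_mem' := fun {x x'} hx hx' y => by
        rw [(isRep_theta A B).lie, LinearMap.sub_apply, map_sub]
        exact Submodule.sub_mem _ (hx _) (hx' _) }
  have hG : ∀ x : AffineSl m, coD x = 0 → x ∈ G := by
    refine mem_of_simple_mem hm G fun c d n ε hs y => ?_
    have hcd := hs.ne hm
    have key := LinearMap.congr_fun (dunklLau_comm A B hs hcd (by omega) hA hB ξ) y
    rw [LinearMap.sub_apply, sub_eq_iff_eq_add, Module.End.mul_apply] at key
    rw [key]
    refine Submodule.add_mem _ ?_ (theta_mem_gPrimeNum A B hm (coD_E _ _ _) _)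
    rw [LinearMap.smul_apply, LinearMap.sum_apply]
    refine Submodule.smul_mem _ _ (Submodule.sum_mem _ fun i _ => ?_)
    refine Submodule.smul_mem _ _ (Submodule.sub_mem _ ?_ ?_)
    · exact theta_mem_gPrimeNum A B hm (coD_E _ _ _) _
    · exact theta_mem_gPrimeNum A B hm (by simp) _
  induction hy using Submodule.span_induction with
  | mem v h =>
    obtain ⟨x, hx, w, rfl⟩ := h
    exact hG x ((mem_derived_iff hm x).1 hx) w
  | zero => rw [map_zero]; exact Submodule.zero_mem _
  | add u v _ _ hu hv => rw [map_add]; exact Submodule.add_mem _ hu hv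
  | smul r u _ hu => rw [map_smul]; exact Submodule.smul_mem _ _ hu

end

end KZ

namespace KZ
open AffineSl DDAHA
variable {m N : ℕ}

section
attribute [local instance] vnGroup midGroup midAddGroup

/-! ### The vacuum map -/

/-- The diagonal part of the operator of index `i`: `z_i ∂/∂z_i` scaled by `κ` plus a function of
the `i`-th tensor factor. -/
def wtOp (κ : ℂ) (s : Fin m → ℂ) (i : Fin N) : Module.End ℂ (Mid m N) :=
  κ • dz i + ∑ a, s a • op 1 (slotE i a a)

/-- The Dunkl operators on the middle factor. -/
def dunklMid (κ : ℂ) (s : Fin m → ℂ) (ξ : Fin N → ℂ) : Module.End ℂ (Mid m N) :=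
  (∑ i, ξ i • wtOp κ s i) + ∑ j, ∑ k, if j < k then (ξ j - ξ k) • xOp j k else 0

theorem slotE_diag_vb (i : Fin N) (a : Fin m) (c : Fin N → Fin m) :
    slotE i a a (vb c) = if c i = a then vb c else 0 := by
  rw [slotE_vb]
  split_ifs with h
  · rw [← h, Function.update_eq_self]
  · rfl

theorem dz_eb (i : Fin N) (η : Fin N → ℤ) (c : Fin N → Fin m) :
    dz i (eb η c) = (η i : ℂ) • eb η c := by
  rw [eb, dz_tmul, partialD_zz, pairing_single, TensorProduct.smul_tmul']

theorem sum_op_slotE_eb (s : Fin m → ℂ) (i : Fin N) (η : Fin N → ℤ) (c : Fin N → Fin m) :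
    (∑ a, s a • op 1 (slotE i a a)) (eb η c) = s (c i) • eb η c := by
  have : (∑ a, s a • op 1 (slotE i a a)) = op (N := N) 1 (∑ a, s a • slotE (m := m) i a a) := by
    rw [op_sum_right]
    simp only [op_smul_right]
  rw [this, ← zz_zero, op_eb, zero_add, LinearMap.sum_apply]
  simp only [LinearMap.smul_apply, slotE_diag_vb, smul_ite, smul_zero, Finset.sum_ite_eq,
    Finset.mem_univ, if_true]
  rw [TensorProduct.tmul_smul, eb]

theorem wtOp_eb (κ : ℂ) (s : Fin m → ℂ) (i : Fin N) (η : Fin N → ℤ) (c : Fin N → Fin m) :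
    wtOp κ s i (eb η c) = (κ * η i + s (c i)) • eb η c := by
  rw [wtOp, LinearMap.add_apply, LinearMap.smul_apply, dz_eb, smul_smul, sum_op_slotE_eb, add_smul]

theorem thetaEval_diag_eb (i : Fin N) (a : Fin m) (η : Fin N → ℤ) (c : Fin N → Fin m) :
    thetaEval i (E a a 0) (eb η c) = ((if c i = a then 1 else 0) - (m : ℂ)⁻¹) • eb η c := by
  rw [thetaEval_E, if_pos rfl, Pi.single_zero, LinearMap.sub_apply, LinearMap.smul_apply, op_eb,
    op_eb, zero_add, slotE_diag_vb, Module.End.one_apply, ← eb, sub_smul]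
  split_ifs
  · rw [one_smul, eb]
  · rw [TensorProduct.tmul_zero, zero_smul]

theorem xOp_eb {j k : Fin N} (h : j ≠ k) (η : Fin N → ℤ) (c : Fin N → Fin m) :
    xOp j k (eb η c) = divDiffFun j k η ⊗ₜ vb (fun i => c (Equiv.swap j k i))
      - rWt (c k) (c j) • eb η (fun i => c (Equiv.swap j k i)) := by
  rw [xOp, LinearMap.sub_apply, eb, TensorProduct.map_tmul, divDiff_zz, tau2_swap_vb, op_tmul,
    one_mul, rV_vb h, TensorProduct.tmul_smul, eb]

/-- The diagonal element `E_{aa} - 1/m` of the Cartan subalgebra. -/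
def diagH (a : Fin m) : cartan m := ⟨E a a 0, Submodule.subset_span (Or.inl ⟨a, rfl⟩)⟩

theorem sum_diagH : ∑ a : Fin m, diagH a = 0 := by
  apply Subtype.ext
  rw [AddSubmonoidClass.coe_finsetSum]
  exact sum_E_diag 0

/-- The diagonal entries of the action of `ρ̌` plus half the sum of the two weights. -/
def vacW (lam mu : Weight m) (a : Fin m) : ℂ :=
  1 / 2 * (mu (diagH a) + lam (diagH a)) + 1 / 2 * ((m : ℂ) - 1 - 2 * (a : ℕ))

section

variable (lam mu : Weight m)

/-- The map from the middle factor to the numerator given by the two vacuum vectors. -/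
def vacNum : Mid m N →ₗ[ℂ] Num m N (Lau N) (Verma mu) (LowestVerma lam) :=
  TensorProduct.mk ℂ (Verma mu) _ (vac (nPlus m) mu) ∘ₗ
    (TensorProduct.mk ℂ (Mid m N) (LowestVerma lam)).flip (vac (nMinus m) (-lam))

/-- The map from the middle factor to the quotient given by the two vacuum vectors. -/
def vacMap : Mid m N →ₗ[ℂ] StdModule N lam mu :=
  (gPrimeNum m N (Verma mu) (LowestVerma lam)).mkQ ∘ₗ vacNum lam mu

theorem thetaA_vacNum (x : AffineSl m) (y : Mid m N) :
    thetaA (Verma mu) (LowestVerma lam) x (vacNum lam mu y) =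
      ⁅x, vac (nPlus m) mu⁆ ⊗ₜ (y ⊗ₜ vac (nMinus m) (-lam)) := rfl

theorem thetaB_vacNum (x : AffineSl m) (y : Mid m N) :
    thetaB (Verma mu) (LowestVerma lam) x (vacNum lam mu y) =
      vac (nPlus m) mu ⊗ₜ (y ⊗ₜ ⁅x, vac (nMinus m) (-lam)⁆) := rfl

theorem liftMid_vacNum (f : Module.End ℂ (Mid m N)) (y : Mid m N) :
    liftMid (Verma mu) (LowestVerma lam) f (vacNum lam mu y) = vacNum lam mu (f y) := rfl

theorem thetaA_vacNum_cartan (h : cartan m) (y : Mid m N) :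
    thetaA (Verma mu) (LowestVerma lam) h.1 (vacNum lam mu y) = mu h • vacNum lam mu y := by
  rw [thetaA_vacNum, lie_vac_cartan, ← TensorProduct.smul_tmul']
  rfl

theorem thetaB_vacNum_cartan (h : cartan m) (y : Mid m N) :
    thetaB (Verma mu) (LowestVerma lam) h.1 (vacNum lam mu y) = -lam h • vacNum lam mu y := by
  rw [thetaB_vacNum, lie_vac_cartan, TensorProduct.tmul_smul, TensorProduct.tmul_smul]
  rfl

theorem thetaA_vacNum_nPlus {x : AffineSl m} (hx : x ∈ nPlus m) (y : Mid m N) :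
    thetaA (Verma mu) (LowestVerma lam) x (vacNum lam mu y) = 0 := by
  rw [thetaA_vacNum, lie_vac_of_mem hx, TensorProduct.zero_tmul]

theorem thetaB_vacNum_nMinus {x : AffineSl m} (hx : x ∈ nMinus m) (y : Mid m N) :
    thetaB (Verma mu) (LowestVerma lam) x (vacNum lam mu y) = 0 := by
  rw [thetaB_vacNum, lie_vac_of_mem hx, TensorProduct.tmul_zero, TensorProduct.tmul_zero]

/-- The left legs of the non-Cartan terms of r lie in 𝔫₊ and kill the vacuum. Of the terms with c
and d only c ⊗ d survives, because c acts by zero on evaluation modules. -/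
theorem rUniv_vacNum_left (i : Fin N) (y : Mid m N) :
    rUniv (thetaA (Verma mu) (LowestVerma lam)) (thetaI (Verma mu) (LowestVerma lam) i)
      (vacNum lam mu y) = vacNum lam mu (((1 / 2 : ℂ) • ∑ a, mu (diagH a) • thetaEval i (E a a 0)
        + (1 / 2 * mu cenH) • dz i : Module.End ℂ (Mid m N)) y) := by
  have h1 : ∑ᶠ n : ℕ, ∑ a : Fin m, ∑ b : Fin m, thetaA (Verma mu) (LowestVerma lam) (E a b (n + 1))
      (thetaI (Verma mu) (LowestVerma lam) i (E b a (-(n + 1))) (vacNum lam mu y)) = 0 := by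
    refine finsum_eq_zero_of_forall_eq_zero fun n => ?_
    refine Finset.sum_eq_zero fun a _ => Finset.sum_eq_zero fun b _ => ?_
    rw [thetaI_eq, liftMid_vacNum]
    exact thetaA_vacNum_nPlus lam mu
      (Submodule.subset_span (Or.inr ⟨a, b, n + 1, by omega, rfl⟩)) _
  have h2 : ∀ (h : cartan m) (x : AffineSl m), thetaA (Verma mu) (LowestVerma lam) h.1
      (thetaI (Verma mu) (LowestVerma lam) i x (vacNum lam mu y)) =
      vacNum lam mu ((mu h • thetaEval i x) y) := by
    intro h x
    rw [thetaI_eq, liftMid_vacNum, thetaA_vacNum_cartan, LinearMap.smul_apply, map_smul]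
  have h3 : thetaA (Verma mu) (LowestVerma lam) deg
      (thetaI (Verma mu) (LowestVerma lam) i cen (vacNum lam mu y)) = 0 := by
    rw [thetaI_eq, thetaEval_cen, map_zero, LinearMap.zero_apply, map_zero]
  have h4 : rBar (thetaA (Verma mu) (LowestVerma lam)) (thetaI (Verma mu) (LowestVerma lam) i)
      (vacNum lam mu y) = vacNum lam mu (((1 / 2 : ℂ) •
        ∑ a, mu (diagH a) • thetaEval i (E a a 0) : Module.End ℂ (Mid m N)) y) := by
    rw [rBar, LinearMap.add_apply, LinearMap.smul_apply, LinearMap.smul_apply, LinearMap.sum_apply,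
      LinearMap.sum_apply, LinearMap.sum_apply, map_smul, map_sum]
    have : ∀ a b : Fin m, (if a < b then thetaA (Verma mu) (LowestVerma lam) (E a b 0)
        * thetaI (Verma mu) (LowestVerma lam) i (E b a 0) else 0 :
        Module.End ℂ (Num m N (Lau N) (Verma mu) (LowestVerma lam)))
        (vacNum lam mu y) = 0 := by
      intro a b
      split_ifs with hab
      · rw [Module.End.mul_apply, thetaI_eq, liftMid_vacNum]
        exact thetaA_vacNum_nPlus lam mu (Submodule.subset_span (Or.inl ⟨a, b, hab, rfl⟩)) _
      · rfl
    simp only [LinearMap.sum_apply, this, Finset.sum_const_zero, add_zero]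
    congr 1
    exact Finset.sum_congr rfl fun a _ => h2 (diagH a) _
  have h5 := h2 cenH deg
  rw [rUniv, h1, h3, h4]
  change _ + (1 / 2 : ℂ) • (thetaA (Verma mu) (LowestVerma lam) (cenH : cartan m).1 _ + 0) + 0 = _
  rw [h5, thetaEval_deg, add_zero, add_zero, ← map_smul, ← map_add, ← LinearMap.smul_apply,
    ← LinearMap.add_apply, smul_smul]

/-- Mirror image: the right legs of the non-Cartan terms lie in 𝔫₋, and the lowest weight is -λ. -/
theorem rUniv_vacNum_right (i : Fin N) (y : Mid m N) :
    rUniv (thetaI (Verma mu) (LowestVerma lam) i) (thetaB (Verma mu) (LowestVerma lam))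
      (vacNum lam mu y) = vacNum lam mu ((-(1 / 2 : ℂ) • ∑ a, lam (diagH a) • thetaEval i (E a a 0)
        + (-(1 / 2 * lam cenH)) • dz i : Module.End ℂ (Mid m N)) y) := by
  have h1 : ∑ᶠ n : ℕ, ∑ a : Fin m, ∑ b : Fin m, thetaI (Verma mu) (LowestVerma lam) i (E a b (n + 1))
      (thetaB (Verma mu) (LowestVerma lam) (E b a (-(n + 1))) (vacNum lam mu y)) = 0 := by
    refine finsum_eq_zero_of_forall_eq_zero fun n => ?_
    refine Finset.sum_eq_zero fun a _ => Finset.sum_eq_zero fun b _ => ?_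
    rw [thetaB_vacNum_nMinus lam mu
      (Submodule.subset_span (Or.inr ⟨b, a, -(n + 1), by omega, rfl⟩)), map_zero]
  have h2 : ∀ (h : cartan m) (x : AffineSl m), thetaI (Verma mu) (LowestVerma lam) i x
      (thetaB (Verma mu) (LowestVerma lam) h.1 (vacNum lam mu y)) =
      vacNum lam mu ((-lam h • thetaEval i x) y) := by
    intro h x
    rw [thetaB_vacNum_cartan, map_smul, thetaI_eq, liftMid_vacNum, LinearMap.smul_apply, map_smul]
  have h3 : thetaI (Verma mu) (LowestVerma lam) i cen
      (thetaB (Verma mu) (LowestVerma lam) deg (vacNum lam mu y)) = 0 := by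
    rw [thetaI_eq, thetaEval_cen, map_zero, LinearMap.zero_apply]
  have h4 : rBar (thetaI (Verma mu) (LowestVerma lam) i) (thetaB (Verma mu) (LowestVerma lam))
      (vacNum lam mu y) = vacNum lam mu ((-(1 / 2 : ℂ) •
        ∑ a, lam (diagH a) • thetaEval i (E a a 0) : Module.End ℂ (Mid m N)) y) := by
    have : ∀ a b : Fin m, (if a < b then thetaI (Verma mu) (LowestVerma lam) i (E a b 0)
        * thetaB (Verma mu) (LowestVerma lam) (E b a 0) else 0 :
        Module.End ℂ (Num m N (Lau N) (Verma mu) (LowestVerma lam)))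
        (vacNum lam mu y) = 0 := by
      intro a b
      split_ifs with hab
      · rw [Module.End.mul_apply, thetaB_vacNum_nMinus lam mu
          (Submodule.subset_span (Or.inl ⟨b, a, hab, rfl⟩)), map_zero]
      · rfl
    rw [rBar, LinearMap.add_apply, LinearMap.smul_apply,
      LinearMap.smul_apply, LinearMap.sum_apply, LinearMap.sum_apply, LinearMap.sum_apply, map_smul,
      map_sum]
    simp only [LinearMap.sum_apply, this, Finset.sum_const_zero, add_zero]
    rw [neg_smul, ← smul_neg, ← Finset.sum_neg_distrib]
    congr 1
    refine Finset.sum_congr rfl fun a _ => ?_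
    rw [LinearMap.smul_apply, map_smul, ← neg_smul, ← map_smul, ← LinearMap.smul_apply]
    exact h2 (diagH a) _
  have h5 := h2 cenH deg
  rw [rUniv, h1, h4]
  change _ + (1 / 2 : ℂ) • (_ + thetaI (Verma mu) (LowestVerma lam) i deg
    (thetaB (Verma mu) (LowestVerma lam) (cenH : cartan m).1 _)) + 0 = _
  rw [h5, h3, thetaEval_deg, add_zero, zero_add, ← map_smul, ← map_add, ← LinearMap.smul_apply,
    ← LinearMap.add_apply, smul_smul, mul_neg]

theorem thetaEval_rhoCheck_eb (i : Fin N) (η : Fin N → ℤ) (c : Fin N → Fin m) :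
    thetaEval i rhoCheck (eb η c) = (1 / 2 * ((m : ℂ) - 1 - 2 * (c i : ℕ)) + m * η i) • eb η c := by
  have hr := isRep_thetaEval (m := m) i
  have hs : ∀ {ι : Type} (s : Finset ι) (f : ι → AffineSl m),
      thetaEval i (∑ a ∈ s, f a) = ∑ a ∈ s, thetaEval i (f a) := by
    intro ι s f
    classical
    induction s using Finset.induction_on with
    | empty => simp [hr.zero]
    | insert a s ha ih => rw [Finset.sum_insert ha, Finset.sum_insert ha, hr.add, ih]
  rw [rhoCheck, hr.add, hr.smul, hr.smul, thetaEval_deg, hs, LinearMap.add_apply,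
    LinearMap.smul_apply, LinearMap.smul_apply, dz_eb, LinearMap.sum_apply, smul_smul, add_smul]
  congr 1
  have h1 : ∀ a : Fin m, thetaEval i (∑ b : Fin m, if a < b then E a a 0 - E b b 0 else 0) (eb η c) =
      (∑ b : Fin m, if a < b then ((if c i = a then (1 : ℂ) else 0) - if c i = b then 1 else 0)
        else 0) • eb η c := by
    intro a
    rw [hs, LinearMap.sum_apply, Finset.sum_smul]
    refine Finset.sum_congr rfl fun b _ => ?_
    by_cases h : a < b
    · rw [if_pos h, if_pos h, hr.sub, LinearMap.sub_apply, thetaEval_diag_eb, thetaEval_diag_eb,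
        ← sub_smul, sub_sub_sub_cancel_right]
    · rw [if_neg h, if_neg h, hr.zero, zero_smul]
      rfl
  rw [Finset.sum_congr rfl fun a _ => h1 a, ← Finset.sum_smul, smul_smul]
  congr 2
  have h2 : ∀ a b : Fin m, (if a < b then ((if c i = a then (1 : ℂ) else 0) -
      if c i = b then 1 else 0) else 0) = (if c i = a then (if c i < b then (1 : ℂ) else 0) else 0)
      - (if c i = b then (if a < c i then (1 : ℂ) else 0) else 0) := by
    intro a b
    by_cases h1 : c i = a
    · by_cases h2 : c i = b
      · simp [← h1, ← h2]
      · rw [← h1]; simp [h2]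
    · by_cases h2 : c i = b
      · rw [← h2]
        split_ifs <;> simp
      · simp [h1, h2]
  simp only [h2, Finset.sum_sub_distrib]
  rw [Finset.sum_comm]
  simp only [Finset.sum_ite_eq, Finset.mem_univ, if_true]
  rw [Finset.sum_boole, Finset.sum_boole, Finset.filter_lt_eq_Ioi, Fin.card_Ioi,
    Finset.filter_gt_eq_Iio, Fin.card_Iio, Nat.sub_sub, Nat.cast_sub (by omega)]
  push_cast
  ring

/-- The correction -1/m in each diagonal element is harmless, because the values of l on all `diagH
a` add up to zero. -/
theorem sum_weight_thetaEval_eb (l : Weight m) (i : Fin N) (η : Fin N → ℤ) (c : Fin N → Fin m) :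
    (∑ a, l (diagH a) • thetaEval i (E a a 0)) (eb η c) = l (diagH (c i)) • eb η c := by
  rw [LinearMap.sum_apply]
  simp only [LinearMap.smul_apply, thetaEval_diag_eb, smul_smul, ← Finset.sum_smul, mul_sub,
    Finset.sum_sub_distrib, mul_ite, mul_one, mul_zero, Finset.sum_ite_eq, Finset.mem_univ, if_true,
    ← Finset.sum_mul]
  rw [← map_sum, sum_diagH, map_zero, zero_mul, sub_zero]

theorem locFin_verma_left (i : Fin N) : LocFin (thetaA (m := m) (Verma mu) (LowestVerma lam))
    (thetaI (Verma mu) (LowestVerma lam) i) :=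
  locFin_thetaA _ _ (exists_E_lie_verma_eq_zero mu) i

theorem locFin_verma_right (i : Fin N) : LocFin (thetaI (m := m) (Verma mu) (LowestVerma lam) i)
    (thetaB (Verma mu) (LowestVerma lam)) :=
  locFin_thetaB _ _ (exists_E_lie_lowestVerma_eq_zero lam) i

/-- Each end contributes half of the level to the coefficient of z_i ∂_i and ρ̌ + m d contributes m;
hence κ = lev + m. -/
theorem outerKZ_vacNum {lev : ℂ} (hlam : lam cenH = lev) (hmu : mu cenH = lev) (i : Fin N)
    (y : Mid m N) : outerKZ (Verma mu) (LowestVerma lam) i (vacNum lam mu y) =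
      vacNum lam mu (wtOp (lev + m) (vacW lam mu) i y) := by
  rw [outerKZ, LinearMap.add_apply, LinearMap.sub_apply, rUnivL_apply (locFin_verma_left lam mu i),
    rUnivL_apply (locFin_verma_right lam mu i), rUniv_vacNum_left, rUniv_vacNum_right, thetaI_eq,
    liftMid_vacNum, ← map_sub, ← map_add, ← LinearMap.sub_apply, ← LinearMap.add_apply]
  congr 1
  revert y
  refine LinearMap.congr_fun (mid_ext fun η c => ?_)
  rw [wtOp_eb, LinearMap.add_apply, LinearMap.sub_apply, LinearMap.add_apply, LinearMap.add_apply, LinearMap.smul_apply, LinearMap.smul_apply,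
    LinearMap.smul_apply, LinearMap.smul_apply, sum_weight_thetaEval_eb, sum_weight_thetaEval_eb,
    dz_eb, thetaEval_rhoCheck_eb, smul_smul, smul_smul, smul_smul, smul_smul, ← add_smul, ← add_smul,
    ← sub_smul, ← add_smul]
  congr 1
  rw [hlam, hmu, vacW]
  ring

theorem dunklLau_vacNum {lev : ℂ} (hlam : lam cenH = lev) (hmu : mu cenH = lev) (ξ : Fin N → ℂ)
    (y : Mid m N) : dunklLau (Verma mu) (LowestVerma lam) ξ (vacNum lam mu y) =
      vacNum lam mu (dunklMid (lev + m) (vacW lam mu) ξ y) := by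
  simp only [dunklLau, dunklMid, LinearMap.add_apply, map_add, LinearMap.sum_apply, map_sum]
  congr 1
  · refine Finset.sum_congr rfl fun i _ => ?_
    rw [LinearMap.smul_apply, LinearMap.smul_apply, map_smul, outerKZ_vacNum lam mu hlam hmu]
  · refine Finset.sum_congr rfl fun j _ => Finset.sum_congr rfl fun k _ => ?_
    split_ifs
    · rw [LinearMap.smul_apply, LinearMap.smul_apply, map_smul, liftMid_vacNum]
    · rw [LinearMap.zero_apply, LinearMap.zero_apply, map_zero]

end

end

end KZ

namespace AffineSl
variable {m : ℕ}

theorem coD_eq_zero_of_mem_nPlus {x : AffineSl m} (h : x ∈ nPlus m) : coD x = 0 := by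
  have : nPlus m ≤ LinearMap.ker (coD (m := m)) := by
    rw [nPlus, Submodule.span_le]
    rintro y (⟨a, b, -, rfl⟩ | ⟨a, b, n, -, rfl⟩) <;> exact coD_E _ _ _
  exact this h

theorem coD_eq_zero_of_mem_nMinus {x : AffineSl m} (h : x ∈ nMinus m) : coD x = 0 := by
  have : nMinus m ≤ LinearMap.ker (coD (m := m)) := by
    rw [nMinus, Submodule.span_le]
    rintro y (⟨a, b, -, rfl⟩ | ⟨a, b, n, -, rfl⟩) <;> exact coD_E _ _ _
  exact this h

theorem diagEntry_E_diag (a b : Fin m) :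
    diagEntry b (E a a 0) = (if a = b then 1 else 0) - (m : ℂ)⁻¹ := by
  have h1 : constTerm (1 : ℂ[T;T⁻¹]) = 1 := by
    have := constTerm_T 0
    rwa [LaurentPolynomial.T_zero, if_pos rfl] at this
  rw [diagEntry, loop_E, tl_val, unitT, LaurentPolynomial.T_zero, Matrix.trace_single_eq_same,
    Matrix.sub_apply, Matrix.smul_apply, Matrix.one_apply_eq, map_sub, smul_eq_mul, mul_one,
    map_smul, h1, smul_eq_mul, mul_one, Matrix.single_apply]
  congr 1
  by_cases h : a = b
  · simp [h, h1]
  · simp [h]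

end AffineSl

namespace KZ
open AffineSl DDAHA
variable {m N : ℕ}

section
attribute [local instance] vnGroup midGroup midAddGroup

/-! ### The quotient is generated by vacuum vectors -/

section

variable (lam mu : Weight m)

theorem mk_theta_eq_zero (hm : 2 ≤ m) {x : AffineSl m} (hx : coD x = 0) (A B : Type)
    [AddCommGroup A] [Module ℂ A] [LieRingModule (AffineSl m) A] [LieModule ℂ (AffineSl m) A]
    [AddCommGroup B] [Module ℂ B] [LieRingModule (AffineSl m) B] [LieModule ℂ (AffineSl m) B]
    (y : Num m N (Lau N) A B) :
    (Submodule.Quotient.mk (theta A B x y) : F m N A B) = 0 :=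
  (Submodule.Quotient.mk_eq_zero _).2 (theta_mem_gPrimeNum A B hm hx y)

theorem theta_tmul (A B : Type)
    [AddCommGroup A] [Module ℂ A] [LieRingModule (AffineSl m) A] [LieModule ℂ (AffineSl m) A]
    [AddCommGroup B] [Module ℂ B] [LieRingModule (AffineSl m) B] [LieModule ℂ (AffineSl m) B]
    (x : AffineSl m) (a : A) (y : Mid m N) (b : B) :
    theta A B x (a ⊗ₜ (y ⊗ₜ b)) = ⁅x, a⁆ ⊗ₜ (y ⊗ₜ b) + a ⊗ₜ ((∑ i, thetaEval i x) y ⊗ₜ b)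
      + a ⊗ₜ (y ⊗ₜ ⁅x, b⁆) := by
  have h : ∑ i : Fin N, thetaI A B i x = liftMid A B (∑ i, thetaEval i x) := by
    rw [map_sum]
    rfl
  rw [theta, h]
  rfl

/-- In the coinvariants an element of 𝔤' acting on one factor can be moved, with a sign, to the
others. The left factor is reduced first, while the right one is its vacuum. -/
theorem vacMap_surjective (hm : 2 ≤ m) : Function.Surjective (vacMap (N := N) lam mu) := by
  let q : Num m N (Lau N) (Verma mu) (LowestVerma lam) →ₗ[ℂ] StdModule N lam mu :=
    (gPrimeNum m N (Verma mu) (LowestVerma lam)).mkQ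
  have hq : ∀ {x : AffineSl m}, coD x = 0 → ∀ y, q (theta (Verma mu) (LowestVerma lam) x y) = 0 :=
    fun hx y => mk_theta_eq_zero hm hx _ _ y
  have hB : ∀ (a : Verma mu) (y : Mid m N),
      q (a ⊗ₜ (y ⊗ₜ vac (nMinus m) (-lam))) ∈ LinearMap.range (vacMap (N := N) lam mu) := by
    let S : Submodule ℂ (Verma mu) :=
      { carrier := {a | ∀ y : Mid m N,
          q (a ⊗ₜ (y ⊗ₜ vac (nMinus m) (-lam))) ∈ LinearMap.range (vacMap (N := N) lam mu)}
        add_mem' := fun {a b} ha hb y => by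
          rw [TensorProduct.add_tmul, map_add]
          exact Submodule.add_mem _ (ha y) (hb y)
        zero_mem' := fun y => by
          rw [TensorProduct.zero_tmul, map_zero]
          exact Submodule.zero_mem _
        smul_mem' := fun r a ha y => by
          rw [← TensorProduct.smul_tmul', map_smul]
          exact Submodule.smul_mem _ _ (ha y) }
    refine verma_induction (nMinus m) nMinus_sup_cartan_sup_nPlus S (fun y => ⟨y, rfl⟩) ?_
    intro x hx a ha y
    -- Since x kills the lowest weight vector, only the middle factor receives x.
    have h1 := hq (coD_eq_zero_of_mem_nMinus hx) (a ⊗ₜ (y ⊗ₜ vac (nMinus m) (-lam)))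
    rw [theta_tmul, lie_vac_of_mem hx, TensorProduct.tmul_zero, TensorProduct.tmul_zero, add_zero,
      map_add] at h1
    rw [eq_neg_of_add_eq_zero_left h1]
    exact Submodule.neg_mem _ (ha _)
  have hA : ∀ (b : LowestVerma lam) (a : Verma mu) (y : Mid m N),
      q (a ⊗ₜ (y ⊗ₜ b)) ∈ LinearMap.range (vacMap (N := N) lam mu) := by
    let S : Submodule ℂ (LowestVerma lam) :=
      { carrier := {b | ∀ (a : Verma mu) (y : Mid m N),
          q (a ⊗ₜ (y ⊗ₜ b)) ∈ LinearMap.range (vacMap (N := N) lam mu)}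
        add_mem' := fun {b c} hb hc a y => by
          rw [TensorProduct.tmul_add, TensorProduct.tmul_add, map_add]
          exact Submodule.add_mem _ (hb a y) (hc a y)
        zero_mem' := fun a y => by
          rw [TensorProduct.tmul_zero, TensorProduct.tmul_zero, map_zero]
          exact Submodule.zero_mem _
        smul_mem' := fun r b hb a y => by
          rw [TensorProduct.tmul_smul, TensorProduct.tmul_smul, map_smul]
          exact Submodule.smul_mem _ _ (hb a y) }
    refine verma_induction (nPlus m) nPlus_sup_cartan_sup_nMinus S hB ?_
    intro x hx b hb a y
    -- The left factor may now change, which is why the induction hypothesis allows every a.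
    have h1 := hq (coD_eq_zero_of_mem_nPlus hx) (a ⊗ₜ (y ⊗ₜ b))
    rw [theta_tmul, map_add, map_add] at h1
    rw [eq_neg_of_add_eq_zero_right h1]
    exact Submodule.neg_mem _ (Submodule.add_mem _ (hb _ _) (hb _ _))
  intro z
  obtain ⟨y, rfl⟩ := Submodule.Quotient.mk_surjective _ z
  change q y ∈ LinearMap.range (vacMap (N := N) lam mu)
  induction y using TensorProduct.induction_on with
  | zero => rw [map_zero]; exact Submodule.zero_mem _
  | add x y hx hy => rw [map_add]; exact Submodule.add_mem _ hx hy
  | tmul a w =>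
    induction w using TensorProduct.induction_on with
    | zero => rw [TensorProduct.tmul_zero, map_zero]; exact Submodule.zero_mem _
    | add x y hx hy => rw [TensorProduct.tmul_add, map_add]; exact Submodule.add_mem _ hx hy
    | tmul y b => exact hA b a y

variable {lam mu} in
theorem weight_diagH {β : Fin m → ℕ} (hβ : ∑ a, β a = N)
    (h : ∀ h : cartan m, coC h.1 = 0 → coD h.1 = 0 →
      (lam - mu) h = ∑ a, (β a : ℂ) * diagEntry a h.1) (a : Fin m) :
    lam (diagH a) - mu (diagH a) = β a - N * (m : ℂ)⁻¹ := by
  have h1 := h (diagH a) (coC_E _ _ _) (coD_E _ _ _)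
  rw [LinearMap.sub_apply] at h1
  rw [h1]
  have h2 : ∀ b, (β b : ℂ) * diagEntry b (diagH a).1 =
      (if a = b then (β b : ℂ) else 0) - β b * (m : ℂ)⁻¹ := by
    intro b
    change (β b : ℂ) * diagEntry b (E a a 0) = _
    rw [diagEntry_E_diag, mul_sub, mul_ite, mul_one, mul_zero]
  simp only [h2, Finset.sum_sub_distrib, Finset.sum_ite_eq, Finset.mem_univ, if_true,
    ← Finset.sum_mul]
  rw [← Nat.cast_sum, hβ]

-- The element `E a a 0` belongs to 𝔤' and acts on such a vector by the number of places of colour a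
-- minus β_a; in the coinvariants this scalar must annihilate the vector.
variable {lam mu} in
theorem vacMap_eb_eq_zero (hm : 2 ≤ m) {β : Fin m → ℕ}
    (hw : ∀ a, lam (diagH a) - mu (diagH a) = β a - N * (m : ℂ)⁻¹) (η : Fin N → ℤ)
    (c : Fin N → Fin m) {a : Fin m} (h : (Finset.univ.filter fun i => c i = a).card ≠ β a) :
    vacMap lam mu (eb η c) = 0 := by
  have h1 := mk_theta_eq_zero hm (coD_E a a 0) (Verma mu) (LowestVerma lam)
    (vacNum lam mu (eb η c))
  have h2 : theta (Verma mu) (LowestVerma lam) (E a a 0) (vacNum lam mu (eb η c)) =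
      ((Finset.univ.filter fun i => c i = a).card - β a : ℂ) • vacNum lam mu (eb η c) := by
    have e1 := thetaA_vacNum_cartan lam mu (diagH a) (eb η c)
    have e2 := thetaB_vacNum_cartan lam mu (diagH a) (eb η c)
    have e3 : (∑ i, thetaI (Verma mu) (LowestVerma lam) i (E a a 0)) (vacNum lam mu (eb η c)) =
        ((Finset.univ.filter fun i => c i = a).card - N * (m : ℂ)⁻¹ : ℂ)
          • vacNum lam mu (eb η c) := by
      rw [LinearMap.sum_apply]
      have : ∀ i, thetaI (Verma mu) (LowestVerma lam) i (E a a 0) (vacNum lam mu (eb η c)) =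
          ((if c i = a then 1 else 0) - (m : ℂ)⁻¹) • vacNum lam mu (eb η c) := by
        intro i
        rw [thetaI_eq, liftMid_vacNum, thetaEval_diag_eb, map_smul]
      simp only [this, ← Finset.sum_smul, Finset.sum_sub_distrib, Finset.sum_boole,
        Finset.sum_const, Finset.card_univ, Fintype.card_fin, nsmul_eq_mul]
    change thetaA (Verma mu) (LowestVerma lam) (E a a 0) _ = _ at e1
    change thetaB (Verma mu) (LowestVerma lam) (E a a 0) _ = _ at e2
    rw [theta, LinearMap.add_apply, LinearMap.add_apply, e1, e2, e3, ← add_smul, ← add_smul]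
    congr 1
    linear_combination -hw a
  rw [h2, Submodule.Quotient.mk_smul] at h1
  refine (smul_eq_zero.1 h1).resolve_left ?_
  rw [sub_eq_zero]
  exact_mod_cast h

end

/-! ### Cross relations on the middle factor -/

theorem tauM_mul (w v : Equiv.Perm (Fin N)) : tauM (m := m) (w * v) = tauM w * tauM v := by
  apply mid_ext
  intro η c
  rw [Module.End.mul_apply, tauM_eb, tauM_eb, tauM_eb]
  rfl

theorem tauM_one : tauM (m := m) (1 : Equiv.Perm (Fin N)) = 1 := by
  apply mid_ext
  intro η c
  rw [tauM_eb]
  rfl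

theorem perm_inv_apply (w : Equiv.Perm (Fin N)) (i : Fin N) : w⁻¹ (w i) = i :=
  w.symm_apply_apply i

theorem tauM_wtOp (κ : ℂ) (s : Fin m → ℂ) (w : Equiv.Perm (Fin N)) (i : Fin N) :
    tauM w * wtOp κ s i = wtOp κ s (w i) * tauM w := by
  apply mid_ext
  intro η c
  rw [Module.End.mul_apply, Module.End.mul_apply, wtOp_eb, map_smul, tauM_eb, wtOp_eb]
  simp only [permLattice, AddMonoidHom.coe_mk, ZeroHom.coe_mk, perm_inv_apply]

theorem tauM_dunklMid (κ : ℂ) (s : Fin m → ℂ) (w : Equiv.Perm (Fin N)) (ξ : Fin N → ℂ) :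
    tauM w * dunklMid κ s ξ = ((∑ i, ξ (w⁻¹ i) • wtOp κ s i) + ∑ j, ∑ k,
      if w⁻¹ j < w⁻¹ k then (ξ (w⁻¹ j) - ξ (w⁻¹ k)) • xOp j k else 0) * tauM w := by
  rw [dunklMid, mul_add, add_mul, Finset.mul_sum, Finset.sum_mul, Finset.mul_sum, Finset.sum_mul,
    ← Equiv.sum_comp w (fun i => ξ (w⁻¹ i) • wtOp κ s i * tauM w), ← Equiv.sum_comp w (fun j => (∑ k, if w⁻¹ j < w⁻¹ k then
      (ξ (w⁻¹ j) - ξ (w⁻¹ k)) • xOp j k else 0) * tauM w)]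
  congr 1
  · refine Finset.sum_congr rfl fun i _ => ?_
    rw [mul_smul_comm, tauM_wtOp, perm_inv_apply, smul_mul_assoc]
  · refine Finset.sum_congr rfl fun j _ => ?_
    rw [Finset.mul_sum, Finset.sum_mul, ← Equiv.sum_comp w (fun k => (if w⁻¹ (w j) < w⁻¹ k then
      (ξ (w⁻¹ (w j)) - ξ (w⁻¹ k)) • xOp (w j) k else 0) * tauM w)]
    refine Finset.sum_congr rfl fun k _ => ?_
    rw [perm_inv_apply, perm_inv_apply]
    split_ifs with h
    · rw [mul_smul_comm, tauM_xOp _ h.ne, smul_mul_assoc]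
    · rw [mul_zero, zero_mul]

/-- Conjugation by an adjacent transposition reverses the order of the pair (a, b) and of no other.
Replacing `xOp b a` by `xOp a b` costs a transposition by `xOp_add_swap`, and its product with the
transposition outside is the identity. -/
theorem tauM_swap_dunklMid (κ : ℂ) (s : Fin m → ℂ) {a b : Fin N} (hab : (a : ℕ) + 1 = b)
    (ξ : Fin N → ℂ) : tauM (Equiv.swap a b) * dunklMid κ s ξ =
      dunklMid κ s (fun i => ξ (Equiv.swap a b i)) * tauM (Equiv.swap a b) - (ξ a - ξ b) • 1 := by
  have hne : a ≠ b := fun e => by rw [e] at hab; omega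
  have hlt : a < b := Fin.lt_def.2 (by omega)
  rw [tauM_dunklMid, Equiv.swap_inv]
  set w := Equiv.swap a b with hw
  -- Since a and b are adjacent, w preserves the order of every pair other than (a, b); the
  -- correction is supported on (a, b) and (b, a).
  have h1 : ∀ j k : Fin N, (if w j < w k then (ξ (w j) - ξ (w k)) • xOp (m := m) j k else 0) =
      (if j < k then (ξ (w j) - ξ (w k)) • xOp j k else 0)
      + if j = a then if k = b then (ξ a - ξ b) • xOp a b else 0
        else if j = b then if k = a then (ξ a - ξ b) • xOp b a else 0 else 0 := by
    intro j k
    by_cases hja : j = a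
    · by_cases hkb : k = b
      · rw [hja, hkb, if_pos rfl, if_pos rfl, if_pos hlt, hw, Equiv.swap_apply_left,
          Equiv.swap_apply_right, if_neg hlt.not_gt, ← add_smul, sub_add_sub_cancel, sub_self,
          zero_smul]
      · rw [if_pos hja, if_neg hkb, add_zero]
        congr 1
        by_cases hka : k = a
        · rw [hja, hka]; simp
        · rw [hja, hw, Equiv.swap_apply_left, Equiv.swap_apply_of_ne_of_ne hka hkb]
          rw [Fin.ext_iff] at hka hkb
          rw [Fin.lt_def, Fin.lt_def, eq_iff_iff]
          omega
    · by_cases hjb : j = b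
      · by_cases hka : k = a
        · rw [hjb, hka, if_neg hne.symm, if_pos rfl, if_pos rfl, if_neg hlt.not_gt, hw,
            Equiv.swap_apply_left, Equiv.swap_apply_right, if_pos hlt, zero_add]
        · rw [if_neg hja, if_pos hjb, if_neg hka, add_zero]
          congr 1
          by_cases hkb : k = b
          · rw [hjb, hkb]; simp
          · rw [hjb, hw, Equiv.swap_apply_right, Equiv.swap_apply_of_ne_of_ne hka hkb]
            rw [Fin.ext_iff] at hka hkb
            rw [Fin.lt_def, Fin.lt_def, eq_iff_iff]
            omega
      · rw [if_neg hja, if_neg hjb, add_zero]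
        congr 1
        rw [hw, Equiv.swap_apply_of_ne_of_ne hja hjb]
        by_cases hka : k = a
        · rw [hka, Equiv.swap_apply_left]
          rw [Fin.ext_iff] at hja hjb
          rw [Fin.lt_def, Fin.lt_def, eq_iff_iff]
          omega
        · by_cases hkb : k = b
          · rw [hkb, Equiv.swap_apply_right]
            rw [Fin.ext_iff] at hja hjb
            rw [Fin.lt_def, Fin.lt_def, eq_iff_iff]
            omega
          · rw [Equiv.swap_apply_of_ne_of_ne hka hkb]
  have h2 : (∑ j : Fin N, ∑ k : Fin N, if j = a then if k = b then (ξ a - ξ b) • xOp a b else 0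
        else if j = b then if k = a then (ξ a - ξ b) • xOp b a else 0 else 0) =
      (-(ξ a - ξ b)) • tauM (m := m) w := by
    rw [← Finset.add_sum_erase _ _ (Finset.mem_univ a), ← Finset.add_sum_erase _ _
      (Finset.mem_erase.2 ⟨hne.symm, Finset.mem_univ b⟩), Finset.sum_eq_zero (s :=
      (Finset.univ.erase a).erase b)]
    · simp only [if_true, if_neg hne.symm, Finset.sum_ite_eq', Finset.mem_univ, add_zero]
      rw [← smul_add, xOp_add_swap hne, smul_neg]
      exact (neg_smul (ξ a - ξ b) (tauM (m := m) w)).symm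
    · intro j hj
      exact Finset.sum_eq_zero fun k _ => by
        rw [if_neg (Finset.ne_of_mem_erase (Finset.mem_of_mem_erase hj)),
          if_neg (Finset.ne_of_mem_erase hj)]
  simp only [h1, Finset.sum_add_distrib]
  rw [h2, ← add_assoc, ← dunklMid, add_mul, smul_mul_assoc, ← tauM_mul, hw, Equiv.swap_mul_self,
    tauM_one]
  exact (congrArg (_ + ·) (neg_smul (ξ a - ξ b) (1 : Module.End ℂ (Mid m N)))).trans
    (sub_eq_add_neg _ _).symm

theorem op_wtOp (κ : ℂ) (s : Fin m → ℂ) (l i : Fin N) : op (zz (Pi.single l 1)) 1 * wtOp κ s i =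
    (wtOp κ s i - (if i = l then κ else 0) • 1) * op (zz (Pi.single l 1)) 1 := by
  apply mid_ext
  intro η c
  rw [Module.End.mul_apply, Module.End.mul_apply, wtOp_eb, map_smul, op_eb, Module.End.one_apply,
    ← eb, LinearMap.sub_apply, LinearMap.smul_apply, wtOp_eb, Module.End.one_apply, ← sub_smul]
  congr 1
  by_cases h : i = l
  · simp [h]
    ring
  · simp [h]

/-- The action of `π` on the middle factor. -/
def piM (m N : ℕ) [NeZero N] : Module.End ℂ (Mid m N) :=
  op (zz (Pi.single 0 1)) 1 * tauM (Equiv.addRight 1)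

theorem val_sub_one [NeZero N] (i : Fin N) (hi : i ≠ 0) : ((i - 1 : Fin N) : ℕ) + 1 = i := by
  obtain ⟨n, rfl⟩ := Nat.exists_eq_succ_of_ne_zero (NeZero.ne N)
  have := Fin.val_sub_one_of_ne_zero hi
  have h2 : (i : ℕ) ≠ 0 := fun e => hi (Fin.ext e)
  rw [this]
  omega

theorem val_zero_sub_one [NeZero N] : ((0 - 1 : Fin N) : ℕ) + 1 = N := by
  obtain ⟨n, rfl⟩ := Nat.exists_eq_succ_of_ne_zero (NeZero.ne N)
  rw [zero_sub, Fin.coe_neg_one]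

/-- The cyclic shift sends the last place to the first, so the pairs containing the last place are
reversed, and multiplication by z_0 reverses them back. The same multiplication shifts κ z_0 ∂_0 by
κ, whence the scalar. -/
theorem piM_dunklMid [NeZero N] (κ : ℂ) (s : Fin m → ℂ) (ξ : Fin N → ℂ) :
    piM m N * dunklMid κ s ξ =
      (dunklMid κ s (fun i => ξ (i - 1)) - (κ * ξ (0 - 1)) • 1) * piM m N := by
  have hinv : ∀ i : Fin N, (Equiv.addRight (1 : Fin N))⁻¹ i = i - 1 := by
    intro i
    rw [Equiv.Perm.inv_eq_iff_eq]
    exact (sub_add_cancel i 1).symm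
  rw [piM, mul_assoc, tauM_dunklMid, ← mul_assoc, ← mul_assoc]
  congr 1
  simp only [hinv]
  set z : Module.End ℂ (Mid m N) := op (zz (Pi.single 0 1)) 1 with hz
  -- In `Fin N` the element 0 - 1 is the last one. So j - 1 < k - 1 means j < k when both are
  -- nonzero, always holds for k = 0 ≠ j (the wrapped pairs), and never holds for j = 0.
  have h1 : ∀ j k : Fin N, z * (if j - 1 < k - 1 then (ξ (j - 1) - ξ (k - 1)) • xOp j k else 0) =
      (if j ≠ 0 then if j < k then (ξ (j - 1) - ξ (k - 1)) • xOp j k * z else 0 else 0)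
      + if k = 0 then if k < j then (ξ (k - 1) - ξ (j - 1)) • xOp k j * z else 0 else 0 := by
    intro j k
    by_cases hj : j = 0
    · subst hj
      have : ¬((0 - 1 : Fin N) < k - 1) := by
        rw [Fin.lt_def]
        have := val_zero_sub_one (N := N)
        omega
      rw [if_neg this, if_neg (not_not.2 rfl), mul_zero, zero_add]
      split_ifs with h1 h2
      · subst h1; exact absurd h2 (lt_irrefl _)
      · rfl
      · rfl
    · rw [if_pos hj]
      by_cases hk : k = 0
      · subst hk
        have h2 : (j - 1 : Fin N) < 0 - 1 := by
          rw [Fin.lt_def]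
          have := val_zero_sub_one (N := N)
          have := val_sub_one j hj
          omega
        have h3 : (0 : Fin N) < j := Fin.pos_iff_ne_zero.2 hj
        rw [if_pos h2, if_neg h3.not_gt, if_pos rfl, if_pos h3, zero_add, mul_smul_comm, hz,
          xOp_translate h3.ne, smul_neg, ← neg_smul, neg_sub, smul_mul_assoc]
      · rw [if_neg hk, add_zero]
        have h2 : (j - 1 : Fin N) < k - 1 ↔ j < k := by
          rw [Fin.lt_def, Fin.lt_def]
          have := val_sub_one k hk
          have := val_sub_one j hj
          omega
        simp only [h2]
        split_ifs with h3
        · rw [mul_smul_comm, hz, xOp_translate_of_ne h3.ne (Ne.symm hj) (Ne.symm hk), smul_mul_assoc]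
        · rw [mul_zero]
  have h2 : ∀ j k : Fin N, (if j ≠ 0 then if j < k then (ξ (j - 1) - ξ (k - 1)) • xOp j k * z
      else 0 else 0) + (if j = 0 then if j < k then (ξ (j - 1) - ξ (k - 1)) • xOp j k * z else 0
      else 0) = (if j < k then (ξ (j - 1) - ξ (k - 1)) • xOp j k else 0) * z := by
    intro j k
    by_cases hj : j = 0
    · rw [if_neg (not_not.2 hj), if_pos hj, zero_add, ite_mul, zero_mul]
    · rw [if_pos hj, if_neg hj, add_zero, ite_mul, zero_mul]
  have h3 : z * (∑ i, ξ (i - 1) • wtOp κ s i) =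
      ((∑ i, ξ (i - 1) • wtOp κ s i) - (κ * ξ (0 - 1)) • 1) * z := by
    rw [Finset.mul_sum]
    have : ∀ i : Fin N, z * ξ (i - 1) • wtOp κ s i =
        (ξ (i - 1) • wtOp κ s i - (if i = 0 then κ * ξ (0 - 1) else 0) • 1) * z := by
      intro i
      rw [mul_smul_comm, hz, op_wtOp, ← smul_mul_assoc, smul_sub, smul_smul]
      split_ifs with h
      · rw [h, mul_comm]
      · rw [mul_zero]
    rw [Finset.sum_congr rfl fun i _ => this i, ← Finset.sum_mul, Finset.sum_sub_distrib,
      ← Finset.sum_smul, Finset.sum_ite_eq', if_pos (Finset.mem_univ _)]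
  have h4 : z * (∑ j : Fin N, ∑ k : Fin N,
      if j - 1 < k - 1 then (ξ (j - 1) - ξ (k - 1)) • xOp j k else 0) =
      (∑ j : Fin N, ∑ k : Fin N, if j < k then (ξ (j - 1) - ξ (k - 1)) • xOp j k else 0) * z := by
    simp only [Finset.mul_sum, Finset.sum_mul, ← h2, h1, Finset.sum_add_distrib]
    congr 1
    rw [Finset.sum_comm]
  rw [mul_add, h3, h4, dunklMid]
  simp only [sub_mul, add_mul]
  abel

end

end KZ

/-! ### The extended affine Weyl group and its action on 𝔱' -/

namespace DDAHA
variable {N : ℕ}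

theorem act_mul (v w : W N) (ξ : T' N) : act (v * w) ξ = act v (act w ξ) := by
  refine Prod.ext rfl ?_
  change ξ.2 - ∑ i, (((v.left * permAut N v.right w.left).toAdd i : ℤ) : ℂ)
      * ξ.1 ((v.right * w.right)⁻¹ i) =
    ξ.2 - (∑ i, (w.left.toAdd i : ℂ) * ξ.1 (w.right⁻¹ i))
      - ∑ i, (v.left.toAdd i : ℂ) * ξ.1 (w.right⁻¹ (v.right⁻¹ i))
  have h : ∀ i, (v.left * permAut N v.right w.left).toAdd i =
      v.left.toAdd i + w.left.toAdd (v.right⁻¹ i) := fun i => rfl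
  have h2 : ∀ i, (v.right * w.right)⁻¹ i = w.right⁻¹ (v.right⁻¹ i) := fun i => by
    rw [mul_inv_rev, Equiv.Perm.mul_apply]
  simp only [h, h2, Int.cast_add, add_mul, Finset.sum_add_distrib]
  rw [Equiv.sum_comp v.right⁻¹ (fun i => (w.left.toAdd i : ℂ) * ξ.1 (w.right⁻¹ i))]
  ring

theorem act_one (ξ : T' N) : act (1 : W N) ξ = ξ := by
  refine Prod.ext rfl ?_
  change ξ.2 - ∑ i, (((0 : ℤ)) : ℂ) * _ = _
  simp

theorem act_ofPerm (w : Equiv.Perm (Fin N)) (ξ : T' N) :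
    act (ofPerm w) ξ = (fun i => ξ.1 (w⁻¹ i), ξ.2) := by
  refine Prod.ext rfl ?_
  change ξ.2 - ∑ i, (((0 : ℤ)) : ℂ) * _ = _
  simp

theorem act_piElt [NeZero N] (ξ : T' N) :
    act (piElt N) ξ = (fun i => ξ.1 (i - 1), ξ.2 - ξ.1 (0 - 1)) := by
  have h1 : ∀ i : Fin N, (Equiv.addRight (1 : Fin N))⁻¹ i = i - 1 := fun i => by
    rw [Equiv.Perm.inv_eq_iff_eq]
    exact (sub_add_cancel i 1).symm
  have hr : (piElt N).right = Equiv.addRight 1 := one_mul _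
  have hl : (piElt N).left.toAdd = Pi.single 0 1 := by
    change Pi.single 0 1 + permLattice 1 0 = Pi.single 0 1
    rw [map_zero, add_zero]
  rw [act, hr, hl]
  simp only [h1]
  congr 2
  rw [Finset.sum_eq_single 0]
  · simp
  · intro b _ hb
    simp [Pi.single_eq_of_ne hb]
  · simp

/-- The affine reflection is conjugate under π to the last finite one, so its cross relation will
follow from that one and from the relation for π. -/
theorem simpleRefl_zero_mul_piElt [NeZero N] (h : (0 - 1 : Fin N) ≠ 0) :
    simpleRefl 0 * piElt N = piElt N * simpleRefl (0 - 1) := by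
  have h0 : Equiv.swap (0 - 1 : Fin N) 0 * Equiv.addRight 1 =
      Equiv.addRight 1 * Equiv.swap (0 - 1 - 1) (0 - 1) := by
    rw [Equiv.mul_swap_eq_swap_mul]
    simp
  rw [simpleRefl, if_pos rfl, simpleRefl, if_neg h, piElt]
  apply SemidirectProduct.ext
  · apply Multiplicative.toAdd.injective
    change (Pi.single 0 1 - Pi.single (0 - 1) 1) + permLattice 1 0
      + permLattice (1 * Equiv.swap (0 - 1) 0) (Pi.single 0 1 + permLattice 1 0) =
      Pi.single 0 1 + permLattice 1 0 + permLattice (1 * Equiv.addRight 1) 0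
    rw [map_zero, map_zero, add_zero, add_zero, add_zero, one_mul, KZ.permLattice_single,
      Equiv.swap_apply_right, sub_add_cancel]
  · change (1 * Equiv.swap (0 - 1) 0) * (1 * Equiv.addRight 1) =
      (1 * Equiv.addRight 1) * Equiv.swap (0 - 1 - 1) (0 - 1)
    rw [one_mul, one_mul, h0]

theorem simpleRoot_piElt [NeZero N] (ξ : T' N) (i : Fin N) :
    simpleRoot i (act (piElt N) ξ) = simpleRoot (i - 1) ξ := by
  rw [act_piElt]
  rfl

/-- The degenerate case N = 1, where s_0 is trivial and α_0 vanishes. -/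
theorem simpleRefl_zero_eq_one [NeZero N] (h : (0 - 1 : Fin N) = 0) :
    simpleRefl (0 : Fin N) = 1 := by
  rw [simpleRefl, if_pos rfl, h, sub_self, Equiv.swap_self]
  exact mul_one _

theorem eq_transl_mul_ofPerm (w : W N) : w = transl w.left.toAdd * ofPerm w.right :=
  (SemidirectProduct.inl_left_mul_inr_right w).symm

theorem transl_add (v w : Fin N → ℤ) : transl (v + w) = transl v * transl w :=
  map_mul (SemidirectProduct.inl : _ →* W N) _ _

theorem ofPerm_mul_transl (w : Equiv.Perm (Fin N)) (η : Fin N → ℤ) :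
    ofPerm w * transl η * (ofPerm w)⁻¹ = transl (permLattice w η) := by
  exact (SemidirectProduct.inl_aut (φ := permAut N) w (Multiplicative.ofAdd η)).symm

/-- The group `W` is generated by the transpositions `s_i` and `π`. -/
theorem W_induction [NeZero N] (G : Subgroup (W N)) (hπ : piElt N ∈ G)
    (hs : ∀ i : Fin N, i ≠ 0 → ofPerm (Equiv.swap (i - 1) i) ∈ G) (w : W N) : w ∈ G := by
  have h1 : ∀ w : Equiv.Perm (Fin N), ofPerm w ∈ G := by
    obtain ⟨n, rfl⟩ := Nat.exists_eq_succ_of_ne_zero (NeZero.ne N)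
    intro w
    have h : Submonoid.closure (Set.range fun i : Fin n => Equiv.swap i.castSucc i.succ) ≤
        (G.comap (SemidirectProduct.inr : _ →* W (n + 1))).toSubmonoid := by
      rw [Submonoid.closure_le]
      rintro _ ⟨i, rfl⟩
      have := hs i.succ (Fin.succ_ne_zero i)
      have h2 : i.succ - 1 = i.castSucc := by
        rw [sub_eq_iff_eq_add, Fin.coeSucc_eq_succ]
      rwa [h2] at this
    rw [Equiv.Perm.mclosure_swap_castSucc_succ] at h
    exact h (Submonoid.mem_top w)
  -- Translation by ε_0 is π times the inverse of the cycle; its conjugates under transpositions are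
  -- the other basic translations.
  have h2 : ∀ i : Fin N, transl (Pi.single i 1) ∈ G := by
    intro i
    have h0 : transl (Pi.single (0 : Fin N) 1) ∈ G := by
      have := G.mul_mem hπ (G.inv_mem (h1 (Equiv.addRight 1)))
      rwa [piElt, mul_inv_cancel_right] at this
    have := G.mul_mem (G.mul_mem (h1 (Equiv.swap 0 i)) h0) (G.inv_mem (h1 (Equiv.swap 0 i)))
    rwa [ofPerm_mul_transl, KZ.permLattice_single, Equiv.swap_apply_left] at this
  have h3 : ∀ η : Fin N → ℤ, transl η ∈ G := by
    intro η
    rw [pi_eq_sum_univ' η]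
    let φ : (Fin N → ℤ) →+ Additive (W N) :=
      AddMonoidHom.mk' (fun η => Additive.ofMul (transl η)) transl_add
    have : ∀ s : Finset (Fin N), ∀ f : Fin N → Fin N → ℤ, (∀ i, transl (f i) ∈ G) →
        transl (∑ i ∈ s, f i) ∈ G := by
      intro s f hf
      induction s using Finset.induction_on with
      | empty => exact G.one_mem
      | insert a s ha ih =>
        rw [Finset.sum_insert ha, transl_add]
        exact G.mul_mem (hf a) ih
    refine this _ _ fun i => ?_
    have e : transl (η i • (Pi.single i 1 : Fin N → ℤ)) = transl (Pi.single i 1) ^ η i :=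
      map_zsmul φ (η i) _
    rw [e]
    exact G.zpow_mem (h2 i) _
  rw [eq_transl_mul_ofPerm w]
  exact G.mul_mem (h3 _) (h1 _)

end DDAHA

namespace KZ
open AffineSl DDAHA
variable {m N : ℕ}

section
attribute [local instance] vnGroup midGroup midAddGroup

/-! ### The action of the Weyl group -/

/-- The action of `W` on the middle factor. -/
def wMid (w : W N) : Module.End ℂ (Mid m N) := op (zz w.left.toAdd) 1 * tauM w.right

theorem wMid_eb (w : W N) (η : Fin N → ℤ) (c : Fin N → Fin m) :
    wMid w (eb η c) = eb (w.left.toAdd + permLattice w.right η) fun i => c (w.right⁻¹ i) := by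
  rw [wMid, Module.End.mul_apply, tauM_eb, op_eb, Module.End.one_apply, eb]

theorem wMid_mul (v w : W N) : wMid (m := m) (v * w) = wMid v * wMid w := by
  apply mid_ext
  intro η c
  rw [Module.End.mul_apply, wMid_eb, wMid_eb, wMid_eb, map_add, ← add_assoc]
  rfl

theorem wMid_one : wMid (m := m) (1 : W N) = 1 := by
  apply mid_ext
  intro η c
  rw [wMid_eb, Module.End.one_apply]
  change eb (0 + η) c = eb η c
  rw [zero_add]

theorem wMid_ofPerm (w : Equiv.Perm (Fin N)) : wMid (m := m) (ofPerm w) = tauM w := by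
  apply mid_ext
  intro η c
  rw [wMid_eb, tauM_eb]
  change eb (0 + permLattice w η) _ = _
  rw [zero_add]
  rfl

theorem wMid_transl (η : Fin N → ℤ) : wMid (m := m) (transl η) = op (zz η) 1 := by
  apply mid_ext
  intro η' c
  rw [wMid_eb, op_eb]
  rfl

theorem wMid_piElt [NeZero N] : wMid (piElt N) = piM m N := by
  rw [piElt, wMid_mul, wMid_transl, wMid_ofPerm, piM]

theorem tauM_op (w : Equiv.Perm (Fin N)) (θ : Fin N → ℤ) {s t : Module.End ℂ (VN m N)}
    (h : tau2 m w * s = t * tau2 m w) :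
    tauM w * op (zz θ) s = op (zz (permLattice w θ)) t * tauM w := by
  apply mid_ext
  intro η c
  rw [Module.End.mul_apply, Module.End.mul_apply, op_eb, tauM_eb, op_eb, tauM,
    TensorProduct.map_tmul, tau1_zz, map_add, ← tau2_vb, ← Module.End.mul_apply, h,
    Module.End.mul_apply]

theorem tauM_thetaEval (w : Equiv.Perm (Fin N)) (i : Fin N) {x : AffineSl m} (hx : coD x = 0) :
    tauM w * thetaEval i x = thetaEval (w i) x * tauM w := by
  have hr := fun i => isRep_thetaEval (m := m) (N := N) i
  -- Subtracting the d-component makes the statement linear in x, so that it can be checked on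
  -- spanning elements.
  have key : ∀ x : AffineSl m, tauM w * thetaEval i (x - coD x • deg) =
      thetaEval (w i) (x - coD x • deg) * tauM w := by
    intro x
    induction x using induction_E with
    | hE a b n =>
      rw [coD_E, zero_smul, sub_zero, thetaEval_E, thetaEval_E, mul_sub, sub_mul, mul_smul_comm,
        smul_mul_assoc, tauM_op w _ (tau2_slotE w i a b), tauM_op w _ (one_mul _).symm,
        permLattice_single]
    | hc => rw [coD_cen, zero_smul, sub_zero, thetaEval_cen, thetaEval_cen, mul_zero, zero_mul]
    | hd =>
      rw [coD_deg, one_smul, sub_self, (hr _).zero, (hr _).zero, mul_zero, zero_mul]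
    | hadd x y hx hy =>
      rw [map_add, add_smul, add_sub_add_comm, (hr _).add, (hr _).add, mul_add, add_mul, hx, hy]
    | hsmul r x hx =>
      rw [map_smul, smul_assoc, ← smul_sub, (hr _).smul, (hr _).smul, mul_smul_comm,
        smul_mul_assoc, hx]
  have := key x
  rwa [hx, zero_smul, sub_zero] at this

theorem op_thetaEval (θ : Fin N → ℤ) (i : Fin N) {x : AffineSl m} (hx : coD x = 0) :
    op (zz θ) 1 * thetaEval i x = thetaEval i x * op (zz θ) 1 := by
  rw [thetaEval_eq, hx, zero_smul, add_zero, thetaMat, Finset.mul_sum, Finset.sum_mul]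
  refine Finset.sum_congr rfl fun a _ => ?_
  rw [Finset.mul_sum, Finset.sum_mul]
  refine Finset.sum_congr rfl fun b _ => ?_
  rw [op_mul, op_mul, mul_comm, one_mul, mul_one]

/-- Permutations only reorder the sum over places, and multiplication by monomials commutes with
everything except z_i ∂_i. The latter is excluded by `hx`, which is why coinvariants are taken for
𝔤' and not for 𝔤. -/
theorem wMid_sum_thetaEval (w : W N) {x : AffineSl m} (hx : coD x = 0) :
    wMid w * ∑ i, thetaEval i x = (∑ i, thetaEval i x) * wMid w := by
  rw [wMid, mul_assoc]
  have h : tauM w.right * ∑ i, thetaEval i x = (∑ i, thetaEval i x) * tauM w.right := by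
    rw [Finset.mul_sum, Finset.sum_mul, ← Equiv.sum_comp w.right fun i => thetaEval i x * tauM w.right]
    exact Finset.sum_congr rfl fun i _ => tauM_thetaEval _ _ hx
  rw [h, ← mul_assoc, ← mul_assoc]
  congr 1
  rw [Finset.mul_sum, Finset.sum_mul]
  exact Finset.sum_congr rfl fun i _ => op_thetaEval _ _ hx

section

variable (lam mu : Weight m)

theorem liftMid_mem_gPrimeNum (hm : 2 ≤ m) {T : Module.End ℂ (Mid m N)}
    (hT : ∀ x : AffineSl m, coD x = 0 → T * (∑ i, thetaEval i x) = (∑ i, thetaEval i x) * T) :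
    gPrimeNum m N (Verma mu) (LowestVerma lam) ≤
      (gPrimeNum m N (Verma mu) (LowestVerma lam)).comap
        (liftMid (Verma mu) (LowestVerma lam) T) := by
  rw [gPrimeNum, Submodule.span_le]
  rintro _ ⟨x, hx, y, rfl⟩
  have hx' := (mem_derived_iff hm x).1 hx
  refine Submodule.subset_span ⟨x, hx, liftMid (Verma mu) (LowestVerma lam) T y, ?_⟩
  have h : ∑ i : Fin N, thetaI (Verma mu) (LowestVerma lam) i x =
      liftMid (Verma mu) (LowestVerma lam) (∑ i, thetaEval i x) := by
    rw [map_sum]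
    rfl
  have : liftMid (Verma mu) (LowestVerma lam) T * theta (Verma mu) (LowestVerma lam) x =
      theta (Verma mu) (LowestVerma lam) x * liftMid (Verma mu) (LowestVerma lam) T := by
    rw [theta, h, thetaA_eq, thetaB_eq, mul_add, mul_add, add_mul, add_mul, liftA_comm_liftMid,
      liftMid_comm_liftB, ← map_mul, hT x hx', map_mul]
  exact LinearMap.congr_fun this y

/-- The action of `W` on the quotient. -/
def wF (hm : 2 ≤ m) (w : W N) : Module.End ℂ (StdModule N lam mu) :=
  Submodule.mapQ _ _ (liftMid (Verma mu) (LowestVerma lam) (wMid w))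
    (liftMid_mem_gPrimeNum lam mu hm fun _ hx => wMid_sum_thetaEval w hx)

/-- The Dunkl operators on the quotient. -/
def dF (hm : 2 ≤ m) (ξ : Fin N → ℂ) : Module.End ℂ (StdModule N lam mu) :=
  Submodule.mapQ _ _ (dunklLau (Verma mu) (LowestVerma lam) ξ)
    fun _ hy => dunklLau_mem_gPrimeNum _ _ hm (locFin_verma_left lam mu)
      (locFin_verma_right lam mu) ξ hy

variable {lam mu}

theorem wF_vacMap (hm : 2 ≤ m) (w : W N) (y : Mid m N) :
    wF lam mu hm w (vacMap lam mu y) = vacMap lam mu (wMid w y) := rfl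

theorem dF_vacMap (hm : 2 ≤ m) {lev : ℂ} (hlam : lam cenH = lev) (hmu : mu cenH = lev)
    (ξ : Fin N → ℂ) (y : Mid m N) : dF lam mu hm ξ (vacMap lam mu y) =
      vacMap lam mu (dunklMid (lev + m) (vacW lam mu) ξ y) :=
  congrArg (Submodule.mkQ _) (dunklLau_vacNum lam mu hlam hmu ξ y)

/-- Relations between operators on the quotient thus follow from relations on the middle factor. -/
theorem end_ext (hm : 2 ≤ m) {S T : Module.End ℂ (StdModule N lam mu)}
    (h : ∀ y, S (vacMap lam mu y) = T (vacMap lam mu y)) : S = T := by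
  refine LinearMap.ext fun z => ?_
  obtain ⟨y, rfl⟩ := vacMap_surjective lam mu hm z
  exact h y

theorem wF_mul (hm : 2 ≤ m) (v w : W N) : wF lam mu hm (v * w) = wF lam mu hm v * wF lam mu hm w :=
  end_ext hm fun y => by
    rw [Module.End.mul_apply, wF_vacMap, wF_vacMap, wF_vacMap, wMid_mul, Module.End.mul_apply]

theorem wF_one (hm : 2 ≤ m) : wF lam mu hm (1 : W N) = 1 :=
  end_ext hm fun y => by
    rw [wF_vacMap, wMid_one, Module.End.one_apply, Module.End.one_apply]

theorem dunklMid_add (κ : ℂ) (s : Fin m → ℂ) (ξ ξ' : Fin N → ℂ) :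
    dunklMid κ s (ξ + ξ') = dunklMid κ s ξ + dunklMid κ s ξ' := by
  simp only [dunklMid, Pi.add_apply, add_smul, Finset.sum_add_distrib]
  rw [add_add_add_comm]
  congr 1
  rw [← Finset.sum_add_distrib]
  refine Finset.sum_congr rfl fun j _ => ?_
  rw [← Finset.sum_add_distrib]
  refine Finset.sum_congr rfl fun k _ => ?_
  split_ifs
  · rw [add_sub_add_comm, add_smul]
  · rw [add_zero]

theorem dunklMid_smul (κ : ℂ) (s : Fin m → ℂ) (r : ℂ) (ξ : Fin N → ℂ) :
    dunklMid κ s (r • ξ) = r • dunklMid κ s ξ := by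
  simp only [dunklMid, Pi.smul_apply, smul_add, Finset.smul_sum, smul_assoc]
  congr 1
  refine Finset.sum_congr rfl fun j _ => Finset.sum_congr rfl fun k _ => ?_
  split_ifs
  · rw [← smul_sub, smul_assoc]
  · rw [smul_zero]

section

variable (hm : 2 ≤ m) {lev : ℂ} (hlam : lam cenH = lev) (hmu : mu cenH = lev)
include hlam hmu

theorem dF_add (ξ ξ' : Fin N → ℂ) : dF lam mu hm (ξ + ξ') = dF lam mu hm ξ + dF lam mu hm ξ' :=
  end_ext hm fun y => by
    rw [LinearMap.add_apply, dF_vacMap hm hlam hmu, dF_vacMap hm hlam hmu, dF_vacMap hm hlam hmu,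
      dunklMid_add, LinearMap.add_apply, map_add]

theorem dF_smul (r : ℂ) (ξ : Fin N → ℂ) : dF lam mu hm (r • ξ) = r • dF lam mu hm ξ :=
  end_ext hm fun y => by
    rw [LinearMap.smul_apply, dF_vacMap hm hlam hmu, dF_vacMap hm hlam hmu,
      dunklMid_smul, LinearMap.smul_apply, map_smul]

theorem wF_swap_dF {a b : Fin N} (hab : (a : ℕ) + 1 = b) (ξ : Fin N → ℂ) :
    wF lam mu hm (ofPerm (Equiv.swap a b)) * dF lam mu hm ξ =
      dF lam mu hm (fun i => ξ (Equiv.swap a b i)) * wF lam mu hm (ofPerm (Equiv.swap a b))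
        - (ξ a - ξ b) • 1 :=
  end_ext hm fun y => by
    rw [Module.End.mul_apply, dF_vacMap hm hlam hmu, wF_vacMap, LinearMap.sub_apply,
      Module.End.mul_apply, wF_vacMap, dF_vacMap hm hlam hmu, LinearMap.smul_apply,
      Module.End.one_apply, wMid_ofPerm, ← Module.End.mul_apply, tauM_swap_dunklMid _ _ hab,
      LinearMap.sub_apply, map_sub, Module.End.mul_apply, LinearMap.smul_apply, map_smul,
      Module.End.one_apply]

theorem wF_piElt_dF [NeZero N] (ξ : Fin N → ℂ) :
    wF lam mu hm (piElt N) * dF lam mu hm ξ =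
      (dF lam mu hm (fun i => ξ (i - 1)) - ((lev + m) * ξ (0 - 1)) • 1)
        * wF lam mu hm (piElt N) :=
  end_ext hm fun y => by
    rw [Module.End.mul_apply, dF_vacMap hm hlam hmu, wF_vacMap,
      Module.End.mul_apply, wF_vacMap, LinearMap.sub_apply, dF_vacMap hm hlam hmu,
      LinearMap.smul_apply, Module.End.one_apply, wMid_piElt, ← Module.End.mul_apply, piM_dunklMid,
      Module.End.mul_apply, LinearMap.sub_apply, map_sub, LinearMap.smul_apply, map_smul,
      Module.End.one_apply]

end

end

end

end KZ

namespace KZ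
open AffineSl DDAHA
variable {m N : ℕ}

section
attribute [local instance] vnGroup midGroup midAddGroup

/-! ### Contents of words -/

theorem exists_monotone_word {β : Fin m → ℕ} (hβ : ∑ a, β a = N) :
    ∃ c : Fin N → Fin m, Monotone c ∧ ∀ a, (Finset.univ.filter fun i => c i = a).card = β a := by
  let e : (Σ a : Fin m, Fin (β a)) ≃ Fin N := finSigmaFinEquiv.trans (finCongr hβ)
  let c : Fin N → Fin m := fun i => (e.symm i).1
  refine ⟨c ∘ Tuple.sort c, Tuple.monotone_sort c, fun a => ?_⟩
  have h1 : (Finset.univ.filter fun i => (c ∘ Tuple.sort c) i = a).card =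
      (Finset.univ.filter fun i => c i = a).card := by
    refine Finset.card_equiv (Tuple.sort c) fun i => ?_
    simp
  have h2 : (Finset.univ.filter fun i => c i = a).card =
      (Finset.univ.filter fun p : Σ a : Fin m, Fin (β a) => p.1 = a).card := by
    refine Finset.card_equiv e.symm fun i => ?_
    simp [c]
  rw [h1, h2, ← Fintype.card_subtype, Fintype.card_congr (Equiv.sigmaSubtype a),
    Fintype.card_fin]

theorem exists_perm_of_card_eq {c c' : Fin N → Fin m}
    (h : ∀ a, (Finset.univ.filter fun i => c i = a).card =
      (Finset.univ.filter fun i => c' i = a).card) :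
    ∃ w : Equiv.Perm (Fin N), ∀ i, c' (w i) = c i := by
  have e : ∀ a, {i // c i = a} ≃ {i // c' i = a} := fun a => by
    refine Fintype.equivOfCardEq ?_
    rw [Fintype.card_subtype, Fintype.card_subtype, h]
  exact ⟨Equiv.ofFiberEquiv e, Equiv.ofFiberEquiv_map e⟩

theorem wF_eb {lam mu : Weight m} (hm : 2 ≤ m) {c c' : Fin N → Fin m}
    {w : Equiv.Perm (Fin N)} (h : ∀ i, c' (w i) = c i) (η : Fin N → ℤ) :
    wF lam mu hm (transl η * ofPerm w⁻¹) (vacMap lam mu (eb 0 c')) = vacMap lam mu (eb η c) := by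
  rw [wF_vacMap, wMid_mul, Module.End.mul_apply, wMid_ofPerm, tauM_eb, wMid_transl, op_eb,
    Module.End.one_apply, map_zero, add_zero, eb]
  simp only [inv_inv, h]

/-- At exponent zero the divided difference vanishes, and for an increasing word the r-matrix
exchanges nothing: its weight is 0 for distinct colours and 1/2 for equal ones. -/
theorem xOp_monotone {j k : Fin N} (hjk : j < k) {c : Fin N → Fin m} (hc : Monotone c) :
    xOp j k (eb 0 c) = (if c j = c k then -(1 / 2 : ℂ) else 0) • eb 0 c := by
  rw [xOp_eb hjk.ne, divDiffFun, if_pos (by simp), rWt]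
  simp only [Pi.zero_apply, sub_self, Int.toNat_zero, Finset.range_zero, Finset.sum_empty,
    TensorProduct.zero_tmul, zero_sub]
  rw [if_neg (hc hjk.le).not_gt]
  by_cases h : c j = c k
  · have : (fun i => c (Equiv.swap j k i)) = c := by
      funext i
      rw [Equiv.swap_apply_def]
      split_ifs with h1 h2
      · rw [h1, h]
      · rw [h2, h]
      · rfl
    rw [if_pos h.symm, if_pos h, this]
    exact (neg_smul _ _).symm
  · have e : ∀ x : Mid m N, (0 : ℂ) • x = 0 := fun x => zero_smul ℂ x
    rw [if_neg (Ne.symm h), if_neg h, e, e]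
    exact neg_zero

theorem exists_dunklMid_eb (κ : ℂ) (s : Fin m → ℂ) (ξ : Fin N → ℂ) {c : Fin N → Fin m}
    (hc : Monotone c) : ∃ r : ℂ, dunklMid κ s ξ (eb 0 c) = r • eb 0 c := by
  refine ⟨(∑ i, ξ i * s (c i)) + ∑ j, ∑ k, if j < k then
    (ξ j - ξ k) * (if c j = c k then -(1 / 2 : ℂ) else 0) else 0, ?_⟩
  simp only [dunklMid, LinearMap.add_apply, LinearMap.sum_apply, add_smul, Finset.sum_smul]
  congr 1
  · refine Finset.sum_congr rfl fun i _ => ?_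
    rw [LinearMap.smul_apply, wtOp_eb, smul_smul, Pi.zero_apply, Int.cast_zero, mul_zero, zero_add]
  · refine Finset.sum_congr rfl fun j _ => Finset.sum_congr rfl fun k _ => ?_
    split_ifs with h h2
    · rw [LinearMap.smul_apply, xOp_monotone h hc, if_pos h2, smul_smul]
    · rw [LinearMap.smul_apply, xOp_monotone h hc, if_neg ‹_›, smul_smul]
    · rw [LinearMap.zero_apply, zero_smul]

/-! ### Commutativity of the Dunkl operators -/

section

variable {lam mu : Weight m} (hm : 2 ≤ m) {lev : ℂ} (hlam : lam cenH = lev) (hmu : mu cenH = lev)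
include hlam hmu

/-- The scalar terms of the cross relation drop out of the commutator, because D_ξ and D_{sξ} differ
by a multiple of one operator, the Dunkl operator of the simple coroot. No commutativity is assumed.
-/
theorem wF_swap_comm [NeZero N] {a b : Fin N} (hab : (a : ℕ) + 1 = b) (ξ ξ' : Fin N → ℂ) :
    wF lam mu hm (ofPerm (Equiv.swap a b)) *
        (dF lam mu hm ξ * dF lam mu hm ξ' - dF lam mu hm ξ' * dF lam mu hm ξ) =
      (dF lam mu hm (fun i => ξ (Equiv.swap a b i)) * dF lam mu hm (fun i => ξ' (Equiv.swap a b i))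
        - dF lam mu hm (fun i => ξ' (Equiv.swap a b i))
          * dF lam mu hm (fun i => ξ (Equiv.swap a b i)))
        * wF lam mu hm (ofPerm (Equiv.swap a b)) := by
  have h1 := wF_swap_dF hm hlam hmu hab
  have h2 : ∀ ξ : Fin N → ℂ, dF lam mu hm ξ = dF lam mu hm (fun i => ξ (Equiv.swap a b i))
      + (ξ a - ξ b) • dF lam mu hm (Pi.single a 1 - Pi.single b 1) := by
    intro ξ
    have hne : a ≠ b := fun e => by rw [e] at hab; omega
    rw [← dF_smul hm hlam hmu, ← dF_add hm hlam hmu]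
    congr 1
    funext i
    simp only [Pi.add_apply, Pi.smul_apply, Pi.sub_apply, Pi.single_apply, smul_eq_mul]
    by_cases hia : i = a
    · subst hia
      rw [Equiv.swap_apply_left, if_pos rfl, if_neg hne]
      ring
    · by_cases hib : i = b
      · subst hib
        rw [Equiv.swap_apply_right, if_pos rfl, if_neg hia]
        ring
      · rw [Equiv.swap_apply_of_ne_of_ne hia hib, if_neg hia, if_neg hib]
        ring
  have e1 := h2 ξ
  have e2 := h2 ξ'
  have hs1 := h1 ξ
  have hs2 := h1 ξ'
  generalize dF lam mu hm (fun i => ξ (Equiv.swap a b i)) = X at *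
  generalize dF lam mu hm (fun i => ξ' (Equiv.swap a b i)) = X' at *
  generalize dF lam mu hm (Pi.single a 1 - Pi.single b 1) = A at *
  generalize wF lam mu hm (ofPerm (Equiv.swap a b)) = S at *
  generalize dF lam mu hm ξ = Y at *
  generalize dF lam mu hm ξ' = Y' at *
  rw [mul_sub, ← mul_assoc, ← mul_assoc, hs1, hs2, sub_mul, sub_mul, mul_assoc, mul_assoc, hs1, hs2,
    sub_mul, mul_sub, mul_sub, e1, e2, mul_assoc, mul_assoc]
  simp only [smul_mul_assoc, mul_smul_comm, one_mul, mul_one, smul_add, smul_smul]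
  module

theorem wF_piElt_comm [NeZero N] (ξ ξ' : Fin N → ℂ) :
    wF lam mu hm (piElt N) *
        (dF lam mu hm ξ * dF lam mu hm ξ' - dF lam mu hm ξ' * dF lam mu hm ξ) =
      (dF lam mu hm (fun i => ξ (i - 1)) * dF lam mu hm (fun i => ξ' (i - 1))
        - dF lam mu hm (fun i => ξ' (i - 1)) * dF lam mu hm (fun i => ξ (i - 1)))
        * wF lam mu hm (piElt N) := by
  rw [mul_sub, ← mul_assoc, ← mul_assoc, wF_piElt_dF hm hlam hmu, wF_piElt_dF hm hlam hmu,
    mul_assoc, mul_assoc, wF_piElt_dF hm hlam hmu, wF_piElt_dF hm hlam hmu, ← mul_assoc,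
    ← mul_assoc, ← sub_mul]
  congr 1
  simp only [mul_sub, sub_mul, smul_mul_assoc, mul_smul_comm, one_mul, mul_one, smul_sub, smul_smul]
  module

/-- The joint kernel of the commutators of the Dunkl operators. -/
def commKer (lam mu : Weight m) (N : ℕ) (hm : 2 ≤ m) : Submodule ℂ (StdModule N lam mu) :=
  ⨅ ξ, ⨅ ξ', LinearMap.ker
    (dF lam mu hm ξ * dF lam mu hm ξ' - dF lam mu hm ξ' * dF lam mu hm ξ)

omit hlam hmu in
theorem mem_commKer {y : StdModule N lam mu} : y ∈ commKer lam mu N hm ↔ ∀ ξ ξ',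
    (dF lam mu hm ξ * dF lam mu hm ξ' - dF lam mu hm ξ' * dF lam mu hm ξ :
      Module.End ℂ (StdModule N lam mu)) y = 0 := by
  simp only [commKer, Submodule.mem_iInf, LinearMap.mem_ker]

omit hlam hmu in
theorem wF_mul_apply (v w : W N) (y : StdModule N lam mu) :
    wF lam mu hm (v * w) y = wF lam mu hm v (wF lam mu hm w y) := by
  rw [wF_mul, Module.End.mul_apply]

omit hlam hmu in
theorem wF_inv_apply (w : W N) (y : StdModule N lam mu) :
    wF lam mu hm w⁻¹ (wF lam mu hm w y) = y := by
  rw [← wF_mul_apply, inv_mul_cancel, wF_one, Module.End.one_apply]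

omit hlam hmu in
theorem wF_apply_inv (w : W N) (y : StdModule N lam mu) :
    wF lam mu hm w (wF lam mu hm w⁻¹ y) = y := by
  rw [← wF_mul_apply, mul_inv_cancel, wF_one, Module.End.one_apply]

/-- A generator of W carries the commutator for ξ, ξ' to the commutator for the transformed pair,
and every pair arises this way. It is therefore enough to know this for the generators in
`W_induction`. -/
theorem wF_mem_commKer_iff [NeZero N] (w : W N) (y : StdModule N lam mu) :
    wF lam mu hm w y ∈ commKer lam mu N hm ↔ y ∈ commKer lam mu N hm := by
  let G : Subgroup (W N) :=
    { carrier := {w | ∀ y, wF lam mu hm w y ∈ commKer lam mu N hm ↔ y ∈ commKer lam mu N hm}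
      mul_mem' := fun {v w} hv hw y => by rw [wF_mul_apply, hv, hw]
      one_mem' := fun y => by rw [wF_one, Module.End.one_apply]
      inv_mem' := fun {w} hw y => by rw [← hw, wF_apply_inv] }
  have main : ∀ w : W N, ∀ f : (Fin N → ℂ) → (Fin N → ℂ), Function.Surjective f → (∀ ξ ξ', wF lam mu hm w *
        (dF lam mu hm ξ * dF lam mu hm ξ' - dF lam mu hm ξ' * dF lam mu hm ξ) =
      (dF lam mu hm (f ξ) * dF lam mu hm (f ξ') - dF lam mu hm (f ξ') * dF lam mu hm (f ξ))
        * wF lam mu hm w) → w ∈ G := by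
    intro w f hsurj hf y
    rw [mem_commKer, mem_commKer]
    constructor
    · intro h ξ ξ'
      have := LinearMap.congr_fun (hf ξ ξ') y
      rw [Module.End.mul_apply, Module.End.mul_apply, h] at this
      rw [← wF_inv_apply hm w ((_ : Module.End ℂ _) y), this, map_zero]
    · intro h ξ ξ'
      obtain ⟨ξ, rfl⟩ := hsurj ξ
      obtain ⟨ξ', rfl⟩ := hsurj ξ'
      have := LinearMap.congr_fun (hf ξ ξ') y
      rw [Module.End.mul_apply, Module.End.mul_apply, h, map_zero] at this
      exact this.symm
  refine W_induction G ?_ ?_ w y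
  · refine main _ (fun ξ i => ξ (i - 1)) (fun ξ => ⟨fun i => ξ (i + 1), ?_⟩)
      fun ξ ξ' => wF_piElt_comm hm hlam hmu ξ ξ'
    funext i
    exact congrArg ξ (sub_add_cancel i 1)
  · intro i hi
    refine main _ (fun ξ j => ξ (Equiv.swap (i - 1) i j))
      (fun ξ => ⟨fun j => ξ (Equiv.swap (i - 1) i j), ?_⟩)
      fun ξ ξ' => wF_swap_comm hm hlam hmu (val_sub_one i hi) ξ ξ'
    funext j
    exact congrArg ξ (Equiv.swap_apply_self _ _ j)

/-- The increasing word of content β at exponent zero gives a joint eigenvector, on which all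
commutators vanish. Its W-translates include every z^η u_c with c of content β, and words of other
content give zero, so the commutators vanish everywhere. -/
theorem dF_comm [NeZero N] (hwt : IsTensorPowerWeight N (lam - mu)) (ξ ξ' : Fin N → ℂ) :
    dF lam mu hm ξ * dF lam mu hm ξ' = dF lam mu hm ξ' * dF lam mu hm ξ := by
  obtain ⟨β, hβ, hw⟩ := hwt
  have hw' := weight_diagH hβ hw
  obtain ⟨c, hc, hcβ⟩ := exists_monotone_word hβ
  have h0 : vacMap lam mu (eb 0 c) ∈ commKer lam mu N hm := by
    rw [mem_commKer]
    intro ξ ξ'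
    have hv : ∀ ξ, ∃ r : ℂ, dF lam mu hm ξ (vacMap lam mu (eb 0 c)) = r • vacMap lam mu (eb 0 c) := by
      intro ξ
      obtain ⟨r, hr⟩ := exists_dunklMid_eb (lev + m) (vacW lam mu) ξ hc
      exact ⟨r, by rw [dF_vacMap hm hlam hmu, hr, map_smul]⟩
    obtain ⟨r, hr⟩ := hv ξ
    obtain ⟨r', hr'⟩ := hv ξ'
    rw [LinearMap.sub_apply, Module.End.mul_apply, Module.End.mul_apply, hr, hr', map_smul,
      map_smul, hr, hr', smul_smul, smul_smul, mul_comm, sub_self]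
  have h1 : ∀ y : Mid m N, vacMap lam mu y ∈ commKer lam mu N hm := by
    intro y
    have hy : y ∈ Submodule.span ℂ {x : Mid m N | ∃ η c, x = eb η c} := by
      rw [span_eb]; trivial
    induction hy using Submodule.span_induction with
    | mem x h =>
      obtain ⟨η, c', rfl⟩ := h
      by_cases hcc : ∀ a, (Finset.univ.filter fun i => c' i = a).card = β a
      · obtain ⟨w, hw⟩ := exists_perm_of_card_eq (c := c') (c' := c) fun a => by rw [hcc, hcβ]
        rw [← wF_eb hm hw, wF_mem_commKer_iff hm hlam hmu]
        exact h0
      · push Not at hcc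
        obtain ⟨a, ha⟩ := hcc
        rw [vacMap_eb_eq_zero hm hw' η c' ha]
        exact Submodule.zero_mem _
    | zero => rw [map_zero]; exact Submodule.zero_mem _
    | add x y _ _ hx hy => rw [map_add]; exact Submodule.add_mem _ hx hy
    | smul r x _ hx => rw [map_smul]; exact Submodule.smul_mem _ _ hx
  refine end_ext hm fun y => ?_
  have := (mem_commKer hm).1 (h1 y) ξ ξ'
  rwa [LinearMap.sub_apply, sub_eq_zero] at this

end

end

end KZ

namespace KZ
open AffineSl DDAHA
variable {m N : ℕ}

/-! ### The action of the degenerate double affine Hecke algebra -/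

section

variable {lam mu : Weight m} (hm : 2 ≤ m) {lev : ℂ} (hlam : lam cenH = lev) (hmu : mu cenH = lev)

/-- The action of `𝔱'` on the quotient. -/
def tF (lam mu : Weight m) (hm : 2 ≤ m) (lev : ℂ) (ξ : T' N) :
    Module.End ℂ (StdModule N lam mu) :=
  dF lam mu hm ξ.1 + (ξ.2 * (lev + m)) • 1

include hlam hmu in
theorem wF_piElt_tF [NeZero N] (ξ : T' N) : wF lam mu hm (piElt N) * tF lam mu hm lev ξ =
    tF lam mu hm lev (act (piElt N) ξ) * wF lam mu hm (piElt N) := by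
  rw [tF, tF, mul_add, wF_piElt_dF hm hlam hmu, act_piElt, add_mul, sub_mul, mul_smul_comm, mul_one,
    add_mul, smul_mul_assoc, smul_mul_assoc, one_mul]
  module

include hlam hmu in
theorem wF_simpleRefl_tF_of_ne [NeZero N] {i : Fin N} (hi : i ≠ 0) (ξ : T' N) :
    wF lam mu hm (simpleRefl i) * tF lam mu hm lev ξ
      - tF lam mu hm lev (act (simpleRefl i) ξ) * wF lam mu hm (simpleRefl i) =
      -simpleRoot i ξ • 1 := by
  rw [simpleRefl, if_neg hi, tF, tF, mul_add, wF_swap_dF hm hlam hmu (val_sub_one i hi), act_ofPerm,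
    add_mul, mul_smul_comm, mul_one, smul_mul_assoc, one_mul, Equiv.swap_inv, simpleRoot]
  module

-- For i = 0 the relation for the last finite reflection is conjugated by π, the case N = 1 being
-- trivial.
include hlam hmu in
theorem wF_simpleRefl_tF [NeZero N] (i : Fin N) (ξ : T' N) :
    wF lam mu hm (simpleRefl i) * tF lam mu hm lev ξ
      - tF lam mu hm lev (act (simpleRefl i) ξ) * wF lam mu hm (simpleRefl i) =
      -simpleRoot i ξ • 1 := by
  by_cases hi : i = 0
  · subst hi
    by_cases h : (0 - 1 : Fin N) = 0
    · rw [simpleRefl_zero_eq_one h, wF_one, act_one, one_mul, mul_one, sub_self, simpleRoot, h,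
        sub_self, neg_zero, zero_smul]
    · have h1 := simpleRefl_zero_mul_piElt h
      have hinv : wF lam mu hm (piElt N) * wF lam mu hm (piElt N)⁻¹ = 1 := by
        rw [← wF_mul, mul_inv_cancel, wF_one]
      have hS : wF lam mu hm (simpleRefl 0) * wF lam mu hm (piElt N) =
          wF lam mu hm (piElt N) * wF lam mu hm (simpleRefl (0 - 1)) := by
        rw [← wF_mul, h1, wF_mul]
      obtain ⟨η, hξ⟩ : ∃ η, ξ = act (piElt N) η :=
        ⟨act (piElt N)⁻¹ ξ, by rw [← act_mul, mul_inv_cancel, act_one]⟩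
      have h2 := wF_simpleRefl_tF_of_ne hm hlam hmu h η
      have h3 := wF_piElt_tF hm hlam hmu η
      have h4 := wF_piElt_tF hm hlam hmu (act (simpleRefl (0 - 1)) η)
      rw [← act_mul, ← h1, act_mul] at h4
      rw [hξ, simpleRoot_piElt]
      generalize tF lam mu hm lev (act (simpleRefl 0) (act (piElt N) η)) = X at *
      generalize tF lam mu hm lev (act (piElt N) η) = Y at *
      have key : (wF lam mu hm (simpleRefl 0) * Y - X * wF lam mu hm (simpleRefl 0))
          * wF lam mu hm (piElt N) = (-simpleRoot (0 - 1) η • 1) * wF lam mu hm (piElt N) := by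
        rw [sub_mul, mul_assoc, mul_assoc, hS, ← h3, ← mul_assoc, hS, ← mul_assoc, ← h4, mul_assoc,
          mul_assoc, ← mul_sub, h2, mul_smul_comm, mul_one, smul_mul_assoc, one_mul]
      have := congrArg (· * wF lam mu hm (piElt N)⁻¹) key
      simpa only [mul_assoc, hinv, mul_one] using this
  · exact wF_simpleRefl_tF_of_ne hm hlam hmu hi ξ

/-- The representation of the degenerate double affine Hecke algebra on the quotient. -/
def heckeRep [NeZero N] (hwt : IsTensorPowerWeight N (lam - mu)) :
    H N →ₐ[ℂ] Module.End ℂ (StdModule N lam mu) :=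
  RingQuot.liftAlgHom ℂ ⟨FreeAlgebra.lift ℂ (Sum.elim (wF lam mu hm) (tF lam mu hm lev)), by
    intro x y hxy
    induction hxy with
    | one => simp only [FreeAlgebra.lift_ι_apply, Sum.elim_inl, map_one, wF_one]
    | mul v w => simp only [FreeAlgebra.lift_ι_apply, Sum.elim_inl, map_mul, wF_mul]
    | add ξ ξ' =>
      simp only [FreeAlgebra.lift_ι_apply, Sum.elim_inr, map_add, tF, Prod.fst_add, Prod.snd_add,
        dF_add hm hlam hmu]
      module
    | smul r ξ =>
      simp only [FreeAlgebra.lift_ι_apply, Sum.elim_inr, map_smul, tF, Prod.smul_fst, Prod.smul_snd,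
        dF_smul hm hlam hmu, smul_eq_mul]
      module
    | comm ξ ξ' =>
      simp only [FreeAlgebra.lift_ι_apply, Sum.elim_inr, map_mul, tF, mul_add, add_mul,
        dF_comm hm hlam hmu hwt ξ.1 ξ'.1, mul_smul_comm, smul_mul_assoc, mul_one, one_mul]
      module
    | refl i ξ =>
      simp only [FreeAlgebra.lift_ι_apply, Sum.elim_inr, Sum.elim_inl, map_mul, map_sub,
        AlgHom.commutes]
      rw [Algebra.algebraMap_eq_smul_one]
      exact wF_simpleRefl_tF hm hlam hmu i ξ
    | pi ξ =>
      simp only [FreeAlgebra.lift_ι_apply, Sum.elim_inr, Sum.elim_inl, map_mul]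
      exact wF_piElt_tF hm hlam hmu ξ⟩

theorem heckeRep_ofW [NeZero N] (hwt : IsTensorPowerWeight N (lam - mu)) (w : W N) :
    heckeRep hm hlam hmu hwt (ofW w) = wF lam mu hm w := by
  rw [heckeRep, ofW, RingQuot.liftAlgHom_mkAlgHom_apply, FreeAlgebra.lift_ι_apply, Sum.elim_inl]

theorem heckeRep_ofT [NeZero N] (hwt : IsTensorPowerWeight N (lam - mu)) (ξ : T' N) :
    heckeRep hm hlam hmu hwt (ofT ξ) = tF lam mu hm lev ξ := by
  rw [heckeRep, ofT, RingQuot.liftAlgHom_mkAlgHom_apply, FreeAlgebra.lift_ι_apply, Sum.elim_inr]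

theorem ofW_mul [NeZero N] (v w : W N) : ofW (v * w) = ofW v * ofW w := by
  rw [ofW, RingQuot.mkAlgHom_rel ℂ (Rel.mul v w), map_mul]
  rfl

theorem ofT_add [NeZero N] (ξ ξ' : T' N) : ofT (ξ + ξ') = ofT ξ + ofT ξ' := by
  rw [ofT, RingQuot.mkAlgHom_rel ℂ (Rel.add ξ ξ'), map_add]
  rfl

theorem ofT_smul [NeZero N] (r : ℂ) (ξ : T' N) : ofT (r • ξ) = r • ofT ξ := by
  rw [ofT, RingQuot.mkAlgHom_rel ℂ (Rel.smul r ξ), map_smul]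
  rfl

include hlam hmu in
theorem isAction_heckeRep [NeZero N] (hwt : IsTensorPowerWeight N (lam - mu)) :
    IsAction (Verma mu) (LowestVerma lam) lev (heckeRep (N := N) hm hlam hmu hwt) where
  map_c := by
    have h0 : dF lam mu hm (0 : Fin N → ℂ) = 0 := by
      have := dF_smul hm hlam hmu 0 (0 : Fin N → ℂ)
      rwa [smul_zero, zero_smul] at this
    rw [heckeRep_ofT, tF]
    change dF lam mu hm 0 + (1 * (lev + m)) • 1 = _
    rw [h0, zero_add, one_mul]
  map_perm w y := by
    rw [heckeRep_ofW, wF, Submodule.mapQ_apply, wMid_ofPerm, tau_eq]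
  map_transl η y := by
    rw [heckeRep_ofW, wF, Submodule.mapQ_apply, wMid_transl, mulLau_eq]
  map_xi ξ y := by
    refine ⟨dunklLau (Verma mu) (LowestVerma lam) ξ y,
      incl_dunklLau _ _ (by omega) (locFin_verma_left lam mu) (locFin_verma_right lam mu) ξ y, ?_⟩
    rw [heckeRep_ofT, tF, zero_mul, zero_smul, add_zero, dF, Submodule.mapQ_apply]

/-- An algebra map is determined on W and 𝔱'. Elements of W are translations times permutations, and
the value on ξ is pinned down because the Laurent polynomial vector representing the Dunkl operator
is unique. -/
theorem isAction_unique [NeZero N] {A B : Type}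
    [AddCommGroup A] [Module ℂ A] [LieRingModule (AffineSl m) A] [LieModule ℂ (AffineSl m) A]
    [AddCommGroup B] [Module ℂ B] [LieRingModule (AffineSl m) B] [LieModule ℂ (AffineSl m) B]
    {ρ ρ' : H N →ₐ[ℂ] Module.End ℂ (F m N A B)}
    (h : IsAction A B lev ρ) (h' : IsAction A B lev ρ') : ρ = ρ' := by
  have hW : ∀ w : W N, ρ (ofW w) = ρ' (ofW w) := by
    intro w
    have h1 : ∀ w, ρ (ofW (ofPerm w)) = ρ' (ofW (ofPerm w)) := by
      intro w
      refine LinearMap.ext fun z => ?_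
      obtain ⟨y, rfl⟩ := Submodule.Quotient.mk_surjective _ z
      rw [h.map_perm, h'.map_perm]
    have h2 : ∀ η, ρ (ofW (transl η)) = ρ' (ofW (transl η)) := by
      intro η
      refine LinearMap.ext fun z => ?_
      obtain ⟨y, rfl⟩ := Submodule.Quotient.mk_surjective _ z
      rw [h.map_transl, h'.map_transl]
    rw [eq_transl_mul_ofPerm w, ofW_mul, map_mul, map_mul, h1, h2]
  have hT : ∀ ξ : T' N, ρ (ofT ξ) = ρ' (ofT ξ) := by
    intro ξ
    have e : ξ = (ξ.1, 0) + ξ.2 • (0, 1) := by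
      refine Prod.ext ?_ ?_ <;> simp
    rw [e, ofT_add, ofT_smul, map_add, map_add, map_smul, map_smul, h.map_c, h'.map_c]
    congr 1
    refine LinearMap.ext fun z => ?_
    obtain ⟨y, rfl⟩ := Submodule.Quotient.mk_surjective _ z
    obtain ⟨y1, e1, e2⟩ := h.map_xi ξ.1 y
    obtain ⟨y2, e3, e4⟩ := h'.map_xi ξ.1 y
    rw [e2, e4, incl_injective A B (e1.trans e3.symm)]
  refine RingQuot.ringQuot_ext' ℂ _ _ (FreeAlgebra.hom_ext (funext fun x => ?_))
  rcases x with w | ξ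
  · exact hW w
  · exact hT ξ

end

end KZ

namespace KZ
open AffineSl DDAHA
variable {m N : ℕ}

/-! ### Joint eigenvalues -/

/-- The diagonal coefficient of the operator `xOp i l` at a basis vector. -/
def diagX (η : Fin N → ℤ) (c : Fin N → Fin m) (i l : Fin N) : ℂ :=
  if c i = c l then (if η l < η i ∨ (η l = η i ∧ l < i) then 1 / 2 else -(1 / 2)) else 0

/-- The diagonal coefficient of the `i`-th Dunkl operator at a basis vector. -/
def eigV (κ : ℂ) (s : Fin m → ℂ) (η : Fin N → ℤ) (c : Fin N → Fin m) (i : Fin N) : ℂ :=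
  κ * η i + s (c i)
    + ((∑ l, if i < l then diagX η c i l else 0) - ∑ l, if l < i then diagX η c l i else 0)

/-- The places of the same colour which lie above the `i`-th one. -/
def above (η : Fin N → ℤ) (c : Fin N → Fin m) (i : Fin N) : Finset (Fin N) :=
  Finset.univ.filter fun l => c l = c i ∧ (η l < η i ∨ (η l = η i ∧ l < i))

/-- Every other place of the same colour contributes 1/2 if it lies above i and -1/2 otherwise, that
is, 1 or 0 minus 1/2. The final 1/2 removes the place i itself from the count of its colour. -/
theorem eigV_eq (κ : ℂ) (s : Fin m → ℂ) (η : Fin N → ℤ) (c : Fin N → Fin m) (i : Fin N) :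
    eigV κ s η c i = κ * η i + s (c i) + (above η c i).card
      - 1 / 2 * (Finset.univ.filter fun l => c l = c i).card + 1 / 2 := by
  have h : ∀ l, (if i < l then diagX η c i l else 0) - (if l < i then diagX η c l i else 0) =
      (if c l = c i ∧ (η l < η i ∨ (η l = η i ∧ l < i)) then 1 else 0)
        - 1 / 2 * (if c l = c i then 1 else 0) + (if l = i then 1 / 2 else 0) := by
    intro l
    rw [diagX, diagX]
    by_cases hc : c l = c i
    · rw [if_pos hc, if_pos hc, if_pos hc.symm]
      rcases lt_trichotomy l i with h1 | h1 | h1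
      · rcases lt_trichotomy (η l) (η i) with h2 | h2 | h2
        · simp [h1, h1.ne, h1.not_gt, h2, h2.ne, h2.ne', h2.not_gt, hc]; norm_num
        · simp [h1, h1.ne, h1.not_gt, h2, hc]; norm_num
        · simp [h1, h1.ne, h1.not_gt, h2, h2.ne, h2.ne', h2.not_gt]
      · subst h1; simp
      · rcases lt_trichotomy (η l) (η i) with h2 | h2 | h2
        · simp [h1, h1.ne', h1.not_gt, h2, h2.ne, hc]; norm_num
        · simp [h1, h1.ne', h1.not_gt, h2]
        · simp [h1, h1.ne', h1.not_gt, h2.ne', h2.not_gt]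
    · have : l ≠ i := fun e => hc (by rw [e])
      simp [hc, Ne.symm hc, this]
  rw [eigV, ← Finset.sum_sub_distrib, Finset.sum_congr rfl fun l _ => h l, Finset.sum_add_distrib,
    Finset.sum_sub_distrib, ← Finset.mul_sum, Finset.sum_boole, Finset.sum_boole,
    Finset.sum_ite_eq', if_pos (Finset.mem_univ i), above]
  ring

/-- The diagonal coefficients of the pairs enter antisymmetrically and cancel in the total. -/
theorem sum_eigV (κ : ℂ) (s : Fin m → ℂ) (η : Fin N → ℤ) (c : Fin N → Fin m) :
    ∑ i, eigV κ s η c i = ∑ i, (κ * η i + s (c i)) := by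
  have h := sum_smul_lt_sub (fun _ : Fin N => (1 : ℂ)) (diagX η c)
  simp only [sub_self, zero_smul, ite_self, Finset.sum_const_zero, one_smul] at h
  simp only [eigV]
  have h' : ∑ i, ((∑ l, if i < l then diagX η c i l else 0) - ∑ l, if l < i then diagX η c l i else 0)
      = 0 := by
    rw [← neg_eq_zero, ← Finset.sum_neg_distrib]
    exact (Finset.sum_congr rfl fun i _ => neg_sub _ _).trans h
  rw [Finset.sum_add_distrib, h', add_zero]

/-- Every integer is a - m n for exactly one pair (a, n). Raising this level by 1 passes to the next
colour, or from the last colour to the first with n lowered by 1; the two hypotheses say that u a +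
κ n then drops by a positive integer. -/
theorem exists_level_function (hm : 2 ≤ m) (κ : ℂ) (u : Fin m → ℂ)
    (h1 : ∀ a b : Fin m, (a : ℕ) + 1 = b → ∃ n : ℕ, u a - u b = n + 1)
    (h2 : ∀ a b : Fin m, (a : ℕ) = 0 → (b : ℕ) + 1 = m → ∃ n : ℕ, κ - u a + u b = n + 1) :
    ∃ (G : ℤ → ℤ) (S : ℂ), StrictMono G ∧
      ∀ (a : Fin m) (n : ℤ), u a + κ * n = S - G ((a : ℕ) - m * n) := by
  have hm0 : (0 : ℤ) < m := by omega
  have hrep : ∀ L : ℤ, ∃ (a : Fin m) (n : ℤ), L = (a : ℕ) - m * n := by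
    intro L
    have e1 := Int.emod_nonneg L hm0.ne'
    have e2 := Int.emod_lt_of_pos L hm0
    refine ⟨⟨(L % m).toNat, by omega⟩, -(L / m), ?_⟩
    have := Int.emod_add_mul_ediv L m
    simp only [Int.toNat_of_nonneg e1]
    linarith
  have huniq : ∀ (a b : Fin m) (n k : ℤ), ((a : ℕ) : ℤ) - m * n = (b : ℕ) - m * k → a = b ∧ n = k := by
    intro a b n k h
    have ha := a.2
    have hb := b.2
    have hnk : n = k := by
      rcases lt_trichotomy n k with h3 | h3 | h3
      · nlinarith
      · exact h3
      · nlinarith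
    subst hnk
    exact ⟨Fin.ext (by omega), rfl⟩
  choose A n hAn using hrep
  let g : ℤ → ℂ := fun L => u (A L) + κ * n L
  have hg : ∀ (a : Fin m) (k : ℤ), g ((a : ℕ) - m * k) = u a + κ * k := by
    intro a k
    obtain ⟨e1, e2⟩ := huniq _ _ _ _ (hAn ((a : ℕ) - m * k))
    simp only [g, ← e1, ← e2]
  have hstep : ∀ L : ℤ, ∃ p : ℕ, g L - g (L + 1) = p + 1 := by
    intro L
    have hL := hAn L
    generalize A L = a at hL
    generalize n L = k at hL
    rw [hL, hg]
    by_cases ha : (a : ℕ) + 1 < m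
    · have : ((a : ℕ) : ℤ) - m * k + 1 = ((⟨a + 1, ha⟩ : Fin m) : ℕ) - m * k := by
        push_cast
        ring
      rw [this, hg]
      obtain ⟨p, hp⟩ := h1 a ⟨a + 1, ha⟩ rfl
      exact ⟨p, by rw [← hp]; ring⟩
    · have ha' : (a : ℕ) + 1 = m := by have := a.2; omega
      have : ((a : ℕ) : ℤ) - m * k + 1 = ((⟨0, by omega⟩ : Fin m) : ℕ) - m * (k - 1) := by
        have : ((a : ℕ) : ℤ) = m - 1 := by omega
        rw [this]
        push_cast
        ring
      rw [this, hg]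
      obtain ⟨p, hp⟩ := h2 ⟨0, by omega⟩ a rfl ha'
      refine ⟨p, ?_⟩
      rw [← hp]
      push_cast
      ring
  choose p hp using hstep
  have hint : ∀ L : ℤ, ∃ z : ℤ, g 0 - g L = z := by
    intro L
    induction L using Int.induction_on with
    | zero => exact ⟨0, by simp⟩
    | succ i ih =>
      obtain ⟨z, hz⟩ := ih
      refine ⟨z + p i + 1, ?_⟩
      have := hp i
      push_cast
      linear_combination hz + this
    | pred i ih =>
      obtain ⟨z, hz⟩ := ih
      refine ⟨z - p (-i - 1) - 1, ?_⟩
      have := hp (-i - 1)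
      rw [sub_add_cancel] at this
      push_cast
      linear_combination hz - this
  choose G hG using hint
  refine ⟨G, g 0, strictMono_int_of_lt_succ fun L => ?_, fun a k => ?_⟩
  · have : G (L + 1) = G L + p L + 1 := by
      have e : (G (L + 1) : ℂ) = G L + p L + 1 := by
        rw [← hG, ← hG]
        linear_combination hp L
      exact_mod_cast e
    omega
  · rw [← hg, ← hG]
    ring

/-- With L_i = c_i - m η_i, the i-th diagonal entry is, up to a common constant, -G(L_i) plus the
number of places above i; the β-terms of `s` and of `eigV_eq` cancel. Comparison with the increasing
word gives L_i ≤ c₀(i) for all i, while the totals of G(L_i) and G(c₀(i)) agree. Monotonicity of G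
then forces equality everywhere. -/
theorem word_eq_of_eigV_eq {κ : ℂ} {u s : Fin m → ℂ} {G : ℤ → ℤ} {S t : ℂ} {β : Fin m → ℕ}
    (hG : StrictMono G) (hu : ∀ (a : Fin m) (n : ℤ), u a + κ * n = S - G ((a : ℕ) - m * n))
    (hs : ∀ a, s a = u a + 1 / 2 * β a + t) {η : Fin N → ℤ} {c c₀ : Fin N → Fin m}
    (hmono : Monotone c₀) (hc₀ : ∀ a, (Finset.univ.filter fun i => c₀ i = a).card = β a)
    (hc : ∀ a, (Finset.univ.filter fun i => c i = a).card = β a)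
    (h : ∀ i, eigV κ s η c i = eigV κ s 0 c₀ i) : η = 0 ∧ c = c₀ := by
  have hN : ∀ i : Fin N, (0 : ℤ) ≤ (i : ℕ) ∧ ((i : ℕ) : ℤ) < N := fun i =>
    ⟨by omega, by have := i.2; omega⟩
  have hM : ∀ a : Fin m, (0 : ℤ) ≤ (a : ℕ) ∧ ((a : ℕ) : ℤ) < m := fun i =>
    ⟨by omega, by have := i.2; omega⟩
  have he : ∀ i, -G ((c i : ℕ) - m * η i) + (above η c i).card =
      -G (c₀ i : ℕ) + (above 0 c₀ i).card := by
    intro i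
    have e := h i
    rw [eigV_eq, eigV_eq, hc, hc₀, hs, hs] at e
    have e1 := hu (c i) (η i)
    have e2 := hu (c₀ i) 0
    rw [mul_zero, sub_zero] at e2
    have : ((-G ((c i : ℕ) - m * η i) + (above η c i).card : ℤ) : ℂ) =
        (-G (c₀ i : ℕ) + (above 0 c₀ i).card : ℤ) := by
      push_cast
      simp only [Pi.zero_apply, Int.cast_zero] at e e2
      linear_combination e - e1 + e2
    exact_mod_cast this
  have hle : ∀ i, ((c i : ℕ) : ℤ) - m * η i ≤ (c₀ i : ℕ) := by
    intro i
    -- The topmost place k of the colour of i: the factor N orders places by level first and by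
    -- index second. Nothing lies above k, so comparing entries at k gives L_k ≤ c₀(k).
    obtain ⟨k, hk, hmax⟩ := Finset.exists_max_image (Finset.univ.filter fun l => c l = c i)
      (fun l => N * (((c l : ℕ) : ℤ) - m * η l) - (l : ℕ)) ⟨i, by simp⟩
    simp only [Finset.mem_filter, Finset.mem_univ, true_and] at hk hmax
    have hki := hmax i rfl
    have hrank : above η c k = ∅ := by
      refine Finset.filter_eq_empty_iff.2 fun l _ => ?_
      rintro ⟨hl, h1⟩
      have h2 := hmax l (hl.trans hk)
      rw [hl] at h2
      have := hN l
      have := hN k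
      rcases h1 with h1 | ⟨h1, h3⟩
      · have hm' : (1 : ℤ) ≤ m := by have := hM (c k); omega
        have h4 : (1 : ℤ) ≤ m * (η k - η l) := by nlinarith
        nlinarith
      · rw [h1] at h2
        rw [Fin.lt_def] at h3
        omega
    have hk1 : ((c k : ℕ) : ℤ) - m * η k ≤ (c₀ k : ℕ) := by
      have := he k
      rw [hrank, Finset.card_empty] at this
      exact hG.le_iff_le.1 (by omega)
    rw [hk] at hki hk1
    have := hN i
    have := hN k
    have := hM (c₀ i)
    have := hM (c₀ k)
    -- If η k < η i, then L_i ≤ L_k - m is negative. If they are equal, k comes before i and c₀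
    -- increases. The last case contradicts the choice of k.
    rcases lt_trichotomy (η k) (η i) with h1 | h1 | h1
    · nlinarith
    · rw [h1] at hki hk1
      have : c₀ k ≤ c₀ i := hmono (by rw [Fin.le_def]; omega)
      rw [Fin.le_def] at this
      omega
    · have hm' : (1 : ℤ) ≤ m := by omega
      have h4 : (1 : ℤ) ≤ m * (η k - η i) := by nlinarith
      nlinarith
  -- The sum of all diagonal entries does not see the ranks, by `sum_eigV`, and the β-terms agree
  -- because the two words have the same content.
  have hsum : ∑ i, G ((c i : ℕ) - m * η i) = ∑ i, G (c₀ i : ℕ) := by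
    obtain ⟨w, hw⟩ := exists_perm_of_card_eq (c := c) (c' := c₀) fun a => by rw [hc, hc₀]
    have h1 : ∑ i, β (c i) = ∑ i, β (c₀ i) := by
      rw [← Equiv.sum_comp w fun i => β (c₀ i)]
      simp only [hw]
    have h2 := Finset.sum_congr rfl fun i (_ : i ∈ Finset.univ) => h i
    rw [sum_eigV, sum_eigV] at h2
    have e1 : ∀ i, κ * η i + s (c i) = S + t - (G ((c i : ℕ) - m * η i) : ℂ) + 1 / 2 * β (c i) := by
      intro i
      rw [hs]
      linear_combination hu (c i) (η i)
    have e2 : ∀ i, κ * ((0 : Fin N → ℤ) i : ℂ) + s (c₀ i) =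
        S + t - (G (c₀ i : ℕ) : ℂ) + 1 / 2 * β (c₀ i) := by
      intro i
      have := hu (c₀ i) 0
      rw [mul_zero, sub_zero] at this
      rw [hs]
      simp only [Pi.zero_apply]
      linear_combination this
    simp only [e1, e2, Finset.sum_add_distrib, Finset.sum_sub_distrib, ← Finset.mul_sum,
      ← Nat.cast_sum, h1] at h2
    have : ((∑ i, G ((c i : ℕ) - m * η i) : ℤ) : ℂ) = (∑ i, G (c₀ i : ℕ) : ℤ) := by
      push_cast
      linear_combination -h2
    exact_mod_cast this
  have heq := (Finset.sum_eq_sum_iff_of_le fun i _ => hG.monotone (hle i)).1 hsum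
  -- Now c_i - m η_i = c₀(i) with both colours in [0, m).
  have hz : ∀ i, η i = 0 := by
    intro i
    have := hG.injective (heq i (Finset.mem_univ i))
    have := hM (c i)
    have := hM (c₀ i)
    rcases lt_trichotomy (η i) 0 with h1 | h1 | h1
    · nlinarith
    · exact h1
    · nlinarith
  refine ⟨funext hz, funext fun i => Fin.ext ?_⟩
  have := hG.injective (heq i (Finset.mem_univ i))
  rw [hz, mul_zero, sub_zero] at this
  exact_mod_cast this

/-! ### Triangularity -/

/-- The quadratic form with respect to which the Dunkl operators are triangular. -/
def energy (η : Fin N → ℤ) (c : Fin N → Fin m) : ℤ :=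
  ∑ i, (N * (((c i : ℕ) : ℤ) - m * η i) - (i : ℕ)) ^ 2

/-- The factored form reduces every comparison of energies below to the signs of two integers. -/
theorem energy_swap {j k : Fin N} (h : j ≠ k) (η : Fin N → ℤ) (c : Fin N → Fin m) (r : ℤ) :
    energy η c - energy (η + r • dl k j) (fun i => c (Equiv.swap j k i)) =
      2 * N * ((((c j : ℕ) : ℤ) - (c k : ℕ) - m * r)
        * (((k : ℕ) : ℤ) - (j : ℕ) - N * m * (η j - η k - r))) := by
  have hk : k ∈ Finset.univ.erase j := Finset.mem_erase.2 ⟨h.symm, Finset.mem_univ k⟩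
  rw [energy, energy, ← Finset.add_sum_erase _ _ (Finset.mem_univ j), ← Finset.add_sum_erase _ _ hk,
    ← Finset.add_sum_erase _ (fun i => (N * (((c (Equiv.swap j k i) : ℕ) : ℤ)
      - m * (η + r • dl k j) i) - (i : ℕ)) ^ 2) (Finset.mem_univ j), ← Finset.add_sum_erase _
      (fun i => (N * (((c (Equiv.swap j k i) : ℕ) : ℤ) - m * (η + r • dl k j) i) - (i : ℕ)) ^ 2) hk]
  have h1 : ∑ i ∈ (Finset.univ.erase j).erase k, (N * (((c (Equiv.swap j k i) : ℕ) : ℤ)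
      - m * (η + r • dl k j) i) - (i : ℕ)) ^ 2 =
      ∑ i ∈ (Finset.univ.erase j).erase k, (N * (((c i : ℕ) : ℤ) - m * η i) - (i : ℕ)) ^ 2 := by
    refine Finset.sum_congr rfl fun i hi => ?_
    have hik := Finset.ne_of_mem_erase hi
    have hij := Finset.ne_of_mem_erase (Finset.mem_of_mem_erase hi)
    rw [Equiv.swap_apply_of_ne_of_ne hij hik]
    simp [dl, hik, hij]
  have h2 : (η + r • dl k j) j = η j - r := by simp [dl, h]; ring
  have h3 : (η + r • dl k j) k = η k + r := by simp [dl, h.symm]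
  rw [h1, h2, h3, Equiv.swap_apply_left, Equiv.swap_apply_right]
  ring

section
attribute [local instance] vnGroup midGroup midAddGroup

/-- The span of the basis vectors of smaller energy. -/
def lower (η : Fin N → ℤ) (c : Fin N → Fin m) : Submodule ℂ (Mid m N) :=
  Submodule.span ℂ {x | ∃ η' c', (∀ a, (Finset.univ.filter fun i => c' i = a).card =
    (Finset.univ.filter fun i => c i = a).card) ∧ energy η' c' < energy η c ∧ x = eb η' c'}

theorem eb_mem_lower {j k : Fin N} (h : j ≠ k) (η : Fin N → ℤ) (c : Fin N → Fin m) {r : ℤ}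
    (hr : 0 < (((c j : ℕ) : ℤ) - (c k : ℕ) - m * r)
        * (((k : ℕ) : ℤ) - (j : ℕ) - N * m * (η j - η k - r))) :
    eb (η + r • dl k j) (fun i => c (Equiv.swap j k i)) ∈ lower η c := by
  refine Submodule.subset_span ⟨_, _, fun a => ?_, ?_, rfl⟩
  · refine Finset.card_equiv (Equiv.swap j k) fun i => ?_
    simp
  · have h1 := energy_swap h η c r
    have h2 : (0 : ℤ) < N := by have := j.2; omega
    have := mul_pos (mul_pos two_pos h2) hr
    omega

/-- Every monomial in the divided difference whose exponent differs from η has smaller energy after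
the swap. The swapped word at exponent η comes from the r-matrix and, if η j > η k, also from the
divided difference: it is lower, it cancels, or it is the vector itself, according to the order of
the two colours. -/
theorem xOp_eb_triangular {j k : Fin N} (hjk : j < k) (η : Fin N → ℤ) (c : Fin N → Fin m) :
    ∃ y ∈ lower η c, xOp j k (eb η c) = diagX η c j k • eb η c + y := by
  have hN : ((j : ℕ) : ℤ) < (k : ℕ) ∧ ((k : ℕ) : ℤ) < N ∧ (0 : ℤ) ≤ (j : ℕ) := by
    have := k.2
    rw [Fin.lt_def] at hjk
    omega
  obtain ⟨hN1, hN2, hN3⟩ := hN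
  have hd1 : (((c j : ℕ) : ℤ) - (c k : ℕ)) < m ∧ -(m : ℤ) < (((c j : ℕ) : ℤ) - (c k : ℕ)) := by
    have := (c j).2
    have := (c k).2
    omega
  set cs : Fin N → Fin m := fun i => c (Equiv.swap j k i) with hcs
  have hx : xOp j k (eb η c) = divDiffFun j k η ⊗ₜ vb cs + (-(rWt (c k) (c j))) • eb η cs := by
    rw [xOp_eb hjk.ne]
    exact (sub_eq_add_neg _ _).trans (congrArg (_ + ·) (neg_smul _ (eb η cs)).symm)
  have hsame : c j = c k → cs = c := by
    intro h
    funext i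
    simp only [hcs]
    rw [Equiv.swap_apply_def]
    split_ifs with h1 h2
    · rw [h1, h]
    · rw [h2, h]
    · rfl
  have hzero : η + (0 : ℤ) • dl k j = η := by rw [zero_smul, add_zero]
  by_cases hn : 0 < η j - η k
  · obtain ⟨p, hp⟩ : ∃ p : ℕ, (η j - η k).toNat = p + 1 := ⟨(η j - η k).toNat - 1, by omega⟩
    -- The term with unshifted exponent is separated, to be combined with the one from the r-matrix.
    have hD : divDiffFun j k η ⊗ₜ vb cs =
        (∑ t ∈ Finset.range p, eb (η + ((t : ℤ) + 1) • dl k j) cs) + eb η cs := by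
      rw [divDiffFun, if_pos hn.le, hp, Finset.sum_range_succ', TensorProduct.add_tmul,
        TensorProduct.sum_tmul]
      simp only [Nat.cast_add, Nat.cast_one, Nat.cast_zero, hzero, eb]
    have hlow : (∑ t ∈ Finset.range p, eb (η + ((t : ℤ) + 1) • dl k j) cs) ∈ lower η c := by
      refine Submodule.sum_mem _ fun t ht => eb_mem_lower hjk.ne η c ?_
      have ht' : (t : ℤ) + 1 ≤ η j - η k - 1 := by
        have := Finset.mem_range.1 ht
        omega
      refine mul_pos_of_neg_of_neg (by nlinarith) ?_
      have h1 : (1 : ℤ) * 1 ≤ m * (η j - η k - (t + 1)) :=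
        mul_le_mul (by omega) (by omega) (by omega) (by omega)
      nlinarith
    rw [hx, hD]
    -- The swapped vector has total coefficient 1 - `rWt (c k) (c j)`: 1 on a lower vector, 1/2 on
    -- the vector itself, or 0.
    rcases lt_trichotomy (c j) (c k) with h | h | h
    · have h0 : eb η cs ∈ lower η c := by
        have := eb_mem_lower (r := 0) hjk.ne η c (mul_pos_of_neg_of_neg ?_ ?_)
        · rwa [hzero] at this
        · rw [Fin.lt_def] at h
          omega
        · have h1 : (1 : ℤ) * 1 ≤ m * (η j - η k - 0) :=
            mul_le_mul (by omega) (by omega) (by omega) (by omega)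
          nlinarith
      refine ⟨_, Submodule.add_mem _ hlow h0, ?_⟩
      rw [diagX, if_neg h.ne, rWt, if_neg h.not_gt, if_neg h.ne']
      module
    · refine ⟨_, hlow, ?_⟩
      rw [diagX, if_pos h, if_pos (Or.inl (by omega)), rWt, if_neg h.not_gt, if_pos h.symm,
        hsame h]
      module
    · refine ⟨_, hlow, ?_⟩
      rw [diagX, if_neg h.ne', rWt, if_pos h]
      module
  · have hD : divDiffFun j k η ⊗ₜ vb cs =
        (-1 : ℂ) • ∑ t ∈ Finset.range (η k - η j).toNat, eb (η + (-((t : ℤ) + 1)) • dl k j) cs := by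
      rw [divDiffFun]
      by_cases h0 : η j = η k
      · rw [h0, sub_self, if_pos le_rfl, Int.toNat_zero, Finset.range_zero, Finset.sum_empty,
          Finset.sum_empty, TensorProduct.zero_tmul, smul_zero]
      · rw [if_neg (by omega), ← neg_one_smul ℂ, ← TensorProduct.smul_tmul', TensorProduct.sum_tmul]
        simp only [neg_smul, ← sub_eq_add_neg, eb]
    have hlow : (-1 : ℂ) • (∑ t ∈ Finset.range (η k - η j).toNat,
        eb (η + (-((t : ℤ) + 1)) • dl k j) cs) ∈ lower η c := by
      refine Submodule.smul_mem _ _ (Submodule.sum_mem _ fun t ht => eb_mem_lower hjk.ne η c ?_)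
      have ht' : (t : ℤ) + 1 ≤ η k - η j := by
        have := Finset.mem_range.1 ht
        omega
      refine mul_pos (by nlinarith) ?_
      have h1 : (0 : ℤ) ≤ N * m * (η k - η j - (t + 1)) :=
        mul_nonneg (mul_nonneg (by omega) (by omega)) (by omega)
      linarith
    have hdiag : ¬(η k < η j ∨ (η k = η j ∧ k < j)) := by
      rintro (h | ⟨-, h⟩)
      · omega
      · exact hjk.not_gt h
    rw [hx, hD]
    -- Here only the r-matrix contributes at exponent η, with coefficient 0, -1/2 on the vector
    -- itself, or -1 on a lower vector.
    rcases lt_trichotomy (c j) (c k) with h | h | h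
    · refine ⟨_, hlow, ?_⟩
      rw [diagX, if_neg h.ne, rWt, if_neg h.not_gt, if_neg h.ne']
      module
    · refine ⟨_, hlow, ?_⟩
      rw [diagX, if_pos h, if_neg hdiag, rWt, if_neg h.not_gt, if_pos h.symm, hsame h]
      module
    · have h0 : eb η cs ∈ lower η c := by
        have := eb_mem_lower (r := 0) hjk.ne η c (mul_pos ?_ ?_)
        · rwa [hzero] at this
        · rw [Fin.lt_def] at h
          omega
        · have h1 : (0 : ℤ) ≤ N * m * (η k - η j) :=
            mul_nonneg (mul_nonneg (by omega) (by omega)) (by omega)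
          linarith
      refine ⟨_, Submodule.add_mem _ hlow (Submodule.smul_mem _ (-1 : ℂ) h0), ?_⟩
      rw [diagX, if_neg h.ne', rWt, if_pos h]
      module

/-- The error space V is left free: it is `lower η c` for triangularity and ⊥ for the increasing
word, an exact eigenvector. -/
theorem dunklMid_eb_of_xOp_eb (κ : ℂ) (s : Fin m → ℂ) (η : Fin N → ℤ) (c : Fin N → Fin m)
    (V : Submodule ℂ (Mid m N)) (hV : ∀ j k : Fin N, j < k → ∃ y ∈ V,
      xOp j k (eb η c) = diagX η c j k • eb η c + y) (i : Fin N) : ∃ y ∈ V,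
      dunklMid κ s (Pi.single i 1) (eb η c) = eigV κ s η c i • eb η c + y := by
  have hX : ∀ j k : Fin N, ∃ y ∈ V, (if j < k then ((Pi.single i 1 : Fin N → ℂ) j
      - (Pi.single i 1 : Fin N → ℂ) k) • xOp j k else 0) (eb η c) =
      (if j < k then ((Pi.single i 1 : Fin N → ℂ) j - (Pi.single i 1 : Fin N → ℂ) k)
        * diagX η c j k else 0) • eb η c + y := by
    intro j k
    split_ifs with h
    · obtain ⟨y, hy, e⟩ := hV j k h
      refine ⟨_, Submodule.smul_mem _ ((Pi.single i 1 : Fin N → ℂ) j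
        - (Pi.single i 1 : Fin N → ℂ) k) hy, ?_⟩
      rw [LinearMap.smul_apply, e, smul_add, smul_smul]
    · exact ⟨0, Submodule.zero_mem _, by rw [zero_smul, add_zero]; rfl⟩
  choose y hy e using hX
  refine ⟨∑ j, ∑ k, y j k, Submodule.sum_mem _ fun j _ => Submodule.sum_mem _ fun k _ => hy j k, ?_⟩
  have h1 := sum_smul_lt_sub (Pi.single i 1 : Fin N → ℂ) (fun j k => -diagX η c j k)
  simp only [neg_neg, smul_eq_mul] at h1
  have h2 : ∑ j, ∑ k, (if j < k then ((Pi.single i 1 : Fin N → ℂ) j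
      - (Pi.single i 1 : Fin N → ℂ) k) * diagX η c j k else 0) =
      (∑ l, if i < l then diagX η c i l else 0) - ∑ l, if l < i then diagX η c l i else 0 := by
    rw [← h1, Finset.sum_eq_single i]
    · rw [Pi.single_eq_same, one_mul, sub_eq_add_neg, sub_eq_add_neg, add_comm,
        ← Finset.sum_neg_distrib, ← Finset.sum_neg_distrib]
      congr 1 <;> refine Finset.sum_congr rfl fun l _ => ?_ <;> split_ifs <;> simp
    · intro l _ hl
      rw [Pi.single_eq_of_ne hl, zero_mul]
    · simp
  simp only [dunklMid, LinearMap.add_apply, LinearMap.sum_apply, e, Finset.sum_add_distrib]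
  rw [eigV, add_smul, ← h2, add_assoc, Finset.sum_smul]
  congr 1
  · rw [Finset.sum_eq_single i]
    · rw [Pi.single_eq_same, one_smul, wtOp_eb]
    · intro l _ hl
      rw [Pi.single_eq_of_ne hl, zero_smul]
      rfl
    · simp
  · simp only [Finset.sum_smul]

theorem dunklMid_eb_monotone (κ : ℂ) (s : Fin m → ℂ) {c : Fin N → Fin m} (hc : Monotone c)
    (i : Fin N) : dunklMid κ s (Pi.single i 1) (eb 0 c) = eigV κ s 0 c i • eb 0 c := by
  obtain ⟨y, hy, e⟩ := dunklMid_eb_of_xOp_eb κ s 0 c ⊥ (fun j k hjk => ⟨0, Submodule.zero_mem _, by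
    rw [xOp_monotone hjk hc, add_zero, diagX]
    have h : ¬((0 : Fin N → ℤ) k < (0 : Fin N → ℤ) j ∨
        ((0 : Fin N → ℤ) k = (0 : Fin N → ℤ) j ∧ k < j)) := by
      rintro (h | ⟨-, h⟩)
      · exact lt_irrefl _ h
      · exact hjk.not_gt h
    rw [if_neg h]⟩) i
  rw [e, (Submodule.mem_bot ℂ).1 hy, add_zero]

end

end KZ

/-! ### A criterion for a unique irreducible quotient -/

theorem hasUniqueIrreducibleQuotient_of_cyclic {R M : Type} [Ring R] [AddCommGroup M] [Module R M]
    (v : M) (hcyc : ∀ K : Submodule R M, v ∈ K → K = ⊤) (S : AddSubgroup M) (hv : v ∉ S)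
    (hS : ∀ K : Submodule R M, v ∉ K → ∀ y ∈ K, y ∈ S) : HasUniqueIrreducibleQuotient R M := by
  -- The largest submodule inside S. It contains every submodule avoiding v, hence every proper one,
  -- so it is the greatest proper submodule.
  let K₀ : Submodule R M :=
    { carrier := {y | ∀ r : R, r • y ∈ S}
      add_mem' := fun {x y} hx hy r => by
        rw [smul_add]
        exact S.add_mem (hx r) (hy r)
      zero_mem' := fun r => by
        rw [smul_zero]
        exact S.zero_mem
      smul_mem' := fun a y hy r => by
        rw [smul_smul]
        exact hy _ }
  have hv₀ : v ∉ K₀ := fun h => hv (by simpa using h 1)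
  have hle : ∀ K : Submodule R M, v ∉ K → K ≤ K₀ := fun K hK y hy r =>
    hS K hK _ (K.smul_mem r hy)
  have htop : K₀ ≠ ⊤ := fun h => hv₀ (h ▸ Submodule.mem_top)
  refine ⟨K₀, ?_, fun K hK => ?_⟩
  · refine isSimpleModule_iff_isCoatom.2 ⟨htop, fun K hK => hcyc K ?_⟩
    by_contra h
    exact hK.not_ge (hle K h)
  · have hK' := isSimpleModule_iff_isCoatom.1 hK
    have hvK : v ∉ K := fun h => hK'.1 (hcyc K h)
    by_contra hne
    exact htop (hK'.2 K₀ (lt_of_le_of_ne (hle K hvK) hne))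

namespace KZ
open AffineSl DDAHA
variable {m N : ℕ}

/-! ### The unique irreducible quotient -/

section

variable {lam mu : Weight m}

/-- Splits off ½ β_a, the term that cancels against the content term of `eigV_eq`. -/
theorem vacW_eq {β : Fin m → ℕ}
    (hw : ∀ a, lam (diagH a) - mu (diagH a) = β a - N * (m : ℂ)⁻¹) (a : Fin m) :
    vacW lam mu a = (mu (diagH a) - (a : ℕ)) + 1 / 2 * β a
      + (1 / 2 * ((m : ℂ) - 1) - 1 / 2 * (N * (m : ℂ)⁻¹)) := by
  rw [vacW]
  linear_combination (1 / 2 : ℂ) * hw a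

/-- The shift by -a and the m in lev + m are the contribution of the affine ρ: they turn the
non-negative integers of dominance into positive ones. -/
theorem exists_level_function_of_isDominantIntegral (hm : 2 ≤ m) {lev : ℂ} (hmu : mu cenH = lev)
    (hdom : IsDominantIntegral mu) : ∃ (G : ℤ → ℤ) (S : ℂ), StrictMono G ∧
      ∀ (a : Fin m) (n : ℤ), (mu (diagH a) - (a : ℕ)) + (lev + m) * n = S - G ((a : ℕ) - m * n) := by
  have hco : ∀ a b, mu (corootH a b) = mu (diagH a) - mu (diagH b) := fun a b => by
    rw [← map_sub]
    rfl
  refine exists_level_function hm _ (fun a => mu (diagH a) - (a : ℕ)) ?_ ?_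
  · intro a b hab
    obtain ⟨n, hn⟩ := hdom.1 a b hab
    refine ⟨n, ?_⟩
    rw [hco] at hn
    rw [← hab]
    push_cast
    linear_combination hn
  · intro a b ha hb
    obtain ⟨n, hn⟩ := hdom.2 a b ha hb
    refine ⟨n, ?_⟩
    rw [map_sub, hco, hmu] at hn
    have hb' : ((b : ℕ) : ℂ) + 1 = m := by exact_mod_cast hb
    rw [ha]
    push_cast
    linear_combination hn - hb'

/-! ### Vectors killed by products of commuting operators -/

section

variable {E : Type} [AddCommGroup E] [Module ℂ E]

theorem mul_comm_of_mem_closure {D : Set (Module.End ℂ E)} (hD : ∀ S ∈ D, ∀ T ∈ D, S * T = T * S)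
    {S T : Module.End ℂ E} (hS : S ∈ Submonoid.closure D) (hT : T ∈ Submonoid.closure D) :
    S * T = T * S := by
  induction hS, hT using Submonoid.closure_induction₂ with
  | mem x y hx hy => exact hD x hx y hy
  | one_left x hx => rw [one_mul, mul_one]
  | one_right x hx => rw [one_mul, mul_one]
  | mul_left x y z hx hy hz h1 h2 => exact Commute.mul_left (c := z) h1 h2
  | mul_right x y z hx hy hz h1 h2 => exact Commute.mul_right (a := z) h1 h2

/-- The vectors which are killed by a product of operators from `D`. -/
def killed (D : Set (Module.End ℂ E)) (hD : ∀ S ∈ D, ∀ T ∈ D, S * T = T * S) : Submodule ℂ E where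
  carrier := {y | ∃ T ∈ Submonoid.closure D, T y = 0}
  add_mem' := by
    rintro x y ⟨S, hS, hx⟩ ⟨T, hT, hy⟩
    have hcomm := mul_comm_of_mem_closure hD hS hT
    refine ⟨S * T, Submonoid.mul_mem _ hS hT, ?_⟩
    rw [map_add, Module.End.mul_apply S T y, hy, map_zero, add_zero, hcomm, Module.End.mul_apply, hx,
      map_zero]
  zero_mem' := ⟨1, Submonoid.one_mem _, map_zero _⟩
  smul_mem' := by
    rintro r y ⟨T, hT, hy⟩
    exact ⟨T, hT, by rw [map_smul, hy, smul_zero]⟩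

theorem closure_apply_eigenvector {D : Set (Module.End ℂ E)} {v : E}
    (hD : ∀ T ∈ D, ∃ r : ℂ, r ≠ 0 ∧ T v = r • v) {T : Module.End ℂ E}
    (hT : T ∈ Submonoid.closure D) : ∃ r : ℂ, r ≠ 0 ∧ T v = r • v := by
  induction hT using Submonoid.closure_induction with
  | mem x hx => exact hD x hx
  | one => exact ⟨1, one_ne_zero, by rw [one_smul, Module.End.one_apply]⟩
  | mul x y hx hy h1 h2 =>
    obtain ⟨r, hr, e⟩ := h1
    obtain ⟨r', hr', e'⟩ := h2
    exact ⟨r' * r, mul_ne_zero hr' hr, by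
      rw [Module.End.mul_apply, e', map_smul, e, smul_smul]⟩

/-- If T y = a v + z with z killed by S, then y - (a/r) v is killed by S T. This is the induction
step along a triangular basis. -/
theorem mem_span_sup_killed {D : Set (Module.End ℂ E)} (hD : ∀ S ∈ D, ∀ T ∈ D, S * T = T * S)
    {v y : E} {T : Module.End ℂ E} (hT : T ∈ D) {r : ℂ} (hr : r ≠ 0) (hv : T v = r • v)
    (hy : T y ∈ Submodule.span ℂ {v} ⊔ killed D hD) : y ∈ Submodule.span ℂ {v} ⊔ killed D hD := by
  obtain ⟨w, hw, z, ⟨S, hS, hz⟩, e⟩ := Submodule.mem_sup.1 hy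
  obtain ⟨a, rfl⟩ := Submodule.mem_span_singleton.1 hw
  have h : y - (a / r) • v ∈ killed D hD := by
    refine ⟨S * T, Submonoid.mul_mem _ hS (Submonoid.subset_closure hT), ?_⟩
    rw [Module.End.mul_apply, map_sub, map_smul, hv, smul_smul, div_mul_cancel₀ a hr, ← e,
      add_sub_cancel_left, hz]
  have h2 := Submodule.add_mem_sup (Submodule.smul_mem _ (a / r) (Submodule.mem_span_singleton_self
    (R := ℂ) v)) h
  rwa [add_sub_cancel] at h2

end

variable (hm : 2 ≤ m) {lev : ℂ} (hlam : lam cenH = lev) (hmu : mu cenH = lev)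

theorem vacMap_eb_mem {β : Fin m → ℕ}
    (hw : ∀ a, lam (diagH a) - mu (diagH a) = β a - N * (m : ℂ)⁻¹) {c₀ : Fin N → Fin m}
    (hc₀ : ∀ a, (Finset.univ.filter fun i => c₀ i = a).card = β a)
    {V : Submodule ℂ (StdModule N lam mu)}
    (hV : ∀ w : W N, wF lam mu hm w (vacMap lam mu (eb 0 c₀)) ∈ V) : V = ⊤ := by
  rw [eq_top_iff]
  rintro z -
  obtain ⟨y, rfl⟩ := vacMap_surjective lam mu hm z
  have hy : y ∈ Submodule.span ℂ {x : Mid m N | ∃ η c, x = eb η c} := by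
    rw [span_eb]; trivial
  induction hy using Submodule.span_induction with
  | mem x h =>
    obtain ⟨η, c', rfl⟩ := h
    by_cases hcc : ∀ a, (Finset.univ.filter fun i => c' i = a).card = β a
    · obtain ⟨w, hw⟩ := exists_perm_of_card_eq (c := c') (c' := c₀) fun a => by rw [hcc, hc₀]
      rw [← wF_eb hm hw]
      exact hV _
    · push Not at hcc
      obtain ⟨a, ha⟩ := hcc
      rw [vacMap_eb_eq_zero hm hw η c' ha]
      exact Submodule.zero_mem _
  | zero => rw [map_zero]; exact Submodule.zero_mem _
  | add x y _ _ hx hy => rw [map_add]; exact Submodule.add_mem _ hx hy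
  | smul r x _ hx => rw [map_smul]; exact Submodule.smul_mem _ _ hx

/-- The vector v is cyclic, and its joint eigenvalue occurs once on the diagonal, so the killed
vectors form a complement of its line. A submodule containing a vector with nonzero v-component
contains v. -/
theorem heckeRep_hasUniqueIrreducibleQuotient [NeZero N] (hdom : IsDominantIntegral mu)
    (hwt : IsTensorPowerWeight N (lam - mu))
    (hvac : ∀ c : Fin N → Fin m, (∀ a, lam (diagH a) - mu (diagH a) =
      ((Finset.univ.filter fun i => c i = a).card : ℂ) - N * (m : ℂ)⁻¹) →
        vacMap lam mu (eb 0 c) ≠ 0) :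
    RepHasUniqueIrreducibleQuotient (heckeRep (N := N) hm hlam hmu hwt) := by
  have hwt' := hwt
  obtain ⟨β, hβ, hw⟩ := hwt'
  have hw' := weight_diagH hβ hw
  obtain ⟨c₀, hc, hcβ⟩ := exists_monotone_word hβ
  set v := vacMap lam mu (eb 0 c₀) with hvdef
  have hv : v ≠ 0 := hvac c₀ fun a => by rw [hcβ, hw']
  -- The factors D_i - a which do not kill v; products of them act on v by nonzero scalars.
  let D : Set (Module.End ℂ (StdModule N lam mu)) :=
    {T | ∃ (i : Fin N) (a : ℂ), T = dF lam mu hm (Pi.single i 1) - a • 1 ∧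
      eigV (lev + m) (vacW lam mu) 0 c₀ i ≠ a}
  have hdv : ∀ i, dF lam mu hm (Pi.single i 1) v = eigV (lev + m) (vacW lam mu) 0 c₀ i • v := by
    intro i
    rw [hvdef, dF_vacMap hm hlam hmu, dunklMid_eb_monotone _ _ hc, map_smul]
  have hDv : ∀ (i : Fin N) (a : ℂ), (dF lam mu hm (Pi.single i 1) - a • 1 :
      Module.End ℂ (StdModule N lam mu)) v = (eigV (lev + m) (vacW lam mu) 0 c₀ i - a) • v := by
    intro i a
    rw [LinearMap.sub_apply, hdv, LinearMap.smul_apply, Module.End.one_apply, sub_smul]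
  have hDcomm : ∀ S ∈ D, ∀ T ∈ D, S * T = T * S := by
    rintro _ ⟨i, a, rfl, -⟩ _ ⟨j, b, rfl, -⟩
    rw [sub_mul, sub_mul, mul_sub, mul_sub, mul_sub, mul_sub, dF_comm hm hlam hmu hwt]
    simp only [smul_mul_assoc, mul_smul_comm, one_mul, mul_one]
    module
  have hDeig : ∀ T ∈ D, ∃ r : ℂ, r ≠ 0 ∧ T v = r • v := by
    rintro _ ⟨i, a, rfl, ha⟩
    exact ⟨_, sub_ne_zero.2 ha, hDv i a⟩
  obtain ⟨G, S, hG, hS⟩ := exists_level_function_of_isDominantIntegral hm hmu hdom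
  -- Strong induction on the energy. Unless (η, c) is the vector v itself, some diagonal entry
  -- differs from that of v, and the corresponding factor of `D` sends the vector to lower ones.
  have hgen : Submodule.span ℂ {v} ⊔ killed D hDcomm = ⊤ := by
    have key : ∀ (n : ℕ) (η : Fin N → ℤ) (c : Fin N → Fin m),
        (∀ a, (Finset.univ.filter fun i => c i = a).card = β a) → (energy η c).toNat = n →
        vacMap lam mu (eb η c) ∈ Submodule.span ℂ {v} ⊔ killed D hDcomm := by
      intro n
      induction n using Nat.strong_induction_on with
      | _ n ih =>
        intro η c hcc hn
        by_cases hb : ∀ i, eigV (lev + m) (vacW lam mu) η c i =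
            eigV (lev + m) (vacW lam mu) 0 c₀ i
        · obtain ⟨rfl, rfl⟩ := word_eq_of_eigV_eq hG hS (vacW_eq hw') hc hcβ hcc hb
          exact Submodule.mem_sup_left (Submodule.mem_span_singleton_self _)
        · push Not at hb
          obtain ⟨i, hi⟩ := hb
          refine mem_span_sup_killed hDcomm ⟨i, _, rfl, hi.symm⟩ (sub_ne_zero.2 hi.symm) (hDv i _) ?_
          obtain ⟨y, hy, e⟩ := dunklMid_eb_of_xOp_eb (lev + m) (vacW lam mu) η c (lower η c)
            (fun j k hjk => xOp_eb_triangular hjk η c) i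
          rw [LinearMap.sub_apply, dF_vacMap hm hlam hmu, e, map_add, map_smul, LinearMap.smul_apply,
            Module.End.one_apply, add_sub_cancel_left]
          have hlow : lower η c ≤ (Submodule.span ℂ {v} ⊔ killed D hDcomm).comap
              (vacMap lam mu) := by
            rw [lower, Submodule.span_le]
            rintro _ ⟨η', c', h1, h2, rfl⟩
            have h0 : 0 ≤ energy η' c' := Finset.sum_nonneg fun i _ => sq_nonneg _
            exact ih _ (by omega) η' c' (fun a => by rw [h1, hcc]) rfl
          exact hlow hy
    rw [eq_top_iff]
    rintro z -
    obtain ⟨y, rfl⟩ := vacMap_surjective lam mu hm z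
    have hy : y ∈ Submodule.span ℂ {x : Mid m N | ∃ η c, x = eb η c} := by
      rw [span_eb]; trivial
    have hle : Submodule.span ℂ {x : Mid m N | ∃ η c, x = eb η c} ≤
        (Submodule.span ℂ {v} ⊔ killed D hDcomm).comap (vacMap lam mu) := by
      rw [Submodule.span_le]
      rintro _ ⟨η, c', rfl⟩
      by_cases hcc : ∀ a, (Finset.univ.filter fun i => c' i = a).card = β a
      · exact key _ η c' hcc rfl
      · push Not at hcc
        obtain ⟨a, ha⟩ := hcc
        change vacMap lam mu (eb η c') ∈ Submodule.span ℂ {v} ⊔ killed D hDcomm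
        rw [vacMap_eb_eq_zero hm hw' η c' ha]
        exact Submodule.zero_mem _
    exact hle hy
  have hfix : ∀ y, y ∈ killed D hDcomm → ∃ T ∈ Submonoid.closure D, T y = 0 := fun y h => h
  rw [RepHasUniqueIrreducibleQuotient]
  let : Module (H N) (StdModule N lam mu) :=
    Module.compHom _ (heckeRep (N := N) hm hlam hmu hwt).toRingHom
  have hsmul : ∀ (h : H N) (y : StdModule N lam mu), h • y = heckeRep hm hlam hmu hwt h y :=
    fun _ _ => rfl
  have hscalar : ∀ (K : Submodule (H N) (StdModule N lam mu)) (r : ℂ) (y : StdModule N lam mu),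
      y ∈ K → r • y ∈ K := by
    intro K r y hy
    have := K.smul_mem (algebraMap ℂ (H N) r) hy
    rwa [hsmul, AlgHom.commutes, Module.algebraMap_end_apply] at this
  refine hasUniqueIrreducibleQuotient_of_cyclic v ?_ (killed D hDcomm).toAddSubgroup ?_ ?_
  · intro K hK
    let V : Submodule ℂ (StdModule N lam mu) :=
      { K.toAddSubgroup with smul_mem' := fun r y hy => hscalar K r y hy }
    have hV : V = ⊤ := vacMap_eb_mem hm hw' hcβ fun w => by
      rw [← heckeRep_ofW hm hlam hmu hwt]
      exact K.smul_mem (ofW w) hK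
    rw [eq_top_iff]
    rintro y -
    have : y ∈ V := hV ▸ Submodule.mem_top
    exact this
  · intro h
    obtain ⟨T, hT, e⟩ := hfix v h
    obtain ⟨r, hr, e'⟩ := closure_apply_eigenvector hDeig hT
    rw [e] at e'
    exact (smul_ne_zero hr hv) e'.symm
  -- Write y = a v + z with T z = 0. Then T y is a nonzero multiple of a v, so a ≠ 0 would put v
  -- into K.
  · intro K hK y hy
    have hy' : y ∈ Submodule.span ℂ {v} ⊔ killed D hDcomm := hgen ▸ Submodule.mem_top
    obtain ⟨w, hw1, z, hz, e⟩ := Submodule.mem_sup.1 hy'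
    obtain ⟨a, rfl⟩ := Submodule.mem_span_singleton.1 hw1
    obtain ⟨T, hT, hTz⟩ := hfix z hz
    have hTK : ∀ T ∈ Submonoid.closure D, ∀ y ∈ K, T y ∈ K := by
      intro T hT
      induction hT using Submonoid.closure_induction with
      | mem x hx =>
        obtain ⟨i, b, rfl, -⟩ := hx
        intro y hy
        have h1 := K.smul_mem (ofT (Pi.single i 1, 0)) hy
        rw [hsmul, heckeRep_ofT, tF, zero_mul, zero_smul, add_zero] at h1
        rw [LinearMap.sub_apply, LinearMap.smul_apply, Module.End.one_apply]
        exact K.sub_mem h1 (hscalar K b y hy)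
      | one => exact fun y hy => hy
      | mul x y _ _ hx hy => exact fun z hz => hx _ (hy _ hz)
    obtain ⟨r, hr, e'⟩ := closure_apply_eigenvector hDeig hT
    by_cases ha : a = 0
    · rw [ha, zero_smul, zero_add] at e
      rw [← e]
      exact hz
    · have h1 := hTK T hT y hy
      rw [← e, map_add, hTz, add_zero, map_smul, e', smul_smul] at h1
      have h2 := hscalar K (a * r)⁻¹ _ h1
      rw [smul_smul, inv_mul_cancel₀ (mul_ne_zero ha hr), one_smul] at h2
      exact absurd h2 hK

end

end KZ

/-! ### Induced representations on enveloping algebras -/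

namespace InducedRep

section
attribute [local instance 100] LieRing.ofAssociativeRing

variable {L : Type} [LieRing L] [LieAlgebra ℂ L]

theorem envelope_induction (S : Submodule ℂ (UniversalEnvelopingAlgebra ℂ L)) (h1 : 1 ∈ S)
    (h : ∀ x : L, ∀ u ∈ S, UniversalEnvelopingAlgebra.ι ℂ x * u ∈ S)
    (u : UniversalEnvelopingAlgebra ℂ L) : u ∈ S := by
  let A : Subalgebra ℂ (UniversalEnvelopingAlgebra ℂ L) :=
    { carrier := {u | ∀ s ∈ S, u * s ∈ S}
      mul_mem' := fun {u v} hu hv s hs => by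
        rw [mul_assoc]
        exact hu _ (hv _ hs)
      add_mem' := fun {u v} hu hv s hs => by
        rw [add_mul]
        exact S.add_mem (hu _ hs) (hv _ hs)
      algebraMap_mem' := fun r s hs => by
        rw [← Algebra.smul_def]
        exact S.smul_mem r hs }
  let f : L →ₗ⁅ℂ⁆ A :=
    { toFun := fun x => ⟨UniversalEnvelopingAlgebra.ι ℂ x, h x⟩
      map_add' := fun x y => Subtype.ext (map_add (UniversalEnvelopingAlgebra.ι ℂ) x y)
      map_smul' := fun r x => Subtype.ext (map_smul (UniversalEnvelopingAlgebra.ι ℂ) r x)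
      map_lie' := fun {x y} => Subtype.ext (LieHom.map_lie (UniversalEnvelopingAlgebra.ι ℂ) x y) }
  have hA : A.val.comp (UniversalEnvelopingAlgebra.lift ℂ f) = AlgHom.id ℂ _ := by
    apply UniversalEnvelopingAlgebra.hom_ext
    ext x
    change (UniversalEnvelopingAlgebra.lift ℂ f (UniversalEnvelopingAlgebra.ι ℂ x)).1 = _
    rw [UniversalEnvelopingAlgebra.lift_ι_apply]
    rfl
  have e : (UniversalEnvelopingAlgebra.lift ℂ f u).1 = u := DFunLike.congr_fun hA u
  have := (UniversalEnvelopingAlgebra.lift ℂ f u).2 1 h1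
  rwa [e, mul_one] at this

/-- A representation of a Lie algebra extends to its enveloping algebra. -/
theorem exists_lift {A : Type} [Ring A] [Algebra ℂ A] (f : L →ₗ[ℂ] A)
    (hf : ∀ x y, f ⁅x, y⁆ = f x * f y - f y * f x) :
    ∃ F : UniversalEnvelopingAlgebra ℂ L →ₐ[ℂ] A,
      ∀ x, F (UniversalEnvelopingAlgebra.ι ℂ x) = f x := by
  let g : L →ₗ⁅ℂ⁆ A := { f with map_lie' := fun {x y} => hf x y }
  exact ⟨UniversalEnvelopingAlgebra.lift ℂ g, UniversalEnvelopingAlgebra.lift_ι_apply ℂ g⟩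

theorem ι_lie (x y : L) : UniversalEnvelopingAlgebra.ι ℂ ⁅x, y⁆ =
    UniversalEnvelopingAlgebra.ι ℂ x * UniversalEnvelopingAlgebra.ι ℂ y
      - UniversalEnvelopingAlgebra.ι ℂ y * UniversalEnvelopingAlgebra.ι ℂ x :=
  LieHom.map_lie (UniversalEnvelopingAlgebra.ι ℂ) x y

/-- For a decomposition `L = a ⊕ b` into subalgebras and a character of `b`, the enveloping algebra
of `a` carries the induced representation of `L`. -/
theorem exists_induced (a : LieSubalgebra ℂ L) (p : L →ₗ[ℂ] a) (χ : L →ₗ[ℂ] ℂ)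
    (hp : ∀ x : a, p x = x) (hχ : ∀ x : a, χ x = 0)
    (hker : ∀ x y, p x = 0 → p y = 0 → p ⁅x, y⁆ = 0 ∧ χ ⁅x, y⁆ = 0) :
    ∃ σ : L →ₗ[ℂ] Module.End ℂ (UniversalEnvelopingAlgebra ℂ a),
      (∀ x y, σ ⁅x, y⁆ = σ x * σ y - σ y * σ x) ∧
      (∀ (x : a) u, σ x u = UniversalEnvelopingAlgebra.ι ℂ x * u) ∧
      ∀ y, σ y 1 = UniversalEnvelopingAlgebra.ι ℂ (p y) + χ y • 1 := by
  -- For fixed u the map y ↦ σ y u is a linear map from L to U(a), and σ y (x u) = x σ y u + σ [y,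
  -- x] u says how it changes under left multiplication of u by x. This rule defines an action of a,
  -- hence of U(a), on such maps, so that no basis of U(a) is needed.
  let op : a →ₗ[ℂ] Module.End ℂ (L →ₗ[ℂ] UniversalEnvelopingAlgebra ℂ a) :=
    LinearMap.mk₂ ℂ (fun x F => LinearMap.mulLeft ℂ (UniversalEnvelopingAlgebra.ι ℂ x) ∘ₗ F
        - F ∘ₗ (LieModule.toEnd ℂ L L x : L →ₗ[ℂ] L))
      (fun x x' F => by ext y; simp [add_mul]; abel)
      (fun r x F => by ext y; simp [smul_sub])
      (fun x F F' => by ext y; simp [mul_add]; abel)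
      (fun r x F => by ext y; simp [smul_sub])
  have hop : ∀ x F y, op x F y = UniversalEnvelopingAlgebra.ι ℂ x * F y - F ⁅(x : L), y⁆ :=
    fun x F y => rfl
  obtain ⟨f, hf⟩ := exists_lift op (by
    intro x x'
    refine LinearMap.ext fun F => LinearMap.ext fun y => ?_
    rw [LinearMap.sub_apply, LinearMap.sub_apply, Module.End.mul_apply, Module.End.mul_apply]
    simp only [hop, ι_lie, LieSubalgebra.coe_bracket, lie_lie, map_sub]
    noncomm_ring)
  -- The value at u = 1: the component in a acts by multiplication and the complement through χ.
  let F0 : L →ₗ[ℂ] UniversalEnvelopingAlgebra ℂ a :=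
    (UniversalEnvelopingAlgebra.ι ℂ : a →ₗ⁅ℂ⁆ _).toLinearMap ∘ₗ p + χ.smulRight 1
  let σ : L →ₗ[ℂ] Module.End ℂ (UniversalEnvelopingAlgebra ℂ a) :=
    (LinearMap.applyₗ F0 ∘ₗ f.toLinearMap).flip
  have hσ : ∀ y u, σ y u = f u F0 y := fun y u => rfl
  have h1 : ∀ y, σ y 1 = UniversalEnvelopingAlgebra.ι ℂ (p y) + χ y • 1 := fun y => by
    rw [hσ, map_one]
    rfl
  have hmul : ∀ (y : L) (x : a) u, σ y (UniversalEnvelopingAlgebra.ι ℂ x * u) =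
      UniversalEnvelopingAlgebra.ι ℂ x * σ y u + σ ⁅y, (x : L)⁆ u := by
    intro y x u
    rw [hσ, map_mul, hf, Module.End.mul_apply, hop, hσ, hσ, ← lie_skew (x : L) y, map_neg,
      sub_neg_eq_add]
  have hsub : ∀ (x : a) u, σ x u = UniversalEnvelopingAlgebra.ι ℂ x * u := by
    intro x u
    have key : ∀ u, u ∈ (⨅ x : a, LinearMap.ker (σ x - LinearMap.mulLeft ℂ
        (UniversalEnvelopingAlgebra.ι ℂ x)) : Submodule ℂ (UniversalEnvelopingAlgebra ℂ a)) := by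
      refine envelope_induction _ ?_ fun z u hu => ?_
      · rw [Submodule.mem_iInf]
        intro x
        rw [LinearMap.mem_ker, LinearMap.sub_apply, h1, hp, hχ, zero_smul, add_zero,
          LinearMap.mulLeft_apply, mul_one, sub_self]
      · rw [Submodule.mem_iInf] at hu ⊢
        have hu' : ∀ x : a, σ x u = UniversalEnvelopingAlgebra.ι ℂ x * u := fun x =>
          sub_eq_zero.1 (hu x)
        intro x
        rw [LinearMap.mem_ker, LinearMap.sub_apply, hmul, hu', ← LieSubalgebra.coe_bracket, hu',
          ι_lie, LinearMap.mulLeft_apply]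
        noncomm_ring
    exact sub_eq_zero.1 ((Submodule.mem_iInf _).1 (key u) x)
  refine ⟨σ, ?_, hsub, h1⟩
  have hb1 : ∀ b b', p b = 0 → p b' = 0 → σ ⁅b, b'⁆ 1 = 0 := fun b b' hb hb' => by
    rw [h1, (hker b b' hb hb').1, (hker b b' hb hb').2, map_zero, zero_smul, add_zero]
  have hone : ∀ y y', σ ⁅y, y'⁆ 1 = σ y (σ y' 1) - σ y' (σ y 1) := by
    intro y y'
    have hd : ∀ y, p (y - p y) = 0 := fun y => by rw [map_sub, hp, sub_self]
    have h2 : ∀ y y', σ y (σ y' 1) = UniversalEnvelopingAlgebra.ι ℂ (p y') *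
        (UniversalEnvelopingAlgebra.ι ℂ (p y) + χ y • 1) + σ ⁅y, (p y' : L)⁆ 1
        + χ y' • (UniversalEnvelopingAlgebra.ι ℂ (p y) + χ y • 1) := by
      intro y y'
      rw [h1 y', map_add, map_smul, h1 y]
      conv_lhs => rw [← mul_one (UniversalEnvelopingAlgebra.ι ℂ (p y')), hmul, h1 y]
    -- Decomposing both arguments along L = a ⊕ ker p leaves only a bracket inside ker p, which acts
    -- by zero on 1.
    have h3 : ⁅y, y'⁆ = ⁅y, (p y' : L)⁆ - ⁅y', (p y : L)⁆ - ⁅(p y : L), (p y' : L)⁆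
        + ⁅y - p y, y' - p y'⁆ := by
      rw [sub_lie, lie_sub, lie_sub, ← lie_skew y' (p y : L)]
      abel
    have h4 : σ ⁅(p y : L), (p y' : L)⁆ 1 = UniversalEnvelopingAlgebra.ι ℂ (p y) *
        UniversalEnvelopingAlgebra.ι ℂ (p y') - UniversalEnvelopingAlgebra.ι ℂ (p y') *
        UniversalEnvelopingAlgebra.ι ℂ (p y) := by
      rw [← LieSubalgebra.coe_bracket, hsub, mul_one, ι_lie]
    have h5 : σ ⁅y, y'⁆ 1 = σ ⁅y, (p y' : L)⁆ 1 - σ ⁅y', (p y : L)⁆ 1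
        - σ ⁅(p y : L), (p y' : L)⁆ 1 + σ ⁅y - p y, y' - p y'⁆ 1 := by
      conv_lhs => rw [h3]
      simp only [map_add, map_sub, LinearMap.add_apply, LinearMap.sub_apply]
    rw [h5, hb1 _ _ (hd y) (hd y'), h4, h2, h2]
    simp only [mul_add, mul_smul_comm, mul_one, smul_add, smul_smul, mul_comm (χ y)]
    abel
  intro y y'
  have key : ∀ u, u ∈ (⨅ y, ⨅ y', LinearMap.ker (σ ⁅y, y'⁆ - (σ y * σ y' - σ y' * σ y)) :
      Submodule ℂ (UniversalEnvelopingAlgebra ℂ a)) := by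
    have hmem : ∀ u, u ∈ (⨅ y, ⨅ y', LinearMap.ker (σ ⁅y, y'⁆ - (σ y * σ y' - σ y' * σ y)) :
        Submodule ℂ (UniversalEnvelopingAlgebra ℂ a)) ↔
        ∀ y y', σ ⁅y, y'⁆ u = σ y (σ y' u) - σ y' (σ y u) := by
      intro u
      simp only [Submodule.mem_iInf, LinearMap.mem_ker, LinearMap.sub_apply, Module.End.mul_apply,
        sub_eq_zero]
    refine envelope_induction _ ((hmem 1).2 hone) fun x u hu => ?_
    rw [hmem] at hu ⊢
    intro y y'
    have h6 : σ ⁅⁅y, y'⁆, (x : L)⁆ u = σ ⁅⁅y, (x : L)⁆, y'⁆ u + σ ⁅y, ⁅y', (x : L)⁆⁆ u := by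
      rw [← LinearMap.add_apply, ← map_add]
      congr 2
      rw [lie_lie, ← lie_skew ⁅y, (x : L)⁆ y']
      abel
    rw [hmul, hmul, hmul, map_add, map_add, hmul, hmul, hu y y', h6, hu ⁅y, (x : L)⁆ y',
      hu y ⁅y', (x : L)⁆, mul_sub]
    abel
  refine LinearMap.ext fun u => ?_
  have := key u
  simp only [Submodule.mem_iInf, LinearMap.mem_ker, LinearMap.sub_apply] at this
  exact sub_eq_zero.1 (this y y')

end

end InducedRep

namespace AffineSl
variable {m : ℕ}

/-! ### The triangular decomposition -/

/-- The only relations among the `E a b n` are the vanishing sums of diagonal ones. The map is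
defined freely on all matrices and kills the scalar matrices, hence ignores the passage to traceless
parts. -/
theorem exists_linearMap_E {V : Type} [AddCommGroup V] [Module ℂ V] (g : Fin m → Fin m → ℤ → V)
    (hg : ∀ n, ∑ a, g a a n = 0) (vc vd : V) : ∃ T : AffineSl m →ₗ[ℂ] V,
      (∀ a b n, T (E a b n) = g a b n) ∧ T cen = vc ∧ T deg = vd := by
  let φ : Fin m → Fin m → ℂ[T;T⁻¹] →ₗ[ℂ] V := fun a b =>
    (AddMonoidAlgebra.basis ℤ ℂ).constr ℂ (g a b)
  have hφ : ∀ a b n, φ a b (LaurentPolynomial.T n) = g a b n := fun a b n => by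
    have := (AddMonoidAlgebra.basis ℤ ℂ).constr_basis ℂ (g a b) n
    rwa [AddMonoidAlgebra.basis_apply] at this
  let ψ : Matrix (Fin m) (Fin m) ℂ[T;T⁻¹] →ₗ[ℂ] V :=
    ∑ a, ∑ b, φ a b ∘ₗ (Matrix.entryLinearMap ℂ ℂ[T;T⁻¹] a b)
  have hψ : ∀ X, ψ X = ∑ a, ∑ b, φ a b (X a b) := fun X => by
    simp only [ψ, LinearMap.sum_apply, LinearMap.comp_apply, Matrix.entryLinearMap_apply]
  have h1 : ∀ f : ℂ[T;T⁻¹], ∑ a, φ a a f = 0 := by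
    have : ∑ a, φ a a = 0 := by
      refine (AddMonoidAlgebra.basis ℤ ℂ).ext fun n => ?_
      rw [LinearMap.sum_apply, LinearMap.zero_apply, AddMonoidAlgebra.basis_apply]
      exact (Finset.sum_congr rfl fun a _ => hφ a a n).trans (hg n)
    intro f
    rw [← LinearMap.sum_apply, this, LinearMap.zero_apply]
  have h2 : ∀ f : ℂ[T;T⁻¹], ψ (f • 1) = 0 := by
    intro f
    rw [hψ, ← h1 f]
    refine Finset.sum_congr rfl fun a _ => ?_
    rw [Finset.sum_eq_single a]
    · rw [Matrix.smul_apply, Matrix.one_apply_eq, smul_eq_mul, mul_one]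
    · intro b _ hb
      rw [Matrix.smul_apply, Matrix.one_apply_ne hb.symm, smul_zero, map_zero]
    · simp
  let val : LoopSl m →ₗ[ℂ] Matrix (Fin m) (Fin m) ℂ[T;T⁻¹] :=
    { toFun := fun X => X.1
      map_add' := fun _ _ => rfl
      map_smul' := fun _ _ => rfl }
  refine ⟨ψ ∘ₗ val ∘ₗ loop + coC.smulRight vc + coD.smulRight vd, fun a b n => ?_, ?_, ?_⟩
  · simp only [LinearMap.add_apply, LinearMap.comp_apply, LinearMap.smulRight_apply, coC_E, coD_E,
      zero_smul, add_zero]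
    change ψ (tl (unitT a b n)).1 = _
    rw [tl_val, map_sub, h2, sub_zero, hψ, Finset.sum_eq_single a, Finset.sum_eq_single b]
    · rw [unitT, Matrix.single_apply_same, hφ]
    · intro d _ hd
      rw [unitT, Matrix.single_apply_of_ne _ _ _ _ _ (fun h => hd h.2.symm), map_zero]
    · simp
    · intro d _ hd
      refine Finset.sum_eq_zero fun e _ => ?_
      rw [unitT, Matrix.single_apply_of_ne _ _ _ _ _ (fun h => hd h.1.symm), map_zero]
    · simp
  · simp
  · simp

/-- The principal degree of `E a b n`. -/
def pdeg (a b : Fin m) (n : ℤ) : ℤ := m * n + (b : ℕ) - (a : ℕ)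

/-- Since |b - a| < m, the sign of the principal degree is decided by n first; 𝔫₋ is thus the
negative part of a single grading. -/
theorem pdeg_neg_cases {a b : Fin m} {n : ℤ} (h : pdeg a b n < 0) : n < 0 ∨ (n = 0 ∧ b < a) := by
  have ha := a.2
  have hb := b.2
  rw [pdeg] at h
  rcases lt_trichotomy n 0 with h1 | h1 | h1
  · exact Or.inl h1
  · refine Or.inr ⟨h1, ?_⟩
    rw [h1] at h
    rw [Fin.lt_def]
    omega
  · nlinarith

theorem pdeg_neg_of_cases {a b : Fin m} {n : ℤ} (h : n < 0 ∨ (n = 0 ∧ b < a)) : pdeg a b n < 0 := by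
  have ha := a.2
  have hb := b.2
  rw [pdeg]
  rcases h with h | ⟨rfl, h⟩
  · nlinarith
  · rw [Fin.lt_def] at h
    omega

theorem nMinus_eq : nMinus m = Submodule.span ℂ {x | ∃ a b n, pdeg a b n < 0 ∧ x = E a b n} := by
  rw [nMinus]
  congr 1
  ext x
  constructor
  · rintro (⟨a, b, h, rfl⟩ | ⟨a, b, n, h, rfl⟩)
    · exact ⟨a, b, 0, pdeg_neg_of_cases (Or.inr ⟨rfl, h⟩), rfl⟩
    · exact ⟨a, b, n, pdeg_neg_of_cases (Or.inl h), rfl⟩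
  · rintro ⟨a, b, n, h, rfl⟩
    rcases pdeg_neg_cases h with h1 | ⟨rfl, h1⟩
    · exact Or.inr ⟨a, b, n, h1, rfl⟩
    · exact Or.inl ⟨a, b, h1, rfl⟩

theorem E_mem_nMinus {a b : Fin m} {n : ℤ} (h : pdeg a b n < 0) : E a b n ∈ nMinus m := by
  rw [nMinus_eq]
  exact Submodule.subset_span ⟨a, b, n, h, rfl⟩

/-- The principal degree is additive, and a central term would need opposite loop degrees, which are
both non-positive and hence zero. -/
theorem nMinus_lie_mem {x y : AffineSl m} (hx : x ∈ nMinus m) (hy : y ∈ nMinus m) :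
    ⁅x, y⁆ ∈ nMinus m := by
  rw [nMinus_eq] at hx hy
  induction hx, hy using Submodule.span_induction₂ with
  | mem_mem x y hx hy =>
    obtain ⟨a, b, n, h1, rfl⟩ := hx
    obtain ⟨c, d, k, h2, rfl⟩ := hy
    have hz : (if n + k = 0 then (n : ℂ) * ((if a = d ∧ b = c then 1 else 0)
        - (if a = b ∧ c = d then (m : ℂ)⁻¹ else 0)) else 0) = 0 := by
      split_ifs with h
      all_goals try rfl
      all_goals
        have e : n = 0 := by
          rcases pdeg_neg_cases h1 with h3 | h3 <;> rcases pdeg_neg_cases h2 with h4 | h4 <;> omega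
        rw [e, Int.cast_zero, zero_mul]
    rw [lie_E_E, hz, zero_smul, add_zero]
    rw [pdeg] at h1 h2
    refine Submodule.sub_mem _ ?_ ?_
    · split_ifs with h
      · subst h
        refine E_mem_nMinus ?_
        rw [pdeg, mul_add]
        omega
      · exact Submodule.zero_mem _
    · split_ifs with h
      · subst h
        refine E_mem_nMinus ?_
        rw [pdeg, mul_add]
        omega
      · exact Submodule.zero_mem _
  | zero_left y hy => rw [zero_lie]; exact Submodule.zero_mem _
  | zero_right x hx => rw [lie_zero]; exact Submodule.zero_mem _
  | add_left x y z _ _ _ h1 h2 => rw [add_lie]; exact Submodule.add_mem _ h1 h2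
  | add_right x y z _ _ _ h1 h2 => rw [lie_add]; exact Submodule.add_mem _ h1 h2
  | smul_left r x y _ _ h => rw [smul_lie]; exact Submodule.smul_mem _ _ h
  | smul_right r x y _ _ h => rw [lie_smul]; exact Submodule.smul_mem _ _ h

variable (m) in
/-- `𝔫₋` as a Lie subalgebra. -/
def nMinusAlg : LieSubalgebra ℂ (AffineSl m) :=
  { nMinus m with lie_mem' := fun hx hy => nMinus_lie_mem hx hy }

theorem E_mem_nMinusAlg {a b : Fin m} {n : ℤ} (h : pdeg a b n < 0) : E a b n ∈ nMinusAlg m :=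
  E_mem_nMinus h

/-- The degree element of the Cartan subalgebra. -/
def degH : cartan m := ⟨deg, Submodule.subset_span (Or.inr (Or.inr rfl))⟩

variable (m) in
/-- `𝔟₊`. -/
def borel : Submodule ℂ (AffineSl m) :=
  Submodule.span ℂ ({x | ∃ a b n, 0 ≤ pdeg a b n ∧ x = E a b n} ∪ {cen, deg})

end AffineSl

namespace AffineSl
open KZ
variable {m : ℕ}

/-- These are the data for `exists_induced`: projection to 𝔫₋ along 𝔟₊, and the weight l extended to
a character of 𝔟₊ that vanishes on 𝔫₊. -/
theorem exists_triangular_projections (l : Weight m) : ∃ (p : AffineSl m →ₗ[ℂ] nMinusAlg m)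
    (χ : AffineSl m →ₗ[ℂ] ℂ), (∀ x : nMinusAlg m, p x = x) ∧ (∀ x : nMinusAlg m, χ x = 0) ∧
    (∀ x y, p x = 0 → p y = 0 → p ⁅x, y⁆ = 0 ∧ χ ⁅x, y⁆ = 0) ∧
    (∀ x ∈ nPlus m, p x = 0 ∧ χ x = 0) ∧ ∀ h : cartan m, p h = 0 ∧ χ h = l h := by
  obtain ⟨p, hpE, hpc, hpd⟩ := exists_linearMap_E (V := nMinusAlg m)
    (fun a b n => if h : pdeg a b n < 0 then ⟨E a b n, E_mem_nMinusAlg h⟩ else 0) (by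
      intro n
      by_cases h : (m : ℤ) * n < 0
      · apply Subtype.ext
        rw [AddSubmonoidClass.coe_finsetSum, ZeroMemClass.coe_zero, ← sum_E_diag n]
        refine Finset.sum_congr rfl fun a _ => ?_
        rw [dif_pos (by rw [pdeg]; omega)]
      · exact Finset.sum_eq_zero fun a _ => dif_neg (by rw [pdeg]; omega)) 0 0
  obtain ⟨χ, hχE, hχc, hχd⟩ := exists_linearMap_E (V := ℂ)
    (fun a b n => if a = b ∧ n = 0 then l (diagH a) else 0) (by
      intro n
      by_cases h : n = 0
      · simp only [h, and_self, if_true]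
        rw [← map_sum, sum_diagH, map_zero]
      · simp [h]) (l cenH) (l degH)
  have hneg : ∀ x ∈ nMinus m, (p x : AffineSl m) = x ∧ χ x = 0 := by
    intro x hx
    rw [nMinus_eq] at hx
    induction hx using Submodule.span_induction with
    | mem x h =>
      obtain ⟨a, b, n, h, rfl⟩ := h
      rw [hpE, dif_pos h, hχE, if_neg]
      · exact ⟨rfl, rfl⟩
      · rintro ⟨rfl, rfl⟩
        rw [pdeg] at h
        omega
    | zero => simp
    | add x y _ _ hx hy =>
      rw [map_add, map_add, hx.2, hy.2, add_zero]
      exact ⟨by rw [AddMemClass.coe_add, hx.1, hy.1], rfl⟩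
    | smul r x _ hx =>
      rw [map_smul, map_smul, hx.2, smul_zero]
      exact ⟨by rw [SetLike.val_smul, hx.1], rfl⟩
  have hpos : ∀ x ∈ borel m, p x = 0 := by
    intro x hx
    have : borel m ≤ LinearMap.ker p := by
      rw [borel, Submodule.span_le]
      rintro _ (⟨a, b, n, h, rfl⟩ | rfl | rfl)
      · exact (hpE a b n).trans (dif_neg h.not_gt)
      · exact hpc
      · exact hpd
    exact this hx
  have hsub : ∀ x, x - (p x : AffineSl m) ∈ borel m := by
    intro x
    induction x using induction_E with
    | hE a b n =>
      rw [hpE]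
      by_cases h : pdeg a b n < 0
      · rw [dif_pos h, sub_self]
        exact Submodule.zero_mem _
      · rw [dif_neg h, ZeroMemClass.coe_zero, sub_zero]
        exact Submodule.subset_span (Or.inl ⟨a, b, n, not_lt.1 h, rfl⟩)
    | hc =>
      rw [hpc, ZeroMemClass.coe_zero, sub_zero]
      exact Submodule.subset_span (Or.inr (Or.inl rfl))
    | hd =>
      rw [hpd, ZeroMemClass.coe_zero, sub_zero]
      exact Submodule.subset_span (Or.inr (Or.inr rfl))
    | hadd x y hx hy =>
      rw [map_add, AddMemClass.coe_add, add_sub_add_comm]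
      exact Submodule.add_mem _ hx hy
    | hsmul r x hx =>
      rw [map_smul, SetLike.val_smul, ← smul_sub]
      exact Submodule.smul_mem _ _ hx
  have hborel : ∀ x, p x = 0 → x ∈ borel m := by
    intro x hx
    have := hsub x
    rwa [hx, ZeroMemClass.coe_zero, sub_zero] at this
  have hlie : ∀ x ∈ borel m, ∀ y ∈ borel m, p ⁅x, y⁆ = 0 ∧ χ ⁅x, y⁆ = 0 := by
    intro x hx y hy
    have hdE : ∀ a b n, 0 ≤ pdeg a b n → p ⁅(deg : AffineSl m), E a b n⁆ = 0 ∧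
        χ ⁅(deg : AffineSl m), E a b n⁆ = 0 := by
      intro a b n h
      rw [lie_deg_E, map_smul, map_smul, hpE, hχE, dif_neg h.not_gt, smul_zero]
      refine ⟨rfl, ?_⟩
      split_ifs with h2
      · rw [h2.2, Int.cast_zero, zero_smul]
      · rw [smul_zero]
    rw [borel] at hx hy
    induction hx, hy using Submodule.span_induction₂ with
    | mem_mem x y hx hy =>
      rcases hx with ⟨a, b, n, h1, rfl⟩ | rfl | rfl
      · rcases hy with ⟨c, d, k, h2, rfl⟩ | rfl | rfl
        · rw [lie_E_E]
          rw [pdeg] at h1 h2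
          constructor
          · rw [map_add, map_smul, hpc, smul_zero, add_zero, map_sub]
            have e1 : p (if b = c then E a d (n + k) else 0) = 0 := by
              split_ifs with h
              · subst h
                rw [hpE, dif_neg]
                rw [pdeg, mul_add]
                omega
              · rw [map_zero]
            have e2 : p (if d = a then E c b (n + k) else 0) = 0 := by
              split_ifs with h
              · subst h
                rw [hpE, dif_neg]
                rw [pdeg, mul_add]
                omega
              · rw [map_zero]
            rw [e1, e2, sub_zero]
          · have ha := a.2
            have hb := b.2
            have hc := c.2
            have hd := d.2
            -- A central term needs opposite principal degrees; both being non-negative, they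
            -- vanish, and so does the cocycle.
            have hn : n + k = 0 → (a = d ∧ b = c) ∨ (a = b ∧ c = d) → n = 0 := by
              intro h h3
              obtain rfl : k = -n := by omega
              rcases lt_trichotomy n 0 with h4 | h4 | h4
              · rcases h3 with ⟨rfl, rfl⟩ | ⟨rfl, rfl⟩ <;> nlinarith
              · exact h4
              · rcases h3 with ⟨rfl, rfl⟩ | ⟨rfl, rfl⟩ <;> nlinarith
            have hz : (if n + k = 0 then (n : ℂ) * ((if a = d ∧ b = c then 1 else 0)
                - (if a = b ∧ c = d then (m : ℂ)⁻¹ else 0)) else 0) = 0 := by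
              split_ifs with h h3 h4 h4
              any_goals rw [hn h (Or.inl h3), Int.cast_zero, zero_mul]
              any_goals rw [hn h (Or.inr h4), Int.cast_zero, zero_mul]
              all_goals simp
            rw [hz, zero_smul, add_zero, map_sub, sub_eq_zero]
            by_cases h : (a = d ∧ b = c) ∧ n + k = 0
            · obtain ⟨⟨rfl, rfl⟩, hk⟩ := h
              obtain rfl := hn hk (Or.inl ⟨rfl, rfl⟩)
              obtain rfl : k = 0 := by omega
              obtain rfl : a = b := Fin.ext (by omega)
              rfl
            · have e1 : χ (if b = c then E a d (n + k) else 0) = 0 := by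
                split_ifs with h3
                · rw [hχE, if_neg fun h4 => h ⟨⟨h4.1, h3⟩, h4.2⟩]
                · rw [map_zero]
              have e2 : χ (if d = a then E c b (n + k) else 0) = 0 := by
                split_ifs with h3
                · rw [hχE, if_neg fun h4 => h ⟨⟨h3.symm, h4.1.symm⟩, h4.2⟩]
                · rw [map_zero]
              rw [e1, e2]
        · rw [lie_cen]; simp
        · rw [← lie_skew, map_neg, map_neg, (hdE a b n h1).1, (hdE a b n h1).2]; simp
      · rw [cen_lie]; simp
      · rcases hy with ⟨c, d, k, h2, rfl⟩ | rfl | rfl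
        · exact hdE c d k h2
        · rw [lie_cen]; simp
        · rw [lie_self]; simp
    | zero_left y hy => simp
    | zero_right x hx => simp
    | add_left x y z _ _ _ h1 h2 => rw [add_lie, map_add, map_add, h1.1, h1.2, h2.1, h2.2]; simp
    | add_right x y z _ _ _ h1 h2 => rw [lie_add, map_add, map_add, h1.1, h1.2, h2.1, h2.2]; simp
    | smul_left r x y _ _ h => rw [smul_lie, map_smul, map_smul, h.1, h.2]; simp
    | smul_right r x y _ _ h => rw [lie_smul, map_smul, map_smul, h.1, h.2]; simp
  refine ⟨p, χ, fun x => Subtype.ext (hneg x x.2).1, fun x => (hneg x x.2).2,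
    fun x y hx hy => hlie x (hborel x hx) y (hborel y hy), ?_, ?_⟩
  · intro x hx
    have : nPlus m ≤ LinearMap.ker p ⊓ LinearMap.ker χ := by
      have hd : ∀ a b n, 0 < pdeg a b n → (E a b n : AffineSl m) ∈ LinearMap.ker p ⊓ LinearMap.ker χ := by
        intro a b n h
        refine ⟨(hpE a b n).trans (dif_neg h.le.not_gt), (hχE a b n).trans (if_neg ?_)⟩
        rintro ⟨rfl, rfl⟩
        rw [pdeg] at h
        omega
      rw [nPlus, Submodule.span_le]
      rintro _ (⟨a, b, h, rfl⟩ | ⟨a, b, n, h, rfl⟩)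
      · refine hd a b 0 ?_
        rw [Fin.lt_def] at h
        rw [pdeg]
        omega
      · refine hd a b n ?_
        have ha := a.2
        rw [pdeg]
        nlinarith
    exact this hx
  · have : ∀ x (hx : x ∈ cartan m), p x = 0 ∧ χ x = l ⟨x, hx⟩ := by
      intro x hx
      induction hx using Submodule.span_induction with
      | mem x h =>
        rcases h with ⟨a, rfl⟩ | rfl | rfl
        · rw [hpE, hχE, dif_neg (by rw [pdeg]; omega), if_pos ⟨rfl, rfl⟩]
          exact ⟨rfl, rfl⟩
        · exact ⟨hpc, hχc⟩
        · exact ⟨hpd, hχd⟩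
      | zero => exact ⟨map_zero p, (map_zero χ).trans (map_zero l).symm⟩
      | add x y h1 h2 hx hy =>
        rw [map_add, map_add, hx.1, hx.2, hy.1, hy.2, add_zero, ← map_add]
        exact ⟨rfl, rfl⟩
      | smul r x h1 hx =>
        rw [map_smul, map_smul, hx.1, hx.2, smul_zero, ← map_smul]
        exact ⟨rfl, rfl⟩
    exact fun h => this h.1 h.2

end AffineSl

/-! ### Universal properties of Verma modules -/

namespace KZ
open AffineSl InducedRep
variable {m N : ℕ}

section
variable {M M' : Type} [AddCommGroup M] [Module ℂ M] [AddCommGroup M'] [Module ℂ M']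
  {p : AffineSl m → Module.End ℂ M} {q : AffineSl m → Module.End ℂ M'}

theorem IsRep.dual (hp : IsRep p) :
    IsRep fun x => (-Module.Dual.transpose (p x) : Module.End ℂ (Module.Dual ℂ M)) where
  add x y := by rw [hp.add, map_add, neg_add]
  smul r x := by rw [hp.smul, map_smul, smul_neg]
  lie x y := by
    ext f v
    simp only [hp.lie, LinearMap.neg_apply, LinearMap.sub_apply, Module.Dual.transpose_apply,
      Module.End.mul_apply, LinearMap.comp_apply, map_sub, map_neg]
    simp

theorem IsRep.tensor (hp : IsRep p) (hq : IsRep q) :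
    IsRep fun x => LinearMap.rTensor M' (p x) + LinearMap.lTensor M (q x) where
  add x y := by
    rw [hp.add, hq.add, LinearMap.rTensor_add, LinearMap.lTensor_add]
    abel
  smul r x := by
    rw [hp.smul, hq.smul, LinearMap.rTensor_smul, LinearMap.lTensor_smul, smul_add]
  lie x y := by
    refine TensorProduct.ext' fun v w => ?_
    simp only [hp.lie, hq.lie, LinearMap.add_apply, LinearMap.sub_apply, Module.End.mul_apply,
      LinearMap.rTensor_tmul, LinearMap.lTensor_tmul, map_add, TensorProduct.sub_tmul,
      TensorProduct.tmul_sub]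
    abel

theorem exists_verma_map (hp : IsRep p) (n : Submodule ℂ (AffineSl m)) (l : Weight m) (w : M)
    (hn : ∀ x ∈ n, p x w = 0) (hl : ∀ h : cartan m, p h.1 w = l h • w) :
    ∃ θ : VermaOf n l →ₗ[ℂ] M, θ (vac n l) = w ∧ ∀ x a, θ ⁅x, a⁆ = p x (θ a) := by
  let f : AffineSl m →ₗ[ℂ] Module.End ℂ M :=
    { toFun := p
      map_add' := hp.add
      map_smul' := hp.smul }
  obtain ⟨F, hF⟩ := exists_lift f hp.lie
  have hF' : ∀ x, F (toU x) = p x := hF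
  let _ : Module (U m) M := Module.compHom M F.toRingHom
  have smul_def : ∀ (u : U m) (v : M), u • v = F u v := fun _ _ => rfl
  have hle : vermaIdeal n l ≤ LinearMap.ker (LinearMap.toSpanSingleton (U m) M w) := by
    rw [vermaIdeal, Submodule.span_le]
    rintro u (⟨x, hx, rfl⟩ | ⟨h, rfl⟩)
    · change toU x • w = 0
      rw [smul_def, hF', hn x hx]
    · change (toU h.1 - algebraMap ℂ (U m) (l h)) • w = 0
      rw [smul_def, map_sub, hF', AlgHom.commutes, LinearMap.sub_apply, hl,
        Module.algebraMap_end_apply, sub_self]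
  let θ : U m ⧸ vermaIdeal n l →ₗ[U m] M := (vermaIdeal n l).liftQ _ hle
  refine ⟨{ toFun := θ, map_add' := map_add θ, map_smul' := fun r a => ?_ }, ?_, fun x a => ?_⟩
  · have h1 : θ (algebraMap ℂ (U m) r • a) = algebraMap ℂ (U m) r • θ a := map_smul θ _ a
    rw [algebraMap_smul, smul_def, AlgHom.commutes, Module.algebraMap_end_apply] at h1
    exact h1
  · change (1 : U m) • w = w
    rw [one_smul]
  · have h1 : θ (toU x • a) = toU x • θ a := map_smul θ _ a
    rw [smul_def, hF'] at h1
    exact h1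

/-- Over `𝔫₋`, the Verma module is generated freely by its vacuum vector. -/
theorem exists_verma_nMinus_map (hp : IsRep p) (l : Weight m) (w : M) :
    ∃ θ : Verma l →ₗ[ℂ] M, θ (vac (nPlus m) l) = w ∧
      ∀ x ∈ nMinus m, ∀ a, θ ⁅x, a⁆ = p x (θ a) := by
  obtain ⟨P, χ, h1, h2, h3, h4, h5⟩ := exists_triangular_projections l
  obtain ⟨σ, hσ, hσm, hσ1⟩ := exists_induced (nMinusAlg m) P χ h1 h2 h3
  -- The Verma module maps to U(𝔫₋), vacuum to 1; letting the resulting element of U(𝔫₋) act on w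
  -- gives the required map.
  obtain ⟨θ, hθ, hθx⟩ := exists_verma_map (p := σ) ⟨map_add σ, map_smul σ, hσ⟩ (nPlus m) l 1
    (fun x hx => by rw [hσ1, (h4 x hx).1, (h4 x hx).2, map_zero, zero_smul, add_zero])
    (fun h => by rw [hσ1, (h5 h).1, (h5 h).2, map_zero, zero_add])
  let f : nMinusAlg m →ₗ[ℂ] Module.End ℂ M :=
    { toFun := fun x => p x
      map_add' := fun x y => hp.add x y
      map_smul' := fun r x => hp.smul r x }
  obtain ⟨F, hF⟩ := exists_lift f fun x y => hp.lie x y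
  refine ⟨LinearMap.applyₗ w ∘ₗ F.toLinearMap ∘ₗ θ, ?_, fun x hx a => ?_⟩
  · change F (θ (vac (nPlus m) l)) w = w
    rw [hθ, map_one, Module.End.one_apply]
  · change F (θ ⁅x, a⁆) w = p x (F (θ a) w)
    rw [hθx, hσm ⟨x, hx⟩, map_mul, hF]
    rfl

end

end KZ

namespace AffineSl
variable {m : ℕ}

theorem cartan_lie_nMinus {h x : AffineSl m} (hh : h ∈ cartan m) (hx : x ∈ nMinus m) :
    ⁅h, x⁆ ∈ nMinus m := by
  rw [nMinus_eq] at hx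
  rw [cartan] at hh
  induction hh, hx using Submodule.span_induction₂ with
  | mem_mem h x hh hx =>
    obtain ⟨c, d, k, hk, rfl⟩ := hx
    rcases hh with ⟨a, rfl⟩ | rfl | rfl
    · rw [lie_E_E, zero_add, Int.cast_zero, zero_mul, ite_self, zero_smul, add_zero]
      refine Submodule.sub_mem _ ?_ ?_
      · split_ifs with h
        · exact h ▸ E_mem_nMinus hk
        · exact Submodule.zero_mem _
      · split_ifs with h
        · exact h ▸ E_mem_nMinus hk
        · exact Submodule.zero_mem _
    · rw [cen_lie]
      exact Submodule.zero_mem _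
    · rw [lie_deg_E]
      exact Submodule.smul_mem _ _ (E_mem_nMinus hk)
  | zero_left y hy => rw [zero_lie]; exact Submodule.zero_mem _
  | zero_right x hx => rw [lie_zero]; exact Submodule.zero_mem _
  | add_left x y z _ _ _ h1 h2 => rw [add_lie]; exact Submodule.add_mem _ h1 h2
  | add_right x y z _ _ _ h1 h2 => rw [lie_add]; exact Submodule.add_mem _ h1 h2
  | smul_left r x y _ _ h => rw [smul_lie]; exact Submodule.smul_mem _ _ h
  | smul_right r x y _ _ h => rw [lie_smul]; exact Submodule.smul_mem _ _ h

end AffineSl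

namespace KZ
open AffineSl
variable {m N : ℕ}

section
attribute [local instance] vnGroup midGroup midAddGroup

/-! ### Vacuum vectors do not vanish in the coinvariants -/

/-- The diagonal action on the middle factor, with the degree element shifted by `t`. -/
def thetaMid (t : ℂ) (x : AffineSl m) : Module.End ℂ (Mid m N) :=
  (∑ i, thetaEval i x) + (coD x * t) • 1

theorem isRep_thetaMid (t : ℂ) : IsRep (thetaMid (m := m) (N := N) t) where
  add x y := by
    simp only [thetaMid, (isRep_thetaEval _).add, Finset.sum_add_distrib, map_add, add_mul,
      add_smul]
    abel
  smul r x := by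
    simp only [thetaMid, (isRep_thetaEval _).smul, smul_add, Finset.smul_sum, map_smul,
      smul_eq_mul, mul_assoc, mul_smul]
  lie x y := by
    have h1 : ∀ i : Fin N, thetaEval (m := m) i ⁅x, y⁆ = thetaEval i x * (∑ j, thetaEval j y)
        - (∑ j, thetaEval j y) * thetaEval i x := by
      intro i
      rw [(isRep_thetaEval i).lie, Finset.mul_sum, Finset.sum_mul, ← Finset.sum_sub_distrib,
        Finset.sum_eq_single i]
      · intro j _ hj
        rw [thetaEval_commute hj.symm, sub_self]
      · simp
    simp only [thetaMid, h1, Finset.sum_sub_distrib, ← Finset.sum_mul, ← Finset.mul_sum, coD_lie,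
      zero_mul, zero_smul, add_zero, add_mul, mul_add, smul_mul_assoc, mul_smul_comm, one_mul,
      mul_one]
    module

theorem thetaMid_of_coD_eq_zero (t : ℂ) {x : AffineSl m} (hx : coD x = 0) :
    thetaMid (N := N) t x = ∑ i, thetaEval i x := by
  rw [thetaMid, hx, zero_mul, zero_smul, add_zero]

theorem exists_coord_eb (c : Fin N → Fin m) : ∃ φ : Module.Dual ℂ (Mid m N),
    ∀ η c', φ (eb η c') = if η = 0 ∧ c' = c then 1 else 0 := by
  refine ⟨LinearMap.mul' ℂ ℂ ∘ₗ TensorProduct.map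
    ((AddMonoidAlgebra.basis (Fin N → ℤ) ℂ).coord 0) ((vBasis m N).coord c), fun η c' => ?_⟩
  have h1 : (AddMonoidAlgebra.basis (Fin N → ℤ) ℂ).coord 0 (zz η) = if η = 0 then 1 else 0 := by
    have := (AddMonoidAlgebra.basis (Fin N → ℤ) ℂ).repr_self_apply η 0
    rwa [AddMonoidAlgebra.basis_apply] at this
  have h2 : (vBasis m N).coord c (vb c') = if c' = c then 1 else 0 := by
    have := (vBasis m N).repr_self_apply c' c
    rwa [vBasis_apply] at this
  rw [LinearMap.comp_apply, eb, TensorProduct.map_tmul, h1, h2, LinearMap.mul'_apply]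
  by_cases h : η = 0 <;> simp [h]

variable (lam mu : Weight m)

/-- The coordinate functional is a weight vector of weight λ - μ. For d this holds only after the
shift by λ(d) - μ(d), which is invisible to 𝔤'; for c it needs equal levels. -/
theorem coord_thetaMid (hcen : lam cenH = mu cenH) {c : Fin N → Fin m}
    (hc : ∀ a, lam (diagH a) - mu (diagH a) =
      ((Finset.univ.filter fun i => c i = a).card : ℂ) - N * (m : ℂ)⁻¹)
    {φ : Module.Dual ℂ (Mid m N)} (hφ : ∀ η c', φ (eb η c') = if η = 0 ∧ c' = c then 1 else 0)
    (h : cartan m) (y : Mid m N) :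
    φ (thetaMid (lam degH - mu degH) h.1 y) = (lam h - mu h) * φ y := by
  set t := lam degH - mu degH
  have key : ∀ x (hx : x ∈ cartan m),
      φ ∘ₗ thetaMid t x = (lam ⟨x, hx⟩ - mu ⟨x, hx⟩) • φ := by
    intro x hx
    induction hx using Submodule.span_induction with
    | mem x hx =>
      apply mid_ext
      intro η c'
      rcases hx with ⟨a, rfl⟩ | rfl | rfl
      · rw [LinearMap.comp_apply, thetaMid_of_coD_eq_zero t (coD_E a a 0), LinearMap.sum_apply,
          LinearMap.smul_apply]
        simp only [thetaEval_diag_eb]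
        rw [← Finset.sum_smul, map_smul, hφ]
        by_cases he : η = 0 ∧ c' = c
        · rw [if_pos he, he.2]
          congr 1
          refine Eq.trans ?_ (hc a).symm
          rw [Finset.sum_sub_distrib, Finset.sum_boole, Finset.sum_const, Finset.card_univ,
            Fintype.card_fin, nsmul_eq_mul]
        · rw [if_neg he, smul_zero, smul_zero]
      · rw [LinearMap.comp_apply, thetaMid_of_coD_eq_zero t coD_cen, LinearMap.smul_apply]
        simp only [thetaEval_cen, Finset.sum_const_zero, LinearMap.zero_apply, map_zero]
        have : lam ⟨cen, cenH.2⟩ - mu ⟨cen, cenH.2⟩ = 0 := sub_eq_zero.2 hcen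
        rw [this, zero_smul]
      · rw [LinearMap.comp_apply, thetaMid, LinearMap.add_apply, LinearMap.sum_apply,
          LinearMap.smul_apply, LinearMap.smul_apply]
        simp only [thetaEval_deg, dz_eb]
        rw [← Finset.sum_smul, coD_deg, one_mul, Module.End.one_apply, map_add, map_smul, map_smul,
          hφ]
        by_cases he : η = 0 ∧ c' = c
        · rw [he.1]
          simp [t]
          rfl
        · rw [if_neg he, smul_zero, smul_zero, smul_zero, add_zero]
    | zero =>
      rw [(isRep_thetaMid t).zero, LinearMap.comp_zero]
      have : (⟨0, Submodule.zero_mem _⟩ : cartan m) = 0 := rfl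
      rw [this, map_zero, map_zero, sub_zero, zero_smul]
    | add x y hx hy h1 h2 =>
      have : (⟨x + y, Submodule.add_mem _ hx hy⟩ : cartan m) = ⟨x, hx⟩ + ⟨y, hy⟩ := rfl
      rw [(isRep_thetaMid t).add, LinearMap.comp_add, h1, h2, this, map_add, map_add]
      module
    | smul r x hx h1 =>
      have : (⟨r • x, Submodule.smul_mem _ r hx⟩ : cartan m) = r • ⟨x, hx⟩ := rfl
      rw [(isRep_thetaMid t).smul, LinearMap.comp_smul, h1, this, map_smul, map_smul]
      module
  exact LinearMap.congr_fun (key h.1 h.2) y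

/-- Invariant functionals on the triple tensor product are maps from M†(λ) to the dual of M(μ) ⊗
middle, that is, lowest weight vectors of weight -λ in that dual. Freeness of M(μ) over 𝔫₋ extends
any coordinate functional to an 𝔫₋-invariant pairing, and the weights make it such a vector. -/
theorem exists_coinvariant_functional (hcen : lam cenH = mu cenH) {c : Fin N → Fin m}
    (hc : ∀ a, lam (diagH a) - mu (diagH a) =
      ((Finset.univ.filter fun i => c i = a).card : ℂ) - N * (m : ℂ)⁻¹) :
    ∃ Φ : Num m N (Lau N) (Verma mu) (LowestVerma lam) →ₗ[ℂ] ℂ,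
      (∀ x, coD x = 0 → ∀ y, Φ (theta _ _ x y) = 0) ∧ Φ (vacNum lam mu (eb 0 c)) = 1 := by
  obtain ⟨φ, hφ⟩ := exists_coord_eb c
  have hφh := coord_thetaMid lam mu hcen hc hφ
  set t := lam degH - mu degH
  have hτ : IsRep (thetaMid (m := m) (N := N) t) := isRep_thetaMid t
  obtain ⟨θ, hθ, hθx⟩ := exists_verma_nMinus_map hτ.dual mu φ
  have hθx' : ∀ x ∈ nMinus m, ∀ a y, θ ⁅x, a⁆ y = -θ a (thetaMid t x y) := by
    intro x hx a y
    rw [hθx x hx]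
    rfl
  -- True on the vacuum, where μ and λ - μ add up to λ, and preserved by 𝔫₋ because 𝔥 normalises it.
  have hθh : ∀ a, ∀ h : cartan m, ∀ y,
      θ ⁅h.1, a⁆ y + θ a (thetaMid t h.1 y) = lam h * θ a y := by
    let S : Submodule ℂ (Verma mu) :=
      { carrier := {a | ∀ h : cartan m, ∀ y,
          θ ⁅h.1, a⁆ y + θ a (thetaMid t h.1 y) = lam h * θ a y}
        zero_mem' := fun h y => by
          rw [lie_zero, map_zero, LinearMap.zero_apply, LinearMap.zero_apply, mul_zero, add_zero]
        add_mem' := fun {a b} ha hb h y => by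
          rw [lie_add, map_add, map_add, LinearMap.add_apply, LinearMap.add_apply,
            LinearMap.add_apply, mul_add, ← ha h y, ← hb h y]
          ring
        smul_mem' := fun r a ha h y => by
          rw [lie_smul, map_smul, map_smul, LinearMap.smul_apply, LinearMap.smul_apply,
            LinearMap.smul_apply, smul_eq_mul, smul_eq_mul, smul_eq_mul]
          linear_combination r * ha h y }
    refine fun a => verma_induction (nMinus m) nMinus_sup_cartan_sup_nPlus S (fun h y => ?_) ?_ a
    · rw [lie_vac_cartan, map_smul, hθ, LinearMap.smul_apply, hφh, smul_eq_mul]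
      ring
    · intro x hx a ha h y
      have h1 := ha h (thetaMid t x y)
      have h2 := hθx' _ (cartan_lie_nMinus h.2 hx) a y
      rw [hτ.lie, LinearMap.sub_apply, map_sub, Module.End.mul_apply, Module.End.mul_apply] at h2
      rw [leibniz_lie, map_add, LinearMap.add_apply, h2, hθx' x hx, hθx' x hx, hθx' x hx]
      linear_combination -h1
  -- The pairing is killed by 𝔫₋ and has weight -λ in the dual, so the lowest weight Verma module
  -- maps to it.
  obtain ⟨Θ, hΘ, hΘx⟩ := exists_verma_map ((isRep_toEnd (m := m) (Verma mu)).tensor hτ).dual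
    (nMinus m) (-lam) (TensorProduct.lift θ)
    (fun x hx => by
      refine TensorProduct.ext' fun a y => ?_
      change -(θ ⁅x, a⁆ y + θ a (thetaMid t x y)) = 0
      rw [hθx' x hx, neg_add_cancel, neg_zero])
    (fun h => by
      refine TensorProduct.ext' fun a y => ?_
      change -(θ ⁅h.1, a⁆ y + θ a (thetaMid t h.1 y)) = (-lam h) * θ a y
      rw [hθh, neg_mul])
  refine ⟨TensorProduct.lift Θ.flip ∘ₗ
    (TensorProduct.assoc ℂ (Verma mu) (Mid m N) (LowestVerma lam)).symm.toLinearMap, ?_, ?_⟩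
  · intro x hx y
    set Φ := TensorProduct.lift Θ.flip ∘ₗ
      (TensorProduct.assoc ℂ (Verma mu) (Mid m N) (LowestVerma lam)).symm.toLinearMap
    have hΦ : ∀ a y b, Φ (a ⊗ₜ (y ⊗ₜ b)) = Θ b (a ⊗ₜ y) := fun _ _ _ => rfl
    have : Φ ∘ₗ theta _ _ x = 0 := by
      apply num_ext
      intro a y b
      rw [LinearMap.comp_apply, theta_tmul, map_add, map_add, hΦ, hΦ, hΦ, hΘx,
        ← thetaMid_of_coD_eq_zero t hx]
      change Θ b (⁅x, a⁆ ⊗ₜ y) + Θ b (a ⊗ₜ thetaMid t x y)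
        + -(Θ b (⁅x, a⁆ ⊗ₜ y + a ⊗ₜ thetaMid t x y)) = 0
      rw [map_add, add_neg_cancel]
    exact LinearMap.congr_fun this y
  · change Θ (vac (nMinus m) (-lam)) (vac (nPlus m) mu ⊗ₜ eb 0 c) = 1
    rw [hΘ, TensorProduct.lift.tmul, hθ, hφ, if_pos ⟨rfl, rfl⟩]

theorem vacMap_eb_ne_zero (hm : 2 ≤ m) (hcen : lam cenH = mu cenH) {c : Fin N → Fin m}
    (hc : ∀ a, lam (diagH a) - mu (diagH a) =
      ((Finset.univ.filter fun i => c i = a).card : ℂ) - N * (m : ℂ)⁻¹) :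
    vacMap lam mu (eb 0 c) ≠ 0 := by
  obtain ⟨Φ, h1, h2⟩ := exists_coinvariant_functional lam mu hcen hc
  have hle : gPrimeNum m N (Verma mu) (LowestVerma lam) ≤ LinearMap.ker Φ := by
    rw [gPrimeNum, Submodule.span_le]
    rintro _ ⟨x, hx, y, rfl⟩
    exact h1 x ((mem_derived_iff hm x).1 hx) y
  intro h
  have h3 : vacNum lam mu (eb 0 c) ∈ gPrimeNum m N (Verma mu) (LowestVerma lam) :=
    (Submodule.Quotient.mk_eq_zero _).1 h
  exact one_ne_zero (h2.symm.trans (hle h3))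

end

end KZ

end

theorem mainTheorem11 (m N : ℕ) [NeZero N] (hm : 2 ≤ m) (lev : ℂ) (lam mu : AffineSl.Weight m)
    (hlam : lam AffineSl.cenH = lev) (hmu : mu AffineSl.cenH = lev)
    (hdom : AffineSl.IsDominantIntegral mu)
    (hwt : AffineSl.IsTensorPowerWeight N (lam - mu)) :
    (∃! ρ : DDAHA.H N →ₐ[ℂ] Module.End ℂ (KZ.StdModule N lam mu),
      KZ.IsAction (AffineSl.Verma mu) (AffineSl.LowestVerma lam) lev ρ) ∧
    ∀ ρ : DDAHA.H N →ₐ[ℂ] Module.End ℂ (KZ.StdModule N lam mu),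
      KZ.IsAction (AffineSl.Verma mu) (AffineSl.LowestVerma lam) lev ρ →
        RepHasUniqueIrreducibleQuotient ρ := by
  have hlm : lam AffineSl.cenH = mu AffineSl.cenH := hlam.trans hmu.symm
  have hex := KZ.isAction_heckeRep hm hlam hmu hwt
  refine ⟨⟨KZ.heckeRep hm hlam hmu hwt, hex, fun ρ h => KZ.isAction_unique h hex⟩,
    fun ρ h => ?_⟩
  rw [KZ.isAction_unique h hex]
  exact KZ.heckeRep_hasUniqueIrreducibleQuotient hm hlam hmu hdom hwt
    fun c hc => KZ.vacMap_eb_ne_zero lam mu hm hlm hc
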